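/- Let $p\ge 2$ be an integer, $q=e^{i\pi/p}$, $[n]=\frac{q^n-q^{-n}}{q-q^{-1}}$, $[n]!=[1][2]\cdots[n]$. **The algebra.** $LU_q=LU_q\,s\ell(2)$ is the associative unital $\mathbb C$-algebra with generators $E,F,K^{\pm1},e,f,h$ and relations $$KEK^{-1}=q^2E,\quad KFK^{-1}=q^{-2}F,\quad [E,F]=\tfrac{K-K^{-1}}{q-q^{-1}},\quad E^p=F^p=0,\quad K^{2p}=1,$$ $$[h,e]=e,\quad [h,f]=-f,\quad [e,f]=2h,\quad [h,K]=[E,e]=[K,e]=[F,f]=[K,f]=0,$$ $$[F,e]=\tfrac1{[p-1]!}K^p\tfrac{qK-q^{-1}K^{-1}}{q-q^{-1}}E^{p-1},\quad [E,f]=\tfrac{(-1)^{p+1}}{[p-1]!}F^{p-1}\tfrac{qK-q^{-1}K^{-1}}{q-q^{-1}},\quad [h,E]=\tfrac12EA,\quad [h,F]=-\tfrac12AF,$$ where $$A=\sum_{s=1}^{p-1}\frac{(u_s(q^{-s-1})-u_s(q^{s-1}))K+q^{s-1}u_s(q^{s-1})-q^{-s-1}u_s(q^{-s-1})}{(q^{s-1}-q^{-s-1})\,u_s(q^{-s-1})\,u_s(q^{s-1})}\,u_s(K)\,\mathbf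 e_s,\qquad u_s(x)=\prod_{1\le n\le p-1,\,n\ne s}(x-q^{s-1-2n}),$$ $$\mathbf e_s=\tfrac1{\psi_s(\beta_s)}\Bigl(\psi_s(c)-\tfrac{\psi_s'(\beta_s)}{\psi_s(\beta_s)}(c-\beta_s)\psi_s(c)\Bigr),\qquad c=(q-q^{-1})^2EF+q^{-1}K+qK^{-1},$$ $\beta_j=q^j+q^{-j}$ and $\psi_s(x)=(x-\beta_0)(x-\beta_p)\prod_{1\le j\le p-1,\,j\ne s}(x-\beta_j)^2$. Let $\mathcal C_p$ be the category of finite-dimensional $LU_q$-modules. The contragredient of $V$ is the dual space $V^*$ on which $x$ acts by the transpose of $S(x)$, with $S$ the antipode: $S(E)=-EK^{-1}$, $S(F)=-KF$, $S(K)=K^{-1}$, $S(e)=-K^pe$, $S(f)=-K^pf$, $S(h)=-h$. The Loewy (semisimple) length of $V$ is the least length of a filtration by submodules with semisimple quotients. A full subcategory is called indecomposable if it is nonzero and is not a direct sum of two nonzero full subcategories. **The modules.** Let $\alpha=\pm$ (also read as $\pm1$), $r\ge1$; vectors with an index out of range are $0$. * $X^\alpha_{s,r}$ ($1\le s\le p$)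 has a basis $x_{n,m}$, $0\le n\le s-1$, $0\le m\le r-1$, with $Kx_{n,m}=\alpha q^{s-1-2n}x_{n,m}$, $hx_{n,m}=\frac{r-1-2m}2x_{n,m}$, $Ex_{n,m}=\alpha[n][s-n]x_{n-1,m}$, $ex_{n,m}=m(r-m)x_{n,m-1}$, $Fx_{n,m}=x_{n+1,m}$, $fx_{n,m}=x_{n,m+1}$. In the following modules $1\le s\le p-1$, $g=\frac{(-1)^p[s]}{[p-1]!}$, and $K,h,e,f$ act as in the direct sum of the irreducible modules listed; $E$ and $F$ act on them as in that direct sum except where stated. * $P^\alpha_{s,r}$ is built from $X^\alpha_{s,r}$ (basis $t_{n,m}$), $X^{-\alpha}_{p-s,r-1}$ (basis $l_{k,m}$, absent for $r=1$), $X^{-\alpha}_{p-s,r+1}$ (basis $\rho_{k,m}$) and $X^\alpha_{s,r}$ (basis $b_{n,m}$), with $Et_{n,m}=\alpha[n][s-n]t_{n-1,m}+\alpha g\,b_{n-1,m}$ for $n\ge1$, $\;Et_{0,m}=\alpha g\frac{r-m}r\rho_{p-s-1,m}+\alpha g\frac mr l_{p-s-1,m-1}$, $\;Ft_{s-1,m}=\frac1r\rho_{0,m+1}-\frac1rl_{0,m}$,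 $\;El_{0,m}=\alpha g(m-r+1)b_{s-1,m}$, $\;Fl_{p-s-1,m}=b_{0,m+1}$, $\;E\rho_{0,m}=\alpha gm\,b_{s-1,m-1}$, $\;F\rho_{p-s-1,m}=b_{0,m}$. * For $n\ge1$, the modules $W^\alpha_{s,r}(n)$, $M^\alpha_{s,r}(n)$ are built from $X_j$, $0\le j\le 2n$, and $N^\alpha_{s,r}(n)$, $\bar N^\alpha_{s,r}(n)$ from $X_j$, $0\le j\le 2n-1$, where $X_j=X^{\alpha_j}_{s_j,r+j}$ with $(\alpha_j,s_j)=(\alpha,s)$ for even $j$ and $(-\alpha,p-s)$ for odd $j$. In $W$ and $\bar N$ the $X_j$ with $j$ even are on top, in $M$ and $N$ those with $j$ odd; the others are submodules. With $v^j_{k,m}$ the basis of $X_j$, each top $X_j$ is glued to its neighbours by $Ev^j_{0,m}=\alpha_jg\bigl((r+j-m)\,v^{j+1}_{p-s_j-1,m}-m\,v^{j-1}_{p-s_j-1,m-1}\bigr)$, $\;Fv^j_{s_j-1,m}=v^{j+1}_{0,m+1}+v^{j-1}_{0,m}$. **Theorem.** All these are $LU_q$-modules. For $1\le s\le p-1$,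 $P^\alpha_{s,r}$ is the projective cover of $X^\alpha_{s,r}$ in $\mathcal C_p$; the modules $W,M,N,\bar N$ have Loewy length $2$; $M^\alpha_{s,r}(n)$ is contragredient to $W^\alpha_{s,r}(n)$ and $\bar N^\alpha_{s,r}(n)$ to $N^\alpha_{s,r}(n)$; and the modules $X^\alpha_{s,r},P^\alpha_{s,r},W^\alpha_{s,r}(n),M^\alpha_{s,r}(n),N^\alpha_{s,r}(n),\bar N^\alpha_{s,r}(n)$ ($\alpha=\pm$, $1\le s\le p-1$, $r,n\ge1$) are pairwise nonisomorphic. Moreover: 1. $\mathcal C_p=\bigoplus_{s=1}^{p-1}\bigl(\mathcal C^+(s)\oplus\mathcal C^-(s)\bigr)\oplus\bigoplus_{r\ge1}\bigl(\mathcal S^+(r)\oplus\mathcal S^-(r)\bigr)$, where every summand is an indecomposable full subcategory. 2. $\mathcal S^\pm(r)$ is semisimple and contains, up to isomorphism, precisely one irreducible module, $X^\pm_{p,r}$. 3. For $1\le s\le p-1$ the irreducible modules in $\mathcal C^+(s)$ are, up to isomorphism, precisely $X^+_{s,2k-1}$ and $X^-_{p-s,2k}$, $k\ge1$, and its indecomposable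 modules are, up to isomorphism, precisely these together with $P^\alpha_{s',r}$, $W^\alpha_{s',r}(n)$, $M^\alpha_{s',r}(n)$, $N^\alpha_{s',r}(n)$, $\bar N^\alpha_{s',r}(n)$ with $n\ge1$ and $(\alpha,s',r)=(+,s,2k-1)$ or $(-,p-s,2k)$, $k\ge1$. 4. The same holds for $\mathcal C^-(s)$ with the labels $(\alpha,s',r)=(+,s,2k)$ and $(-,p-s,2k-1)$, $k\ge1$. -/

import Mathlib

open CategoryTheory
open scoped ModuleCat DirectSum

noncomputable section

namespace LUq

/-! ### The quantum group at `q = exp (iπ/p)` -/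

/-- The primitive `2p`-th root of unity `q = exp (iπ/p)`. -/
def q (p : ℕ) : ℂ := Complex.exp (Complex.I * Real.pi / p)

/-- The quantum integer `[n] = (q^n - q^{-n}) / (q - q⁻¹)`. -/
def qInt (p : ℕ) (n : ℤ) : ℂ := (q p ^ n - q p ^ (-n)) / (q p - (q p)⁻¹)

/-- The quantum factorial `[n]! = [1] [2] ⋯ [n]`. -/
def qFactorial (p n : ℕ) : ℂ := ∏ k ∈ Finset.Icc 1 n, qInt p k

/-- `β_j = q^j + q^{-j}`. -/
def beta (p j : ℕ) : ℂ := q p ^ (j : ℤ) + q p ^ (-(j : ℤ))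

/-- `ψ_s(x) = (x - β_0) (x - β_p) ∏_{1 ≤ j ≤ p - 1, j ≠ s} (x - β_j)^2`. -/
def psi (p s : ℕ) : Polynomial ℂ :=
  (Polynomial.X - Polynomial.C (beta p 0)) * (Polynomial.X - Polynomial.C (beta p p)) *
    ∏ j ∈ (Finset.Icc 1 (p - 1)).erase s, (Polynomial.X - Polynomial.C (beta p j)) ^ 2

/-- The polynomial whose value at the Casimir element is the primitive central idempotent `e_s` of
the restricted quantum group, `1 ≤ s ≤ p - 1`:
`e_s = ψ_s(β_s)⁻¹ (ψ_s(c) - (ψ_s'(β_s) / ψ_s(β_s)) (c - β_s) ψ_s(c))`. -/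
def idemPoly (p s : ℕ) : Polynomial ℂ :=
  Polynomial.C ((psi p s).eval (beta p s))⁻¹ *
    (psi p s - Polynomial.C ((psi p s).derivative.eval (beta p s) / (psi p s).eval (beta p s)) *
      (Polynomial.X - Polynomial.C (beta p s)) * psi p s)

/-- `u_s(x) = ∏_{1 ≤ n ≤ p - 1, n ≠ s} (x - q^{s - 1 - 2n})`. -/
def uPoly (p s : ℕ) : Polynomial ℂ :=
  ∏ n ∈ (Finset.Icc 1 (p - 1)).erase s,
    (Polynomial.X - Polynomial.C (q p ^ ((s : ℤ) - 1 - 2 * (n : ℤ))))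

/-- The polynomial in `K` that multiplies `e_s` in the element `A`: with `a = q^{s-1}` and
`b = q^{-s-1}` it is
`((u_s(b) - u_s(a)) K + a u_s(a) - b u_s(b)) / ((a - b) u_s(b) u_s(a)) * u_s(K)`. -/
def aPoly (p s : ℕ) : Polynomial ℂ :=
  let a : ℂ := q p ^ ((s : ℤ) - 1)
  let b : ℂ := q p ^ (-(s : ℤ) - 1)
  let ua : ℂ := (uPoly p s).eval a
  let ub : ℂ := (uPoly p s).eval b
  Polynomial.C ((a - b) * ub * ua)⁻¹ *
    (Polynomial.C (ub - ua) * Polynomial.X + Polynomial.C (a * ua - b * ub)) * uPoly p s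

/-- Names of the generators `E, F, K, K⁻¹, e, f, h`. -/
inductive Gen : Type
  | E | F | K | Kinv | e | f | h

namespace Free

abbrev E : FreeAlgebra ℂ Gen := FreeAlgebra.ι ℂ Gen.E
abbrev F : FreeAlgebra ℂ Gen := FreeAlgebra.ι ℂ Gen.F
abbrev K : FreeAlgebra ℂ Gen := FreeAlgebra.ι ℂ Gen.K
abbrev Kinv : FreeAlgebra ℂ Gen := FreeAlgebra.ι ℂ Gen.Kinv
abbrev e : FreeAlgebra ℂ Gen := FreeAlgebra.ι ℂ Gen.e
abbrev f : FreeAlgebra ℂ Gen := FreeAlgebra.ι ℂ Gen.f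
abbrev h : FreeAlgebra ℂ Gen := FreeAlgebra.ι ℂ Gen.h

/-- The Casimir element `(q - q⁻¹)^2 E F + q⁻¹ K + q K⁻¹`. -/
def casimir (p : ℕ) : FreeAlgebra ℂ Gen :=
  (q p - (q p)⁻¹) ^ 2 • (E * F) + (q p)⁻¹ • K + q p • Kinv

/-- The element `A = ∑_{s=1}^{p-1} aPoly_s(K) e_s`. -/
def A (p : ℕ) : FreeAlgebra ℂ Gen :=
  ∑ s ∈ Finset.Icc 1 (p - 1),
    Polynomial.aeval K (aPoly p s) * Polynomial.aeval (casimir p) (idemPoly p s)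

/-- `(q K - q⁻¹ K⁻¹) / (q - q⁻¹)`. -/
def H (p : ℕ) : FreeAlgebra ℂ Gen :=
  (q p - (q p)⁻¹)⁻¹ • (q p • K - (q p)⁻¹ • Kinv)

end Free

open Free in
/-- The defining relations of the Lusztig quantum group `LU_q sl(2)`. -/
inductive Rel (p : ℕ) : FreeAlgebra ℂ Gen → FreeAlgebra ℂ Gen → Prop
  | K_Kinv : Rel p (K * Kinv) 1
  | Kinv_K : Rel p (Kinv * K) 1
  | K_E : Rel p (K * E * Kinv) (q p ^ 2 • E)
  | K_F : Rel p (K * F * Kinv) (((q p) ^ 2)⁻¹ • F)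
  | E_F : Rel p (E * F - F * E) ((q p - (q p)⁻¹)⁻¹ • (K - Kinv))
  | E_pow : Rel p (E ^ p) 0
  | F_pow : Rel p (F ^ p) 0
  | K_pow : Rel p (K ^ (2 * p)) 1
  | h_e : Rel p (h * e - e * h) e
  | h_f : Rel p (h * f - f * h) (-f)
  | e_f : Rel p (e * f - f * e) ((2 : ℂ) • h)
  | h_K : Rel p (h * K) (K * h)
  | E_e : Rel p (E * e) (e * E)
  | K_e : Rel p (K * e) (e * K)
  | F_f : Rel p (F * f) (f * F)
  | K_f : Rel p (K * f) (f * K)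
  | F_e : Rel p (F * e - e * F)
      ((qFactorial p (p - 1))⁻¹ • (K ^ p * H p * E ^ (p - 1)))
  | E_f : Rel p (E * f - f * E)
      (((-1 : ℂ) ^ (p + 1) * (qFactorial p (p - 1))⁻¹) • (F ^ (p - 1) * H p))
  | h_E : Rel p (h * E - E * h) ((2 : ℂ)⁻¹ • (E * A p))
  | h_F : Rel p (h * F - F * h) (-((2 : ℂ)⁻¹ • (A p * F)))

/-- The Lusztig quantum group `LU_q sl(2)` at `q = exp (iπ/p)`, as a complex algebra. -/
def LU (p : ℕ) : Type := RingQuot (Rel p)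

instance (p : ℕ) : Ring (LU p) := inferInstanceAs (Ring (RingQuot (Rel p)))

instance (p : ℕ) : Algebra ℂ (LU p) := inferInstanceAs (Algebra ℂ (RingQuot (Rel p)))

/-- The generators of `LU_q sl(2)`. -/
def gen (p : ℕ) (x : Gen) : LU p := RingQuot.mkAlgHom ℂ (Rel p) (FreeAlgebra.ι ℂ x)

/-! ### The category of finite-dimensional modules, and notions for its objects -/

/-- The category `C_p` of finite-dimensional `LU_q sl(2)`-modules. -/
abbrev FinRep (p : ℕ) : Type 1 :=
  ObjectProperty.FullSubcategory
    (fun M : ModuleCat.{0} (LU p) => FiniteDimensional ℂ M)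

/-- A nonzero module that is not the direct sum of two nonzero submodules. -/
def IsIndecomposableModule (R M : Type*) [Ring R] [AddCommGroup M] [Module R M] : Prop :=
  Nontrivial M ∧ ∀ A B : Submodule R M, IsCompl A B → A = ⊥ ∨ B = ⊥

/-- `M` has a semisimple filtration `M = N_0 ⊇ N_1 ⊇ ⋯ ⊇ N_l = 0` of length `l`. -/
def HasSemisimpleFiltration (R M : Type*) [Ring R] [AddCommGroup M] [Module R M] (l : ℕ) : Prop :=
  ∃ N : ℕ → Submodule R M, Antitone N ∧ N 0 = ⊤ ∧ N l = ⊥ ∧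
    ∀ i < l, IsSemisimpleModule R (N i ⧸ (N (i + 1)).submoduleOf (N i))

/-- `l` is the semisimple (Loewy) length of `M`: the least length of a semisimple filtration. -/
def HasLoewyLength (R M : Type*) [Ring R] [AddCommGroup M] [Module R M] (l : ℕ) : Prop :=
  IsLeast {k : ℕ | HasSemisimpleFiltration R M k} l

variable {p : ℕ}

/-- `P` is a projective cover of `X` in the category `C_p`: `P` is a projective object, and there is
a surjective morphism from `P` onto `X` with superfluous kernel. -/
def IsProjectiveCover (P X : FinRep p) : Prop :=
  Projective P ∧ ∃ π : P.obj →ₗ[LU p] X.obj, Function.Surjective π ∧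
    ∀ A : Submodule (LU p) P.obj, A ⊔ LinearMap.ker π = ⊤ → A = ⊤

/-- `V` is the contragredient module of `W`, that is, the dual space of `W` on which `x` acts by the
transpose of `S(x)`. The antipode `S` is given on generators by `S(E) = -E K⁻¹`, `S(F) = -K F`,
`S(K) = K⁻¹`, `S(e) = -K^p e`, `S(f) = -K^p f`, `S(h) = -h`. -/
def IsContragredient (V W : FinRep p) : Prop :=
  ∃ B : V.obj →ₗ[ℂ] W.obj →ₗ[ℂ] ℂ, B.Nondegenerate ∧ ∀ (v : V.obj) (w : W.obj),
    B (gen p .E • v) w = B v (-(gen p .E * gen p .Kinv) • w) ∧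
    B (gen p .F • v) w = B v (-(gen p .K * gen p .F) • w) ∧
    B (gen p .K • v) w = B v (gen p .Kinv • w) ∧
    B (gen p .e • v) w = B v (-(gen p .K ^ p * gen p .e) • w) ∧
    B (gen p .f • v) w = B v (-(gen p .K ^ p * gen p .f) • w) ∧
    B (gen p .h • v) w = B v (-gen p .h • w)

/-! ### Decompositions of full subcategories -/

/-- The full subcategory `C` of `C_p` is the direct sum of its full subcategories `D i`: they are
closed under isomorphisms, there are no nonzero morphisms between different ones, and every object
of `C` is a direct sum of objects of the `D i` (almost all of which vanish, by finiteness of the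
dimension). -/
structure IsDirectSumOfSubcategories {ι : Type} (C : ObjectProperty (FinRep p))
    (D : ι → ObjectProperty (FinRep p)) : Prop where
  closed_iso : ∀ i, (D i).IsClosedUnderIsomorphisms
  le : ∀ i M, D i M → C M
  hom_eq_zero : ∀ i j, i ≠ j → ∀ M N : FinRep p, D i M → D j N → ∀ φ : M ⟶ N, φ = 0
  exists_decomposition : ∀ M, C M → ∃ N : ι → FinRep p, (∀ i, D i (N i)) ∧
    Nonempty (M.obj ≃ₗ[LU p] ⨁ i, (N i).obj)

/-- A full subcategory is indecomposable if it is nonzero and is not the direct sum of two nonzero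
full subcategories. -/
def IsIndecomposableSubcategory (C : ObjectProperty (FinRep p)) : Prop :=
  (∃ M, C M ∧ ¬ Limits.IsZero M) ∧
    ∀ D : Bool → ObjectProperty (FinRep p), IsDirectSumOfSubcategories C D →
      ∃ i, ∀ M, D i M → Limits.IsZero M

/-! ### The indecomposable modules, in terms of bases and action -/

/-- The vectors `v i n m`, with `0 ≤ n < s i` and `0 ≤ m < r i`, form a basis of `M` (the other
`v i n m` are set to zero), on which `K`, `h`, `e` and `f` act as in the direct sum over `i` of the
irreducible modules `X^{α i}_{s i, r i}`. -/
structure IsLayeredBasis {ι : Type} (M : FinRep p) (α : ι → ℤˣ) (s r : ι → ℤ)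
    (v : ι → ℤ → ℤ → M.obj) : Prop where
  eq_zero : ∀ i n m, ¬ (0 ≤ n ∧ n < s i ∧ 0 ≤ m ∧ m < r i) → v i n m = 0
  linearIndependent : LinearIndependent ℂ
    (fun x : {x : ι × ℤ × ℤ // 0 ≤ x.2.1 ∧ x.2.1 < s x.1 ∧ 0 ≤ x.2.2 ∧ x.2.2 < r x.1} =>
      v x.1.1 x.1.2.1 x.1.2.2)
  span_eq_top : Submodule.span ℂ {w : M.obj | ∃ i n m, w = v i n m} = ⊤
  smul_K : ∀ i n m, gen p .K • v i n m = (((α i : ℤ) : ℂ) * q p ^ (s i - 1 - 2 * n)) • v i n m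
  smul_h : ∀ i n m, gen p .h • v i n m = (((r i - 1 - 2 * m : ℤ) : ℂ) / 2) • v i n m
  smul_e : ∀ i n m, gen p .e • v i n m = ((m * (r i - m) : ℤ) : ℂ) • v i n (m - 1)
  smul_f : ∀ i n m, 0 ≤ m → gen p .f • v i n m = v i n (m + 1)

/-- `M` is (isomorphic to) the irreducible module `X^α_{s,r}`. -/
def IsX (α : ℤˣ) (s r : ℕ) (M : FinRep p) : Prop :=
  ∃ v : Unit → ℤ → ℤ → M.obj, IsLayeredBasis M (fun _ => α) (fun _ => s) (fun _ => r) v ∧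
    ∀ n m : ℤ, 0 ≤ n → n < s → 0 ≤ m → m < r →
      gen p .E • v () n m = (((α : ℤ) : ℂ) * qInt p n * qInt p (s - n)) • v () (n - 1) m ∧
      gen p .F • v () n m = v () (n + 1) m

/-- The constant `g = (-1)^p [s] / [p-1]!`. -/
def gConst (p s : ℕ) : ℂ := (-1) ^ p * qInt p s / qFactorial p (p - 1)

/-- The four irreducible subquotients of the modules `P^α_{s,r}`. -/
inductive Corner : Type
  | top | bot | left | right

/-- The signs of the subquotients of `P^α_{s,r}`. -/
def Corner.sign (α : ℤˣ) : Corner → ℤˣ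
  | top => α
  | bot => α
  | left => -α
  | right => -α

/-- The first indices of the subquotients of `P^α_{s,r}`. -/
def Corner.fst (p s : ℕ) : Corner → ℤ
  | top => s
  | bot => s
  | left => p - s
  | right => p - s

/-- The second indices of the subquotients of `P^α_{s,r}` (for `r = 1` there is no left one). -/
def Corner.snd (r : ℕ) : Corner → ℤ
  | top => r
  | bot => r
  | left => r - 1
  | right => r + 1

/-- `M` is (isomorphic to) the module `P^α_{s,r}`, whose subquotients are `X^α_{s,r}` (top),
`X^{-α}_{p-s,r-1}` (left), `X^{-α}_{p-s,r+1}` (right) and `X^α_{s,r}` (bottom). -/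
def IsP (α : ℤˣ) (s r : ℕ) (M : FinRep p) : Prop :=
  ∃ v : Corner → ℤ → ℤ → M.obj,
    IsLayeredBasis M (Corner.sign α) (Corner.fst p s) (Corner.snd r) v ∧
    -- the action on the top subquotient
    (∀ n m : ℤ, 0 ≤ n → n < s → 0 ≤ m → m < r →
      gen p .E • v .top n m =
        (if n = 0 then
          (((α : ℤ) : ℂ) * gConst p s * ((r - m : ℤ) : ℂ) / r) • v .right (p - s - 1) m +
          (((α : ℤ) : ℂ) * gConst p s * (m : ℂ) / r) • v .left (p - s - 1) (m - 1)
        else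
          (((α : ℤ) : ℂ) * qInt p n * qInt p (s - n)) • v .top (n - 1) m +
          (((α : ℤ) : ℂ) * gConst p s) • v .bot (n - 1) m) ∧
      gen p .F • v .top n m =
        (if n = s - 1 then
          (r : ℂ)⁻¹ • v .right 0 (m + 1) - (r : ℂ)⁻¹ • v .left 0 m
        else v .top (n + 1) m)) ∧
    -- the action on the left subquotient
    (∀ k m : ℤ, 0 ≤ k → k < p - s → 0 ≤ m → m < r - 1 →
      gen p .E • v .left k m =
        (if k = 0 then
          (((α : ℤ) : ℂ) * gConst p s * ((m - r + 1 : ℤ) : ℂ)) • v .bot (s - 1) m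
        else
          (-((α : ℤ) : ℂ) * qInt p k * qInt p (p - s - k)) • v .left (k - 1) m) ∧
      gen p .F • v .left k m =
        (if k = p - s - 1 then v .bot 0 (m + 1) else v .left (k + 1) m)) ∧
    -- the action on the right subquotient
    (∀ k m : ℤ, 0 ≤ k → k < p - s → 0 ≤ m → m < r + 1 →
      gen p .E • v .right k m =
        (if k = 0 then
          (((α : ℤ) : ℂ) * gConst p s * (m : ℂ)) • v .bot (s - 1) (m - 1)
        else
          (-((α : ℤ) : ℂ) * qInt p k * qInt p (p - s - k)) • v .right (k - 1) m) ∧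
      gen p .F • v .right k m =
        (if k = p - s - 1 then v .bot 0 m else v .right (k + 1) m)) ∧
    -- the action on the bottom subquotient
    (∀ n m : ℤ, 0 ≤ n → n < s → 0 ≤ m → m < r →
      gen p .E • v .bot n m =
        (((α : ℤ) : ℂ) * qInt p n * qInt p (s - n)) • v .bot (n - 1) m ∧
      gen p .F • v .bot n m = v .bot (n + 1) m)

/-- The sign of the `j`-th subquotient of a zigzag module: `α` for even `j`, `-α` for odd `j`. -/
def zigzagSign (α : ℤˣ) (j : ℤ) : ℤˣ := if Even j then α else -α

/-- The first index of the `j`-th subquotient: `s` for even `j`, `p - s` for odd `j`. -/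
def zigzagFst (p s : ℕ) (j : ℤ) : ℤ := if Even j then (s : ℤ) else p - s

/-- The second index of the `j`-th subquotient: `r + j` for `0 ≤ j < l`; there are no other
subquotients. -/
def zigzagSnd (r l : ℕ) (j : ℤ) : ℤ := if 0 ≤ j ∧ j < l then r + j else 0

/-- `M` is (isomorphic to) the zigzag module with the `l` subquotients
`X^α_{s,r}, X^{-α}_{p-s,r+1}, X^α_{s,r+2}, X^{-α}_{p-s,r+3}, …` (numbered `j = 0, …, l - 1`), in
which the subquotients with `top j` are glued on top of both their neighbours `j - 1` and `j + 1`,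
and the others are submodules. -/
def IsZigzag (α : ℤˣ) (s r l : ℕ) (top : ℤ → Prop) [DecidablePred top] (M : FinRep p) : Prop :=
  ∃ v : ℤ → ℤ → ℤ → M.obj,
    IsLayeredBasis M (zigzagSign α) (zigzagFst p s) (zigzagSnd r l) v ∧
    ∀ j n m : ℤ, 0 ≤ j → j < l → 0 ≤ n → n < zigzagFst p s j → 0 ≤ m → m < r + j →
      gen p .E • v j n m =
        (((zigzagSign α j : ℤ) : ℂ) * qInt p n * qInt p (zigzagFst p s j - n)) • v j (n - 1) m +
        (if n = 0 ∧ top j then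
          (((zigzagSign α j : ℤ) : ℂ) * gConst p s) •
            (((r + j - m : ℤ) : ℂ) • v (j + 1) (zigzagFst p s (j + 1) - 1) m -
              (m : ℂ) • v (j - 1) (zigzagFst p s (j - 1) - 1) (m - 1))
        else 0) ∧
      gen p .F • v j n m =
        v j (n + 1) m +
        (if n = zigzagFst p s j - 1 ∧ top j then v (j + 1) 0 (m + 1) + v (j - 1) 0 m else 0)

/-- `W^α_{s,r}(n)`: top `X^α_{s,r}, X^α_{s,r+2}, …, X^α_{s,r+2n}`, bottom
`X^{-α}_{p-s,r+1}, …, X^{-α}_{p-s,r+2n-1}`. -/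
def IsW (α : ℤˣ) (s r n : ℕ) (M : FinRep p) : Prop :=
  IsZigzag α s r (2 * n + 1) (fun j => Even j) M

/-- `M^α_{s,r}(n)`: top `X^{-α}_{p-s,r+1}, …, X^{-α}_{p-s,r+2n-1}`, bottom
`X^α_{s,r}, X^α_{s,r+2}, …, X^α_{s,r+2n}`. -/
def IsM (α : ℤˣ) (s r n : ℕ) (M : FinRep p) : Prop :=
  IsZigzag α s r (2 * n + 1) (fun j => Odd j) M

/-- `N^α_{s,r}(n)`: top `X^{-α}_{p-s,r+1}, …, X^{-α}_{p-s,r+2n-1}`, bottom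
`X^α_{s,r}, X^α_{s,r+2}, …, X^α_{s,r+2n-2}`. -/
def IsN (α : ℤˣ) (s r n : ℕ) (M : FinRep p) : Prop :=
  IsZigzag α s r (2 * n) (fun j => Odd j) M

/-- `N̄^α_{s,r}(n)`: top `X^α_{s,r}, X^α_{s,r+2}, …, X^α_{s,r+2n-2}`, bottom
`X^{-α}_{p-s,r+1}, …, X^{-α}_{p-s,r+2n-1}`. -/
def IsNbar (α : ℤˣ) (s r n : ℕ) (M : FinRep p) : Prop :=
  IsZigzag α s r (2 * n) (fun j => Even j) M

/-- The six types of indecomposable modules. -/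
inductive Shape : Type
  | X
  | P
  | W (n : ℕ+)
  | M (n : ℕ+)
  | N (n : ℕ+)
  | Nbar (n : ℕ+)

/-- `M` is the module of the given shape with the labels `α, s, r`. -/
def HasShape (α : ℤˣ) (s r : ℕ) (M : FinRep p) : Shape → Prop
  | .X => IsX α s r M
  | .P => IsP α s r M
  | .W n => IsW α s r n M
  | .M n => IsM α s r n M
  | .N n => IsN α s r n M
  | .Nbar n => IsNbar α s r n M

/-! ### The blocks -/

/-- Names of the blocks `C^±(s)`, `1 ≤ s ≤ p - 1`, and `S^±(r)`, `r ≥ 1`. -/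
inductive Block (p : ℕ) : Type
  | C (β : ℤˣ) (s : ℕ) (hs : 1 ≤ s ∧ s ≤ p - 1)
  | S (β : ℤˣ) (r : ℕ) (hr : 1 ≤ r)

/-- `BlockLabel p β s α s' r` says that the label `(α, s', r)` belongs to the block `C^β(s)`: the
labels of `C^+(s)` are `(+, s, 2k-1)` and `(-, p-s, 2k)`, those of `C^-(s)` are `(+, s, 2k)` and
`(-, p-s, 2k-1)`, with `k ≥ 1`. -/
inductive BlockLabel (p : ℕ) : ℤˣ → ℕ → ℤˣ → ℕ → ℕ → Prop
  | plus_odd (s k : ℕ) (hk : 1 ≤ k) : BlockLabel p 1 s 1 s (2 * k - 1)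
  | plus_even (s k : ℕ) (hk : 1 ≤ k) : BlockLabel p 1 s (-1) (p - s) (2 * k)
  | minus_even (s k : ℕ) (hk : 1 ≤ k) : BlockLabel p (-1) s 1 s (2 * k)
  | minus_odd (s k : ℕ) (hk : 1 ≤ k) : BlockLabel p (-1) s (-1) (p - s) (2 * k - 1)

end LUq

end

open CategoryTheory
open scoped ModuleCat DirectSum

set_option linter.unusedSectionVars false

noncomputable section

namespace LUq

open Module

variable {p : ℕ}

local notation "gE" => gen p Gen.E
local notation "gF" => gen p Gen.F
local notation "gK" => gen p Gen.K
local notation "gKi" => gen p Gen.Kinv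
local notation "ge" => gen p Gen.e
local notation "gf" => gen p Gen.f
local notation "gh" => gen p Gen.h
local notation "dl" => (q p - (q p)⁻¹)

/-! ### Generalised eigenspaces -/

section GenEigen

variable {V : Type*} [AddCommGroup V] [Module ℂ V]

/-- An operator that intertwines `T` with `T` up to a shift maps generalised eigenspaces of `T` to
generalised eigenspaces. -/
theorem mem_maxGenEigenspace_of_semiconj {T a : End ℂ V} {μ ν : ℂ}
    (h : ∀ v, T (a v) - ν • a v = a (T v - μ • v)) {v : V} (hv : v ∈ T.maxGenEigenspace μ) :
    a v ∈ T.maxGenEigenspace ν := by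
  rw [End.mem_maxGenEigenspace] at hv ⊢
  obtain ⟨k, hk⟩ := hv
  have hs : SemiconjBy a (T - μ • 1) (T - ν • 1) := by
    ext w
    simpa using (h w).symm
  refine ⟨k, ?_⟩
  have := LinearMap.congr_fun (hs.pow_right k) v
  simp only [End.mul_apply] at this
  rw [← this, hk, map_zero]

theorem eq_of_mem_maxGenEigenspace {T : End ℂ V} {μ ν : ℂ} {v : V}
    (hv : v ∈ T.maxGenEigenspace μ) (h : T v = ν • v) (h0 : v ≠ 0) : ν = μ := by
  by_contra hne
  have hv' : v ∈ T.maxGenEigenspace ν :=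
    End.eigenspace_le_maxGenEigenspace (End.mem_eigenspace_iff.2 h)
  have := (End.disjoint_genEigenspace T hne ⊤ ⊤).le_bot ⟨hv', hv⟩
  exact h0 (by simpa using this)

theorem mem_maxGenEigenspace_of_eq {T : End ℂ V} {μ : ℂ} {v : V} (h : T v = μ • v) :
    v ∈ T.maxGenEigenspace μ :=
  End.eigenspace_le_maxGenEigenspace (End.mem_eigenspace_iff.2 h)

/-- A property of vectors that is preserved by `T - μ` and holds for some nonzero generalised
eigenvector holds for an eigenvector. -/
theorem exists_eigenvector_of_mem_maxGenEigenspace {T : End ℂ V} {μ : ℂ} {P : V → Prop}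
    (hP : ∀ v, P v → P (T v - μ • v)) {v : V} (hv : v ∈ T.maxGenEigenspace μ) (h0 : v ≠ 0)
    (hPv : P v) : ∃ w, w ≠ 0 ∧ T w = μ • w ∧ P w := by
  rw [End.mem_maxGenEigenspace] at hv
  obtain ⟨k, hk⟩ := hv
  induction k generalizing v with
  | zero => simp at hk; exact absurd hk h0
  | succ k ih =>
    by_cases h1 : T v - μ • v = 0
    · exact ⟨v, h0, sub_eq_zero.1 h1, hPv⟩
    · refine ih h1 (hP v hPv) ?_
      rw [pow_succ, End.mul_apply] at hk
      simpa using hk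

theorem hasEigenvalue_of_mem_maxGenEigenspace {T : End ℂ V} {μ : ℂ} {v : V}
    (hv : v ∈ T.maxGenEigenspace μ) (h0 : v ≠ 0) : T.HasEigenvalue μ := by
  obtain ⟨w, hw, h, -⟩ := exists_eigenvector_of_mem_maxGenEigenspace (P := fun _ => True)
    (fun _ _ => trivial) hv h0 trivial
  exact End.hasEigenvalue_of_hasEigenvector ⟨End.mem_eigenspace_iff.2 h, hw⟩

theorem exists_apply_eq_of_injOn [FiniteDimensional ℂ V] (W : Submodule ℂ V) (T : End ℂ V)
    (hT : ∀ v ∈ W, T v ∈ W) (hi : ∀ v ∈ W, T v = 0 → v = 0) {v : V} (hv : v ∈ W) :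
    ∃ w ∈ W, T w = v := by
  have hinj : Function.Injective (T.restrict hT) := by
    rw [← LinearMap.ker_eq_bot, LinearMap.ker_eq_bot']
    rintro ⟨w, hw⟩ h
    exact Subtype.ext (hi w hw (by simpa using congrArg Subtype.val h))
  obtain ⟨⟨w, hw⟩, h⟩ := (LinearMap.injective_iff_surjective.1 hinj) ⟨v, hv⟩
  exact ⟨w, hw, congrArg Subtype.val h⟩

end GenEigen

/-! ### Finite-dimensional representations of `sl(2)` -/

/-- Operators `e, f, h` with `[h, e] = e`, `[h, f] = -f`, `[e, f] = 2 h`. -/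
structure IsSl2 {V : Type*} [AddCommGroup V] [Module ℂ V] (e f h : End ℂ V) : Prop where
  he : ∀ v, h (e v) = e (h v) + e v
  hf : ∀ v, h (f v) = f (h v) - f v
  ef : ∀ v, e (f v) = f (e v) + (2 : ℂ) • h v

section Sl2

variable {V : Type*} [AddCommGroup V] [Module ℂ V] {e f h : End ℂ V}

/-- The Casimir operator of `sl(2)`. -/
def sl2Cas (e f h : End ℂ V) : End ℂ V := f * e + h * h + h

/-- Highest weight vectors of the `r`-dimensional irreducible representation. -/
def hwSpace (e h : End ℂ V) (r : ℤ) : Submodule ℂ V where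
  carrier := {v | e v = 0 ∧ h v = (((r : ℂ) - 1) / 2) • v}
  add_mem' := by
    rintro a b ⟨ha, ha'⟩ ⟨hb, hb'⟩
    exact ⟨by simp [ha, hb], by simp [ha', hb', smul_add]⟩
  zero_mem' := by simp
  smul_mem' := by
    rintro c a ⟨ha, ha'⟩
    exact ⟨by simp [ha], by rw [map_smul, ha', smul_comm]⟩

namespace IsSl2

theorem cas_e (H : IsSl2 e f h) (v : V) : sl2Cas e f h (e v) = e (sl2Cas e f h v) := by
  simp only [sl2Cas, LinearMap.add_apply, End.mul_apply, map_add, H.he, H.ef]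
  module

theorem cas_f (H : IsSl2 e f h) (v : V) : sl2Cas e f h (f v) = f (sl2Cas e f h v) := by
  simp only [sl2Cas, LinearMap.add_apply, End.mul_apply, map_add, map_sub, H.hf, H.ef, map_smul]
  module

theorem cas_h (H : IsSl2 e f h) (v : V) : sl2Cas e f h (h v) = h (sl2Cas e f h v) := by
  simp only [sl2Cas, LinearMap.add_apply, End.mul_apply, map_add, H.hf, H.he]
  module

/-- The joint generalised eigenspace of `h` and the Casimir operator. -/
theorem e_mem (H : IsSl2 e f h) {a w : ℂ} {v : V} (hv : v ∈ h.maxGenEigenspace a)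
    (hw : v ∈ (sl2Cas e f h).maxGenEigenspace w) :
    e v ∈ h.maxGenEigenspace (a + 1) ∧ e v ∈ (sl2Cas e f h).maxGenEigenspace w := by
  refine ⟨mem_maxGenEigenspace_of_semiconj (fun v => ?_) hv,
    mem_maxGenEigenspace_of_semiconj (fun v => ?_) hw⟩
  · rw [H.he, map_sub, map_smul]; module
  · rw [H.cas_e, map_sub, map_smul]

theorem f_mem (H : IsSl2 e f h) {a w : ℂ} {v : V} (hv : v ∈ h.maxGenEigenspace a)
    (hw : v ∈ (sl2Cas e f h).maxGenEigenspace w) :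
    f v ∈ h.maxGenEigenspace (a - 1) ∧ f v ∈ (sl2Cas e f h).maxGenEigenspace w := by
  refine ⟨mem_maxGenEigenspace_of_semiconj (fun v => ?_) hv,
    mem_maxGenEigenspace_of_semiconj (fun v => ?_) hw⟩
  · rw [H.hf, map_sub, map_smul]; module
  · rw [H.cas_f, map_sub, map_smul]

theorem cas_eq (H : IsSl2 e f h) (v : V) : sl2Cas e f h v = e (f v) + h (h v) - h v := by
  simp only [sl2Cas, LinearMap.add_apply, End.mul_apply, H.ef]
  module

theorem e_injOn (H : IsSl2 e f h) {a w : ℂ} (hne : w ≠ a * (a + 1)) {v : V} (hv : v ∈ h.maxGenEigenspace a)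
    (hw : v ∈ (sl2Cas e f h).maxGenEigenspace w) (h0 : e v = 0) : v = 0 := by
  by_contra hv0
  obtain ⟨u, hu0, hu, hu1, hu2⟩ := exists_eigenvector_of_mem_maxGenEigenspace
    (P := fun v => e v = 0 ∧ v ∈ (sl2Cas e f h).maxGenEigenspace w) (by
      rintro v ⟨h1, h2⟩
      refine ⟨?_, Submodule.sub_mem _ ?_ (Submodule.smul_mem _ _ h2)⟩
      · have := H.he v
        rw [h1, map_zero, add_zero] at this
        rw [map_sub, map_smul, ← this, h1, smul_zero, sub_zero]
      · refine mem_maxGenEigenspace_of_semiconj (fun v => ?_) h2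
        rw [H.cas_h, map_sub, map_smul]) hv hv0 ⟨h0, hw⟩
  refine hne (eq_of_mem_maxGenEigenspace (ν := a * (a + 1)) hu2 ?_ hu0).symm
  simp only [sl2Cas, LinearMap.add_apply, End.mul_apply, hu1, hu, map_smul, map_zero]
  module

theorem f_injOn (H : IsSl2 e f h) {a w : ℂ} (hne : w ≠ a * (a - 1)) {v : V} (hv : v ∈ h.maxGenEigenspace a)
    (hw : v ∈ (sl2Cas e f h).maxGenEigenspace w) (h0 : f v = 0) : v = 0 := by
  by_contra hv0
  obtain ⟨u, hu0, hu, hu1, hu2⟩ := exists_eigenvector_of_mem_maxGenEigenspace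
    (P := fun v => f v = 0 ∧ v ∈ (sl2Cas e f h).maxGenEigenspace w) (by
      rintro v ⟨h1, h2⟩
      refine ⟨?_, Submodule.sub_mem _ ?_ (Submodule.smul_mem _ _ h2)⟩
      · have := H.hf v
        rw [h1, map_zero, sub_zero] at this
        rw [map_sub, map_smul, ← this, h1, smul_zero, sub_zero]
      · refine mem_maxGenEigenspace_of_semiconj (fun v => ?_) h2
        rw [H.cas_h, map_sub, map_smul]) hv hv0 ⟨h0, hw⟩
  refine hne (eq_of_mem_maxGenEigenspace (ν := a * (a - 1)) hu2 ?_ hu0).symm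
  rw [H.cas_eq, hu1, hu, map_smul, map_zero, hu]
  module

theorem f_surjOn (H : IsSl2 e f h) [FiniteDimensional ℂ V] {a w : ℂ} (hne : w ≠ a * (a + 1)) {v : V}
    (hv : v ∈ h.maxGenEigenspace a) (hw : v ∈ (sl2Cas e f h).maxGenEigenspace w) :
    ∃ u, u ∈ h.maxGenEigenspace (a + 1) ∧ u ∈ (sl2Cas e f h).maxGenEigenspace w ∧ f u = v := by
  obtain ⟨u, hu, hfu⟩ := exists_apply_eq_of_injOn
    (h.maxGenEigenspace a ⊓ (sl2Cas e f h).maxGenEigenspace w) (f * e) (by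
      rintro v ⟨h1, h2⟩
      have := H.e_mem h1 h2
      have := H.f_mem this.1 this.2
      rw [add_sub_cancel_right] at this
      exact this) (by
      rintro v ⟨h1, h2⟩ h3
      have h4 := H.e_mem h1 h2
      refine H.e_injOn hne h1 h2 (H.f_injOn ?_ h4.1 h4.2 h3)
      rwa [add_sub_cancel_right, mul_comm]) ⟨hv, hw⟩
  exact ⟨e u, (H.e_mem hu.1 hu.2).1, (H.e_mem hu.1 hu.2).2, hfu⟩

theorem exists_up (H : IsSl2 e f h) [FiniteDimensional ℂ V] {a w : ℂ} {v : V} (hv : v ∈ h.maxGenEigenspace a)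
    (hw : v ∈ (sl2Cas e f h).maxGenEigenspace w) (h0 : v ≠ 0) :
    ∃ i : ℕ, w = (a + i) * (a + i + 1) := by
  by_contra! hcon
  have key : ∀ i : ℕ, ∃ u, u ∈ h.maxGenEigenspace (a + i) ∧
      u ∈ (sl2Cas e f h).maxGenEigenspace w ∧ u ≠ 0 := by
    intro i
    induction i with
    | zero => exact ⟨v, by simpa using hv, hw, h0⟩
    | succ i ih =>
      obtain ⟨u, h1, h2, h3⟩ := ih
      refine ⟨e u, ?_, (H.e_mem h1 h2).2, fun h4 => h3 (H.e_injOn (hcon i) h1 h2 h4)⟩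
      rw [Nat.cast_succ, ← add_assoc]
      exact (H.e_mem h1 h2).1
  refine Set.infinite_of_injective_forall_mem (f := fun i : ℕ => a + (i : ℂ)) ?_ ?_
    h.finite_hasEigenvalue
  · intro i j hij
    simpa using hij
  · intro i
    obtain ⟨u, h1, -, h3⟩ := key i
    exact hasEigenvalue_of_mem_maxGenEigenspace h1 h3

theorem exists_down (H : IsSl2 e f h) [FiniteDimensional ℂ V] {a w : ℂ} {v : V} (hv : v ∈ h.maxGenEigenspace a)
    (hw : v ∈ (sl2Cas e f h).maxGenEigenspace w) (h0 : v ≠ 0) :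
    ∃ i : ℕ, w = (a - i) * (a - i - 1) := by
  by_contra! hcon
  have key : ∀ i : ℕ, ∃ u, u ∈ h.maxGenEigenspace (a - i) ∧
      u ∈ (sl2Cas e f h).maxGenEigenspace w ∧ u ≠ 0 := by
    intro i
    induction i with
    | zero => exact ⟨v, by simpa using hv, hw, h0⟩
    | succ i ih =>
      obtain ⟨u, h1, h2, h3⟩ := ih
      refine ⟨f u, ?_, (H.f_mem h1 h2).2, fun h4 => h3 (H.f_injOn (hcon i) h1 h2 h4)⟩
      rw [Nat.cast_succ, ← sub_sub]
      exact (H.f_mem h1 h2).1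
  refine Set.infinite_of_injective_forall_mem (f := fun i : ℕ => a - (i : ℂ)) ?_ ?_
    h.finite_hasEigenvalue
  · intro i j hij
    simpa using hij
  · intro i
    obtain ⟨u, h1, -, h3⟩ := key i
    exact hasEigenvalue_of_mem_maxGenEigenspace h1 h3

theorem exists_weight (H : IsSl2 e f h) [FiniteDimensional ℂ V] {a w : ℂ} {v : V} (hv : v ∈ h.maxGenEigenspace a)
    (hw : v ∈ (sl2Cas e f h).maxGenEigenspace w) (h0 : v ≠ 0) :
    ∃ r m : ℕ, m < r ∧ a = ((r : ℂ) - 1) / 2 - m ∧ w = ((r : ℂ) ^ 2 - 1) / 4 := by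
  obtain ⟨i, hi⟩ := H.exists_up hv hw h0
  obtain ⟨j, hj⟩ := H.exists_down hv hw h0
  have h1 : (2 * a + i - j) * ((i : ℂ) + j + 1) = 0 := by linear_combination hi.symm.trans hj
  have h2 : ((i : ℂ) + j + 1) ≠ 0 := by exact_mod_cast (Nat.succ_ne_zero (i + j))
  have h3 : a = ((j : ℂ) - i) / 2 := by
    have := (mul_eq_zero.1 h1).resolve_right h2
    linear_combination this / 2
  refine ⟨i + j + 1, i, by omega, ?_, ?_⟩
  · rw [h3]; push_cast; ring
  · rw [hi, h3]; push_cast; ring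

theorem hwSpace_cas {r : ℤ} {v : V} (hv : v ∈ hwSpace e h r) :
    sl2Cas e f h v = (((r : ℂ) ^ 2 - 1) / 4) • v := by
  obtain ⟨h1, h2⟩ := hv
  simp only [sl2Cas, LinearMap.add_apply, End.mul_apply, h1, h2, map_smul, map_zero]
  module

theorem hwSpace_eq_bot (H : IsSl2 e f h) [FiniteDimensional ℂ V] {r : ℤ} (hr : r ≤ 0) : hwSpace e h r = ⊥ := by
  rw [eq_bot_iff]
  intro v hv
  by_contra h0
  obtain ⟨k, m, hm, h1, h2⟩ := H.exists_weight (mem_maxGenEigenspace_of_eq hv.2)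
    (mem_maxGenEigenspace_of_eq (hwSpace_cas hv)) h0
  have h3 : (r : ℂ) = k - 2 * m := by linear_combination 2 * h1
  have h4 : (r : ℂ) ^ 2 = k ^ 2 := by linear_combination 4 * h2
  have h3' : r = k - 2 * m := by exact_mod_cast h3
  have h4' : r ^ 2 = (k : ℤ) ^ 2 := by exact_mod_cast h4
  rcases sq_eq_sq_iff_eq_or_eq_neg.1 h4' with h5 | h5 <;> omega

theorem h_f_pow (H : IsSl2 e f h) {r : ℤ} {u : V} (hu : u ∈ hwSpace e h r) (m : ℕ) :
    h ((f ^ m) u) = (((r : ℂ) - 1) / 2 - m) • (f ^ m) u := by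
  induction m with
  | zero => simpa using hu.2
  | succ m ih => rw [pow_succ', End.mul_apply, H.hf, ih, map_smul]; push_cast; module

theorem e_f_pow (H : IsSl2 e f h) {r : ℤ} {u : V} (hu : u ∈ hwSpace e h r) (m : ℕ) :
    e ((f ^ (m + 1)) u) = (((m : ℂ) + 1) * (r - 1 - m)) • (f ^ m) u := by
  induction m with
  | zero => simp [H.ef, hu.1, hu.2]; module
  | succ m ih =>
    rw [pow_succ', End.mul_apply, H.ef, ih, H.h_f_pow hu, map_smul, pow_succ' f m, End.mul_apply]
    push_cast; module

theorem cas_f_pow (H : IsSl2 e f h) {r : ℤ} {u : V} (hu : u ∈ hwSpace e h r) (m : ℕ) :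
    sl2Cas e f h ((f ^ m) u) = (((r : ℂ) ^ 2 - 1) / 4) • (f ^ m) u := by
  induction m with
  | zero => simpa using hwSpace_cas hu
  | succ m ih => rw [pow_succ', End.mul_apply, H.cas_f, ih, map_smul]

theorem f_pow_eq_zero (H : IsSl2 e f h) [FiniteDimensional ℂ V] {r : ℤ} {u : V} (hu : u ∈ hwSpace e h r) {m : ℕ}
    (hm : r ≤ m) : (f ^ m) u = 0 := by
  rcases le_or_gt r 0 with hr | hr
  · rw [H.hwSpace_eq_bot hr] at hu
    rw [(Submodule.mem_bot ℂ).1 hu, map_zero]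
  obtain ⟨k, rfl⟩ : ∃ k : ℕ, r = k + 1 := ⟨(r - 1).toNat, by omega⟩
  have h1 : (f ^ (k + 1)) u ∈ hwSpace e h (-(k + 1)) := by
    refine ⟨?_, ?_⟩
    · rw [H.e_f_pow hu]; push_cast; simp
    · rw [H.h_f_pow hu]; push_cast; congr 1; ring
  rw [H.hwSpace_eq_bot (by omega), Submodule.mem_bot] at h1
  obtain ⟨j, rfl⟩ : ∃ j, m = j + (k + 1) := ⟨m - (k + 1), by omega⟩
  rw [pow_add, End.mul_apply, h1, map_zero]

theorem f_pow_injOn (H : IsSl2 e f h) {r : ℤ} {u : V} (hu : u ∈ hwSpace e h r) {m : ℕ} (hm : (m : ℤ) < r)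
    (h0 : (f ^ m) u = 0) : u = 0 := by
  induction m with
  | zero => simpa using h0
  | succ m ih =>
    refine ih (by omega) ?_
    have h1 := H.e_f_pow hu m
    rw [h0, map_zero] at h1
    refine (smul_eq_zero.1 h1.symm).resolve_left (mul_ne_zero ?_ ?_)
    · exact_mod_cast Nat.succ_ne_zero m
    · have : ((r - 1 - m : ℤ) : ℂ) ≠ 0 := Int.cast_ne_zero.2 (by push_cast at hm; omega)
      exact_mod_cast this

theorem exists_f_pow_eq (H : IsSl2 e f h) [FiniteDimensional ℂ V] {r m : ℕ} (hm : m < r) {v : V}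
    (hv : v ∈ h.maxGenEigenspace (((r : ℂ) - 1) / 2 - m))
    (hw : v ∈ (sl2Cas e f h).maxGenEigenspace (((r : ℂ) ^ 2 - 1) / 4)) :
    ∃ u, u ∈ h.maxGenEigenspace (((r : ℂ) - 1) / 2) ∧
      u ∈ (sl2Cas e f h).maxGenEigenspace (((r : ℂ) ^ 2 - 1) / 4) ∧ (f ^ m) u = v := by
  induction m generalizing v with
  | zero => exact ⟨v, by simpa using hv, hw, by simp⟩
  | succ m ih =>
    obtain ⟨u, h1, h2, h3⟩ := H.f_surjOn (by
      intro h4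
      have : ((m : ℂ) + 1) * ((r : ℂ) - (m + 1)) = 0 := by
        push_cast at h4; linear_combination h4
      rcases mul_eq_zero.1 this with h5 | h5
      · exact absurd h5 (by exact_mod_cast Nat.succ_ne_zero m)
      · have : (r : ℂ) = (m + 1 : ℕ) := by push_cast; linear_combination h5
        have := Nat.cast_injective this
        omega) hv hw
    obtain ⟨u', h4, h5, h6⟩ := ih (by omega) (v := u) (by
      convert h1 using 1; push_cast; ring_nf) h2
    exact ⟨u', h4, h5, by rw [pow_succ', End.mul_apply, h6, h3]⟩

theorem f_pow_injOn' (H : IsSl2 e f h) {r m : ℕ} (hm : m < r) {v : V}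
    (hv : v ∈ h.maxGenEigenspace (((r : ℂ) - 1) / 2))
    (hw : v ∈ (sl2Cas e f h).maxGenEigenspace (((r : ℂ) ^ 2 - 1) / 4)) :
    (f ^ m) v ∈ h.maxGenEigenspace (((r : ℂ) - 1) / 2 - m) ∧
    (f ^ m) v ∈ (sl2Cas e f h).maxGenEigenspace (((r : ℂ) ^ 2 - 1) / 4) ∧
    ((f ^ m) v = 0 → v = 0) := by
  induction m with
  | zero =>
    refine ⟨?_, hw, fun h => h⟩
    rw [Nat.cast_zero, sub_zero]
    exact hv
  | succ m ih =>
    obtain ⟨h1, h2, h3⟩ := ih (by omega)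
    rw [pow_succ', End.mul_apply, Nat.cast_succ, ← sub_sub]
    refine ⟨(H.f_mem h1 h2).1, (H.f_mem h1 h2).2, fun h4 => h3 (H.f_injOn ?_ h1 h2 h4)⟩
    intro h4
    have : ((m : ℂ) + 1) * ((r : ℂ) - (m + 1)) = 0 := by
      linear_combination h4
    rcases mul_eq_zero.1 this with h5 | h5
    · exact absurd h5 (by exact_mod_cast Nat.succ_ne_zero m)
    · have : (r : ℂ) = (m + 1 : ℕ) := by push_cast; linear_combination h5
      have := Nat.cast_injective this
      omega

theorem h_pow_f (H : IsSl2 e f h) (k : ℕ) (v : V) : h ((f ^ k) v) = (f ^ k) (h v) - (k : ℂ) • (f ^ k) v := by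
  induction k with
  | zero => simp
  | succ k ih =>
    rw [pow_succ', End.mul_apply, H.hf, ih, End.mul_apply, map_sub, map_smul]; push_cast; module

theorem mem_hwSpace_of_mem_maxGen (H : IsSl2 e f h) [FiniteDimensional ℂ V] {r : ℕ} (hr : 0 < r) {v : V}
    (hv : v ∈ h.maxGenEigenspace (((r : ℂ) - 1) / 2))
    (hw : v ∈ (sl2Cas e f h).maxGenEigenspace (((r : ℂ) ^ 2 - 1) / 4)) : v ∈ hwSpace e h r := by
  have he : e v = 0 := by
    by_contra h0
    have h1 := H.e_mem hv hw
    obtain ⟨k, m, hm, h3, h4⟩ := H.exists_weight h1.1 h1.2 h0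
    have h5 : (r : ℂ) + 2 + 2 * m = k := by linear_combination 2 * h3
    have h6 : (r : ℂ) ^ 2 = k ^ 2 := by linear_combination 4 * h4
    have h5' : r + 2 + 2 * m = k := by exact_mod_cast h5
    have h6' : r ^ 2 = k ^ 2 := by exact_mod_cast h6
    have := Nat.pow_left_injective (n := 2) (by norm_num) h6'
    omega
  refine ⟨he, ?_⟩
  have h1 := H.f_pow_injOn' (m := r - 1) (by omega) hv hw
  have hfz : f ((f ^ (r - 1)) v) = 0 := by
    by_contra h0
    have h2 := H.f_mem h1.1 h1.2.1
    obtain ⟨k, m, hm, h3, h4⟩ := H.exists_weight h2.1 h2.2 h0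
    rw [Nat.cast_pred hr] at h3
    have h5 : (k : ℂ) + r = 2 * m := by linear_combination -2 * h3
    have h6 : (r : ℂ) ^ 2 = k ^ 2 := by linear_combination 4 * h4
    have h5' : k + r = 2 * m := by exact_mod_cast h5
    have h6' : r ^ 2 = k ^ 2 := by exact_mod_cast h6
    have := Nat.pow_left_injective (n := 2) (by norm_num) h6'
    omega
  have h2 := H.cas_eq ((f ^ (r - 1)) v)
  have h3 : ∀ k : ℕ, sl2Cas e f h ((f ^ k) v) = (f ^ k) (sl2Cas e f h v) := by
    intro k
    induction k with
    | zero => simp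
    | succ k ih => rw [pow_succ', End.mul_apply, H.cas_f, ih, End.mul_apply]
  rw [h3, hfz, map_zero, H.h_pow_f, map_sub, map_smul, H.h_pow_f, H.h_pow_f,
    Nat.cast_pred hr] at h2
  have h4 : (f ^ (r - 1)) ((r : ℂ) • ((2 : ℂ) • h v - ((r : ℂ) - 1) • v)) = 0 := by
    simp only [sl2Cas, LinearMap.add_apply, End.mul_apply, he, map_zero, zero_add, map_add] at h2
    simp only [map_smul, map_sub]
    linear_combination (norm := module) h2
  have h5 := H.f_pow_injOn' (r := r) (m := r - 1) (v := (r : ℂ) • ((2 : ℂ) • h v - ((r : ℂ) - 1) • v))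
    (by omega) ?_ ?_
  · have h6 := (smul_eq_zero.1 (h5.2.2 h4)).resolve_left (by exact_mod_cast hr.ne')
    push_cast
    linear_combination (norm := module) (1 / 2 : ℂ) • h6
  · refine Submodule.smul_mem _ _ (Submodule.sub_mem _ (Submodule.smul_mem _ _ ?_)
      (Submodule.smul_mem _ _ hv))
    exact mem_maxGenEigenspace_of_semiconj (fun v => by rw [map_sub, map_smul]) hv
  · refine Submodule.smul_mem _ _ (Submodule.sub_mem _ (Submodule.smul_mem _ _ ?_)
      (Submodule.smul_mem _ _ hw))
    exact mem_maxGenEigenspace_of_semiconj (fun v => by rw [H.cas_h, map_sub, map_smul]) hw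

/-- Every finite-dimensional representation of `sl(2)` is spanned by the vectors `f ^ m u` with
`u` a highest weight vector. -/
theorem mem_iSup_map_hwSpace (H : IsSl2 e f h) [FiniteDimensional ℂ V] {P : Submodule ℂ V}
    (hP : ∀ r m : ℕ, m < r → ∀ u ∈ hwSpace e h r, (f ^ m) u ∈ P) : P = ⊤ := by
  rw [eq_top_iff, ← End.iSup_iInf_maxGenEigenspace_eq_top_of_iSup_maxGenEigenspace_eq_top_of_commute
    (![h, sl2Cas e f h]) ?_ (fun i => End.iSup_maxGenEigenspace_eq_top _)]
  · refine iSup_le fun χ v hv => ?_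
    by_cases h0 : v = 0
    · rw [h0]; exact P.zero_mem
    have h1 : v ∈ h.maxGenEigenspace (χ 0) := (Submodule.mem_iInf _).1 hv 0
    have h2 : v ∈ (sl2Cas e f h).maxGenEigenspace (χ 1) := (Submodule.mem_iInf _).1 hv 1
    obtain ⟨r, m, hm, h3, h4⟩ := H.exists_weight h1 h2 h0
    rw [h3] at h1
    rw [h4] at h2
    obtain ⟨u, h5, h6, rfl⟩ := H.exists_f_pow_eq hm h1 h2
    exact hP r m hm u (H.mem_hwSpace_of_mem_maxGen (by omega) h5 h6)
  · have : Commute h (sl2Cas e f h) := LinearMap.ext fun v => (H.cas_h v).symm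
    intro i j hij
    fin_cases i <;> fin_cases j
    · exact absurd rfl hij
    · exact this
    · exact this.symm
    · exact absurd rfl hij

end IsSl2

end Sl2

/-! ### The root of unity `q` -/

section Root

variable (p) [hp : Fact (2 ≤ p)]

theorem q_isPrimitiveRoot : IsPrimitiveRoot (q p) (2 * p) := by
  have h := Complex.isPrimitiveRoot_exp (2 * p) (by have := hp.out; omega)
  convert h using 1
  rw [q]
  congr 1
  push_cast
  have : (p : ℂ) ≠ 0 := by have := hp.out; exact_mod_cast (by omega : p ≠ 0)
  field_simp

omit hp in
theorem q_ne_zero : q p ≠ 0 := Complex.exp_ne_zero _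

theorem q_zpow_eq_one_iff (n : ℤ) : q p ^ n = 1 ↔ ((2 * p : ℕ) : ℤ) ∣ n :=
  (q_isPrimitiveRoot p).zpow_eq_one_iff_dvd n

theorem q_zpow_p : q p ^ (p : ℤ) = -1 := by
  have h1 : (q p ^ (p : ℤ)) ^ 2 = 1 := by
    rw [← zpow_natCast, ← zpow_mul, q_zpow_eq_one_iff]
    exact ⟨1, by push_cast; ring⟩
  rw [sq] at h1
  rcases mul_self_eq_one_iff.1 h1 with h | h
  · rw [q_zpow_eq_one_iff] at h
    have := Int.le_of_dvd (by have := hp.out; omega) h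
    have := hp.out
    push_cast at *
    omega
  · exact h

theorem q_pow_p : q p ^ p = -1 := by rw [← zpow_natCast, q_zpow_p]

theorem q_zpow_eq_iff (m n : ℤ) : q p ^ m = q p ^ n ↔ ((2 * p : ℕ) : ℤ) ∣ m - n := by
  rw [← q_zpow_eq_one_iff, zpow_sub₀ (q_ne_zero p), div_eq_one_iff_eq (zpow_ne_zero _ (q_ne_zero p))]

theorem q_sub_inv_ne_zero : q p - (q p)⁻¹ ≠ 0 := by
  intro h
  have h1 : q p ^ (1 : ℤ) = q p ^ (-1 : ℤ) := by simpa [sub_eq_zero] using h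
  rw [q_zpow_eq_iff] at h1
  have := Int.le_of_dvd (by norm_num) h1
  have := hp.out
  omega

theorem qInt_eq_zero_iff (n : ℤ) : qInt p n = 0 ↔ (p : ℤ) ∣ n := by
  rw [qInt, div_eq_zero_iff, or_iff_left (q_sub_inv_ne_zero p), sub_eq_zero, q_zpow_eq_iff]
  have : n - -n = 2 * n := by ring
  rw [this, Nat.cast_mul]
  exact mul_dvd_mul_iff_left (by norm_num)

theorem qInt_sub (n : ℤ) : qInt p (p - n) = qInt p n := by
  have := q_ne_zero p
  simp only [qInt, neg_sub, zpow_sub₀ this, q_zpow_p, zpow_neg]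
  field_simp
  ring

omit hp in
theorem qInt_zero : qInt p 0 = 0 := by simp [qInt]

theorem qInt_ne_zero {n : ℤ} (h1 : 0 < n) (h2 : n < p) : qInt p n ≠ 0 := by
  rw [Ne, qInt_eq_zero_iff]
  intro h
  have := Int.le_of_dvd h1 h
  omega

theorem qFactorial_ne_zero {n : ℕ} (h : n < p) : qFactorial p n ≠ 0 := by
  rw [qFactorial, Finset.prod_ne_zero_iff]
  intro k hk
  rw [Finset.mem_Icc] at hk
  exact qInt_ne_zero p (by omega) (by omega)

theorem qInt_mul_qInt (s n : ℤ) : (q p - (q p)⁻¹) ^ 2 * (qInt p n * qInt p (s - n)) =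
    q p ^ s + q p ^ (-s) - q p ^ (s - 2 * n) - q p ^ (-(s - 2 * n)) := by
  have h := q_sub_inv_ne_zero p
  have h0 := q_ne_zero p
  have e1 : q p ^ s = q p ^ n * q p ^ (s - n) := by rw [← zpow_add₀ h0]; congr 1; ring
  have e2 : q p ^ (-s) = q p ^ (-n) * q p ^ (-(s - n)) := by rw [← zpow_add₀ h0]; congr 1; ring
  have e3 : q p ^ (s - 2 * n) = q p ^ (-n) * q p ^ (s - n) := by
    rw [← zpow_add₀ h0]; congr 1; ring
  have e4 : q p ^ (-(s - 2 * n)) = q p ^ n * q p ^ (-(s - n)) := by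
    rw [← zpow_add₀ h0]; congr 1; ring
  rw [e1, e2, e3, e4, qInt, qInt]
  generalize q p - (q p)⁻¹ = d at h
  field_simp
  rw [neg_sub]
  ring

end Root

/-! ### The relations of `LU_q sl(2)`, as identities for the action on a module -/

section Relations

variable {M : Type*} [AddCommGroup M] [Module (LU p) M] [Module ℂ M]
  [IsScalarTower ℂ (LU p) M]

theorem mkAlgHom_rel {a b : FreeAlgebra ℂ Gen} (h : Rel p a b) :
    RingQuot.mkAlgHom ℂ (Rel p) a = RingQuot.mkAlgHom ℂ (Rel p) b :=
  RingQuot.mkAlgHom_rel ℂ h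

/-- The projection from the free algebra. -/
def mkLU (p : ℕ) : FreeAlgebra ℂ Gen →ₐ[ℂ] LU p := RingQuot.mkAlgHom ℂ (Rel p)

theorem mkLU_surjective (p : ℕ) : Function.Surjective (mkLU p) :=
  RingQuot.mkAlgHom_surjective ℂ (Rel p)

theorem mkLU_ι (x : Gen) : mkLU p (FreeAlgebra.ι ℂ x) = gen p x := rfl

theorem mkLU_rel {a b : FreeAlgebra ℂ Gen} (h : Rel p a b) : mkLU p a = mkLU p b :=
  RingQuot.mkAlgHom_rel ℂ h

/-- The Casimir element. -/
def casLU (p : ℕ) : LU p := mkLU p (Free.casimir p)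

/-- The element `A`. -/
def elA (p : ℕ) : LU p := mkLU p (Free.A p)

/-- The element `H`. -/
def elH (p : ℕ) : LU p := mkLU p (Free.H p)

theorem K_Kinv_smul (v : M) : gK • gKi • v = v := by
  have h := congrArg (· • v) (mkLU_rel (p := p) Rel.K_Kinv)
  simpa [mul_smul, mkLU_ι] using h

theorem Kinv_K_smul (v : M) : gKi • gK • v = v := by
  have h := congrArg (· • v) (mkLU_rel (p := p) Rel.Kinv_K)
  simpa [mul_smul, mkLU_ι] using h

theorem K_E_smul (v : M) : gK • gE • v = (q p ^ 2) • gE • gK • v := by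
  have h := congrArg (· • gK • v) (mkLU_rel (p := p) Rel.K_E)
  simpa [mul_smul, mkLU_ι, Kinv_K_smul] using h

theorem K_F_smul (v : M) : gK • gF • v = (q p ^ 2)⁻¹ • gF • gK • v := by
  have h := congrArg (· • gK • v) (mkLU_rel (p := p) Rel.K_F)
  simpa [mul_smul, mkLU_ι, Kinv_K_smul] using h

theorem E_F_smul (v : M) : gE • gF • v = gF • gE • v + dl⁻¹ • (gK • v - gKi • v) := by
  have h := congrArg (· • v) (mkLU_rel (p := p) Rel.E_F)
  rw [← sub_eq_iff_eq_add']
  simpa [mul_smul, mkLU_ι, sub_smul] using h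

theorem E_pow_smul (v : M) : gE ^ p • v = 0 := by
  have h := congrArg (· • v) (mkLU_rel (p := p) Rel.E_pow)
  simpa [mkLU_ι] using h

theorem F_pow_smul (v : M) : gF ^ p • v = 0 := by
  have h := congrArg (· • v) (mkLU_rel (p := p) Rel.F_pow)
  simpa [mkLU_ι] using h

theorem K_pow_smul (v : M) : gK ^ (2 * p) • v = v := by
  have h := congrArg (· • v) (mkLU_rel (p := p) Rel.K_pow)
  simpa [mkLU_ι] using h

theorem h_e_smul (v : M) : gh • ge • v = ge • gh • v + ge • v := by
  have h := congrArg (· • v) (mkLU_rel (p := p) Rel.h_e)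
  rw [← sub_eq_iff_eq_add']
  simpa [mul_smul, mkLU_ι, sub_smul] using h

theorem h_f_smul (v : M) : gh • gf • v = gf • gh • v - gf • v := by
  have h := congrArg (· • v) (mkLU_rel (p := p) Rel.h_f)
  rw [sub_eq_add_neg, ← sub_eq_iff_eq_add']
  simpa [mul_smul, mkLU_ι, sub_smul] using h

theorem e_f_smul (v : M) : ge • gf • v = gf • ge • v + (2 : ℂ) • gh • v := by
  have h := congrArg (· • v) (mkLU_rel (p := p) Rel.e_f)
  rw [← sub_eq_iff_eq_add', ← smul_assoc]
  simpa [mul_smul, mkLU_ι, sub_smul] using h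

theorem h_K_smul (v : M) : gh • gK • v = gK • gh • v := by
  have h := congrArg (· • v) (mkLU_rel (p := p) Rel.h_K)
  simpa [mul_smul, mkLU_ι] using h

theorem E_e_smul (v : M) : gE • ge • v = ge • gE • v := by
  have h := congrArg (· • v) (mkLU_rel (p := p) Rel.E_e)
  simpa [mul_smul, mkLU_ι] using h

theorem K_e_smul (v : M) : gK • ge • v = ge • gK • v := by
  have h := congrArg (· • v) (mkLU_rel (p := p) Rel.K_e)
  simpa [mul_smul, mkLU_ι] using h

theorem F_f_smul (v : M) : gF • gf • v = gf • gF • v := by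
  have h := congrArg (· • v) (mkLU_rel (p := p) Rel.F_f)
  simpa [mul_smul, mkLU_ι] using h

theorem K_f_smul (v : M) : gK • gf • v = gf • gK • v := by
  have h := congrArg (· • v) (mkLU_rel (p := p) Rel.K_f)
  simpa [mul_smul, mkLU_ι] using h

theorem F_e_smul (v : M) : gF • ge • v = ge • gF • v +
    (qFactorial p (p - 1))⁻¹ • gK ^ p • elH p • gE ^ (p - 1) • v := by
  have h := congrArg (· • v) (mkLU_rel (p := p) Rel.F_e)
  rw [← sub_eq_iff_eq_add']
  simpa [mul_smul, mkLU_ι, sub_smul, elH] using h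

theorem E_f_smul (v : M) : gE • gf • v = gf • gE • v +
    ((-1 : ℂ) ^ (p + 1) * (qFactorial p (p - 1))⁻¹) • gF ^ (p - 1) • elH p • v := by
  have h := congrArg (· • v) (mkLU_rel (p := p) Rel.E_f)
  rw [← sub_eq_iff_eq_add']
  simp only [map_sub, map_mul, map_smul, map_pow, mkLU_ι, sub_smul, mul_smul, smul_assoc] at h
  rw [mul_smul]
  exact h

theorem h_E_smul (v : M) : gh • gE • v = gE • gh • v + (2 : ℂ)⁻¹ • gE • elA p • v := by
  have h := congrArg (· • v) (mkLU_rel (p := p) Rel.h_E)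
  rw [← sub_eq_iff_eq_add']
  simpa [mul_smul, mkLU_ι, sub_smul, elA] using h

theorem h_F_smul (v : M) : gh • gF • v = gF • gh • v - (2 : ℂ)⁻¹ • elA p • gF • v := by
  have h := congrArg (· • v) (mkLU_rel (p := p) Rel.h_F)
  rw [sub_eq_add_neg, ← sub_eq_iff_eq_add']
  simpa [mul_smul, mkLU_ι, sub_smul, elA] using h

theorem casLU_smul (v : M) :
    casLU p • v = dl ^ 2 • gE • gF • v + (q p)⁻¹ • gK • v + q p • gKi • v := by
  simp [casLU, Free.casimir, mkLU_ι, add_smul, mul_smul]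

theorem elH_smul (v : M) : elH p • v = dl⁻¹ • (q p • gK • v - (q p)⁻¹ • gKi • v) := by
  simp [elH, Free.H, mkLU_ι, sub_smul]

theorem gen_smul_comm (x : LU p) (c : ℂ) (v : M) : x • c • v = c • x • v :=
  haveI : SMulCommClass (LU p) ℂ M := IsScalarTower.to_smulCommClass'
  smul_comm x c v

theorem casLU_smul' [Fact (2 ≤ p)] (v : M) :
    casLU p • v = dl ^ 2 • gF • gE • v + q p • gK • v + (q p)⁻¹ • gKi • v := by
  rw [casLU_smul, E_F_smul]
  have h := q_sub_inv_ne_zero p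
  have : dl ^ 2 • dl⁻¹ • (gK • v - gKi • v) = dl • (gK • v - gKi • v) := by
    rw [smul_smul]; congr 1; field_simp
  rw [smul_add, this]
  generalize gK • v = a, gKi • v = b, gF • gE • v = c
  module

theorem Kinv_E_smul (v : M) : gKi • gE • v = (q p ^ 2)⁻¹ • gE • gKi • v := by
  have h := congrArg (gKi • ·) (K_E_smul (p := p) (gKi • v))
  simp only [Kinv_K_smul, K_Kinv_smul, gen_smul_comm] at h
  rw [h, inv_smul_smul₀ (pow_ne_zero _ (q_ne_zero p))]

theorem Kinv_F_smul (v : M) : gKi • gF • v = q p ^ 2 • gF • gKi • v := by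
  have h := congrArg (gKi • ·) (K_F_smul (p := p) (gKi • v))
  simp only [Kinv_K_smul, K_Kinv_smul, gen_smul_comm] at h
  rw [h, smul_inv_smul₀ (pow_ne_zero _ (q_ne_zero p))]

theorem Kinv_e_smul (v : M) : gKi • ge • v = ge • gKi • v := by
  have h := congrArg (gKi • ·) (K_e_smul (p := p) (gKi • v))
  simpa only [Kinv_K_smul, K_Kinv_smul] using h.symm

theorem Kinv_f_smul (v : M) : gKi • gf • v = gf • gKi • v := by
  have h := congrArg (gKi • ·) (K_f_smul (p := p) (gKi • v))
  simpa only [Kinv_K_smul, K_Kinv_smul] using h.symm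

theorem Kinv_h_smul (v : M) : gKi • gh • v = gh • gKi • v := by
  have h := congrArg (gKi • ·) (h_K_smul (p := p) (gKi • v))
  simpa only [Kinv_K_smul, K_Kinv_smul] using h

theorem elH_F_smul (v : M) : ∃ w : M, elH p • gF • v = gF • w := by
  refine ⟨dl⁻¹ • (q p • (q p ^ 2)⁻¹ • gK • v - (q p)⁻¹ • q p ^ 2 • gKi • v), ?_⟩
  rw [elH_smul, K_F_smul, Kinv_F_smul]
  simp only [smul_sub, gen_smul_comm]

theorem E_K_pow_smul (n : ℕ) {w : M} (hw : gE • w = 0) : gE • gK ^ n • w = 0 := by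
  induction n with
  | zero => simpa using hw
  | succ n ih =>
    rw [pow_succ', mul_smul]
    have h := K_E_smul (p := p) (gK ^ n • w)
    rw [ih, smul_zero] at h
    exact (smul_eq_zero.1 h.symm).resolve_left (pow_ne_zero _ (q_ne_zero p))

theorem E_elH_smul {w : M} (hw : gE • w = 0) : gE • elH p • w = 0 := by
  have h1 : gE • gK • w = 0 := by simpa using E_K_pow_smul (p := p) 1 hw
  have h2 : gE • gKi • w = 0 := by
    have h := Kinv_E_smul (p := p) w
    rw [hw, smul_zero] at h
    exact (smul_eq_zero.1 h.symm).resolve_left (inv_ne_zero (pow_ne_zero _ (q_ne_zero p)))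
  rw [elH_smul]
  simp only [smul_sub, gen_smul_comm, h1, h2, smul_zero, sub_zero]

variable [hp : Fact (2 ≤ p)]

theorem E_mul_E_pow_smul (v : M) : gE • gE ^ (p - 1) • v = 0 := by
  rw [← mul_smul, ← pow_succ', show p - 1 + 1 = p by have := hp.out; omega, E_pow_smul]

theorem F_pow_F_smul (v : M) : gF ^ (p - 1) • gF • v = 0 := by
  rw [← mul_smul, ← pow_succ, show p - 1 + 1 = p by have := hp.out; omega, F_pow_smul]

theorem casLU_E (v : M) : casLU p • gE • v = gE • casLU p • v := by
  rw [casLU_smul, casLU_smul' v]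
  simp only [smul_add, gen_smul_comm]
  rw [K_E_smul, Kinv_E_smul]
  have h0 := q_ne_zero p
  generalize gE • gK • v = a, gE • gKi • v = b, gE • gF • gE • v = c
  match_scalars <;> field_simp

theorem casLU_F (v : M) : casLU p • gF • v = gF • casLU p • v := by
  rw [casLU_smul', casLU_smul v]
  simp only [smul_add, gen_smul_comm]
  rw [K_F_smul, Kinv_F_smul]
  have h0 := q_ne_zero p
  generalize gF • gK • v = a, gF • gKi • v = b, gF • gE • gF • v = c
  match_scalars <;> field_simp

theorem casLU_K (v : M) : casLU p • gK • v = gK • casLU p • v := by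
  rw [casLU_smul, casLU_smul v]
  simp only [smul_add, gen_smul_comm]
  rw [K_E_smul, K_F_smul, K_Kinv_smul, Kinv_K_smul, gen_smul_comm]
  have h0 := q_ne_zero p
  generalize gK • gK • v = a, gE • gF • gK • v = b
  match_scalars <;> field_simp

theorem casLU_h (v : M) : casLU p • gh • v = gh • casLU p • v := by
  rw [casLU_smul, casLU_smul v]
  simp only [smul_add, gen_smul_comm]
  rw [h_E_smul, h_F_smul, h_K_smul, Kinv_h_smul, smul_sub, gen_smul_comm]
  simp

theorem casLU_e (v : M) : casLU p • ge • v = ge • casLU p • v := by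
  rw [casLU_smul, casLU_smul v]
  simp only [smul_add, gen_smul_comm]
  rw [F_e_smul, smul_add, K_e_smul, Kinv_e_smul, E_e_smul, gen_smul_comm,
    E_K_pow_smul _ (E_elH_smul (E_mul_E_pow_smul v))]
  simp

theorem casLU_f (v : M) : casLU p • gf • v = gf • casLU p • v := by
  rw [casLU_smul, casLU_smul v]
  simp only [smul_add, gen_smul_comm]
  obtain ⟨w, hw⟩ := elH_F_smul (p := p) v
  rw [F_f_smul, E_f_smul, hw, F_pow_F_smul, K_f_smul, Kinv_f_smul]
  simp

/-- The action of an element of the algebra as a linear operator. -/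
def act (M : Type*) [AddCommGroup M] [Module (LU p) M] [Module ℂ M]
    [IsScalarTower ℂ (LU p) M] (x : LU p) : End ℂ M := Algebra.lsmul ℂ ℂ M x

omit hp in
@[simp] theorem act_apply (x : LU p) (v : M) : act M x v = x • v := rfl

omit hp in
theorem act_pow_apply (x : LU p) (n : ℕ) (v : M) : (act M x ^ n) v = x ^ n • v := by
  rw [act, ← map_pow]; rfl

omit hp in
variable (p M) in
theorem isSl2_act : IsSl2 (act M ge) (act M gf) (act M gh) where
  he v := by simp [h_e_smul]
  hf v := by simp [h_f_smul]
  ef v := by simp [e_f_smul]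

omit hp in
theorem span_gen_le {P : Submodule ℂ M} (hP : ∀ (x : Gen), ∀ v ∈ P, gen p x • v ∈ P) (x : LU p)
    {v : M} (hv : v ∈ P) : x • v ∈ P := by
  obtain ⟨y, rfl⟩ := mkLU_surjective p x
  induction y using FreeAlgebra.induction generalizing v with
  | grade0 c => simpa using P.smul_mem c hv
  | grade1 g => exact hP g v hv
  | mul a b ha hb => rw [map_mul, mul_smul]; exact ha (hb hv)
  | add a b ha hb => rw [map_add, add_smul]; exact P.add_mem (ha hv) (hb hv)

omit hp in
/-- A linear map that commutes with the generators is a homomorphism of modules. -/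
theorem map_smul_of_gen {N : Type*} [AddCommGroup N] [Module (LU p) N] [Module ℂ N]
    [IsScalarTower ℂ (LU p) N] (φ : M →ₗ[ℂ] N)
    (h : ∀ (x : Gen) (v : M), φ (gen p x • v) = gen p x • φ v) (x : LU p) (v : M) :
    φ (x • v) = x • φ v := by
  obtain ⟨y, rfl⟩ := mkLU_surjective p x
  induction y using FreeAlgebra.induction generalizing v with
  | grade0 c => simp
  | grade1 g => exact h g v
  | mul a b ha hb => rw [map_mul, mul_smul, ha, hb, mul_smul]
  | add a b ha hb => rw [map_add, add_smul, map_add, ha, hb, add_smul]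

omit hp in
theorem map_complex_smul {N : Type*} [AddCommGroup N] [Module (LU p) N] [Module ℂ N]
    [IsScalarTower ℂ (LU p) N] (φ : M →ₗ[LU p] N) (c : ℂ) (v : M) : φ (c • v) = c • φ v :=
  φ.map_smul_of_tower c v

end Relations

/-! ### The action of the element `A` -/

section ElementA

variable (p) [hp : Fact (2 ≤ p)]

theorem beta_injOn {i j : ℕ} (hi : i ≤ p) (hj : j ≤ p) (h : beta p i = beta p j) : i = j := by
  have h0 := q_ne_zero p
  have key : (q p ^ (i : ℤ) - q p ^ (j : ℤ)) * (q p ^ ((i : ℤ) + j) - 1) = 0 := by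
    have e1 : q p ^ (-(i : ℤ)) * q p ^ (i : ℤ) = 1 := by rw [← zpow_add₀ h0]; simp
    have e2 : q p ^ (-(j : ℤ)) * q p ^ (j : ℤ) = 1 := by rw [← zpow_add₀ h0]; simp
    rw [beta, beta] at h
    rw [zpow_add₀ h0]
    linear_combination q p ^ (i : ℤ) * q p ^ (j : ℤ) * h - q p ^ (j : ℤ) * e1 +
      q p ^ (i : ℤ) * e2
  have := hp.out
  rcases mul_eq_zero.1 key with h1 | h1
  · rw [sub_eq_zero, q_zpow_eq_iff] at h1
    obtain ⟨k, hk⟩ := h1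
    have : k = 0 := by
      by_contra hk0
      rcases lt_or_gt_of_ne hk0 with hk1 | hk1
      · push_cast at hk; nlinarith
      · push_cast at hk; nlinarith
    subst this
    omega
  · rw [sub_eq_zero, q_zpow_eq_one_iff] at h1
    obtain ⟨k, hk⟩ := h1
    push_cast at hk
    have : k = 0 ∨ k = 1 := by
      by_contra! hk0
      rcases lt_or_gt_of_ne hk0.1 with hk1 | hk1
      · nlinarith
      · have : 2 ≤ k := by omega
        nlinarith
    rcases this with rfl | rfl <;> omega

theorem q_zpow_injOn {i j m : ℤ} (h : q p ^ (m - 2 * i) = q p ^ (m - 2 * j)) (h1 : i - j < p)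
    (h2 : j - i < p) : i = j := by
  rw [q_zpow_eq_iff] at h
  obtain ⟨k, hk⟩ := h
  push_cast at hk
  have : k = 0 := by
    by_contra hk0
    rcases lt_or_gt_of_ne hk0 with hk1 | hk1 <;> nlinarith
  subst this
  omega

theorem psi_eval_self {s : ℕ} (h1 : 1 ≤ s) (h2 : s < p) : (psi p s).eval (beta p s) ≠ 0 := by
  have hne : ∀ j, j ≤ p → j ≠ s → beta p s - beta p j ≠ 0 := fun j hj hjs h =>
    hjs (beta_injOn p h2.le hj (sub_eq_zero.1 h)).symm
  simp only [psi, Polynomial.eval_mul, Polynomial.eval_sub, Polynomial.eval_X, Polynomial.eval_C,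
    Polynomial.eval_prod, Polynomial.eval_pow]
  refine mul_ne_zero (mul_ne_zero (hne 0 (by omega) (by omega)) (hne p le_rfl (by omega))) ?_
  rw [Finset.prod_ne_zero_iff]
  intro j hj
  simp only [Finset.mem_erase, Finset.mem_Icc] at hj
  exact pow_ne_zero _ (hne j (by omega) hj.1)

theorem psi_sq_dvd {s j : ℕ} (h1 : 1 ≤ j) (h2 : j < p) (hne : j ≠ s) :
    (Polynomial.X - Polynomial.C (beta p j)) ^ 2 ∣ psi p s :=
  Dvd.dvd.mul_left (Finset.dvd_prod_of_mem
    (fun j => (Polynomial.X - Polynomial.C (beta p j)) ^ 2) (by simp; omega)) _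

theorem psi_eval_other {s j : ℕ} (h1 : j ≤ p) (hne : j ≠ s) :
    (psi p s).eval (beta p j) = 0 := by
  rcases Nat.eq_zero_or_pos j with rfl | hj
  · simp [psi]
  rcases h1.eq_or_lt with rfl | h1
  · simp [psi]
  · obtain ⟨r, hr⟩ := psi_sq_dvd p hj h1 hne
    simp [hr]

variable {p}

theorem aeval_apply_of_sq {V : Type*} [AddCommGroup V] [Module ℂ V] {T : End ℂ V} {γ : ℂ} {v : V}
    (h : T (T v - γ • v) = γ • (T v - γ • v)) (P : Polynomial ℂ) :
    Polynomial.aeval T P v = P.eval γ • v + P.derivative.eval γ • (T v - γ • v) := by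
  induction P using Polynomial.induction_on' with
  | add a b ha hb =>
    simp only [map_add, LinearMap.add_apply, ha, hb, Polynomial.eval_add]
    module
  | monomial n a =>
    induction n with
    | zero => simp
    | succ n ih =>
      have hs : Polynomial.monomial (n + 1) a = Polynomial.X * Polynomial.monomial n a := by
        rw [Polynomial.X_mul_monomial]
      rw [hs]
      simp only [map_mul, Polynomial.aeval_X, End.mul_apply, ih, Polynomial.derivative_mul,
        Polynomial.derivative_X, Polynomial.eval_add, Polynomial.eval_mul, Polynomial.eval_X,
        Polynomial.eval_one]
      rw [map_add, map_smul, map_smul, h]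
      module

theorem aeval_apply_of_eigen {V : Type*} [AddCommGroup V] [Module ℂ V] {T : End ℂ V} {γ : ℂ}
    {v : V} (h : T v = γ • v) (P : Polynomial ℂ) : Polynomial.aeval T P v = P.eval γ • v := by
  rw [aeval_apply_of_sq (γ := γ) (by simp [h]) P, h]
  simp

theorem idemPoly_apply_self {V : Type*} [AddCommGroup V] [Module ℂ V] {T : End ℂ V} {v : V}
    {s : ℕ} (h1 : 1 ≤ s) (h2 : s < p)
    (h : T (T v - beta p s • v) = beta p s • (T v - beta p s • v)) :
    Polynomial.aeval T (idemPoly p s) v = v := by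
  have hψ := psi_eval_self p h1 h2
  have hd : (idemPoly p s).derivative.eval (beta p s) = 0 := by
    simp only [idemPoly, Polynomial.derivative_mul, Polynomial.derivative_C, zero_mul, zero_add,
      Polynomial.derivative_sub, Polynomial.derivative_X, sub_zero, mul_one, Polynomial.eval_mul,
      Polynomial.eval_C, Polynomial.eval_sub, Polynomial.eval_add, Polynomial.eval_X, sub_self,
      mul_zero, add_zero]
    field_simp
    ring
  have he : (idemPoly p s).eval (beta p s) = 1 := by
    simp [idemPoly, hψ]
  rw [aeval_apply_of_sq h, hd, he]
  simp

theorem idemPoly_apply_other {V : Type*} [AddCommGroup V] [Module ℂ V] {T : End ℂ V} {v : V}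
    {s j : ℕ} (h1 : 1 ≤ j) (h2 : j < p) (hne : j ≠ s)
    (h : T (T v - beta p j • v) = beta p j • (T v - beta p j • v)) :
    Polynomial.aeval T (idemPoly p s) v = 0 := by
  obtain ⟨r, hr⟩ := psi_sq_dvd p h1 h2 hne
  have hd : (psi p s).derivative.eval (beta p j) = 0 := by
    rw [hr]
    simp [Polynomial.derivative_mul, Polynomial.derivative_pow]
  have he : (psi p s).eval (beta p j) = 0 := psi_eval_other p h2.le hne
  rw [aeval_apply_of_sq h]
  simp [idemPoly, hd, he, Polynomial.derivative_mul]

theorem idemPoly_apply_edge {V : Type*} [AddCommGroup V] [Module ℂ V] {T : End ℂ V} {v : V}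
    {s j : ℕ} (h2 : j ≤ p) (hne : j ≠ s) (h : T v = beta p j • v) :
    Polynomial.aeval T (idemPoly p s) v = 0 := by
  rw [aeval_apply_of_eigen h]
  simp [idemPoly, psi_eval_other p h2 hne]

theorem uPoly_eval_ne_zero {s : ℕ} (h1 : 1 ≤ s) (h2 : s < p) {j : ℕ} (hj : j = 0 ∨ j = s) :
    (uPoly p s).eval (q p ^ ((s : ℤ) - 1 - 2 * j)) ≠ 0 := by
  simp only [uPoly, Polynomial.eval_prod, Polynomial.eval_sub, Polynomial.eval_X,
    Polynomial.eval_C, Finset.prod_ne_zero_iff]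
  intro n hn h
  simp only [Finset.mem_erase, Finset.mem_Icc] at hn
  have := q_zpow_injOn p (sub_eq_zero.1 h) (by omega) (by omega)
  omega

theorem aPoly_eval_one {s : ℕ} (h1 : 1 ≤ s) (h2 : s < p) {j : ℕ} (hj : j = 0 ∨ j = s) :
    (aPoly p s).eval (q p ^ ((s : ℤ) - 1 - 2 * j)) = 1 := by
  have ha := uPoly_eval_ne_zero h1 h2 (Or.inl rfl)
  have hb := uPoly_eval_ne_zero h1 h2 (Or.inr rfl)
  have hab : q p ^ ((s : ℤ) - 1) - q p ^ (-(s : ℤ) - 1) ≠ 0 := by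
    intro h
    have h3 : q p ^ ((s : ℤ) - 1 - 2 * 0) = q p ^ ((s : ℤ) - 1 - 2 * s) := by
      rw [sub_eq_zero] at h
      convert h using 2 <;> ring
    have := q_zpow_injOn p h3 (by omega) (by omega)
    omega
  have eb : (s : ℤ) - 1 - 2 * s = -(s : ℤ) - 1 := by ring
  rw [eb] at hb
  rw [Nat.cast_zero, mul_zero, sub_zero] at ha
  rcases hj with rfl | hj
  · rw [Nat.cast_zero, mul_zero, sub_zero]
    simp only [aPoly, Polynomial.eval_mul, Polynomial.eval_C, Polynomial.eval_add,
      Polynomial.eval_X]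
    field_simp
    ring
  · subst hj
    rw [eb]
    simp only [aPoly, Polynomial.eval_mul, Polynomial.eval_C, Polynomial.eval_add,
      Polynomial.eval_X]
    field_simp
    ring

theorem aPoly_eval_zero {s j : ℕ} (h1 : 1 ≤ j) (h2 : j < p) (hj : j ≠ s) :
    (aPoly p s).eval (q p ^ ((s : ℤ) - 1 - 2 * j)) = 0 := by
  have : (uPoly p s).eval (q p ^ ((s : ℤ) - 1 - 2 * j)) = 0 := by
    rw [uPoly, Polynomial.eval_prod]
    exact Finset.prod_eq_zero (i := j) (by simp; omega) (by simp)
  simp [aPoly, this]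

variable (p) in
/-- The eigenvalue of the Casimir element on the modules with labels `α, s`. -/
def casVal (α : ℤˣ) (s : ℤ) : ℂ := ((α : ℤ) : ℂ) * (q p ^ s + q p ^ (-s))

variable (p) in
/-- The eigenvalue of `K` on the `n`-th vectors of the modules with labels `α, s`. -/
def kVal (α : ℤˣ) (s n : ℤ) : ℂ := ((α : ℤ) : ℂ) * q p ^ (s - 1 - 2 * n)

/-- The element `A` in terms of operators `S` (for `K`) and `T` (for the Casimir element). -/
def opA (p : ℕ) {V : Type*} [AddCommGroup V] [Module ℂ V] (S T : End ℂ V) : End ℂ V :=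
  ∑ s ∈ Finset.Icc 1 (p - 1), Polynomial.aeval S (aPoly p s) * Polynomial.aeval T (idemPoly p s)

theorem casVal_neg (α : ℤˣ) (s : ℤ) : casVal p (-α) (p - s) = casVal p α s := by
  have h0 := q_ne_zero p
  simp only [casVal, Units.val_neg, neg_sub, Int.cast_neg]
  rw [zpow_sub₀ h0, zpow_sub₀ h0, q_zpow_p, zpow_neg]
  field_simp
  ring

theorem kVal_neg (α : ℤˣ) (s n : ℤ) : kVal p (-α) (p - s) n = kVal p α s (n + s) := by
  have h0 := q_ne_zero p
  simp only [kVal, Units.val_neg, Int.cast_neg]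
  have : (p : ℤ) - s - 1 - 2 * n = p + (s - 1 - 2 * (n + s)) := by ring
  rw [this, zpow_add₀ h0, q_zpow_p]
  ring

theorem kVal_add_p (α : ℤˣ) (s n : ℤ) : kVal p α s (n + p) = kVal p α s n := by
  have h0 := q_ne_zero p
  simp only [kVal]
  have : s - 1 - 2 * (n + p) = (s - 1 - 2 * n) - p - p := by ring
  rw [this, zpow_sub₀ h0, zpow_sub₀ h0, q_zpow_p]
  ring

theorem casVal_one (s : ℕ) : casVal p 1 s = beta p s := by simp [casVal, beta]

theorem casVal_neg_one {s : ℕ} (hs : s ≤ p) : casVal p (-1) s = beta p (p - s) := by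
  have := casVal_neg (p := p) 1 (p - s : ℕ)
  rw [← casVal_one, ← this]
  congr 1
  omega

variable {V : Type*} [AddCommGroup V] [Module ℂ V] {S T : End ℂ V} {v : V}

theorem opA_apply_of_block {j : ℕ} (h1 : 1 ≤ j) (h2 : j < p) {k : ℂ} (hS : S v = k • v)
    (hT : T (T v - beta p j • v) = beta p j • (T v - beta p j • v)) :
    opA p S T v = (aPoly p j).eval k • v := by
  rw [opA, LinearMap.sum_apply, Finset.sum_eq_single j]
  · rw [End.mul_apply, idemPoly_apply_self h1 h2 hT, aeval_apply_of_eigen hS]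
  · intro i _ hij
    rw [End.mul_apply, idemPoly_apply_other h1 h2 hij.symm hT, map_zero]
  · intro h
    simp at h
    omega

theorem opA_apply {α : ℤˣ} {s n : ℤ} (h1 : 1 ≤ s) (h2 : s < p) (hn : 0 ≤ n) (hns : n < s)
    (hS : S v = kVal p α s n • v)
    (hT : T (T v - casVal p α s • v) = casVal p α s • (T v - casVal p α s • v)) :
    opA p S T v = if n = 0 then v else 0 := by
  obtain ⟨s, rfl⟩ := Int.eq_ofNat_of_zero_le (by omega : 0 ≤ s)
  obtain ⟨n, rfl⟩ := Int.eq_ofNat_of_zero_le hn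
  have hp' := hp.out
  rcases Int.units_eq_one_or α with rfl | rfl
  · rw [casVal_one] at hT
    rw [opA_apply_of_block (by omega) (by omega) hS hT]
    have : kVal p 1 s n = q p ^ ((s : ℤ) - 1 - 2 * n) := by simp [kVal]
    rw [this]
    split_ifs with h
    · rw [aPoly_eval_one (by omega) (by omega) (Or.inl (by omega)), one_smul]
    · rw [aPoly_eval_zero (by omega) (by omega) (by omega), zero_smul]
  · rw [casVal_neg_one (by omega)] at hT
    rw [opA_apply_of_block (by omega) (by omega) hS hT]
    have : kVal p (-1) s n = q p ^ (((p - s : ℕ) : ℤ) - 1 - 2 * ((p - s + n : ℕ) : ℤ)) := by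
      have := kVal_neg (p := p) 1 (p - s : ℕ) n
      rw [show (p : ℤ) - ((p - s : ℕ) : ℤ) = s by omega] at this
      rw [this]
      simp only [kVal, Units.val_one, Int.cast_one, one_mul]
      congr 1
      push_cast
      ring
    rw [this]
    split_ifs with h
    · rw [aPoly_eval_one (by omega) (by omega) (Or.inr (by omega)), one_smul]
    · rw [aPoly_eval_zero (by omega) (by omega) (by omega), zero_smul]

theorem opA_apply_edge {α : ℤˣ} (hT : T v = casVal p α p • v) : opA p S T v = 0 := by
  have hp' := hp.out
  rw [opA, LinearMap.sum_apply]
  refine Finset.sum_eq_zero fun i hi => ?_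
  rw [Finset.mem_Icc] at hi
  rcases Int.units_eq_one_or α with rfl | rfl
  · rw [casVal_one] at hT
    rw [End.mul_apply, idemPoly_apply_edge le_rfl (by omega) hT, map_zero]
  · rw [casVal_neg_one le_rfl, Nat.sub_self] at hT
    rw [End.mul_apply, idemPoly_apply_edge (by omega) (by omega) hT, map_zero]

end ElementA

/-! ### Weight spaces for `K` and the Casimir element -/

section Weights

variable {M : Type*} [AddCommGroup M] [Module (LU p) M] [Module ℂ M]
  [IsScalarTower ℂ (LU p) M] [hp : Fact (2 ≤ p)]

omit hp in
theorem gen_csmul (x : LU p) (c : ℂ) (v : M) : x • c • v = c • x • v := gen_smul_comm x c v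

variable (M) in
/-- The space of vectors of weight `k` for `K` and of generalised weight `γ` for the Casimir
element. -/
def wSpace (γ k : ℂ) : Submodule ℂ M :=
  (act M (casLU p)).maxGenEigenspace γ ⊓ (act M gK).eigenspace k

theorem mem_wSpace {γ k : ℂ} {v : M} :
    v ∈ wSpace (p := p) M γ k ↔ v ∈ (act M (casLU p)).maxGenEigenspace γ ∧ gK • v = k • v := by
  rw [wSpace, Submodule.mem_inf, End.mem_eigenspace_iff]
  rfl

theorem mem_gen_of_comm {x : LU p} (hx : ∀ v : M, casLU p • x • v = x • casLU p • v) {γ : ℂ} {v : M}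
    (hv : v ∈ (act M (casLU p)).maxGenEigenspace γ) :
    x • v ∈ (act M (casLU p)).maxGenEigenspace γ :=
  mem_maxGenEigenspace_of_semiconj (a := act M x) (fun v => by
    simp only [act_apply, smul_sub, hx, gen_csmul]) hv

theorem E_mem_wSpace {γ k : ℂ} {v : M} (hv : v ∈ wSpace (p := p) M γ k) :
    gE • v ∈ wSpace (p := p) M γ (q p ^ 2 * k) := by
  rw [mem_wSpace] at hv ⊢
  refine ⟨mem_gen_of_comm casLU_E hv.1, ?_⟩
  rw [K_E_smul, hv.2, gen_csmul, mul_smul]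

theorem F_mem_wSpace {γ k : ℂ} {v : M} (hv : v ∈ wSpace (p := p) M γ k) :
    gF • v ∈ wSpace (p := p) M γ ((q p ^ 2)⁻¹ * k) := by
  rw [mem_wSpace] at hv ⊢
  refine ⟨mem_gen_of_comm casLU_F hv.1, ?_⟩
  rw [K_F_smul, hv.2, gen_csmul, mul_smul]

theorem mem_wSpace_of_comm {x : LU p} (hx : ∀ v : M, casLU p • x • v = x • casLU p • v)
    (hx' : ∀ v : M, gK • x • v = x • gK • v) {γ k : ℂ} {v : M}
    (hv : v ∈ wSpace (p := p) M γ k) : x • v ∈ wSpace (p := p) M γ k := by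
  rw [mem_wSpace] at hv ⊢
  refine ⟨mem_gen_of_comm hx hv.1, ?_⟩
  rw [hx', hv.2, gen_csmul]

theorem ne_zero_of_mem_wSpace {γ k : ℂ} {v : M} (hv : v ∈ wSpace (p := p) M γ k) (h0 : v ≠ 0) :
    k ≠ 0 := by
  rintro rfl
  have h := (mem_wSpace.1 hv).2
  rw [zero_smul] at h
  apply h0
  rw [← Kinv_K_smul (p := p) v, h, smul_zero]

theorem Kinv_of_K {k : ℂ} {v : M} (h : gK • v = k • v) : gKi • v = k⁻¹ • v := by
  by_cases h0 : k = 0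
  · rw [h0, zero_smul] at h
    have : v = 0 := by rw [← Kinv_K_smul (p := p) v, h, smul_zero]
    simp [this]
  · have h1 := Kinv_K_smul (p := p) v
    rw [h, gen_csmul] at h1
    rw [eq_inv_smul_iff₀ h0, h1]

theorem FE_of_K {k : ℂ} {v : M} (h : gK • v = k • v) :
    dl ^ 2 • gF • gE • v = casLU p • v - (q p * k + (q p * k)⁻¹) • v := by
  rw [casLU_smul', h, Kinv_of_K h, mul_inv]
  generalize gF • gE • v = w
  module

theorem EF_of_K {k : ℂ} {v : M} (h : gK • v = k • v) :
    dl ^ 2 • gE • gF • v = casLU p • v - ((q p)⁻¹ * k + q p * k⁻¹) • v := by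
  rw [casLU_smul, h, Kinv_of_K h]
  generalize gE • gF • v = w
  module

theorem E_injOn_wSpace {γ k : ℂ} (hne : γ ≠ q p * k + (q p * k)⁻¹) {v : M}
    (hv : v ∈ wSpace (p := p) M γ k) (h0 : gE • v = 0) : v = 0 := by
  by_contra hv0
  rw [mem_wSpace] at hv
  have h := FE_of_K hv.2
  rw [h0, smul_zero, smul_zero, eq_comm, sub_eq_zero] at h
  exact hne (eq_of_mem_maxGenEigenspace hv.1 h hv0).symm

theorem K_pow_of_K {k : ℂ} {v : M} (h : gK • v = k • v) (n : ℕ) : gK ^ n • v = k ^ n • v := by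
  induction n with
  | zero => simp
  | succ n ih => rw [pow_succ', mul_smul, ih, gen_csmul, h, smul_smul, pow_succ]

/-- The weights that occur in a module. -/
theorem exists_weight {γ k : ℂ} {v : M} (hv : v ∈ wSpace (p := p) M γ k) (h0 : v ≠ 0) :
    ∃ (α : ℤˣ) (s n : ℕ), 1 ≤ s ∧ s ≤ p ∧ n < s ∧ γ = casVal p α s ∧ k = kVal p α s n := by
  have hp' := hp.out
  have hq := q_ne_zero p
  have hex : ∃ i : ℕ, i < p ∧ γ = q p * (q p ^ (2 * i) * k) + (q p * (q p ^ (2 * i) * k))⁻¹ := by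
    by_contra! hcon
    have key : ∀ i : ℕ, i ≤ p → gE ^ i • v ∈ wSpace (p := p) M γ (q p ^ (2 * i) * k) ∧
        gE ^ i • v ≠ 0 := by
      intro i
      induction i with
      | zero => intro _; simpa using ⟨hv, h0⟩
      | succ i ih =>
        intro hi
        obtain ⟨h1, h2⟩ := ih (by omega)
        rw [pow_succ', mul_smul]
        refine ⟨?_, fun h3 => h2 (E_injOn_wSpace (hcon i (by omega)) h1 h3)⟩
        have := E_mem_wSpace h1
        rwa [← mul_assoc, ← pow_add, show 2 + 2 * i = 2 * (i + 1) by ring] at this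
    exact (key p le_rfl).2 (E_pow_smul v)
  classical
  obtain ⟨hip, hi⟩ := Nat.find_spec hex
  have hmin := fun m => Nat.find_min hex (m := m)
  set i := Nat.find hex
  have hk0 := ne_zero_of_mem_wSpace hv h0
  have hk : k ^ (2 * p) = 1 := by
    have h1 := K_pow_of_K (mem_wSpace.1 hv).2 (2 * p)
    rw [K_pow_smul] at h1
    have h2 : (k ^ (2 * p) - 1) • v = 0 := by rw [sub_smul, ← h1, one_smul, sub_self]
    exact sub_eq_zero.1 ((smul_eq_zero.1 h2).resolve_right h0)
  have : NeZero (2 * p) := ⟨by omega⟩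
  obtain ⟨j, hj, hkj⟩ := (q_isPrimitiveRoot p).eq_pow_of_pow_eq_one hk
  -- write `q ^ (2 * i) * k = q ^ a`, with `a = j + 2 * i`, and reduce `a + 1` modulo `p`
  obtain ⟨α, s, hs1, hsp, hs⟩ : ∃ (α : ℤˣ) (s : ℕ), 1 ≤ s ∧ s ≤ p ∧
      q p ^ (2 * i) * k = ((α : ℤ) : ℂ) * q p ^ ((s : ℤ) - 1) := by
    refine ⟨(-1) ^ ((j + 2 * i) / p), (j + 2 * i) % p + 1, by omega,
      Nat.mod_lt _ (by omega), ?_⟩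
    have : ((((j + 2 * i) % p + 1 : ℕ) : ℤ) - 1) = (((j + 2 * i) % p : ℕ) : ℤ) := by push_cast; ring
    rw [← hkj, ← pow_add, this, zpow_natCast]
    conv_lhs => rw [show 2 * i + j = p * ((j + 2 * i) / p) + (j + 2 * i) % p by
      rw [Nat.div_add_mod]; ring]
    rw [pow_add, pow_mul, q_pow_p]
    push_cast
    rfl
  have hα2 : ((α : ℤ) : ℂ) * ((α : ℤ) : ℂ) = 1 := by
    rcases Int.units_eq_one_or α with rfl | rfl <;> simp
  have hα0 : ((α : ℤ) : ℂ) ≠ 0 := fun h => by simp [h] at hα2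
  have hαi : ((α : ℤ) : ℂ)⁻¹ = ((α : ℤ) : ℂ) := inv_eq_of_mul_eq_one_right hα2
  have hγ : γ = casVal p α s := by
    rw [hi, hs, casVal, mul_inv, mul_inv, hαi, zpow_sub₀ hq, zpow_neg]
    field_simp
  have hkv : k = kVal p α s i := by
    have h1 : q p ^ (2 * i) ≠ 0 := pow_ne_zero _ hq
    apply mul_left_cancel₀ h1
    rw [hs, kVal, zpow_sub₀ hq ((s : ℤ) - 1) (2 * i)]
    have : q p ^ (2 * (i : ℤ)) = q p ^ (2 * i) := by
      rw [← zpow_natCast]; push_cast; rfl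
    rw [this]
    field_simp
  refine ⟨α, s, i, hs1, hsp, ?_, hγ, hkv⟩
  by_contra! his
  refine hmin (i - s) (by omega) ⟨by omega, ?_⟩
  have h2 : q p ^ (2 * (i - s)) * k = ((α : ℤ) : ℂ) * q p ^ (-(s : ℤ) - 1) := by
    rw [hkv, kVal, ← zpow_natCast, mul_left_comm, ← zpow_add₀ hq]
    congr 2
    push_cast [his]
    ring
  rw [h2, hγ, casVal, mul_inv, mul_inv, hαi, zpow_sub₀ hq, zpow_neg]
  field_simp
  ring

variable (M) in
/-- The weight space with the weights of the `n`-th vectors of the modules with labels `α, s`. -/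
def wt (α : ℤˣ) (s n : ℤ) : Submodule ℂ M := wSpace (p := p) M (casVal p α s) (kVal p α s n)

theorem K_of_mem_wt {α : ℤˣ} {s n : ℤ} {v : M} (hv : v ∈ wt (p := p) M α s n) :
    gK • v = kVal p α s n • v := (mem_wSpace.1 hv).2

theorem wt_neg (α : ℤˣ) (s n : ℤ) :
    wt (p := p) M (-α) (p - s) n = wt (p := p) M α s (n + s) := by
  rw [wt, wt, casVal_neg, kVal_neg]

theorem wt_add_p (α : ℤˣ) (s n : ℤ) :
    wt (p := p) M α s (n + p) = wt (p := p) M α s n := by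
  rw [wt, wt, kVal_add_p]

omit hp in
theorem kVal_succ (α : ℤˣ) (s n : ℤ) : kVal p α s n = q p ^ 2 * kVal p α s (n + 1) := by
  rw [kVal, kVal, mul_left_comm, ← zpow_natCast, ← zpow_add₀ (q_ne_zero p)]
  congr 2; push_cast; ring

theorem E_mem_wt {α : ℤˣ} {s n : ℤ} {v : M} (hv : v ∈ wt (p := p) M α s (n + 1)) :
    gE • v ∈ wt (p := p) M α s n := by
  rw [wt, kVal_succ]
  exact E_mem_wSpace hv

theorem F_mem_wt {α : ℤˣ} {s n : ℤ} {v : M} (hv : v ∈ wt (p := p) M α s n) :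
    gF • v ∈ wt (p := p) M α s (n + 1) := by
  have := F_mem_wSpace hv
  rwa [kVal_succ, inv_mul_cancel_left₀ (pow_ne_zero _ (q_ne_zero p))] at this

theorem e_mem_wt {α : ℤˣ} {s n : ℤ} {v : M} (hv : v ∈ wt (p := p) M α s n) :
    ge • v ∈ wt (p := p) M α s n := mem_wSpace_of_comm casLU_e K_e_smul hv

theorem f_mem_wt {α : ℤˣ} {s n : ℤ} {v : M} (hv : v ∈ wt (p := p) M α s n) :
    gf • v ∈ wt (p := p) M α s n := mem_wSpace_of_comm casLU_f K_f_smul hv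

theorem h_mem_wt {α : ℤˣ} {s n : ℤ} {v : M} (hv : v ∈ wt (p := p) M α s n) :
    gh • v ∈ wt (p := p) M α s n :=
  mem_wSpace_of_comm casLU_h (fun v => (h_K_smul v).symm) hv

variable (p) in
/-- The nilpotent part of the Casimir element, suitably normalised. -/
def nuLU (α : ℤˣ) (s : ℤ) : LU p :=
  ((dl ^ 2)⁻¹ : ℂ) • (casLU p - algebraMap ℂ (LU p) (casVal p α s))

theorem nuLU_smul (α : ℤˣ) (s : ℤ) (v : M) :
    nuLU p α s • v = (dl ^ 2)⁻¹ • (casLU p • v - casVal p α s • v) := by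
  rw [nuLU, smul_assoc, sub_smul, algebraMap_smul]

theorem kVal_FE (α : ℤˣ) (s n : ℤ) :
    q p * kVal p α s n + (q p * kVal p α s n)⁻¹ =
      casVal p α s - dl ^ 2 * (((α : ℤ) : ℂ) * qInt p n * qInt p (s - n)) := by
  have hq := q_ne_zero p
  have hα : ((α : ℤ) : ℂ)⁻¹ = ((α : ℤ) : ℂ) := by
    rcases Int.units_eq_one_or α with rfl | rfl <;> norm_num
  have h := qInt_mul_qInt p s n
  have e1 : q p * kVal p α s n = ((α : ℤ) : ℂ) * q p ^ (s - 2 * n) := by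
    rw [kVal, mul_left_comm, ← zpow_one_add₀ hq]; congr 2; ring
  rw [e1, mul_inv, hα, ← zpow_neg, casVal]
  linear_combination ((α : ℤ) : ℂ) * h

theorem FE_of_mem_wt {α : ℤˣ} {s n : ℤ} {v : M} (hv : v ∈ wt (p := p) M α s n) :
    gF • gE • v = (((α : ℤ) : ℂ) * qInt p n * qInt p (s - n)) • v + nuLU p α s • v := by
  have hd := q_sub_inv_ne_zero p
  have h := FE_of_K (K_of_mem_wt hv)
  rw [kVal_FE] at h
  rw [nuLU_smul, ← inv_smul_smul₀ (pow_ne_zero 2 hd) (gF • gE • v), h]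
  generalize casLU p • v = w, q p - (q p)⁻¹ = d at hd
  match_scalars <;> field_simp
  ring

theorem EF_of_mem_wt {α : ℤˣ} {s n : ℤ} {v : M} (hv : v ∈ wt (p := p) M α s n) :
    gE • gF • v =
      (((α : ℤ) : ℂ) * qInt p (n + 1) * qInt p (s - (n + 1))) • v + nuLU p α s • v := by
  have hd := q_sub_inv_ne_zero p
  have hq := q_ne_zero p
  have h := EF_of_K (K_of_mem_wt hv)
  have e : (q p)⁻¹ * kVal p α s n + q p * (kVal p α s n)⁻¹ =
      q p * kVal p α s (n + 1) + (q p * kVal p α s (n + 1))⁻¹ := by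
    rw [kVal_succ, mul_inv, mul_inv]
    field_simp
  rw [e, kVal_FE] at h
  rw [nuLU_smul, ← inv_smul_smul₀ (pow_ne_zero 2 hd) (gE • gF • v), h]
  generalize casLU p • v = w, q p - (q p)⁻¹ = d at hd
  match_scalars <;> field_simp
  ring

theorem nuLU_comm {x : LU p} (hx : ∀ v : M, casLU p • x • v = x • casLU p • v) (α : ℤˣ) (s : ℤ)
    (v : M) : nuLU p α s • x • v = x • nuLU p α s • v := by
  simp only [nuLU_smul, hx, smul_sub, gen_csmul]

theorem nuLU_comm_pow {x : LU p} (hx : ∀ v : M, casLU p • x • v = x • casLU p • v) (α : ℤˣ) (s : ℤ)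
    (n : ℕ) (v : M) : nuLU p α s • x ^ n • v = x ^ n • nuLU p α s • v := by
  induction n with
  | zero => simp
  | succ n ih => rw [pow_succ', mul_smul, nuLU_comm hx, ih, mul_smul]

theorem eq_zero_of_nuLU {α : ℤˣ} {s n : ℤ} {v : M} (hv : v ∈ wt (p := p) M α s n) {c : ℂ}
    (hc : c ≠ 0) (h : c • v + nuLU p α s • v = 0) : v = 0 := by
  by_contra h0
  have hd := pow_ne_zero 2 (q_sub_inv_ne_zero p)
  have h1 : casLU p • v = (casVal p α s - dl ^ 2 * c) • v := by
    have h2 := congrArg (dl ^ 2 • ·) h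
    simp only [nuLU_smul, smul_add, smul_zero, smul_inv_smul₀ hd] at h2
    generalize casLU p • v = w at *
    linear_combination (norm := module) h2
  have h2 := eq_of_mem_maxGenEigenspace (T := act M (casLU p)) (mem_wSpace.1 hv).1 h1 h0
  have : dl ^ 2 * c = 0 := by linear_combination -h2
  rcases mul_eq_zero.1 this with h3 | h3
  · exact hd h3
  · exact hc h3

theorem coef_ne_zero (α : ℤˣ) {s n : ℤ} (h1 : ¬ (p : ℤ) ∣ n) (h2 : ¬ (p : ℤ) ∣ s - n) :
    ((α : ℤ) : ℂ) * qInt p n * qInt p (s - n) ≠ 0 := by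
  refine mul_ne_zero (mul_ne_zero ?_ ?_) ?_
  · exact_mod_cast α.ne_zero
  · rwa [Ne, qInt_eq_zero_iff]
  · rwa [Ne, qInt_eq_zero_iff]

theorem F_injOn_wt {α : ℤˣ} {s n : ℤ} (h1 : ¬ (p : ℤ) ∣ n + 1) (h2 : ¬ (p : ℤ) ∣ s - (n + 1)) {v : M}
    (hv : v ∈ wt (p := p) M α s n) (h0 : gF • v = 0) : v = 0 := by
  have h := EF_of_mem_wt hv
  rw [h0, smul_zero] at h
  exact eq_zero_of_nuLU hv (coef_ne_zero α h1 h2) h.symm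

theorem F_surjOn_wt [FiniteDimensional ℂ M] {α : ℤˣ} {s n : ℤ} (h1 : ¬ (p : ℤ) ∣ n + 1)
    (h2 : ¬ (p : ℤ) ∣ s - (n + 1)) {v : M} (hv : v ∈ wt (p := p) M α s (n + 1)) :
    ∃ w ∈ wt (p := p) M α s n, gF • w = v := by
  obtain ⟨w, hw, h⟩ := exists_apply_eq_of_injOn (wt (p := p) M α s (n + 1)) (act M (gF * gE))
    (fun v hv => by
      rw [act_apply, mul_smul]; exact F_mem_wt (E_mem_wt hv))
    (fun v hv h => by
      rw [act_apply, mul_smul, FE_of_mem_wt hv] at h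
      exact eq_zero_of_nuLU hv (coef_ne_zero α h1 h2) h) hv
  exact ⟨gE • w, E_mem_wt hw, by rw [← h, act_apply, mul_smul]⟩

theorem E_surjOn_wt [FiniteDimensional ℂ M] {α : ℤˣ} {s n : ℤ} (h1 : ¬ (p : ℤ) ∣ n + 1)
    (h2 : ¬ (p : ℤ) ∣ s - (n + 1)) {v : M} (hv : v ∈ wt (p := p) M α s n) :
    ∃ w ∈ wt (p := p) M α s (n + 1), gE • w = v := by
  obtain ⟨w, hw, h⟩ := exists_apply_eq_of_injOn (wt (p := p) M α s n) (act M (gE * gF))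
    (fun v hv => by
      rw [act_apply, mul_smul]; exact E_mem_wt (F_mem_wt hv))
    (fun v hv h => by
      rw [act_apply, mul_smul, EF_of_mem_wt hv] at h
      exact eq_zero_of_nuLU hv (coef_ne_zero α h1 h2) h) hv
  exact ⟨gF • w, F_mem_wt hw, by rw [← h, act_apply, mul_smul]⟩

omit hp in
theorem not_dvd_of_lt {n : ℤ} (h1 : 0 < n) (h2 : n < p) : ¬ (p : ℤ) ∣ n := fun h => by
  have := Int.le_of_dvd h1 h
  omega

theorem E_pow_surjOn_wt [FiniteDimensional ℂ M] {α : ℤˣ} {s n : ℤ} (hs : s ≤ p) (hn : 0 ≤ n) (k : ℕ)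
    (hk : n + k < s) {v : M} (hv : v ∈ wt (p := p) M α s n) :
    ∃ w ∈ wt (p := p) M α s (n + k), gE ^ k • w = v := by
  induction k with
  | zero => exact ⟨v, by simpa using hv, by simp⟩
  | succ k ih =>
    push_cast at hk
    obtain ⟨w, hw, h⟩ := ih (by omega)
    obtain ⟨u, hu, h'⟩ := E_surjOn_wt (not_dvd_of_lt (by omega) (by omega))
      (not_dvd_of_lt (by omega) (by omega)) hw
    refine ⟨u, by push_cast; rwa [← add_assoc], ?_⟩
    rw [pow_succ, mul_smul, h', h]

theorem F_pow_surjOn_wt [FiniteDimensional ℂ M] {α : ℤˣ} {s n : ℤ} (hs : s ≤ p) (hn : 0 ≤ n) (k : ℕ)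
    (hk : n + k < s) {v : M} (hv : v ∈ wt (p := p) M α s (n + k)) :
    ∃ w ∈ wt (p := p) M α s n, gF ^ k • w = v := by
  induction k generalizing v with
  | zero => exact ⟨v, by simpa using hv, by simp⟩
  | succ k ih =>
    push_cast at hk hv
    rw [← add_assoc] at hv
    obtain ⟨w, hw, h⟩ := F_surjOn_wt (not_dvd_of_lt (by omega) (by omega))
      (not_dvd_of_lt (by omega) (by omega)) hv
    obtain ⟨u, hu, h'⟩ := ih (by omega) hw
    exact ⟨u, hu, by rw [pow_succ', mul_smul, h', h]⟩

theorem F_pow_mem_wt {α : ℤˣ} {s n : ℤ} (k : ℕ) {v : M} (hv : v ∈ wt (p := p) M α s n) :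
    gF ^ k • v ∈ wt (p := p) M α s (n + k) := by
  induction k with
  | zero => simpa using hv
  | succ k ih =>
    rw [pow_succ', mul_smul]
    push_cast
    rw [← add_assoc]
    exact F_mem_wt ih

theorem E_pow_mem_wt {α : ℤˣ} {s n : ℤ} (k : ℕ) {v : M} (hv : v ∈ wt (p := p) M α s (n + k)) :
    gE ^ k • v ∈ wt (p := p) M α s n := by
  induction k generalizing v with
  | zero => simpa using hv
  | succ k ih =>
    rw [pow_succ, mul_smul]
    push_cast at hv
    rw [← add_assoc] at hv
    exact ih (E_mem_wt hv)

theorem F_pow_injOn_wt {α : ℤˣ} {s n : ℤ} (hs : s ≤ p) (hn : 0 ≤ n) (k : ℕ)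
    (hk : n + k < s) {v : M} (hv : v ∈ wt (p := p) M α s n) (h0 : gF ^ k • v = 0) : v = 0 := by
  induction k with
  | zero => simpa using h0
  | succ k ih =>
    push_cast at hk
    refine ih (by omega) ?_
    rw [pow_succ', mul_smul] at h0
    exact F_injOn_wt (not_dvd_of_lt (by omega) (by omega))
      (not_dvd_of_lt (by omega) (by omega)) (F_pow_mem_wt k hv) h0

variable [FiniteDimensional ℂ M]

omit hp [FiniteDimensional ℂ M] in
theorem E_pow_eq_zero {n : ℕ} (hn : p ≤ n) (v : M) : gE ^ n • v = 0 := by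
  obtain ⟨k, rfl⟩ := Nat.exists_eq_add_of_le hn
  rw [add_comm, pow_add, mul_smul, E_pow_smul, smul_zero]

theorem E_eq_zero_of_mem_wt_zero {α : ℤˣ} {v : M} (hv : v ∈ wt (p := p) M α p 0) :
    gE • v = 0 := by
  have hp' := hp.out
  obtain ⟨w, -, rfl⟩ := E_pow_surjOn_wt le_rfl le_rfl (p - 1) (by omega) hv
  rw [← mul_smul, ← pow_succ']
  exact E_pow_eq_zero (by omega) w

theorem nuLU_E {α : ℤˣ} {s : ℤ} (h1 : 1 ≤ s) (h2 : s ≤ p) {v : M}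
    (hv : v ∈ wt (p := p) M α s 0) : nuLU p α s • gE • v = 0 := by
  obtain ⟨w, hw, rfl⟩ := E_pow_surjOn_wt h2 le_rfl (s - 1).toNat (by omega) hv
  have h3 := EF_of_mem_wt hw
  rw [show (s - (0 + ((s - 1).toNat : ℤ) + 1)) = 0 by omega, qInt_zero, mul_zero, zero_smul,
    zero_add] at h3
  rw [← mul_smul (gE), ← pow_succ', nuLU_comm_pow casLU_E, ← h3, ← mul_smul, ← pow_succ]
  have hFw := F_mem_wt hw
  rcases h2.eq_or_lt with rfl | h2
  · exact E_pow_eq_zero (by omega) _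
  · rw [show 0 + ((s - 1).toNat : ℤ) + 1 = 0 + s by omega, ← wt_neg] at hFw
    obtain ⟨u, -, hu⟩ := E_pow_surjOn_wt (by omega) le_rfl (p - s - 1).toNat (by omega) hFw
    rw [← hu, ← mul_smul, ← pow_add]
    exact E_pow_eq_zero (by omega) _

theorem FE_of_mem_wt_zero {α : ℤˣ} {s : ℤ} {v : M} (hv : v ∈ wt (p := p) M α s 0) :
    gF • gE • v = nuLU p α s • v := by
  rw [FE_of_mem_wt hv, qInt_zero, mul_zero, zero_mul, zero_smul, zero_add]

theorem nuLU_nuLU {α : ℤˣ} {s n : ℤ} (h2 : s ≤ p) (hn : 0 ≤ n) (hns : n < s) {v : M}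
    (hv : v ∈ wt (p := p) M α s n) : nuLU p α s • nuLU p α s • v = 0 := by
  obtain ⟨w, hw, rfl⟩ := F_pow_surjOn_wt (n := 0) h2 le_rfl n.toNat (by omega) (v := v)
    (by rwa [zero_add, Int.toNat_of_nonneg hn])
  rw [nuLU_comm_pow casLU_F, nuLU_comm_pow casLU_F, ← FE_of_mem_wt_zero hw,
    nuLU_comm casLU_F, nuLU_E (by omega) h2 hw, smul_zero, smul_zero]

theorem elA_smul (v : M) : elA p • v = opA p (act M gK) (act M (casLU p)) v := by
  simp only [elA, Free.A, map_sum, map_mul, Finset.sum_smul, opA, LinearMap.sum_apply]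
  refine Finset.sum_congr rfl fun s _ => ?_
  rw [mul_smul, ← Polynomial.aeval_algHom_apply, ← Polynomial.aeval_algHom_apply, End.mul_apply]
  have key : ∀ (x : LU p) (P : Polynomial ℂ) (u : M),
      Polynomial.aeval (act M x) P u = Polynomial.aeval x P • u := by
    intro x P u
    rw [act, Polynomial.aeval_algHom_apply]
    rfl
  rw [key, key]
  rfl

theorem cas_of_nuLU (α : ℤˣ) (s : ℤ) (v : M) :
    casLU p • v - casVal p α s • v = dl ^ 2 • nuLU p α s • v := by
  rw [nuLU_smul, smul_inv_smul₀ (pow_ne_zero 2 (q_sub_inv_ne_zero p))]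

theorem elA_of_mem_wt {α : ℤˣ} {s n : ℤ} (h2 : s < p) (hn : 0 ≤ n) (hns : n < s) {v : M}
    (hv : v ∈ wt (p := p) M α s n) : elA p • v = if n = 0 then v else 0 := by
  rw [elA_smul]
  refine opA_apply (α := α) (by omega) h2 hn hns (K_of_mem_wt hv) ?_
  simp only [act_apply]
  rw [cas_of_nuLU, gen_csmul]
  have := cas_of_nuLU (p := p) α s (nuLU p α s • v)
  rw [nuLU_nuLU h2.le hn hns hv, smul_zero, sub_eq_zero] at this
  rw [this, smul_comm]

theorem elA_of_mem_wt_p {α : ℤˣ} {n : ℤ} (hn : 0 ≤ n) (hns : n < p) {v : M}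
    (hv : v ∈ wt (p := p) M α p n) : elA p • v = 0 := by
  rw [elA_smul]
  refine opA_apply_edge (α := α) ?_
  rw [act_apply, ← sub_eq_zero, cas_of_nuLU]
  obtain ⟨w, hw, rfl⟩ := F_pow_surjOn_wt (α := α) (s := (p : ℤ)) (n := 0) le_rfl le_rfl n.toNat
    (by omega) (v := v) (by rwa [zero_add, Int.toNat_of_nonneg hn])
  rw [nuLU_comm_pow casLU_F, ← FE_of_mem_wt_zero hw, E_eq_zero_of_mem_wt_zero hw]
  simp

/-- `e` commutes with `F` except at the ends. -/
theorem F_e_of_mem_wt {α : ℤˣ} {s n : ℤ} (h1 : ¬ (p : ℤ) ∣ n + 1) (h2 : ¬ (p : ℤ) ∣ s - (n + 1))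
    {v : M} (hv : v ∈ wt (p := p) M α s n) : ge • gF • v = gF • ge • v := by
  have hp' := hp.out
  obtain ⟨w, -, rfl⟩ := E_surjOn_wt h1 h2 hv
  rw [F_e_smul, ← mul_smul (gE ^ (p - 1)), ← pow_succ, E_pow_eq_zero (by omega)]
  simp

/-- `h` commutes with `F` except at the ends. -/
theorem h_F_of_mem_wt {α : ℤˣ} {s n : ℤ} (h2 : s ≤ p) (hn : 0 ≤ n) (hns : n + 1 < s)
    {v : M} (hv : v ∈ wt (p := p) M α s n) : gh • gF • v = gF • gh • v := by
  rw [h_F_smul]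
  have hF := F_mem_wt hv
  rcases h2.eq_or_lt with rfl | h2
  · rw [elA_of_mem_wt_p (by omega) (by omega) hF]
    simp
  · rw [elA_of_mem_wt h2 (by omega) (by omega) hF, if_neg (by omega)]
    simp

end Weights

/-! ### Highest weight vectors -/

section Highest

variable {M : Type*} [AddCommGroup M] [Module (LU p) M] [Module ℂ M]
  [IsScalarTower ℂ (LU p) M] [hp : Fact (2 ≤ p)]

variable (M) in
/-- The vectors that are of highest weight for `sl(2)`, with label `r`, and of the weights of the
highest weight vectors with labels `α, s`. -/
def hw (α : ℤˣ) (s r : ℤ) : Submodule ℂ M :=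
  wt (p := p) M α s 0 ⊓ hwSpace (act M ge) (act M gh) r

theorem mem_hw {α : ℤˣ} {s r : ℤ} {u : M} : u ∈ hw (p := p) M α s r ↔
    u ∈ wt (p := p) M α s 0 ∧ ge • u = 0 ∧ gh • u = (((r : ℂ) - 1) / 2) • u := Iff.rfl

variable (p) in
/-- The vector `f ^ m F ^ n u`. -/
def br (n m : ℕ) (u : M) : M := gf ^ m • gF ^ n • u

theorem br_zero_zero (u : M) : br p 0 0 u = u := by simp [br]

theorem br_zero (n m : ℕ) : br p n m (0 : M) = 0 := by simp [br]

theorem br_add (n m : ℕ) (u v : M) : br p n m (u + v) = br p n m u + br p n m v := by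
  simp [br, smul_add]

theorem br_smul (n m : ℕ) (c : ℂ) (u : M) : br p n m (c • u) = c • br p n m u := by
  simp [br, gen_csmul]

theorem F_f_pow_smul (m : ℕ) (v : M) : gF • gf ^ m • v = gf ^ m • gF • v := by
  induction m with
  | zero => simp
  | succ m ih => rw [pow_succ', mul_smul, F_f_smul, ih, mul_smul]

theorem F_pow_f_pow_smul (n m : ℕ) (v : M) : gF ^ n • gf ^ m • v = gf ^ m • gF ^ n • v := by
  induction n with
  | zero => simp
  | succ n ih => rw [pow_succ', mul_smul, ih, F_f_pow_smul, mul_smul]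

theorem F_br (n m : ℕ) (u : M) : gF • br p n m u = br p (n + 1) m u := by
  rw [br, br, F_f_pow_smul, pow_succ', mul_smul]

theorem F_pow_br (k n m : ℕ) (u : M) : gF ^ k • br p n m u = br p (k + n) m u := by
  rw [br, br, F_pow_f_pow_smul, pow_add, mul_smul]

theorem f_br (n m : ℕ) (u : M) : gf • br p n m u = br p n (m + 1) u := by
  rw [br, br, pow_succ', mul_smul]

theorem br_eq_act (n m : ℕ) (u : M) : br p n m u = ((act M gf) ^ m) (gF ^ n • u) := by
  rw [br, act_pow_apply]

section
variable [FiniteDimensional ℂ M]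

theorem F_pow_mem_hwSpace {α : ℤˣ} {s r : ℤ} (hs : s ≤ p) {n : ℕ} (hn : n < s) {u : M}
    (hu : u ∈ hw (p := p) M α s r) :
    gF ^ n • u ∈ wt (p := p) M α s n ∧
      gF ^ n • u ∈ hwSpace (act M ge) (act M gh) r := by
  have hw := F_pow_mem_wt n hu.1
  rw [zero_add] at hw
  refine ⟨hw, ?_⟩
  clear hw
  induction n with
  | zero => simpa using hu.2
  | succ n ih =>
    obtain ⟨h1, h2⟩ := ih (by omega)
    have h3 := F_pow_mem_wt n hu.1
    rw [pow_succ', mul_smul]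
    refine ⟨?_, ?_⟩
    · rw [act_apply, F_e_of_mem_wt (not_dvd_of_lt (by omega) (by omega))
        (not_dvd_of_lt (by omega) (by omega)) h3]
      rw [act_apply] at h1
      rw [h1, smul_zero]
    · rw [act_apply, h_F_of_mem_wt hs (by omega) (by omega) h3]
      rw [act_apply] at h2
      rw [h2, gen_csmul]

theorem hw_eq_bot {α : ℤˣ} {s r : ℤ} (hr : r ≤ 0) : hw (p := p) M α s r = ⊥ := by
  rw [hw, (isSl2_act p M).hwSpace_eq_bot hr, inf_bot_eq]

variable {α : ℤˣ} {s r : ℤ}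

theorem br_mem_wt {u : M} (n m : ℕ) (hu : u ∈ hw (p := p) M α s r) :
    br p n m u ∈ wt (p := p) M α s n := by
  rw [br]
  have h := F_pow_mem_wt n hu.1
  rw [zero_add] at h
  induction m with
  | zero => simpa using h
  | succ m ih => rw [pow_succ', mul_smul]; exact f_mem_wt ih

theorem K_br {u : M} (n m : ℕ) (hu : u ∈ hw (p := p) M α s r) :
    gK • br p n m u = kVal p α s n • br p n m u := K_of_mem_wt (br_mem_wt n m hu)

theorem h_br (hs : s ≤ p) {n : ℕ} (hn : n < s) (m : ℕ) {u : M} (hu : u ∈ hw (p := p) M α s r) :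
    gh • br p n m u = (((r : ℂ) - 1) / 2 - m) • br p n m u := by
  rw [br_eq_act]
  exact (isSl2_act p M).h_f_pow (F_pow_mem_hwSpace hs hn hu).2 m

theorem e_br_zero (hs : s ≤ p) {n : ℕ} (hn : n < s) {u : M} (hu : u ∈ hw (p := p) M α s r) :
    ge • br p n 0 u = 0 := by
  have := (F_pow_mem_hwSpace hs hn hu).2.1
  simpa [br] using this

theorem e_br_succ (hs : s ≤ p) {n : ℕ} (hn : n < s) (m : ℕ) {u : M}
    (hu : u ∈ hw (p := p) M α s r) :
    ge • br p n (m + 1) u = (((m : ℂ) + 1) * (r - 1 - m)) • br p n m u := by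
  rw [br_eq_act, br_eq_act]
  exact (isSl2_act p M).e_f_pow (F_pow_mem_hwSpace hs hn hu).2 m

theorem cas_br (hs : s ≤ p) {n : ℕ} (hn : n < s) (m : ℕ) {u : M}
    (hu : u ∈ hw (p := p) M α s r) :
    sl2Cas (act M ge) (act M gf) (act M gh) (br p n m u) =
      (((r : ℂ) ^ 2 - 1) / 4) • br p n m u := by
  rw [br_eq_act]
  exact (isSl2_act p M).cas_f_pow (F_pow_mem_hwSpace hs hn hu).2 m

theorem br_eq_zero (hs : s ≤ p) {n : ℕ} (hn : n < s) {m : ℕ} (hm : r ≤ m) {u : M}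
    (hu : u ∈ hw (p := p) M α s r) : br p n m u = 0 := by
  rw [br_eq_act]
  exact (isSl2_act p M).f_pow_eq_zero (F_pow_mem_hwSpace hs hn hu).2 hm

theorem br_injOn (hs : s ≤ p) {n : ℕ} (hn : n < s) {m : ℕ} (hm : m < r) {u : M}
    (hu : u ∈ hw (p := p) M α s r) (h0 : br p n m u = 0) : u = 0 := by
  rw [br_eq_act] at h0
  exact F_pow_injOn_wt hs le_rfl n (by omega) hu.1
    ((isSl2_act p M).f_pow_injOn (F_pow_mem_hwSpace hs hn hu).2 hm h0)

end

/-! ### The raising and lowering maps between spaces of highest weight vectors -/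

variable (p) in
/-- The component of `F ^ s u` in the module with the greater second label. -/
def xop (s r : ℤ) (u : M) : M := (r : ℂ)⁻¹ • ge • gF ^ s.toNat • u

variable (p) in
/-- The component of `F ^ s u` in the module with the smaller second label. -/
def yop (s r : ℤ) (u : M) : M := gF ^ s.toNat • u - gf • xop p s r u

theorem F_pow_eq_xop_yop (s r : ℤ) (u : M) :
    gF ^ s.toNat • u = gf • xop p s r u + yop p s r u := by
  rw [yop]; abel

theorem xop_smul (s r : ℤ) (c : ℂ) (u : M) : xop p s r (c • u) = c • xop p s r u := by
  simp only [xop, gen_csmul]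
  rw [smul_comm]

theorem xop_add (s r : ℤ) (u v : M) : xop p s r (u + v) = xop p s r u + xop p s r v := by
  simp only [xop, smul_add]

theorem yop_smul (s r : ℤ) (c : ℂ) (u : M) : yop p s r (c • u) = c • yop p s r u := by
  simp only [yop, xop_smul, gen_csmul, smul_sub]

theorem yop_add (s r : ℤ) (u v : M) : yop p s r (u + v) = yop p s r u + yop p s r v := by
  simp only [yop, xop_add, smul_add]; abel

theorem xop_zero (s r : ℤ) : xop p s r (0 : M) = 0 := by simp [xop]

theorem yop_zero (s r : ℤ) : yop p s r (0 : M) = 0 := by simp [yop, xop_zero]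

variable (p) in
/-- The constant `g`, for integral labels. -/
def gz (s : ℤ) : ℂ := gConst p s.toNat

theorem gz_neg {s : ℤ} (h1 : 1 ≤ s) (h2 : s < p) : gz p (p - s) = gz p s := by
  have := qInt_sub p s
  simp only [gz, gConst]
  rw [Int.toNat_of_nonneg (by omega), Int.toNat_of_nonneg (by omega), this]

section
variable [FiniteDimensional ℂ M] {α : ℤˣ} {s r : ℤ}

theorem e_F_pow (h1 : 1 ≤ s) (h2 : s ≤ p) {u : M} (hu : u ∈ hw (p := p) M α s r) :
    ge • gF ^ s.toNat • u =
      -((qFactorial p (p - 1))⁻¹ • gK ^ p • elH p • gE ^ (p - 1) • gF ^ (s - 1).toNat • u) := by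
  have h3 := (F_pow_mem_hwSpace h2 (n := (s - 1).toNat) (by omega) hu).2.1
  rw [act_apply] at h3
  have h4 := F_e_smul (p := p) (gF ^ (s - 1).toNat • u)
  rw [h3, smul_zero, ← mul_smul gF, ← pow_succ', show (s - 1).toNat + 1 = s.toNat by omega] at h4
  rw [eq_neg_iff_add_eq_zero, ← h4]

theorem e_pow_comm_E {v : M} (n : ℕ) : ge • gE ^ n • v = gE ^ n • ge • v := by
  induction n with
  | zero => simp
  | succ n ih => rw [pow_succ', mul_smul, ← E_e_smul, ih, mul_smul]

theorem e_pow_comm_K {v : M} (n : ℕ) : ge • gK ^ n • v = gK ^ n • ge • v := by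
  induction n with
  | zero => simp
  | succ n ih => rw [pow_succ', mul_smul, ← K_e_smul, ih, mul_smul]

theorem e_elH (v : M) : ge • elH p • v = elH p • ge • v := by
  simp only [elH_smul, gen_csmul, smul_sub, K_e_smul, Kinv_e_smul]

theorem e_e_F_pow (h1 : 1 ≤ s) (h2 : s ≤ p) {u : M} (hu : u ∈ hw (p := p) M α s r) :
    ge • ge • gF ^ s.toNat • u = 0 := by
  have h3 := (F_pow_mem_hwSpace h2 (n := (s - 1).toNat) (by omega) hu).2.1
  rw [act_apply] at h3
  rw [e_F_pow h1 h2 hu, smul_neg, gen_csmul, e_pow_comm_K, e_elH, e_pow_comm_E, h3]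
  simp

theorem F_pow_mem_wt_neg (h1 : 1 ≤ s) {u : M} (hu : u ∈ hw (p := p) M α s r) :
    gF ^ s.toNat • u ∈ wt (p := p) M (-α) (p - s) 0 := by
  rw [wt_neg]
  have h := F_pow_mem_wt s.toNat hu.1
  rwa [Int.toNat_of_nonneg (by omega)] at h

theorem h_F_pow (h1 : 1 ≤ s) (h2 : s < p) {u : M} (hu : u ∈ hw (p := p) M α s r) :
    gh • gF ^ s.toNat • u = (((r : ℂ) - 2) / 2) • gF ^ s.toNat • u := by
  have h3 := F_pow_mem_wt_neg h1 hu
  have h4 := (F_pow_mem_hwSpace h2.le (n := (s - 1).toNat) (by omega) hu).2.2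
  rw [act_apply] at h4
  have h5 : gF ^ s.toNat • u = gF • gF ^ (s - 1).toNat • u := by
    rw [← mul_smul, ← pow_succ']; congr 2; omega
  rw [h5] at h3 ⊢
  rw [h_F_smul, h4, elA_of_mem_wt (by omega) le_rfl (by omega) h3, if_pos rfl, gen_csmul]
  generalize gF • gF ^ (s - 1).toNat • u = w
  module

theorem F_pow_p_eq_zero {u : M} (hs : s = p) : gF ^ s.toNat • u = 0 := by
  rw [hs, Int.toNat_natCast, F_pow_smul]

theorem xop_p (u : M) : xop p p r u = 0 := by rw [xop, F_pow_p_eq_zero rfl]; simp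

theorem yop_p (u : M) : yop p p r u = 0 := by rw [yop, F_pow_p_eq_zero rfl, xop_p]; simp

theorem r_pos_of_ne_zero {u : M} (hu : u ∈ hw (p := p) M α s r) (h0 : u ≠ 0) : 0 < r := by
  by_contra! hr
  rw [hw_eq_bot hr] at hu
  exact h0 ((Submodule.mem_bot ℂ).1 hu)

theorem xop_mem (h1 : 1 ≤ s) (h2 : s < p) {u : M} (hu : u ∈ hw (p := p) M α s r) :
    xop p s r u ∈ hw (p := p) M (-α) (p - s) (r + 1) := by
  rw [mem_hw]
  refine ⟨Submodule.smul_mem _ _ (e_mem_wt (F_pow_mem_wt_neg h1 hu)), ?_, ?_⟩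
  · rw [xop, gen_csmul, e_e_F_pow h1 h2.le hu, smul_zero]
  · rw [xop, gen_csmul, h_e_smul, h_F_pow h1 h2 hu, gen_csmul]
    generalize ge • gF ^ s.toNat • u = w
    push_cast
    module

theorem r_smul_xop {u : M} (hu : u ∈ hw (p := p) M α s r) :
    (r : ℂ) • xop p s r u = ge • gF ^ s.toNat • u := by
  by_cases h0 : u = 0
  · simp [h0, xop_zero]
  · have := r_pos_of_ne_zero hu h0
    rw [xop, smul_inv_smul₀ (by exact_mod_cast this.ne')]

theorem yop_mem (h1 : 1 ≤ s) (h2 : s < p) {u : M} (hu : u ∈ hw (p := p) M α s r) :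
    yop p s r u ∈ hw (p := p) M (-α) (p - s) (r - 1) := by
  have hx := xop_mem h1 h2 hu
  rw [mem_hw]
  refine ⟨Submodule.sub_mem _ (F_pow_mem_wt_neg h1 hu) (f_mem_wt hx.1), ?_, ?_⟩
  · have h3 := e_br_succ (by omega) (n := 0) (by omega) 0 hx
    have h4 : br p 0 (0 + 1) (xop p s r u) = gf • xop p s r u := by simp [br]
    rw [h4, br_zero_zero] at h3
    rw [yop, smul_sub, h3, ← r_smul_xop hu]
    push_cast
    module
  · have h3 := h_br (by omega) (n := 0) (by omega) 1 hx
    have h4 : br p 0 1 (xop p s r u) = gf • xop p s r u := by simp [br]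
    rw [h4] at h3
    rw [yop, smul_sub, h3, h_F_pow h1 h2 hu]
    generalize gf • xop p s r u = w, gF ^ s.toNat • u = w'
    push_cast
    module

/-! ### Products of quantum integers -/

omit hp in
theorem qFactorial_succ (n : ℕ) : qFactorial p (n + 1) = qFactorial p n * qInt p (n + 1) := by
  rw [qFactorial, Finset.prod_Icc_succ_top (by omega)]
  push_cast
  rfl

theorem qFactorial_mul {n : ℕ} (hn : n < p) :
    qFactorial p n * qFactorial p (p - 1 - n) = qFactorial p (p - 1) := by
  induction n with
  | zero => simp [qFactorial]
  | succ n ih =>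
    rw [← ih (by omega), show p - 1 - n = (p - 1 - (n + 1)) + 1 by omega, qFactorial_succ,
      qFactorial_succ]
    have : qInt p (((p - 1 - (n + 1) : ℕ) : ℤ) + 1) = qInt p ((n : ℤ) + 1) := by
      rw [← qInt_sub p ((n : ℤ) + 1)]; congr 1; omega
    rw [this]
    ring

variable (p) in
/-- The product of the first `k` structure constants of the modules with labels `α, s`. -/
def cProd (α : ℤˣ) (s : ℤ) (k : ℕ) : ℂ :=
  ∏ j ∈ Finset.range k, (((α : ℤ) : ℂ) * qInt p (j + 1) * qInt p (s - (j + 1)))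

omit hp in
theorem cProd_eq (α : ℤˣ) (k : ℕ) :
    cProd p α (k + 1) k = ((α : ℤ) : ℂ) ^ k * qFactorial p k ^ 2 := by
  have h1 : ∀ k : ℕ, ∏ j ∈ Finset.range k, qInt p (j + 1) = qFactorial p k := by
    intro k
    induction k with
    | zero => simp [qFactorial]
    | succ k ih => rw [Finset.prod_range_succ, ih, qFactorial_succ]
  have h2 : ∏ j ∈ Finset.range k, qInt p ((k : ℤ) + 1 - (j + 1)) = qFactorial p k := by
    rw [← h1, ← Finset.prod_range_reflect]
    refine Finset.prod_congr rfl fun j hj => ?_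
    rw [Finset.mem_range] at hj
    congr 1
    omega
  rw [cProd, Finset.prod_mul_distrib, Finset.prod_mul_distrib, h1, h2]
  simp
  ring

theorem E_pow_F_pow {u : M} (hu : u ∈ wt (p := p) M α s 0) (k : ℕ) :
    ∃ z ∈ wt (p := p) M α s 0, gE ^ k • gF ^ k • u = cProd p α s k • u + nuLU p α s • z := by
  induction k with
  | zero => exact ⟨0, Submodule.zero_mem _, by simp [cProd]⟩
  | succ k ih =>
    obtain ⟨z, hz, h⟩ := ih
    have h1 := F_pow_mem_wt k hu
    have h2 := EF_of_mem_wt h1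
    rw [zero_add] at h2
    refine ⟨(((α : ℤ) : ℂ) * qInt p (k + 1) * qInt p (s - (k + 1))) • z + gE ^ k • gF ^ k • u,
      Submodule.add_mem _ (Submodule.smul_mem _ _ hz) (E_pow_mem_wt k h1), ?_⟩
    rw [pow_succ, mul_smul, pow_succ' gF, mul_smul gF, h2, smul_add, ← nuLU_comm_pow casLU_E,
      gen_csmul, smul_add (nuLU p α s), gen_csmul]
    nth_rewrite 1 [h]
    rw [cProd, cProd, Finset.prod_range_succ, ← cProd]
    generalize nuLU p α s • z = a, nuLU p α s • gE ^ k • gF ^ k • u = b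
    module

theorem F_pow_E_pow {k : ℕ} {v : M} (hv : v ∈ wt (p := p) M α (k + 1) k)
    (h0 : nuLU p α (k + 1) • v = 0) : gF ^ k • gE ^ k • v = cProd p α (k + 1) k • v := by
  have key : ∀ j : ℕ, j ≤ k → gF ^ j • gE ^ j • v = (∏ i ∈ Finset.range j,
      (((α : ℤ) : ℂ) * qInt p (k - i) * qInt p (i + 1))) • v := by
    intro j
    induction j with
    | zero => simp
    | succ j ih =>
      intro hj
      have h1 : gE ^ j • v ∈ wt (p := p) M α (k + 1) (k - j) :=
        E_pow_mem_wt j (by rwa [sub_add_cancel])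
      have h2 := FE_of_mem_wt h1
      rw [nuLU_comm_pow casLU_E, h0, smul_zero, add_zero] at h2
      rw [pow_succ gF, mul_smul, pow_succ' gE, mul_smul gE, h2, gen_csmul, ih (by omega),
        Finset.prod_range_succ, show (k : ℤ) + 1 - (k - j) = j + 1 by ring]
      generalize (∏ i ∈ Finset.range j, _ : ℂ) = P
      module
  rw [key k le_rfl, cProd]
  congr 1
  rw [← Finset.prod_range_reflect]
  refine Finset.prod_congr rfl fun j hj => ?_
  rw [Finset.mem_range] at hj
  congr 2 <;> [congr 2; skip] <;> omega

end

end Highest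

section Frame

variable {M : Type*} [AddCommGroup M] [Module (LU p) M] [Module ℂ M]
  [IsScalarTower ℂ (LU p) M] [hp : Fact (2 ≤ p)]

/-! ### The action of `E` on highest weight vectors -/

theorem elH_of_mem_wt {α : ℤˣ} {s : ℤ} {v : M} (hv : v ∈ wt (p := p) M α s 0) :
    elH p • v = (((α : ℤ) : ℂ) * qInt p s) • v := by
  have hα : ((α : ℤ) : ℂ)⁻¹ = ((α : ℤ) : ℂ) := by
    rcases Int.units_eq_one_or α with rfl | rfl <;> norm_num
  have hq := q_ne_zero p
  rw [elH_smul, K_of_mem_wt hv, Kinv_of_K (K_of_mem_wt hv), smul_smul, smul_smul, ← sub_smul,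
    smul_smul, ← mul_inv]
  have e1 : q p * kVal p α s 0 = ((α : ℤ) : ℂ) * q p ^ s := by
    rw [kVal, mul_left_comm, ← zpow_one_add₀ hq]; congr 2; ring
  rw [e1, mul_inv, hα, qInt, zpow_neg]
  congr 1
  ring

theorem E_scalar {α : ℤˣ} {k l : ℕ} (hp' : p = k + l + 2) :
    ((α : ℤ) : ℂ) * gz p (k + 1) * -((qFactorial p (p - 1))⁻¹ * kVal p (-α) (l + 1) 0 ^ p *
      ((((-α : ℤˣ) : ℤ) : ℂ) * qInt p (l + 1)) * cProd p α (k + 1) k *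
        cProd p (-α) (l + 1) l) = 1 := by
  have h1 : qInt p ((l : ℤ) + 1) = qInt p ((k : ℤ) + 1) := by
    rw [← qInt_sub p ((k : ℤ) + 1)]; congr 1; omega
  have h2 := qFactorial_mul (p := p) (n := k + 1) (by omega)
  rw [qFactorial_succ, show p - 1 - (k + 1) = l by omega] at h2
  have h3 := qFactorial_ne_zero p (n := p - 1) (by omega)
  have h4 : kVal p (-α) (l + 1) 0 ^ p = (((-α : ℤˣ) : ℤ) : ℂ) ^ p * (-1) ^ l := by
    rw [kVal, mul_pow]
    congr 1
    rw [show ((l : ℤ) + 1 - 1 - 2 * 0) = l by ring, zpow_natCast, pow_right_comm, q_pow_p]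
  rw [h4, h1, cProd_eq, cProd_eq, gz, show (((k : ℤ) + 1).toNat) = k + 1 by omega, gConst]
  push_cast
  rw [← h2] at h3 ⊢
  have h5 : qFactorial p k ≠ 0 := fun h => by simp [h] at h3
  have h6 : qFactorial p l ≠ 0 := fun h => by simp [h] at h3
  have h7 : qInt p ((k : ℤ) + 1) ≠ 0 := fun h => by simp [h] at h3
  field_simp
  have h8 : ((-1 : ℂ) ^ k) * (-1) ^ k = 1 := by rw [← mul_pow]; simp
  have h9 : ((-1 : ℂ) ^ l) * (-1) ^ l = 1 := by rw [← mul_pow]; simp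
  rw [hp']
  rcases Int.units_eq_one_or α with rfl | rfl
  · simp only [Units.val_one, Int.cast_one, pow_add]
    linear_combination (-1 : ℂ) ^ l * (-1 : ℂ) ^ l * (-1 : ℂ) ^ l * (-1 : ℂ) ^ l * h8 +
      ((-1 : ℂ) ^ l * (-1 : ℂ) ^ l + 1) * h9
  · simp only [Units.val_one, Int.cast_one, Units.val_neg, Int.cast_neg, pow_add, neg_neg]
    linear_combination (-1 : ℂ) ^ l * (-1 : ℂ) ^ l * h8 + h9

variable [FiniteDimensional ℂ M] {α : ℤˣ} {s r : ℤ}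

theorem E_eq_xop (h1 : 1 ≤ s) (h2 : s < p) {u : M} (hu : u ∈ hw (p := p) M α s r) :
    gE • u = (((α : ℤ) : ℂ) * gz p s * r) • gF ^ (p - s - 1).toNat • xop p s r u := by
  obtain ⟨k, rfl⟩ : ∃ k : ℕ, s = k + 1 := ⟨(s - 1).toNat, by omega⟩
  obtain ⟨l, hl⟩ : ∃ l : ℕ, p = k + l + 2 := ⟨p - (k + 2), by omega⟩
  have ht : (p : ℤ) - (k + 1) = l + 1 := by omega
  obtain ⟨z, hz, h3⟩ := E_pow_F_pow hu.1 k
  have h4 : gE ^ (k + 1) • gF ^ k • u = cProd p α (k + 1) k • gE • u := by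
    rw [pow_succ', mul_smul, h3, smul_add, gen_csmul, ← nuLU_comm casLU_E,
      nuLU_E h1 h2.le hz, add_zero]
  have h5 : gE • u ∈ wt (p := p) M (-α) (l + 1) l := by
    have := hu.1
    rw [show (0 : ℤ) = -1 + 1 by ring] at this
    have := E_mem_wt this
    rw [← wt_add_p, show (-1 + (p : ℤ)) = l + (k + 1) by omega, ← wt_neg, ht] at this
    exact this
  have hnu : nuLU p (-α) (l + 1) = nuLU p α (k + 1) := by
    rw [nuLU, nuLU, ← ht, casVal_neg]
  have h6 := F_pow_E_pow h5 (by rw [hnu]; exact nuLU_E h1 h2.le hu.1)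
  have h7 : gE ^ l • gE • u ∈ wt (p := p) M (-α) (l + 1) 0 :=
    E_pow_mem_wt l (by rwa [zero_add])
  have h8 := r_smul_xop hu
  rw [e_F_pow h1 h2.le hu, show ((k : ℤ) + 1 - 1).toNat = k by omega,
    show p - 1 = l + (k + 1) by omega, pow_add, mul_smul, h4, gen_csmul, gen_csmul, gen_csmul,
    elH_of_mem_wt h7, gen_csmul, K_pow_of_K (K_of_mem_wt h7), smul_smul, smul_smul, smul_smul] at h8
  have h9 := congrArg (gF ^ l • ·) h8
  simp only [smul_neg] at h9
  rw [gen_csmul, gen_csmul, h6, smul_smul] at h9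
  rw [show ((p : ℤ) - (k + 1) - 1).toNat = l by omega, mul_smul, h9, ← neg_smul, smul_smul]
  have h10 := E_scalar (α := α) hl
  rw [show p - 1 = l + (k + 1) by omega] at h10
  conv_lhs => rw [← one_smul ℂ (gE • u), ← h10]
  congr 1
  ring

theorem E_br_zero (h1 : 1 ≤ s) (h2 : s < p) {u : M} (hu : u ∈ hw (p := p) M α s r) (m : ℕ) :
    gE • br p 0 m u = (((α : ℤ) : ℂ) * gz p s) •
      (((r : ℂ) - m) • br p (p - s - 1).toNat m (xop p s r u) -
        (m : ℂ) • br p (p - s - 1).toNat (m - 1) (yop p s r u)) := by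
  induction m with
  | zero =>
    rw [br_zero_zero, E_eq_xop h1 h2 hu]
    simp [br, mul_smul]
  | succ m ih =>
    have hc : ((-1 : ℂ) ^ (p + 1) * (qFactorial p (p - 1))⁻¹) * (((α : ℤ) : ℂ) * qInt p s) =
        -(((α : ℤ) : ℂ) * gz p s) := by
      rw [gz, gConst, Int.toNat_of_nonneg (by omega), pow_succ]; ring
    have h4 : gF ^ (p - 1) • br p 0 m u = br p (p - s - 1).toNat (m + 1) (xop p s r u) +
        br p (p - s - 1).toNat m (yop p s r u) := by
      have h5 : ∀ v : M, gF ^ ((p : ℤ) - s - 1).toNat • gf • v =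
          gf • gF ^ ((p : ℤ) - s - 1).toNat • v :=
        fun v => by simpa using F_pow_f_pow_smul (p := p) ((p : ℤ) - s - 1).toNat 1 v
      have h6 : gF ^ (((p : ℤ) - s - 1).toNat + s.toNat) • u =
          gf • gF ^ ((p : ℤ) - s - 1).toNat • xop p s r u +
            gF ^ ((p : ℤ) - s - 1).toNat • yop p s r u := by
        rw [pow_add, mul_smul, F_pow_eq_xop_yop s r, smul_add, h5]
      rw [show ((p : ℤ) - s - 1).toNat + s.toNat = p - 1 by omega] at h6
      rw [F_pow_br, br, add_zero, h6, smul_add, br, br, pow_succ, mul_smul]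
    have h7 : ∀ v : M, ((-1 : ℂ) ^ (p + 1) * (qFactorial p (p - 1))⁻¹) •
        (((α : ℤ) : ℂ) * qInt p s) • v = -(((α : ℤ) : ℂ) * gz p s) • v := fun v => by
      rw [smul_smul, hc]
    rw [← f_br, E_f_smul, elH_of_mem_wt (br_mem_wt 0 m hu), gen_csmul, h7, ih, h4,
      gen_csmul, smul_sub, gen_csmul, gen_csmul, f_br, f_br]
    rcases Nat.eq_zero_or_pos m with rfl | hm
    · push_cast
      generalize br p (p - s - 1).toNat _ (xop p s r u) = a, br p (p - s - 1).toNat _ (yop p s r u) = b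
      module
    · rw [show m - 1 + 1 = m by omega, show m + 1 - 1 = m by omega]
      push_cast
      generalize br p (p - s - 1).toNat _ (xop p s r u) = a, br p (p - s - 1).toNat _ (yop p s r u) = b
      module

theorem E_br_zero_p {u : M} (hu : u ∈ hw (p := p) M α p r) (m : ℕ) : gE • br p 0 m u = 0 := by
  induction m with
  | zero => rw [br_zero_zero, E_eq_zero_of_mem_wt_zero hu.1]
  | succ m ih =>
    rw [← f_br, E_f_smul, elH_of_mem_wt (br_mem_wt 0 m hu), ih,
      (qInt_eq_zero_iff p p).2 dvd_rfl]
    simp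

theorem F_br_last (h1 : 1 ≤ s) {u : M} (m : ℕ) :
    gF • br p (s - 1).toNat m u = br p 0 (m + 1) (xop p s r u) + br p 0 m (yop p s r u) := by
  rw [F_br, br, show (s - 1).toNat + 1 = s.toNat by omega, F_pow_eq_xop_yop s r, smul_add]
  simp [br, pow_succ, mul_smul]

theorem xop_yop_relations (h1 : 1 ≤ s) (h2 : s < p) {u : M} (hu : u ∈ hw (p := p) M α s r) :
    xop p (p - s) (r + 1) (xop p s r u) = 0 ∧ yop p (p - s) (r - 1) (yop p s r u) = 0 ∧
    (r ≠ 1 → xop p (p - s) (r - 1) (yop p s r u) = - yop p (p - s) (r + 1) (xop p s r u)) := by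
  by_cases h0 : u = 0
  · simp [h0, xop_zero, yop_zero]
  have hr := r_pos_of_ne_zero hu h0
  have hx := xop_mem h1 h2 hu
  have hy := yop_mem h1 h2 hu
  have hxx := xop_mem (by omega) (by omega) hx
  have hyx := yop_mem (by omega) (by omega) hx
  have hxy := xop_mem (by omega) (by omega) hy
  have hyy := yop_mem (by omega) (by omega) hy
  simp only [neg_neg, sub_sub_cancel, add_sub_cancel_right, sub_add_cancel] at hxx hyx hxy hyy
  have h3 : gF ^ p • u = 0 := F_pow_smul u
  set a := xop p (p - s) (r + 1) (xop p s r u)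
  set b1 := yop p (p - s) (r + 1) (xop p s r u)
  set b2 := xop p (p - s) (r - 1) (yop p s r u)
  set c := yop p (p - s) (r - 1) (yop p s r u)
  have h4 : br p 0 2 a + br p 0 1 (b1 + b2) + c = 0 := by
    have h3 : gF ^ ((p - s).toNat + s.toNat) • u = 0 := by
      rw [show (p - s).toNat + s.toNat = p by omega]; exact h3
    rw [← h3, pow_add, mul_smul, F_pow_eq_xop_yop s r, smul_add]
    have h5 : ∀ v : M, gF ^ ((p : ℤ) - s).toNat • gf • v = gf • gF ^ ((p : ℤ) - s).toNat • v :=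
      fun v => by simpa using F_pow_f_pow_smul (p := p) ((p : ℤ) - s).toNat 1 v
    rw [h5, F_pow_eq_xop_yop (p - s) (r + 1), F_pow_eq_xop_yop (p - s) (r - 1)]
    simp only [br, smul_add, pow_two, mul_smul, pow_zero, one_smul, pow_one]
    abel
  have hb := Submodule.add_mem _ hyx hxy
  clear_value a b1 b2 c
  obtain ⟨b, hbe⟩ : ∃ b, b = b1 + b2 := ⟨_, rfl⟩
  rw [← hbe] at hb h4
  have e0 : ∀ {v : M} {r' : ℤ}, v ∈ hw (p := p) M α s r' → ge • v = 0 := fun h => h.2.1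
  have h5 := congrArg (ge • ·) h4
  simp only [smul_add, smul_zero] at h5
  rw [e_br_succ h2.le (n := 0) (by omega) 1 hxx, show (1 : ℕ) = 0 + 1 from rfl,
    e_br_succ h2.le (n := 0) (by omega) 0 hb, e0 hyy, br_zero_zero] at h5
  have h6 := congrArg (ge • ·) h5
  simp only [smul_add, smul_zero] at h6
  rw [gen_csmul, gen_csmul, show (0 + 1 : ℕ) = 0 + 1 from rfl,
    e_br_succ h2.le (n := 0) (by omega) 0 hxx, e0 hb, br_zero_zero] at h6
  have hr0 : (r : ℂ) ≠ 0 := by exact_mod_cast hr.ne'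
  have hr1 : (r : ℂ) + 1 ≠ 0 := by exact_mod_cast (by omega : r + 1 ≠ 0)
  have ha : a = 0 := by
    simp only [smul_zero, add_zero, smul_smul] at h6
    refine (smul_eq_zero.1 h6).resolve_left (mul_ne_zero (mul_ne_zero ?_ ?_) (mul_ne_zero ?_ ?_))
    · norm_num
    · push_cast; ring_nf; exact hr0
    · norm_num
    · push_cast; ring_nf; rw [add_comm]; exact hr1
  have hb' : r ≠ 1 → b = 0 := by
    intro hr2
    rw [ha, br_zero] at h5
    simp only [smul_zero, zero_add, add_zero] at h5
    refine (smul_eq_zero.1 h5).resolve_left ?_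
    have : ((r - 1 : ℤ) : ℂ) ≠ 0 := by exact_mod_cast (by omega : r - 1 ≠ 0)
    push_cast at this
    simpa using this
  refine ⟨ha, ?_, fun hr2 => ?_⟩
  · by_cases hr2 : r = 1
    · have : c ∈ (⊥ : Submodule ℂ M) := by
        rw [← hw_eq_bot (p := p) (α := α) (s := s) (r := r - 1 - 1) (by omega)]; exact hyy
      simpa using this
    · rw [ha, hb' hr2, br_zero, br_zero] at h4
      simpa using h4
  · rw [eq_neg_iff_add_eq_zero, add_comm, ← hbe]
    exact hb' hr2

theorem nuLU_eq_yop_xop (h1 : 1 ≤ s) (h2 : s < p) {u : M} (hu : u ∈ hw (p := p) M α s r) :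
    nuLU p α s • u =
      (((α : ℤ) : ℂ) * gz p s * r) • yop p (p - s) (r + 1) (xop p s r u) := by
  rw [← FE_of_mem_wt_zero hu.1, E_eq_xop h1 h2 hu, gen_csmul]
  congr 1
  rw [← mul_smul, ← pow_succ', show (p - s - 1).toNat + 1 = (p - s).toNat by omega,
    F_pow_eq_xop_yop (p - s) (r + 1), (xop_yop_relations h1 h2 hu).1, smul_zero, zero_add]

theorem E_br_succ {n : ℕ} (m : ℕ) {u : M}
    (hu : u ∈ hw (p := p) M α s r) :
    gE • br p (n + 1) m u = (((α : ℤ) : ℂ) * qInt p (n + 1) * qInt p (s - (n + 1))) • br p n m u +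
      br p n m (nuLU p α s • u) := by
  have h3 := EF_of_mem_wt (br_mem_wt n m hu)
  rw [F_br] at h3
  rw [h3]
  congr 1
  rw [br, br, nuLU_comm_pow casLU_f, nuLU_comm_pow casLU_F]

/-! ### Decomposition into the spaces spanned by the vectors `f ^ m F ^ n u` -/

variable (p) in
/-- The positions `(α, s, r, n, m)` of basis vectors of irreducible modules. -/
@[ext] structure Slot where
  α : ℤˣ
  s : ℤ
  r : ℤ
  n : ℕ
  m : ℕ
  hs : s ≤ p
  hn : n < s
  hm : m < r

variable (M) in
/-- The vectors in position `x`. -/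
def slotSpace (x : Slot p) : Submodule ℂ M :=
  (hw (p := p) M x.α x.s x.r).map (act M (gf ^ x.m * gF ^ x.n))

theorem mem_slotSpace {x : Slot p} {v : M} :
    v ∈ slotSpace M x ↔ ∃ u ∈ hw (p := p) M x.α x.s x.r, br p x.n x.m u = v := by
  simp only [slotSpace, Submodule.mem_map, act_apply, mul_smul, br]

/-- The joint eigenvalues of the Casimir element, `K`, `h` and the Casimir element of `sl(2)`. -/
def slotVal (x : Slot p) : Fin 4 → ℂ :=
  ![casVal p x.α x.s, kVal p x.α x.s x.n, ((x.r : ℂ) - 1) / 2 - x.m, ((x.r : ℂ) ^ 2 - 1) / 4]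

variable (p M) in
/-- The four commuting operators that separate the positions. -/
def slotOps : Fin 4 → End ℂ M :=
  ![act M (casLU p), act M gK, act M gh, sl2Cas (act M ge) (act M gf) (act M gh)]

theorem commute_slotOps (i j : Fin 4) : Commute (slotOps p M i) (slotOps p M j) := by
  have h1 : Commute (act M (casLU p)) (act M gK) := LinearMap.ext fun v => casLU_K v
  have h2 : Commute (act M (casLU p)) (act M gh) := LinearMap.ext fun v => casLU_h v
  have h3 : Commute (act M gK) (act M gh) := LinearMap.ext fun v => (h_K_smul v).symm
  have h4 : Commute (act M gh) (sl2Cas (act M ge) (act M gf) (act M gh)) :=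
    LinearMap.ext fun v => ((isSl2_act p M).cas_h v).symm
  have h5 : ∀ x : LU p, Commute (act M x) (act M ge) → Commute (act M x) (act M gf) →
      Commute (act M x) (act M gh) →
      Commute (act M x) (sl2Cas (act M ge) (act M gf) (act M gh)) := fun x a b c =>
    ((b.mul_right a).add_right (c.mul_right c)).add_right c
  have h6 := h5 (casLU p) (LinearMap.ext fun v => casLU_e v) (LinearMap.ext fun v => casLU_f v) h2
  have h7 := h5 gK (LinearMap.ext fun v => K_e_smul v) (LinearMap.ext fun v => K_f_smul v) h3
  fin_cases i <;> fin_cases j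
  · exact Commute.refl _
  · exact h1
  · exact h2
  · exact h6
  · exact h1.symm
  · exact Commute.refl _
  · exact h3
  · exact h7
  · exact h2.symm
  · exact h3.symm
  · exact Commute.refl _
  · exact h4
  · exact h6.symm
  · exact h7.symm
  · exact h4.symm
  · exact Commute.refl _

theorem casVal_kVal_injective {α β : ℤˣ} {s t : ℤ} {n k : ℕ} (hs : s ≤ p) (ht : t ≤ p)
    (hn : n < s) (hk : k < t) (h1 : casVal p α s = casVal p β t)
    (h2 : kVal p α s n = kVal p β t k) : α = β ∧ s = t ∧ n = k := by
  obtain ⟨s, rfl⟩ := Int.eq_ofNat_of_zero_le (by omega : 0 ≤ s)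
  obtain ⟨t, rfl⟩ := Int.eq_ofNat_of_zero_le (by omega : 0 ≤ t)
  have hp' := hp.out
  have same : ∀ γ : ℤˣ, ∀ s : ℕ, kVal p γ s n = kVal p γ s k → (n : ℤ) - k < p → (k : ℤ) - n < p →
      n = k := by
    intro γ s h h3 h4
    have hγ : ((γ : ℤ) : ℂ) ≠ 0 := by exact_mod_cast γ.ne_zero
    have := q_zpow_injOn p (mul_left_cancel₀ hγ h) h3 h4
    omega
  have diff : ∀ s t n k : ℕ, s ≤ p → t ≤ p → n < s → k < t → casVal p 1 s = casVal p (-1) t →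
      kVal p 1 s n = kVal p (-1) t k → False := by
    intro s t n k hs ht hn hk h1 h2
    rw [casVal_one, casVal_neg_one (by omega)] at h1
    have h3 := beta_injOn p (by omega) (by omega) h1
    have h4 : (t : ℤ) = p - s := by omega
    rw [h4, kVal_neg] at h2
    simp only [kVal, Units.val_one, Int.cast_one, one_mul] at h2
    have := q_zpow_injOn p h2 (by omega) (by omega)
    omega
  rcases Int.units_eq_one_or α with rfl | rfl <;> rcases Int.units_eq_one_or β with rfl | rfl
  · rw [casVal_one, casVal_one] at h1
    have h3 := beta_injOn p (by omega) (by omega) h1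
    subst h3
    exact ⟨rfl, rfl, same _ _ h2 (by omega) (by omega)⟩
  · exact (diff s t n k (by omega) (by omega) (by omega) (by omega) h1 h2).elim
  · exact (diff t s k n (by omega) (by omega) (by omega) (by omega) h1.symm h2.symm).elim
  · rw [casVal_neg_one (by omega), casVal_neg_one (by omega)] at h1
    have h3 := beta_injOn p (by omega) (by omega) h1
    have h4 : s = t := by omega
    subst h4
    exact ⟨rfl, rfl, same _ _ h2 (by omega) (by omega)⟩

theorem slotVal_injective : Function.Injective (slotVal (p := p)) := by
  intro x y h
  have h0 : casVal p x.α x.s = casVal p y.α y.s := congrFun h 0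
  have h1 : kVal p x.α x.s x.n = kVal p y.α y.s y.n := congrFun h 1
  have h2 : ((x.r : ℂ) - 1) / 2 - x.m = ((y.r : ℂ) - 1) / 2 - y.m := congrFun h 2
  have h3 : ((x.r : ℂ) ^ 2 - 1) / 4 = ((y.r : ℂ) ^ 2 - 1) / 4 := congrFun h 3
  obtain ⟨ha, hs, hn⟩ := casVal_kVal_injective x.hs y.hs x.hn y.hn h0 h1
  have hx := x.hm
  have hy := y.hm
  have h4 : x.r = y.r := by
    have h5 : (x.r : ℂ) ^ 2 = (y.r : ℂ) ^ 2 := by linear_combination 4 * h3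
    have h6 : x.r ^ 2 = y.r ^ 2 := by exact_mod_cast h5
    rcases sq_eq_sq_iff_eq_or_eq_neg.1 h6 with h7 | h7
    · exact h7
    · omega
  refine Slot.ext ha hs h4 hn ?_
  rw [h4] at h2
  have : (x.m : ℂ) = y.m := by linear_combination -h2
  exact_mod_cast this

theorem slotSpace_le (x : Slot p) :
    slotSpace M x ≤ ⨅ i, (slotOps p M i).maxGenEigenspace (slotVal x i) := by
  intro v hv
  obtain ⟨u, hu, rfl⟩ := mem_slotSpace.1 hv
  rw [Submodule.mem_iInf]
  intro i
  fin_cases i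
  · exact (mem_wSpace.1 (br_mem_wt x.n x.m hu)).1
  · exact mem_maxGenEigenspace_of_eq (K_br x.n x.m hu)
  · exact mem_maxGenEigenspace_of_eq (h_br x.hs x.hn x.m hu)
  · exact mem_maxGenEigenspace_of_eq (cas_br x.hs x.hn x.m hu)

variable (p M) in
theorem iSupIndep_slotSpace : iSupIndep (slotSpace (p := p) M) := by
  have h := End.independent_iInf_maxGenEigenspace_of_forall_mapsTo (slotOps p M)
    (fun i j φ => End.mapsTo_maxGenEigenspace_of_comm (commute_slotOps j i) φ)
  exact (h.comp slotVal_injective).mono slotSpace_le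

theorem K_maxGenEigenspace (k : ℂ) :
    (act M gK).maxGenEigenspace k = (act M gK).eigenspace k := by
  have hs : (act M gK).IsSemisimple := by
    refine End.isSemisimple_of_squarefree_aeval_eq_zero
      (p := (Polynomial.X ^ (2 * p) - 1 : Polynomial ℂ)) ?_ ?_
    · refine Polynomial.Separable.squarefree ?_
      rw [Polynomial.X_pow_sub_one_separable_iff]
      have := hp.out
      exact_mod_cast (by omega : 2 * p ≠ 0)
    · ext v
      simp [act_pow_apply, K_pow_smul]
  exact hs.isFinitelySemisimple.maxGenEigenspace_eq_eigenspace k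

theorem mem_of_mem_wt_zero {α : ℤˣ} {s : ℤ} {P : Submodule ℂ M}
    (hP : ∀ r m : ℕ, m < r → ∀ u ∈ hw (p := p) M α s r, gf ^ m • u ∈ P) {v : M}
    (hv : v ∈ wt (p := p) M α s 0) : v ∈ P := by
  have H : IsSl2 ((act M ge).restrict (p := wt (p := p) M α s 0) (fun v hv => e_mem_wt hv))
      ((act M gf).restrict (p := wt (p := p) M α s 0) (fun v hv => f_mem_wt hv))
      ((act M gh).restrict (p := wt (p := p) M α s 0) (fun v hv => h_mem_wt hv)) :=
    ⟨fun v => Subtype.ext (h_e_smul _), fun v => Subtype.ext (h_f_smul _),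
      fun v => Subtype.ext (e_f_smul _)⟩
  have key := H.mem_iSup_map_hwSpace (P := P.comap (wt (p := p) M α s 0).subtype) (by
    intro r m hm u hu
    have h1 : u.1 ∈ hw (p := p) M α s r :=
      ⟨u.2, congrArg Subtype.val hu.1, congrArg Subtype.val hu.2⟩
    have h2 := hP r m hm u.1 h1
    rw [Submodule.mem_comap]
    convert h2 using 1
    clear h2
    induction m with
    | zero => simp
    | succ m ih =>
      rw [pow_succ', pow_succ', mul_smul, ← ih (by omega)]
      rfl)
  have : (⟨v, hv⟩ : wt (p := p) M α s 0) ∈ P.comap (wt (p := p) M α s 0).subtype := by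
    rw [key]; trivial
  exact this

theorem eq_top_of_br_mem {P : Submodule ℂ M} (hP : ∀ x : Slot p, slotSpace M x ≤ P) : P = ⊤ := by
  rw [eq_top_iff, ← End.iSup_iInf_maxGenEigenspace_eq_top_of_iSup_maxGenEigenspace_eq_top_of_commute
    (![act M (casLU p), act M gK]) ?_ (fun i => End.iSup_maxGenEigenspace_eq_top _)]
  · refine iSup_le fun χ v hv => ?_
    by_cases h0 : v = 0
    · rw [h0]; exact P.zero_mem
    have h1 : v ∈ (act M (casLU p)).maxGenEigenspace (χ 0) := (Submodule.mem_iInf _).1 hv 0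
    have h2 : v ∈ (act M gK).maxGenEigenspace (χ 1) := (Submodule.mem_iInf _).1 hv 1
    rw [K_maxGenEigenspace] at h2
    have h3 : v ∈ wSpace (p := p) M (χ 0) (χ 1) := ⟨h1, h2⟩
    obtain ⟨α, s, n, hs1, hs2, hn, h4, h5⟩ := exists_weight h3 h0
    rw [h4, h5] at h3
    obtain ⟨w, hw, h6⟩ := F_pow_surjOn_wt (p := p) (α := α) (s := (s : ℤ)) (n := 0) (by omega) le_rfl n
      (by omega) (v := v) (by rwa [zero_add])
    have h7 : w ∈ P.comap (act M (gF ^ n)) := mem_of_mem_wt_zero (fun r m hm u hu => by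
      have h8 := hP (⟨α, (s : ℤ), (r : ℤ), n, m, by omega, by omega, by omega⟩ : Slot p)
        (mem_slotSpace.2 ⟨u, hu, rfl⟩)
      rw [Submodule.mem_comap, act_apply, F_pow_f_pow_smul]
      exact h8) hw
    rw [← h6]
    exact h7
  · have : Commute (act M (casLU p)) (act M gK) := LinearMap.ext fun v => casLU_K v
    intro i j hij
    fin_cases i <;> fin_cases j
    · exact absurd rfl hij
    · exact this
    · exact this.symm
    · exact absurd rfl hij

end Frame

section Lattice

variable {ι V : Type*} [AddCommGroup V] [Module ℂ V] {t A B : ι → Submodule ℂ V}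

theorem inf_iSup_le_of_iSupIndep (ht : iSupIndep t) (hA : ∀ i, A i ≤ t i) (i : ι) :
    t i ⊓ ⨆ j, A j ≤ A i := by
  have h1 : ⨆ j, A j ≤ A i ⊔ ⨆ (j) (_ : j ≠ i), t j := by
    refine iSup_le fun j => ?_
    by_cases h : j = i
    · rw [h]; exact le_sup_left
    · exact (hA j).trans ((le_iSup₂ (f := fun j (_ : j ≠ i) => t j) j h).trans le_sup_right)
  calc t i ⊓ ⨆ j, A j ≤ t i ⊓ (A i ⊔ ⨆ (j) (_ : j ≠ i), t j) := inf_le_inf_left _ h1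
    _ = A i ⊔ (t i ⊓ ⨆ (j) (_ : j ≠ i), t j) := by
      rw [inf_comm, sup_inf_assoc_of_le _ (hA i), inf_comm]
    _ = A i := by rw [(ht i).eq_bot, sup_bot_eq]

theorem disjoint_iSup_of_iSupIndep (ht : iSupIndep t) (hA : ∀ i, A i ≤ t i) (hB : ∀ i, B i ≤ t i)
    (h : ∀ i, Disjoint (A i) (B i)) : Disjoint (⨆ i, A i) (⨆ i, B i) := by
  classical
  rw [Submodule.disjoint_def]
  intro v hvA hvB
  rw [Submodule.mem_iSup_iff_exists_finsupp] at hvA hvB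
  obtain ⟨f, hf, rfl⟩ := hvA
  obtain ⟨g, hg, hgf⟩ := hvB
  rw [Finsupp.sum_of_support_subset f Finset.subset_union_left _ (fun _ _ => rfl),
    Finsupp.sum_of_support_subset g (Finset.subset_union_right (s₁ := f.support)) _
      (fun _ _ => rfl)] at hgf
  have h1 := (iSupIndep_iff_finsetSum_eq_imp_eq t).1 ht _ _ _
    (fun i _ => ⟨hB i (hg i), hA i (hf i)⟩) hgf
  refine Finset.sum_eq_zero fun i hi => ?_
  refine Submodule.disjoint_def.1 (h i) _ (hf i) ?_
  rw [← h1 i (Finset.mem_union_left _ hi)]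
  exact hg i

end Lattice

section Families

variable {M : Type*} [AddCommGroup M] [Module (LU p) M] [Module ℂ M]
  [IsScalarTower ℂ (LU p) M] [hp : Fact (2 ≤ p)]

instance finiteDimensional_submodule [FiniteDimensional ℂ M] (N : Submodule (LU p) M) :
    FiniteDimensional ℂ N :=
  FiniteDimensional.of_injective (N.subtype.restrictScalars ℂ) N.injective_subtype

instance finiteDimensional_quotient [FiniteDimensional ℂ M] (N : Submodule (LU p) M) :
    FiniteDimensional ℂ (M ⧸ N) :=
  Module.Finite.of_surjective (N.mkQ.restrictScalars ℂ) N.mkQ_surjective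

/-! ### Homomorphisms and highest weight vectors -/

section Hom

variable {N : Type*} [AddCommGroup N] [Module (LU p) N] [Module ℂ N] [IsScalarTower ℂ (LU p) N]

omit hp in
theorem map_pow_apply (φ : M →ₗ[LU p] N) {S : End ℂ M} {T : End ℂ N} (h : ∀ v, φ (S v) = T (φ v))
    (k : ℕ) (v : M) : φ ((S ^ k) v) = (T ^ k) (φ v) := by
  induction k with
  | zero => simp
  | succ k ih => rw [pow_succ', pow_succ', End.mul_apply, End.mul_apply, h, ih]

theorem map_hw (φ : M →ₗ[LU p] N) {α : ℤˣ} {s r : ℤ} {u : M} (hu : u ∈ hw (p := p) M α s r) :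
    φ u ∈ hw (p := p) N α s r := by
  obtain ⟨h1, h2, h3⟩ := mem_hw.1 hu
  rw [wt, mem_wSpace] at h1
  refine mem_hw.2 ⟨mem_wSpace.2 ⟨?_, ?_⟩, ?_, ?_⟩
  · rw [End.mem_maxGenEigenspace] at h1 ⊢
    obtain ⟨⟨k, hk⟩, -⟩ := h1
    refine ⟨k, ?_⟩
    have h4 : ∀ v, φ ((act M (casLU p) - casVal p α s • 1 : End ℂ M) v) =
        (act N (casLU p) - casVal p α s • 1 : End ℂ N) (φ v) := fun v => by
      simp
    rw [← map_pow_apply φ h4, hk, map_zero]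
  · rw [← map_smul, h1.2, map_complex_smul]
  · rw [← map_smul, h2, map_zero]
  · rw [← map_smul, h3, map_complex_smul]

theorem map_xop (φ : M →ₗ[LU p] N) (s r : ℤ) (u : M) : φ (xop p s r u) = xop p s r (φ u) := by
  simp [xop]

theorem map_yop (φ : M →ₗ[LU p] N) (s r : ℤ) (u : M) : φ (yop p s r u) = yop p s r (φ u) := by
  simp [yop, map_xop]

theorem map_br (φ : M →ₗ[LU p] N) (n m : ℕ) (u : M) : φ (br p n m u) = br p n m (φ u) := by
  simp [br]

end Hom

/-! ### Submodules generated by families of spaces of highest weight vectors -/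

/-- A family of subspaces of the spaces of highest weight vectors that is stable under the operators
`xop` and `yop`. -/
structure IsStableFamily (U : ℤˣ → ℤ → ℤ → Submodule ℂ M) : Prop where
  le : ∀ (α : ℤˣ) (s r : ℤ), 1 ≤ s → s ≤ p → U α s r ≤ hw (p := p) M α s r
  xop_mem : ∀ (α : ℤˣ) (s r : ℤ), 1 ≤ s → s < p → ∀ u ∈ U α s r, xop p s r u ∈ U (-α) (p - s) (r + 1)
  yop_mem : ∀ (α : ℤˣ) (s r : ℤ), 1 ≤ s → s < p → ∀ u ∈ U α s r, yop p s r u ∈ U (-α) (p - s) (r - 1)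

variable (p) in
/-- The vectors obtained in position `x` from a family of spaces of highest weight vectors. -/
def slotMap (U : ℤˣ → ℤ → ℤ → Submodule ℂ M) (x : Slot p) : Submodule ℂ M :=
  (U x.α x.s x.r).map (act M (gf ^ x.m * gF ^ x.n))

theorem mem_slotMap {U : ℤˣ → ℤ → ℤ → Submodule ℂ M} {x : Slot p} {v : M} :
    v ∈ slotMap p U x ↔ ∃ u ∈ U x.α x.s x.r, br p x.n x.m u = v := by
  simp only [slotMap, Submodule.mem_map, act_apply, mul_smul, br]

theorem slotMap_le {U : ℤˣ → ℤ → ℤ → Submodule ℂ M}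
    (hU : ∀ (α : ℤˣ) (s r : ℤ), 1 ≤ s → s ≤ p → U α s r ≤ hw (p := p) M α s r) (x : Slot p) :
    slotMap p U x ≤ slotSpace M x :=
  Submodule.map_mono (hU _ _ _ (by have := x.hn; omega) x.hs)

variable [FiniteDimensional ℂ M] {U H : ℤˣ → ℤ → ℤ → Submodule ℂ M}

theorem br_mem_iSup (hU : IsStableFamily (p := p) U) {α : ℤˣ} {s r : ℤ} (hs : s ≤ p) {n : ℕ}
    (hn : n < s) (m : ℕ) {u : M} (hu : u ∈ U α s r) : br p n m u ∈ ⨆ x, slotMap p U x := by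
  by_cases hm : m < r
  · exact Submodule.mem_iSup_of_mem (⟨α, s, r, n, m, hs, hn, hm⟩ : Slot p)
      (mem_slotMap.2 ⟨u, hu, rfl⟩)
  · rw [br_eq_zero hs hn (not_lt.1 hm) (hU.le α s r (by omega) hs hu)]
    exact Submodule.zero_mem _

theorem gen_smul_br_mem (hU : IsStableFamily (p := p) U) {α : ℤˣ} {s r : ℤ} (hs : s ≤ p) {n : ℕ}
    (hn : n < s) (m : ℕ) {u : M} (hu : u ∈ U α s r) (x : Gen) :
    gen p x • br p n m u ∈ ⨆ x, slotMap p U x := by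
  have h1 : 1 ≤ s := by omega
  have hu' := hU.le α s r h1 hs hu
  have hb := br_mem_iSup hU hs hn m hu
  cases x with
  | E =>
    rcases n with _ | n
    · rcases hs.lt_or_eq with h2 | rfl
      · rw [E_br_zero h1 h2 hu']
        refine Submodule.smul_mem _ _ (Submodule.sub_mem _ (Submodule.smul_mem _ _ ?_)
          (Submodule.smul_mem _ _ ?_))
        · exact br_mem_iSup hU (by omega) (by omega) _ (hU.xop_mem _ _ _ h1 h2 u hu)
        · exact br_mem_iSup hU (by omega) (by omega) _ (hU.yop_mem _ _ _ h1 h2 u hu)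
      · rw [E_br_zero_p hu']; exact Submodule.zero_mem _
    · rw [E_br_succ m hu']
      refine Submodule.add_mem _ (Submodule.smul_mem _ _ (br_mem_iSup hU hs (by omega) m hu)) ?_
      rcases hs.lt_or_eq with h2 | rfl
      · rw [nuLU_eq_yop_xop h1 h2 hu', br_smul]
        have h3 := hU.yop_mem _ _ _ (by omega) (by omega) _ (hU.xop_mem _ _ _ h1 h2 u hu)
        rw [neg_neg, sub_sub_cancel, add_sub_cancel_right] at h3
        exact Submodule.smul_mem _ _ (br_mem_iSup hU hs (by omega) m h3)
      · rw [← FE_of_mem_wt_zero hu'.1, E_eq_zero_of_mem_wt_zero hu'.1, smul_zero, br_zero]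
        exact Submodule.zero_mem _
  | F =>
    by_cases h3 : (n : ℤ) + 1 < s
    · rw [F_br]; exact br_mem_iSup hU hs (by omega) m hu
    · rw [show n = (s - 1).toNat by omega, F_br_last (r := r) h1]
      rcases hs.lt_or_eq with h2 | rfl
      · exact Submodule.add_mem _
          (br_mem_iSup hU (by omega) (by omega) _ (hU.xop_mem _ _ _ h1 h2 u hu))
          (br_mem_iSup hU (by omega) (by omega) _ (hU.yop_mem _ _ _ h1 h2 u hu))
      · rw [xop_p, yop_p, br_zero, br_zero, add_zero]; exact Submodule.zero_mem _
  | K => rw [K_br n m hu']; exact Submodule.smul_mem _ _ hb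
  | Kinv => rw [Kinv_of_K (K_br n m hu')]; exact Submodule.smul_mem _ _ hb
  | e =>
    rcases m with _ | m
    · rw [e_br_zero hs hn hu']; exact Submodule.zero_mem _
    · rw [e_br_succ hs hn m hu']; exact Submodule.smul_mem _ _ (br_mem_iSup hU hs hn m hu)
  | f => rw [f_br]; exact br_mem_iSup hU hs hn _ hu
  | h => rw [h_br hs hn m hu']; exact Submodule.smul_mem _ _ hb

/-- The submodule spanned by the vectors `f ^ m F ^ n u` with `u` in a stable family. -/
def genSub (hU : IsStableFamily (p := p) U) : Submodule (LU p) M where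
  carrier := (⨆ x, slotMap p U x : Submodule ℂ M)
  add_mem' := Submodule.add_mem _
  zero_mem' := Submodule.zero_mem _
  smul_mem' := by
    intro a v hv
    refine span_gen_le (P := ⨆ x, slotMap p U x) (fun g w hw => ?_) a hv
    have : (⨆ x, slotMap p U x) ≤ (⨆ x, slotMap p U x).comap (act M (gen p g)) := by
      refine iSup_le fun x v hv => ?_
      obtain ⟨u, hu, rfl⟩ := mem_slotMap.1 hv
      exact gen_smul_br_mem hU x.hs x.hn x.m hu g
    exact this hw

theorem mem_genSub (hU : IsStableFamily (p := p) U) {v : M} :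
    v ∈ genSub hU ↔ v ∈ ⨆ x, slotMap p U x := Iff.rfl

theorem le_genSub (hU : IsStableFamily (p := p) U) {α : ℤˣ} {s r : ℤ} (h1 : 1 ≤ s) (h2 : s ≤ p)
    {u : M} (hu : u ∈ U α s r) : u ∈ genSub hU := by
  have := br_mem_iSup hU h2 (n := 0) (by omega) 0 hu
  rwa [br_zero_zero] at this

theorem genSub_le (hU : IsStableFamily (p := p) U) {N : Submodule (LU p) M}
    (h : ∀ (α : ℤˣ) (s r : ℤ), 1 ≤ s → s ≤ p → ∀ u ∈ U α s r, u ∈ N) : genSub hU ≤ N := by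
  have : (⨆ x, slotMap p U x) ≤ N.restrictScalars ℂ := by
    refine iSup_le fun x v hv => ?_
    obtain ⟨u, hu, rfl⟩ := mem_slotMap.1 hv
    exact N.smul_mem _ (N.smul_mem _ (h _ _ _ (by have := x.hn; omega) x.hs u hu))
  exact this

theorem mem_of_mem_hw_of_mem_iSup (hU : ∀ (α : ℤˣ) (s r : ℤ), 1 ≤ s → s ≤ p → U α s r ≤ hw (p := p) M α s r)
    {α : ℤˣ} {s r : ℤ} (h1 : 1 ≤ s) (h2 : s ≤ p) {u : M} (hu : u ∈ hw (p := p) M α s r)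
    (hv : u ∈ ⨆ x, slotMap p U x) : u ∈ U α s r := by
  by_cases h0 : u = 0
  · rw [h0]; exact Submodule.zero_mem _
  have hr := r_pos_of_ne_zero hu h0
  let x : Slot p := ⟨α, s, r, 0, 0, h2, by omega, by exact_mod_cast hr⟩
  have h3 := inf_iSup_le_of_iSupIndep (iSupIndep_slotSpace p M) (slotMap_le hU) x
    ⟨mem_slotSpace.2 ⟨u, hu, br_zero_zero u⟩, hv⟩
  obtain ⟨w, hw, h4⟩ := mem_slotMap.1 h3
  rw [show br p x.n x.m w = w from br_zero_zero w] at h4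
  rwa [← h4]

theorem mem_of_mem_hw_of_mem_genSub (hU : IsStableFamily (p := p) U) {α : ℤˣ} {s r : ℤ}
    (h1 : 1 ≤ s) (h2 : s ≤ p) {u : M} (hu : u ∈ hw (p := p) M α s r) (hv : u ∈ genSub hU) :
    u ∈ U α s r :=
  mem_of_mem_hw_of_mem_iSup hU.le h1 h2 hu hv

theorem disjoint_genSub (hU : IsStableFamily (p := p) U) (hH : IsStableFamily (p := p) H)
    (h : ∀ (α : ℤˣ) (s r : ℤ), 1 ≤ s → s ≤ p → ∀ u, u ∈ U α s r → u ∈ H α s r → u = 0) :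
    Disjoint (genSub hU) (genSub hH) := by
  have := disjoint_iSup_of_iSupIndep (iSupIndep_slotSpace p M) (slotMap_le hU.le)
    (slotMap_le hH.le) (fun x => by
      rw [Submodule.disjoint_def]
      intro v h1 h2
      obtain ⟨u, hu, rfl⟩ := mem_slotMap.1 h1
      obtain ⟨w, hw, h3⟩ := mem_slotMap.1 h2
      have hs : 1 ≤ x.s := by have := x.hn; omega
      have h4 : w - u = 0 := by
        refine br_injOn x.hs x.hn x.hm
          (Submodule.sub_mem _ (hH.le _ _ _ hs x.hs hw) (hU.le _ _ _ hs x.hs hu)) ?_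
        rw [sub_eq_add_neg, ← neg_one_smul ℂ u, br_add, br_smul, h3, neg_one_smul, add_neg_cancel]
      rw [sub_eq_zero.1 h4] at hw
      rw [h _ _ _ hs x.hs u hu hw, br_zero])
  rw [Submodule.disjoint_def] at this ⊢
  exact this

theorem eq_top_of_hw_le {N : Submodule (LU p) M}
    (h : ∀ (α : ℤˣ) (s r : ℤ), 1 ≤ s → s ≤ p → ∀ u ∈ hw (p := p) M α s r, u ∈ N) : N = ⊤ := by
  have : N.restrictScalars ℂ = ⊤ := eq_top_of_br_mem (p := p) (fun x v hv => by
    obtain ⟨u, hu, rfl⟩ := mem_slotSpace.1 hv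
    exact N.smul_mem _ (N.smul_mem _ (h _ _ _ (by have := x.hn; omega) x.hs u hu)))
  rwa [Submodule.restrictScalars_eq_top_iff] at this

theorem isCompl_genSub (hU : IsStableFamily (p := p) U) (hH : IsStableFamily (p := p) H)
    (h : ∀ (α : ℤˣ) (s r : ℤ), 1 ≤ s → s ≤ p → ∀ u, u ∈ U α s r → u ∈ H α s r → u = 0)
    (h' : ∀ (α : ℤˣ) (s r : ℤ), 1 ≤ s → s ≤ p → ∀ u ∈ hw (p := p) M α s r,
      ∃ a ∈ U α s r, ∃ b ∈ H α s r, u = a + b) : IsCompl (genSub hU) (genSub hH) := by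
  refine ⟨disjoint_genSub hU hH h, codisjoint_iff.2 (eq_top_of_hw_le fun α s r h1 h2 u hu => ?_)⟩
  obtain ⟨a, ha, b, hb, rfl⟩ := h' α s r h1 h2 u hu
  exact Submodule.add_mem_sup (le_genSub hU h1 h2 ha) (le_genSub hH h1 h2 hb)

theorem exists_map_eq_of_surjective {N : Type*} [AddCommGroup N] [Module (LU p) N] [Module ℂ N]
    [IsScalarTower ℂ (LU p) N] [FiniteDimensional ℂ N] (φ : M →ₗ[LU p] N)
    (hφ : Function.Surjective φ) {α : ℤˣ} {s r : ℤ} (h1 : 1 ≤ s) (h2 : s ≤ p) {w : N}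
    (hw' : w ∈ hw (p := p) N α s r) : ∃ u ∈ hw (p := p) M α s r, φ u = w := by
  have h3 : w ∈ ⨆ x, slotMap p (fun α s r => (hw (p := p) M α s r).map (φ.restrictScalars ℂ)) x := by
    obtain ⟨v, rfl⟩ := hφ w
    have : (⊤ : Submodule ℂ M) ≤ (⨆ x, slotMap p
        (fun α s r => (hw (p := p) M α s r).map (φ.restrictScalars ℂ)) x).comap
          (φ.restrictScalars ℂ) := by
      rw [← eq_top_of_br_mem (p := p) (P := (⨆ x, slotMap p
        (fun α s r => (hw (p := p) M α s r).map (φ.restrictScalars ℂ)) x).comap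
          (φ.restrictScalars ℂ)) fun x v hv => ?_]
      obtain ⟨u, hu, rfl⟩ := mem_slotSpace.1 hv
      refine Submodule.mem_iSup_of_mem x (mem_slotMap.2 ⟨φ u, ⟨u, hu, rfl⟩, ?_⟩)
      exact (map_br φ _ _ u).symm
    exact this trivial
  obtain ⟨u, hu, h4⟩ := mem_of_mem_hw_of_mem_iSup (fun α s r _ _ => by
    rintro _ ⟨u, hu, rfl⟩
    exact map_hw φ hu) h1 h2 hw' h3
  exact ⟨u, hu, h4⟩

theorem exists_hw_ne_zero [Nontrivial M] : ∃ (α : ℤˣ) (s r : ℤ) (u : M), 1 ≤ s ∧ s ≤ p ∧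
    u ∈ hw (p := p) M α s r ∧ u ≠ 0 := by
  by_contra! h
  have := eq_top_of_hw_le (N := (⊥ : Submodule (LU p) M)) (fun α s r h1 h2 u hu => by
    rw [h α s r u h1 h2 hu]; exact Submodule.zero_mem _)
  exact bot_ne_top this

end Families

section Families

variable {M : Type*} [AddCommGroup M] [Module (LU p) M] [Module ℂ M]
  [IsScalarTower ℂ (LU p) M] [hp : Fact (2 ≤ p)]

/-! ### Families of spaces spanned by given vectors -/

section SpanFamily

variable {ι : Type*} {α : ι → ℤˣ} {s r : ι → ℤ} {u : ι → M}

/-- The family of the spaces spanned by the `u i` that have the given label. -/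
def spanFamily (α : ι → ℤˣ) (s r : ι → ℤ) (u : ι → M) (β : ℤˣ) (t l : ℤ) : Submodule ℂ M :=
  Submodule.span ℂ {w | ∃ i, α i = β ∧ s i = t ∧ r i = l ∧ u i = w}

theorem mem_spanFamily (i : ι) : u i ∈ spanFamily α s r u (α i) (s i) (r i) :=
  Submodule.subset_span ⟨i, rfl, rfl, rfl, rfl⟩

theorem isStableFamily_spanFamily (hu : ∀ i, u i ∈ hw (p := p) M (α i) (s i) (r i))
    (hx : ∀ i, s i < p → xop p (s i) (r i) (u i) ∈
      spanFamily α s r u (-α i) (p - s i) (r i + 1))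
    (hy : ∀ i, s i < p → yop p (s i) (r i) (u i) ∈
      spanFamily α s r u (-α i) (p - s i) (r i - 1)) :
    IsStableFamily (p := p) (spanFamily α s r u) := by
  refine ⟨fun β t l _ _ => Submodule.span_le.2 ?_, fun β t l h1 h2 w hw => ?_,
    fun β t l h1 h2 w hw => ?_⟩
  · rintro _ ⟨i, rfl, rfl, rfl, rfl⟩
    exact hu i
  · induction hw using Submodule.span_induction with
    | mem w hw => obtain ⟨i, rfl, rfl, rfl, rfl⟩ := hw; exact hx i h2
    | zero => rw [xop_zero]; exact Submodule.zero_mem _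
    | add a b _ _ ha hb => rw [xop_add]; exact Submodule.add_mem _ ha hb
    | smul c a _ ha => rw [xop_smul]; exact Submodule.smul_mem _ _ ha
  · induction hw using Submodule.span_induction with
    | mem w hw => obtain ⟨i, rfl, rfl, rfl, rfl⟩ := hw; exact hy i h2
    | zero => rw [yop_zero]; exact Submodule.zero_mem _
    | add a b _ _ ha hb => rw [yop_add]; exact Submodule.add_mem _ ha hb
    | smul c a _ ha => rw [yop_smul]; exact Submodule.smul_mem _ _ ha

end SpanFamily

/-! ### Simple and semisimple modules -/

variable [FiniteDimensional ℂ M] {α : ℤˣ} {s r : ℤ} {u : M}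

variable (p) in
/-- A highest weight vector that is annihilated by the operators `xop` and `yop`. -/
structure IsKilled (α : ℤˣ) (s r : ℤ) (u : M) : Prop where
  one_le : 1 ≤ s
  le : s ≤ p
  mem : u ∈ hw (p := p) M α s r
  xop : xop p s r u = 0
  yop : yop p s r u = 0

theorem IsKilled.isStableFamily (h : IsKilled p α s r u) : IsStableFamily (p := p)
    (spanFamily (fun _ : Unit => α) (fun _ => s) (fun _ => r) (fun _ => u)) :=
  isStableFamily_spanFamily (fun _ => h.mem)
    (fun _ _ => by rw [h.xop]; exact Submodule.zero_mem _)
    (fun _ _ => by rw [h.yop]; exact Submodule.zero_mem _)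

theorem mem_spanFamily_unit {β : ℤˣ} {t l : ℤ} {w : M}
    (hw : w ∈ spanFamily (fun _ : Unit => α) (fun _ => s) (fun _ => r) (fun _ => u) β t l)
    (h0 : w ≠ 0) : α = β ∧ s = t ∧ r = l ∧ ∃ c : ℂ, c ≠ 0 ∧ w = c • u := by
  rw [spanFamily] at hw
  by_cases h : α = β ∧ s = t ∧ r = l
  · obtain ⟨rfl, rfl, rfl⟩ := h
    simp only [true_and, exists_const, Set.ofPred_eq_eq_singleton'] at hw
    obtain ⟨c, rfl⟩ := Submodule.mem_span_singleton.1 hw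
    exact ⟨rfl, rfl, rfl, c, fun hc => h0 (by rw [hc, zero_smul]), rfl⟩
  · exfalso
    have : {w : M | ∃ _ : Unit, α = β ∧ s = t ∧ r = l ∧ u = w} = ∅ := by
      ext w; simp; tauto
    rw [this, Submodule.span_empty] at hw
    exact h0 hw

theorem IsKilled.mem_genSub (h : IsKilled p α s r u) : u ∈ genSub h.isStableFamily :=
  le_genSub _ h.one_le h.le (mem_spanFamily (u := fun _ : Unit => u) ())

theorem IsKilled.genSub_le (h : IsKilled p α s r u) {N : Submodule (LU p) M} (hu : u ∈ N) :
    genSub h.isStableFamily ≤ N :=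
  LUq.genSub_le _ fun β t l _ _ w hw => by
    by_cases h0 : w = 0
    · rw [h0]; exact N.zero_mem
    · obtain ⟨-, -, -, c, -, rfl⟩ := mem_spanFamily_unit hw h0
      exact (N.restrictScalars ℂ).smul_mem c hu

theorem IsKilled.of_mem_genSub (h : IsKilled p α s r u) {β : ℤˣ} {t l : ℤ} {w : M} (h1 : 1 ≤ t)
    (h2 : t ≤ p) (hw' : w ∈ hw (p := p) M β t l) (hw : w ∈ genSub h.isStableFamily) (h0 : w ≠ 0) :
    α = β ∧ s = t ∧ r = l ∧ ∃ c : ℂ, c ≠ 0 ∧ w = c • u :=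
  mem_spanFamily_unit (mem_of_mem_hw_of_mem_genSub _ h1 h2 hw' hw) h0

theorem IsKilled.isSimpleModule (h : IsKilled p α s r u) (h0 : u ≠ 0) :
    IsSimpleModule (LU p) (genSub h.isStableFamily) := by
  rw [isSimpleModule_iff_isAtom]
  refine ⟨fun hb => h0 ?_, fun N hN => ?_⟩
  · have := h.mem_genSub
    rwa [hb, Submodule.mem_bot] at this
  · by_contra hne
    have := Submodule.nontrivial_iff_ne_bot.2 hne
    obtain ⟨β, t, l, w, h1, h2, h3, h4⟩ := exists_hw_ne_zero (p := p) (M := N)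
    have h5 := map_hw N.subtype h3
    obtain ⟨-, -, -, c, hc, h6⟩ := h.of_mem_genSub h1 h2 h5 (hN.le w.2) (by simpa using h4)
    refine hN.not_ge (h.genSub_le ?_)
    have h7 : u = c⁻¹ • (w : M) := by
      rw [show (w : M) = c • u from h6, inv_smul_smul₀ hc]
    rw [h7]
    exact (N.restrictScalars ℂ).smul_mem _ w.2

theorem exists_isKilled [Nontrivial M] : ∃ (α : ℤˣ) (s r : ℤ) (u : M), IsKilled p α s r u ∧ u ≠ 0 := by
  obtain ⟨α, s, r, u, h1, h2, hu, h0⟩ := exists_hw_ne_zero (p := p) (M := M)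
  rcases h2.lt_or_eq with h2 | rfl
  swap
  · exact ⟨α, p, r, u, ⟨h1, le_rfl, hu, xop_p u, yop_p u⟩, h0⟩
  have hx := xop_mem h1 h2 hu
  have hy := yop_mem h1 h2 hu
  obtain ⟨hxx, hyy, hxy⟩ := xop_yop_relations h1 h2 hu
  by_cases h3 : xop p s r u = 0
  · by_cases h4 : yop p s r u = 0
    · exact ⟨α, s, r, u, ⟨h1, h2.le, hu, h3, h4⟩, h0⟩
    · refine ⟨-α, p - s, r - 1, _, ⟨by omega, by omega, hy, ?_, hyy⟩, h4⟩
      have hr : r ≠ 1 := by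
        rintro rfl
        rw [hw_eq_bot (by norm_num)] at hy
        exact h4 hy
      rw [hxy hr, h3, yop_zero, neg_zero]
  · by_cases h4 : yop p (p - s) (r + 1) (xop p s r u) = 0
    · exact ⟨-α, p - s, r + 1, _, ⟨by omega, by omega, hx, hxx, h4⟩, h3⟩
    · have hyx := yop_mem (by omega) (by omega) hx
      obtain ⟨-, h5, h6⟩ := xop_yop_relations (by omega) (by omega) hx
      simp only [neg_neg, sub_sub_cancel, add_sub_cancel_right] at hyx h5 h6
      refine ⟨α, s, r, _, ⟨h1, h2.le, hyx, ?_, h5⟩, h4⟩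
      have hr := r_pos_of_ne_zero hu h0
      rw [h6 (by omega), hxx, yop_zero, neg_zero]

theorem isSemisimpleModule_of_isKilled (h : ∀ (α : ℤˣ) (s r : ℤ), 1 ≤ s → s ≤ p →
    ∀ u ∈ hw (p := p) M α s r, xop p s r u = 0 ∧ yop p s r u = 0) :
    IsSemisimpleModule (LU p) M := by
  let T := {x : ℤˣ × ℤ × ℤ × M // IsKilled p x.1 x.2.1 x.2.2.1 x.2.2.2 ∧ x.2.2.2 ≠ 0}
  refine isSemisimpleModule_of_isSemisimpleModule_submodule'
    (p := fun x : T => genSub x.2.1.isStableFamily) (fun x => ?_) (eq_top_of_hw_le (p := p) ?_)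
  · have := x.2.1.isSimpleModule x.2.2
    infer_instance
  · intro α s r h1 h2 u hu
    by_cases h0 : u = 0
    · rw [h0]; exact Submodule.zero_mem _
    have hk : IsKilled p α s r u := ⟨h1, h2, hu, (h α s r h1 h2 u hu).1, (h α s r h1 h2 u hu).2⟩
    exact Submodule.mem_iSup_of_mem (⟨(α, s, r, u), hk, h0⟩ : T) hk.mem_genSub

theorem hasSemisimpleFiltration_two
    (h : ∀ (α : ℤˣ) (s r : ℤ), 1 ≤ s → s < p → ∀ u ∈ hw (p := p) M α s r,
      yop p (p - s) (r + 1) (xop p s r u) = 0 ∧ xop p (p - s) (r - 1) (yop p s r u) = 0) :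
    HasSemisimpleFiltration (LU p) M 2 := by
  let T := {x : ℤˣ × ℤ × ℤ × M // IsKilled p x.1 x.2.1 x.2.2.1 x.2.2.2 ∧ x.2.2.2 ≠ 0}
  let N₁ : Submodule (LU p) M := ⨆ x ∈ (Set.univ : Set T), genSub x.2.1.isStableFamily
  have hN : IsSemisimpleModule (LU p) N₁ :=
    isSemisimpleModule_biSup_of_isSemisimpleModule_submodule fun x _ => by
      have := x.2.1.isSimpleModule x.2.2
      infer_instance
  have hk : ∀ (α : ℤˣ) (s r : ℤ) (u : M), IsKilled p α s r u → u ∈ N₁ := fun α s r u hk => by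
    by_cases h0 : u = 0
    · rw [h0]; exact Submodule.zero_mem _
    exact (le_iSup₂ (f := fun (x : T) (_ : x ∈ (Set.univ : Set T)) => genSub x.2.1.isStableFamily)
      (⟨(α, s, r, u), hk, h0⟩ : T) trivial) hk.mem_genSub
  refine ⟨fun i => if i = 0 then ⊤ else if i = 1 then N₁ else ⊥, ?_, rfl, rfl, ?_⟩
  · refine antitone_nat_of_succ_le fun n => ?_
    rcases n with _ | _ | n <;> simp
  · intro i hi
    interval_cases i
    · let φ : M →ₗ[LU p] ((⊤ : Submodule (LU p) M) ⧸ N₁.submoduleOf ⊤) :=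
        (N₁.submoduleOf ⊤).mkQ ∘ₗ (Submodule.topEquiv.symm : M ≃ₗ[LU p] _).toLinearMap
      have hφ : Function.Surjective φ :=
        (N₁.submoduleOf ⊤).mkQ_surjective.comp (Submodule.topEquiv.symm : M ≃ₗ[LU p] _).surjective
      have h0 : ∀ u ∈ N₁, φ u = 0 := fun u hu =>
        (Submodule.Quotient.mk_eq_zero (N₁.submoduleOf ⊤)).2 hu
      refine isSemisimpleModule_of_isKilled (p := p)
        (M := (⊤ : Submodule (LU p) M) ⧸ N₁.submoduleOf ⊤) fun α s r h1 h2 u hu => ?_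
      obtain ⟨v, hv, rfl⟩ := exists_map_eq_of_surjective φ hφ h1 h2 hu
      rcases h2.lt_or_eq with h2 | rfl
      swap
      · exact ⟨xop_p _, yop_p _⟩
      obtain ⟨hxx, hyy, -⟩ := xop_yop_relations h1 h2 hv
      obtain ⟨hyx, hxy⟩ := h α s r h1 h2 v hv
      rw [← map_xop, ← map_yop]
      exact ⟨h0 _ (hk _ _ _ _ ⟨by omega, by omega, xop_mem h1 h2 hv, hxx, hyx⟩),
        h0 _ (hk _ _ _ _ ⟨by omega, by omega, yop_mem h1 h2 hv, hxy, hyy⟩)⟩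
    · show IsSemisimpleModule (LU p) (N₁ ⧸ (⊥ : Submodule (LU p) M).submoduleOf N₁)
      infer_instance

end Families

/-! ### Verification of the defining relations on explicit vectors -/

section Pack

variable {V : Type*} [AddCommGroup V] [Module ℂ V] [hp : Fact (2 ≤ p)]

variable (p) in
/-- The operators `K, K⁻¹, h, e, f` act on the vectors `v n m` as in an irreducible module. -/
structure IsLayer (T : Gen → End ℂ V) (α : ℤˣ) (s r : ℤ) (v : ℤ → ℤ → V) : Prop where
  K : ∀ n m, T .K (v n m) = kVal p α s n • v n m
  Kinv : ∀ n m, T .Kinv (v n m) = (kVal p α s n)⁻¹ • v n m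
  h : ∀ n m, T .h (v n m) = (((r : ℂ) - 1) / 2 - m) • v n m
  e : ∀ n m, T .e (v n m) = ((m : ℂ) * (r - m)) • v n (m - 1)
  f : ∀ n m, 0 ≤ m → T .f (v n m) = v n (m + 1)

variable (p) in
/-- Moreover `E` and `F` act as in an irreducible module, except for `E` on the first vectors and
`F` on the last ones. -/
structure IsChain (T : Gen → End ℂ V) (α : ℤˣ) (s r : ℤ) (v : ℤ → ℤ → V) : Prop
    extends IsLayer p T α s r v where
  E_succ : ∀ n m, 0 < n → n < s →
    T .E (v n m) = (((α : ℤ) : ℂ) * qInt p n * qInt p (s - n)) • v (n - 1) m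
  F_succ : ∀ n m, 0 ≤ n → n < s - 1 → T .F (v n m) = v (n + 1) m

variable (p) in
/-- The shape of a projective module: the vectors `v` are glued on top of `X` and `Y`, and these on
top of `N`. -/
structure IsPack (T : Gen → End ℂ V) (α : ℤˣ) (s r : ℤ) (v X Y N : ℤ → ℤ → V) : Prop
    extends IsLayer p T α s r v where
  one_le : 1 ≤ s
  le : s ≤ p
  chX : IsChain p T (-α) (p - s) (r + 1) X
  chY : IsChain p T (-α) (p - s) (r - 1) Y
  chN : IsChain p T α s r N
  E_zero : ∀ m, T .E (v 0 m) = (((α : ℤ) : ℂ) * gz p s) •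
    (((r : ℂ) - m) • X (p - s - 1) m - (m : ℂ) • Y (p - s - 1) (m - 1))
  E_succ : ∀ n m, 0 < n → n < s →
    T .E (v n m) = (((α : ℤ) : ℂ) * qInt p n * qInt p (s - n)) • v (n - 1) m +
      (((α : ℤ) : ℂ) * gz p s * r) • N (n - 1) m
  F_succ : ∀ n m, 0 ≤ n → n < s - 1 → T .F (v n m) = v (n + 1) m
  F_last : ∀ m, 0 ≤ m → T .F (v (s - 1) m) = X 0 (m + 1) + Y 0 m
  X_E_zero : ∀ m, T .E (X 0 m) = (((α : ℤ) : ℂ) * gz p s * m) • N (s - 1) (m - 1)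
  X_F_last : s < p → ∀ m, 0 ≤ m → T .F (X (p - s - 1) m) = N 0 m
  Y_E_zero : ∀ m, T .E (Y 0 m) = (((α : ℤ) : ℂ) * gz p s * (r - 1 - m)) • N (s - 1) m
  Y_F_last : s < p → ∀ m, 0 ≤ m → T .F (Y (p - s - 1) m) = - N 0 (m + 1)
  N_E_zero : ∀ m, T .E (N 0 m) = 0
  N_F_last : ∀ m, 0 ≤ m → T .F (N (s - 1) m) = 0
  edge : s = p → X = 0 ∧ Y = 0 ∧ N = 0

variable {T : Gen → End ℂ V} {α : ℤˣ} {s r : ℤ} {v X Y N : ℤ → ℤ → V}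

omit hp in
theorem pow_apply_of_eigen {S : End ℂ V} {c : ℂ} {w : V} (h : S w = c • w) (k : ℕ) :
    (S ^ k) w = c ^ k • w := by
  induction k with
  | zero => simp
  | succ k ih => rw [pow_succ', End.mul_apply, ih, map_smul, h, smul_smul, pow_succ]

omit hp in
theorem pow_add_apply (S : End ℂ V) (i j : ℕ) (w : V) : (S ^ (i + j)) w = (S ^ i) ((S ^ j) w) := by
  rw [pow_add, End.mul_apply]

variable (p T) in
/-- The Casimir element as an operator. -/
def opCas : End ℂ V := dl ^ 2 • (T .E * T .F) + (q p)⁻¹ • T .K + q p • T .Kinv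

variable (p T) in
/-- The element `H` as an operator. -/
def opH : End ℂ V := dl⁻¹ • (q p • T .K - (q p)⁻¹ • T .Kinv)

theorem EF_sub_FE_scalar (α : ℤˣ) (s n : ℤ) :
    ((α : ℤ) : ℂ) * qInt p (n + 1) * qInt p (s - (n + 1)) - ((α : ℤ) : ℂ) * qInt p n * qInt p (s - n)
      = dl⁻¹ * (kVal p α s n - (kVal p α s n)⁻¹) := by
  have h1 := kVal_FE (p := p) α s n
  have h2 := kVal_FE (p := p) α s (n + 1)
  have hd := q_sub_inv_ne_zero p
  have hq := q_ne_zero p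
  have h3 : q p * kVal p α s (n + 1) = (q p)⁻¹ * kVal p α s n := by
    rw [kVal_succ α s n]; field_simp
  rw [h3] at h2
  rw [mul_inv] at h1 h2
  rw [inv_inv] at h2
  apply mul_left_cancel₀ (pow_ne_zero 2 hd)
  rw [pow_two, mul_assoc dl dl (dl⁻¹ * _), mul_inv_cancel_left₀ hd]
  linear_combination h2 - h1

theorem opCas_scalar (α : ℤˣ) (s n : ℤ) :
    dl ^ 2 * (((α : ℤ) : ℂ) * qInt p (n + 1) * qInt p (s - (n + 1))) + (q p)⁻¹ * kVal p α s n +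
      q p * (kVal p α s n)⁻¹ = casVal p α s := by
  have h2 := kVal_FE (p := p) α s (n + 1)
  have hq := q_ne_zero p
  have h3 : q p * kVal p α s (n + 1) = (q p)⁻¹ * kVal p α s n := by
    rw [kVal_succ α s n]; field_simp
  rw [h3, mul_inv, inv_inv] at h2
  linear_combination h2

theorem opCas_apply {n : ℤ} {w z : V} (hK : T .K w = kVal p α s n • w)
    (hKi : T .Kinv w = (kVal p α s n)⁻¹ • w)
    (h : T .E (T .F w) = (((α : ℤ) : ℂ) * qInt p (n + 1) * qInt p (s - (n + 1))) • w + z) :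
    opCas p T w = casVal p α s • w + dl ^ 2 • z := by
  simp only [opCas, LinearMap.add_apply, LinearMap.smul_apply, End.mul_apply]
  rw [h, hK, hKi, ← opCas_scalar α s n]
  module

theorem opH_apply {n : ℤ} {w : V} (hK : T .K w = kVal p α s n • w)
    (hKi : T .Kinv w = (kVal p α s n)⁻¹ • w) (hn : n = 0) :
    opH p T w = (((α : ℤ) : ℂ) * qInt p s) • w := by
  subst hn
  have hα : ((α : ℤ) : ℂ)⁻¹ = ((α : ℤ) : ℂ) := by
    rcases Int.units_eq_one_or α with rfl | rfl <;> norm_num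
  have hq := q_ne_zero p
  have e1 : q p * kVal p α s 0 = ((α : ℤ) : ℂ) * q p ^ s := by
    rw [kVal, mul_left_comm, ← zpow_one_add₀ hq]; congr 2; ring
  have e2 : (q p)⁻¹ * (kVal p α s 0)⁻¹ = ((α : ℤ) : ℂ) * q p ^ (-s) := by
    rw [← mul_inv, e1, mul_inv, hα, zpow_neg]
  simp only [opH, LinearMap.sub_apply, LinearMap.smul_apply]
  rw [hK, hKi, smul_smul, smul_smul, ← sub_smul, smul_smul, e1, e2, qInt]
  congr 1
  ring

namespace IsLayer

variable (L : IsLayer p T α s r v)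
include L

theorem f_pred (n : ℤ) {m : ℤ} (hm : 0 ≤ m) : (m : ℂ) • T .f (v n (m - 1)) = (m : ℂ) • v n m := by
  rcases hm.eq_or_lt with rfl | hm
  · simp
  · rw [L.f n (m - 1) (by omega), sub_add_cancel]

theorem h_e (n m : ℤ) : T .h (T .e (v n m)) - T .e (T .h (v n m)) = T .e (v n m) := by
  rw [L.h, map_smul, L.e, map_smul, L.h]
  push_cast
  module

theorem h_f (n : ℤ) {m : ℤ} (hm : 0 ≤ m) :
    T .h (T .f (v n m)) - T .f (T .h (v n m)) = - T .f (v n m) := by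
  rw [L.h, map_smul, L.f n m hm, L.h]
  push_cast
  module

theorem e_f (n : ℤ) {m : ℤ} (hm : 0 ≤ m) :
    T .e (T .f (v n m)) - T .f (T .e (v n m)) = (2 : ℂ) • T .h (v n m) := by
  have h1 := L.f_pred n hm
  rw [L.h, L.e, map_smul, L.f n m hm, L.e, mul_comm (m : ℂ), mul_smul ((r : ℂ) - m), h1,
    add_sub_cancel_right]
  push_cast
  module

theorem h_K (n m : ℤ) : T .h (T .K (v n m)) = T .K (T .h (v n m)) := by
  rw [L.h, L.K, map_smul, map_smul, L.h, L.K, smul_comm]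

theorem K_e (n m : ℤ) : T .K (T .e (v n m)) = T .e (T .K (v n m)) := by
  rw [L.K, L.e, map_smul, map_smul, L.e, L.K, smul_comm]

theorem K_f (n : ℤ) {m : ℤ} (hm : 0 ≤ m) : T .K (T .f (v n m)) = T .f (T .K (v n m)) := by
  rw [L.K, map_smul, L.f n m hm, L.K]

theorem K_pow (n m : ℤ) : (T .K ^ (2 * p)) (v n m) = v n m := by
  have h : (q p ^ (s - 1 - 2 * n)) ^ (2 * p) = 1 := by
    rw [← zpow_natCast, ← zpow_mul, q_zpow_eq_one_iff]
    exact dvd_mul_left _ _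
  rw [pow_apply_of_eigen (L.K n m), kVal, mul_pow, h]
  rcases Int.units_eq_one_or α with rfl | rfl <;> simp

theorem kVal_ne_zero (n : ℤ) : kVal p α s n ≠ 0 :=
  mul_ne_zero (by exact_mod_cast α.ne_zero) (zpow_ne_zero _ (q_ne_zero p))

end IsLayer

namespace IsChain

variable (L : IsChain p T α s r v)
include L

theorem F_pow {n : ℤ} {k : ℕ} (m : ℤ) (hn : 0 ≤ n) (hk : n + k < s) :
    (T .F ^ k) (v n m) = v (n + k) m := by
  induction k with
  | zero => simp
  | succ k ih =>
    push_cast at hk ⊢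
    rw [pow_succ', End.mul_apply, ih (by omega), L.F_succ _ _ (by omega) (by omega), add_assoc]

theorem E_pow {k : ℕ} (m : ℤ) (hk : k < s) : (T .E ^ k) (v k m) = cProd p α s k • v 0 m := by
  induction k with
  | zero => simp [cProd]
  | succ k ih =>
    push_cast at hk ⊢
    rw [pow_succ, End.mul_apply, L.E_succ _ _ (by omega) (by omega), map_smul, add_sub_cancel_right,
      ih (by omega), smul_smul, cProd, cProd, Finset.prod_range_succ, mul_comm]

end IsChain

namespace IsPack

variable (P : IsPack p T α s r v X Y N)
include P

theorem F_E {n m : ℤ} (hn : 0 ≤ n) (hns : n < s) (hm : 0 ≤ m) :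
    T .F (T .E (v n m)) = (((α : ℤ) : ℂ) * qInt p n * qInt p (s - n)) • v n m +
      (((α : ℤ) : ℂ) * gz p s * r) • N n m := by
  rcases hn.eq_or_lt with rfl | hn
  · rw [P.E_zero, qInt_zero, mul_zero, zero_mul, zero_smul, zero_add, map_smul, map_sub, map_smul,
      map_smul]
    rcases P.le.lt_or_eq with h | h
    · rw [P.X_F_last h m hm]
      have h1 : (m : ℂ) • T .F (Y (p - s - 1) (m - 1)) = -((m : ℂ) • N 0 m) := by
        rcases hm.eq_or_lt with rfl | hm
        · simp
        · rw [P.Y_F_last h _ (by omega), sub_add_cancel, smul_neg]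
      rw [h1]
      module
    · obtain ⟨rfl, rfl, rfl⟩ := P.edge h
      simp
  · rw [P.E_succ n m hn hns, map_add, map_smul, map_smul, P.F_succ _ _ (by omega) (by omega),
      P.chN.F_succ _ _ (by omega) (by omega), sub_add_cancel]

theorem E_F {n m : ℤ} (hn : 0 ≤ n) (hns : n < s) (hm : 0 ≤ m) :
    T .E (T .F (v n m)) = (((α : ℤ) : ℂ) * qInt p (n + 1) * qInt p (s - (n + 1))) • v n m +
      (((α : ℤ) : ℂ) * gz p s * r) • N n m := by
  by_cases h : n < s - 1
  · rw [P.F_succ n m hn h, P.E_succ _ _ (by omega) (by omega), add_sub_cancel_right]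
  · obtain rfl : n = s - 1 := by omega
    rw [P.F_last m hm, map_add, P.X_E_zero, P.Y_E_zero, sub_add_cancel, sub_self, qInt_zero,
      mul_zero, zero_smul, zero_add, add_sub_cancel_right, ← add_smul]
    push_cast
    congr 1
    ring

theorem N_E_F {n m : ℤ} (hn : 0 ≤ n) (hns : n < s) (hm : 0 ≤ m) :
    T .E (T .F (N n m)) = (((α : ℤ) : ℂ) * qInt p (n + 1) * qInt p (s - (n + 1))) • N n m := by
  by_cases h : n < s - 1
  · rw [P.chN.F_succ n m hn h, P.chN.E_succ _ _ (by omega) (by omega), add_sub_cancel_right]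
  · obtain rfl : n = s - 1 := by omega
    rw [P.N_F_last m hm, sub_add_cancel, sub_self, qInt_zero]
    simp

theorem X_E_F (h : s < p) {m : ℤ} (hm : 0 ≤ m) : T .E (T .F (X 0 m)) =
    ((((-α : ℤˣ) : ℤ) : ℂ) * qInt p (0 + 1) * qInt p (p - s - (0 + 1))) • X 0 m := by
  by_cases h1 : (0 : ℤ) < p - s - 1
  · rw [P.chX.F_succ _ _ le_rfl h1, P.chX.E_succ _ _ (by omega) (by omega)]
    simp
  · have h2 : (p : ℤ) - s - 1 = 0 := by omega
    have h3 := P.X_F_last h m hm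
    rw [h2] at h3
    rw [h3, P.N_E_zero, zero_add, h2, qInt_zero, mul_zero, zero_smul]

theorem Y_E_F (h : s < p) {m : ℤ} (hm : 0 ≤ m) : T .E (T .F (Y 0 m)) =
    ((((-α : ℤˣ) : ℤ) : ℂ) * qInt p (0 + 1) * qInt p (p - s - (0 + 1))) • Y 0 m := by
  by_cases h1 : (0 : ℤ) < p - s - 1
  · rw [P.chY.F_succ _ _ le_rfl h1, P.chY.E_succ _ _ (by omega) (by omega)]
    simp
  · have h2 : (p : ℤ) - s - 1 = 0 := by omega
    have h3 := P.Y_F_last h m hm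
    rw [h2] at h3
    rw [h3, map_neg, P.N_E_zero, zero_add, h2, qInt_zero, mul_zero, zero_smul, neg_zero]

theorem opA_apply {n m : ℤ} (hn : 0 ≤ n) (hns : n < s) (hm : 0 ≤ m) (h : s < p) :
    opA p (T .K) (opCas p T) (v n m) = if n = 0 then v n m else 0 := by
  refine LUq.opA_apply (α := α) P.one_le h hn hns (P.K n m) ?_
  have h1 := opCas_apply (P.K n m) (P.Kinv n m) (P.E_F hn hns hm)
  have h2 := opCas_apply (z := 0) (P.chN.K n m) (P.chN.Kinv n m)
    ((P.N_E_F hn hns hm).trans (add_zero _).symm)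
  rw [h1, add_sub_cancel_left, map_smul, map_smul, h2, smul_zero, add_zero]
  module

theorem opA_apply_X {m : ℤ} (hm : 0 ≤ m) (h : s < p) : opA p (T .K) (opCas p T) (X 0 m) = X 0 m := by
  have := P.one_le
  have h1 := opCas_apply (z := 0) (P.chX.K 0 m) (P.chX.Kinv 0 m) ((P.X_E_F h hm).trans (add_zero _).symm)
  rw [LUq.opA_apply (α := -α) (s := p - s) (n := 0) (by omega) (by omega) le_rfl (by omega)
    (P.chX.K 0 m) (by rw [h1]; simp), if_pos rfl]

theorem opA_apply_Y {m : ℤ} (hm : 0 ≤ m) (h : s < p) : opA p (T .K) (opCas p T) (Y 0 m) = Y 0 m := by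
  have := P.one_le
  have h1 := opCas_apply (z := 0) (P.chY.K 0 m) (P.chY.Kinv 0 m) ((P.Y_E_F h hm).trans (add_zero _).symm)
  rw [LUq.opA_apply (α := -α) (s := p - s) (n := 0) (by omega) (by omega) le_rfl (by omega)
    (P.chY.K 0 m) (by rw [h1]; simp), if_pos rfl]

theorem opA_apply_edge {n m : ℤ} (hn : 0 ≤ n) (hns : n < s) (hm : 0 ≤ m) (h : s = p) :
    opA p (T .K) (opCas p T) (v n m) = 0 := by
  obtain ⟨rfl, rfl, rfl⟩ := P.edge h
  have h1 := opCas_apply (P.K n m) (P.Kinv n m) (P.E_F hn hns hm)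
  refine LUq.opA_apply_edge (α := α) ?_
  rw [h1, h]
  simp

/-! Powers of `E` and `F` -/

theorem F_pow {n : ℤ} {k : ℕ} (m : ℤ) (hn : 0 ≤ n) (hk : n + k < s) :
    (T .F ^ k) (v n m) = v (n + k) m := by
  induction k with
  | zero => simp
  | succ k ih =>
    push_cast at hk ⊢
    rw [pow_succ', End.mul_apply, ih (by omega), P.F_succ _ _ (by omega) (by omega), add_assoc]

theorem E_pow_self {k : ℕ} (m : ℤ) (hk : k < s) :
    ∃ c : ℂ, (T .E ^ k) (v k m) = cProd p α s k • v 0 m + c • N 0 m := by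
  induction k with
  | zero => exact ⟨0, by simp [cProd]⟩
  | succ k ih =>
    obtain ⟨c, h⟩ := ih (by push_cast at hk; omega)
    push_cast at hk ⊢
    refine ⟨((α : ℤ) : ℂ) * qInt p (k + 1) * qInt p (s - (k + 1)) * c +
      ((α : ℤ) : ℂ) * gz p s * r * cProd p α s k, ?_⟩
    rw [pow_succ, End.mul_apply, P.E_succ _ _ (by omega) (by omega), map_add, map_smul, map_smul,
      add_sub_cancel_right, h, P.chN.E_pow m (by omega), cProd, cProd, Finset.prod_range_succ, ← cProd]
    module

theorem E_pow_zero (h : s < p) (m : ℤ) : (T .E ^ (p - s).toNat) (v 0 m) =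
    (((α : ℤ) : ℂ) * gz p s * cProd p (-α) (p - s) (p - s - 1).toNat) •
      (((r : ℂ) - m) • X 0 m - (m : ℂ) • Y 0 (m - 1)) := by
  obtain ⟨l, hl⟩ : ∃ l : ℕ, (p : ℤ) - s - 1 = l := ⟨(p - s - 1).toNat, by omega⟩
  rw [show (p - s).toNat = (p - s - 1).toNat + 1 by omega, pow_succ, End.mul_apply, P.E_zero, hl,
    Int.toNat_natCast, map_smul, map_sub, map_smul, map_smul, P.chX.E_pow m (by omega),
    P.chY.E_pow (m - 1) (by omega)]
  module

theorem E_pow_eq_zero (m : ℤ) {k : ℕ} (hk : p - s < k) : (T .E ^ k) (v 0 m) = 0 := by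
  rcases P.le.lt_or_eq with h | h
  · obtain ⟨j, rfl⟩ : ∃ j, k = j + (1 + (p - s).toNat) := ⟨k - (1 + (p - s).toNat), by omega⟩
    rw [pow_add_apply, pow_add_apply, P.E_pow_zero h, pow_one]
    simp only [map_smul, map_sub]
    rw [P.X_E_zero, P.Y_E_zero]
    simp only [map_smul]
    rw [smul_smul, smul_smul ((m : ℂ)), ← sub_smul]
    push_cast
    rw [show ((r : ℂ) - m) * (((α : ℤ) : ℂ) * gz p s * m) -
      m * (((α : ℤ) : ℂ) * gz p s * (r - 1 - (m - 1))) = 0 by ring]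
    simp
  · obtain ⟨rfl, rfl, rfl⟩ := P.edge h
    obtain ⟨j, rfl⟩ : ∃ j, k = j + 1 := ⟨k - 1, by omega⟩
    rw [pow_succ, End.mul_apply, P.E_zero]
    simp

theorem E_pow_apply_eq_zero {n : ℤ} (m : ℤ) (hn : 0 ≤ n) (hns : n < s) {k : ℕ}
    (hk : p - s + n < k) : (T .E ^ k) (v n m) = 0 := by
  obtain ⟨n, rfl⟩ := Int.eq_ofNat_of_zero_le hn
  have := P.le
  obtain ⟨j, rfl⟩ : ∃ j, k = (j + 1) + n := ⟨k - n - 1, by omega⟩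
  obtain ⟨c, h⟩ := P.E_pow_self m hns
  rw [pow_add_apply, h, map_add, map_smul, map_smul, P.E_pow_eq_zero m (by push_cast at hk ⊢; omega),
    pow_succ, End.mul_apply, P.N_E_zero]
  simp

theorem F_pow_last {n m : ℤ} (hn : 0 ≤ n) (hns : n < s) (hm : 0 ≤ m) :
    (T .F ^ (s - n).toNat) (v n m) = X 0 (m + 1) + Y 0 m := by
  rw [show (s - n).toNat = 1 + (s - 1 - n).toNat by omega, pow_add_apply,
    P.F_pow m hn (by omega), pow_one, show n + ((s - 1 - n).toNat : ℤ) = s - 1 by omega, P.F_last m hm]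

theorem F_pow_apply_eq_zero {n m : ℤ} (hn : 0 ≤ n) (hns : n < s) (hm : 0 ≤ m) {k : ℕ}
    (hk : p - n ≤ k) : (T .F ^ k) (v n m) = 0 := by
  have := P.le
  obtain ⟨j, rfl⟩ : ∃ j, k = j + (s - n).toNat := ⟨k - (s - n).toNat, by omega⟩
  rw [pow_add_apply, P.F_pow_last hn hns hm]
  rcases P.le.lt_or_eq with h | h
  · obtain ⟨i, rfl⟩ : ∃ i, j = i + (1 + (p - s - 1).toNat) :=
      ⟨j - (1 + (p - s - 1).toNat), by omega⟩
    have h1 : (0 : ℤ) + ((p - s - 1).toNat : ℤ) = p - s - 1 := by omega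
    rw [pow_add_apply, pow_add_apply, map_add, P.chX.F_pow _ le_rfl (by omega),
      P.chY.F_pow _ le_rfl (by omega), h1, pow_one, map_add, P.X_F_last h _ (by omega),
      P.Y_F_last h _ hm, add_neg_cancel, map_zero]
  · obtain ⟨rfl, rfl, rfl⟩ := P.edge h
    simp

/-! The defining relations -/

theorem rel_E_F {n m : ℤ} (hn : 0 ≤ n) (hns : n < s) (hm : 0 ≤ m) :
    T .E (T .F (v n m)) - T .F (T .E (v n m)) = dl⁻¹ • (T .K (v n m) - T .Kinv (v n m)) := by
  have h := EF_sub_FE_scalar (p := p) α s n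
  rw [P.E_F hn hns hm, P.F_E hn hns hm, P.K, P.Kinv, ← sub_smul, smul_smul, ← h]
  module

theorem rel_K_E {n m : ℤ} (hn : 0 ≤ n) (hns : n < s) :
    T .K (T .E (T .Kinv (v n m))) = q p ^ 2 • T .E (v n m) := by
  have h0 := P.kVal_ne_zero n
  have h1 : T .K (T .E (v n m)) = kVal p α s (n - 1) • T .E (v n m) := by
    rcases hn.eq_or_lt with rfl | hn
    · have h2 : kVal p (-α) (p - s) (p - s - 1) = kVal p α s (0 - 1) := by
        rw [kVal_neg, ← kVal_add_p α s (0 - 1)]; congr 1; ring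
      rw [P.E_zero, map_smul, map_sub, map_smul, map_smul, P.chX.K, P.chY.K, h2]
      module
    · rw [P.E_succ n m hn hns, map_add, map_smul, map_smul, P.K, P.chN.K]
      module
  have h3 := kVal_succ (p := p) α s (n - 1)
  rw [sub_add_cancel] at h3
  rw [P.Kinv, map_smul, map_smul, h1, smul_smul, h3, mul_comm (q p ^ 2), inv_mul_cancel_left₀ h0]

theorem rel_K_F {n m : ℤ} (hn : 0 ≤ n) (hns : n < s) (hm : 0 ≤ m) :
    T .K (T .F (T .Kinv (v n m))) = ((q p) ^ 2)⁻¹ • T .F (v n m) := by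
  have h0 := P.kVal_ne_zero (n + 1)
  have hq := q_ne_zero p
  have h1 : T .K (T .F (v n m)) = kVal p α s (n + 1) • T .F (v n m) := by
    by_cases h : n < s - 1
    · rw [P.F_succ n m hn h, P.K]
    · obtain rfl : n = s - 1 := by omega
      rw [P.F_last m hm, map_add, P.chX.K, P.chY.K, kVal_neg, ← smul_add, zero_add, sub_add_cancel]
  rw [P.Kinv, map_smul, map_smul, h1, smul_smul, kVal_succ α s n]
  congr 1
  field_simp

theorem rel_E_e {n m : ℤ} (hn : 0 ≤ n) (hns : n < s) :
    T .E (T .e (v n m)) = T .e (T .E (v n m)) := by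
  rcases hn.eq_or_lt with rfl | hn
  · rw [P.E_zero, P.e, map_smul, P.E_zero, map_smul, map_sub, map_smul, map_smul, P.chX.e, P.chY.e]
    push_cast
    module
  · rw [P.E_succ n m hn hns, P.e, map_smul, P.E_succ _ _ hn hns, map_add, map_smul, map_smul,
      P.e, P.chN.e]
    module

theorem rel_F_f {n m : ℤ} (hn : 0 ≤ n) (hns : n < s) (hm : 0 ≤ m) :
    T .F (T .f (v n m)) = T .f (T .F (v n m)) := by
  rw [P.f n m hm]
  by_cases h : n < s - 1
  · rw [P.F_succ n m hn h, P.F_succ _ _ hn h, P.f _ _ hm]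
  · obtain rfl : n = s - 1 := by omega
    rw [P.F_last m hm, P.F_last _ (by omega), map_add, P.chX.f _ _ (by omega), P.chY.f _ _ hm]

theorem rel_h_E {n m : ℤ} (hn : 0 ≤ n) (hns : n < s) (hm : 0 ≤ m) :
    T .h (T .E (v n m)) - T .E (T .h (v n m)) =
      (2 : ℂ)⁻¹ • T .E (opA p (T .K) (opCas p T) (v n m)) := by
  rw [P.h, map_smul]
  rcases hn.eq_or_lt with rfl | hn
  · rcases P.le.lt_or_eq with h | h
    · rw [P.opA_apply le_rfl hns hm h, if_pos rfl, P.E_zero, map_smul, map_sub, map_smul, map_smul,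
        P.chX.h, P.chY.h]
      push_cast
      module
    · rw [P.opA_apply_edge le_rfl hns hm h]
      obtain ⟨rfl, rfl, rfl⟩ := P.edge h
      rw [P.E_zero]
      simp
  · have h0 : opA p (T .K) (opCas p T) (v n m) = 0 := by
      rcases P.le.lt_or_eq with h | h
      · rw [P.opA_apply hn.le hns hm h, if_neg hn.ne']
      · rw [P.opA_apply_edge hn.le hns hm h]
    rw [h0, P.E_succ n m hn hns, map_add, map_smul, map_smul, P.h, P.chN.h]
    simp only [map_zero, smul_zero]
    module

theorem rel_h_F {n m : ℤ} (hn : 0 ≤ n) (hns : n < s) (hm : 0 ≤ m) :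
    T .h (T .F (v n m)) - T .F (T .h (v n m)) =
      -((2 : ℂ)⁻¹ • opA p (T .K) (opCas p T) (T .F (v n m))) := by
  rw [P.h, map_smul]
  by_cases h1 : n < s - 1
  · have h0 : opA p (T .K) (opCas p T) (v (n + 1) m) = 0 := by
      rcases P.le.lt_or_eq with h | h
      · rw [P.opA_apply (by omega) (by omega) hm h, if_neg (by omega)]
      · rw [P.opA_apply_edge (by omega) (by omega) hm h]
    rw [P.F_succ n m hn h1, P.h, h0]
    simp
  · obtain rfl : n = s - 1 := by omega
    rw [P.F_last m hm]
    rcases P.le.lt_or_eq with h | h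
    · rw [map_add, map_add, P.opA_apply_X (by omega) h, P.opA_apply_Y hm h, P.chX.h, P.chY.h]
      push_cast
      module
    · obtain ⟨rfl, rfl, rfl⟩ := P.edge h
      simp

theorem rel_F_e {n m : ℤ} (hn : 0 ≤ n) (hns : n < s) (hm : 0 ≤ m) :
    T .F (T .e (v n m)) - T .e (T .F (v n m)) =
      (qFactorial p (p - 1))⁻¹ • (T .K ^ p) (opH p T ((T .E ^ (p - 1)) (v n m))) := by
  have hp' := hp.out
  have hle := P.le
  rw [P.e, map_smul]
  by_cases h1 : n < s - 1
  · rw [P.F_succ n _ hn h1, P.F_succ n _ hn h1, P.e, P.E_pow_apply_eq_zero m hn hns (by omega)]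
    simp
  · obtain rfl : n = s - 1 := by omega
    rw [P.F_last m hm]
    obtain ⟨k, hk⟩ : ∃ k : ℕ, s - 1 = k := ⟨(s - 1).toNat, by omega⟩
    obtain ⟨c, h3⟩ := P.E_pow_self (k := k) m (by omega)
    rcases P.le.lt_or_eq with h | h
    · have h4 : (m : ℂ) • T .F (v (s - 1) (m - 1)) = (m : ℂ) • (X 0 m + Y 0 (m - 1)) := by
        rcases hm.eq_or_lt with rfl | hm
        · simp
        · rw [P.F_last _ (by omega), sub_add_cancel]
      obtain ⟨l, hl⟩ : ∃ l : ℕ, p = k + l + 2 := ⟨p - (k + 2), by omega⟩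
      have h5 : (T .E ^ (p - 1)) (v (s - 1) m) = (cProd p α (k + 1) k * (((α : ℤ) : ℂ) * gz p (k + 1)
          * cProd p (-α) (l + 1) l)) • (((r : ℂ) - m) • X 0 m - (m : ℂ) • Y 0 (m - 1)) := by
        have h6 := P.E_pow_zero h m
        have h7 : s = k + 1 := by omega
        have h8 : (p : ℤ) - (k + 1) = l + 1 := by omega
        have h9 : (p - s).toNat = l + 1 := by omega
        rw [show p - 1 = (p - s).toNat + k by omega, pow_add_apply, hk, h3, map_add, map_smul,
          map_smul, h6, h9, pow_succ, End.mul_apply, P.N_E_zero, h7, h8, add_sub_cancel_right]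
        simp only [map_zero, smul_zero, add_zero, Int.toNat_natCast, smul_smul]
      have h10 : (p : ℤ) - s = l + 1 := by omega
      have hX := opH_apply (P.chX.K 0 m) (P.chX.Kinv 0 m) rfl
      have hY := opH_apply (P.chY.K 0 (m - 1)) (P.chY.Kinv 0 (m - 1)) rfl
      have hX' := pow_apply_of_eigen (P.chX.K 0 m) p
      have hY' := pow_apply_of_eigen (P.chY.K 0 (m - 1)) p
      rw [h10] at hX hY hX' hY'
      have h11 := E_scalar (α := α) hl
      rw [h5]
      simp only [map_smul, map_sub]
      rw [hX, hY]
      simp only [map_smul]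
      rw [hX', hY', map_add, P.chX.e, P.chY.e, mul_comm (m : ℂ), mul_smul, h4,
        add_sub_cancel_right]
      have h12 : ∀ x y : V, (qFactorial p (p - 1))⁻¹ • (cProd p α (k + 1) k * (((α : ℤ) : ℂ) *
          gz p (k + 1) * cProd p (-α) (l + 1) l)) • (((r : ℂ) - m) •
            ((((-α : ℤˣ) : ℤ) : ℂ) * qInt p (l + 1)) • kVal p (-α) (l + 1) 0 ^ p • x -
          (m : ℂ) • ((((-α : ℤˣ) : ℤ) : ℂ) * qInt p (l + 1)) • kVal p (-α) (l + 1) 0 ^ p • y) =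
          -(((r : ℂ) - m) • x - (m : ℂ) • y) := by
        intro x y
        conv_rhs => rw [← one_smul ℂ (((r : ℂ) - m) • x - (m : ℂ) • y), ← h11]
        module
      rw [h12]
      push_cast
      module
    · obtain ⟨rfl, rfl, rfl⟩ := P.edge h
      have h4 : (m : ℂ) • T .F (v (s - 1) (m - 1)) = 0 := by
        rcases hm.eq_or_lt with rfl | hm
        · simp
        · rw [P.F_last _ (by omega)]; simp
      rw [mul_comm, mul_smul, h4, show p - 1 = k by omega, hk, h3]
      simp only [map_add, map_smul]
      rw [opH_apply (P.K 0 m) (P.Kinv 0 m) rfl, h, (qInt_eq_zero_iff p p).2 dvd_rfl]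
      simp

theorem rel_E_f {n m : ℤ} (hn : 0 ≤ n) (hns : n < s) (hm : 0 ≤ m) :
    T .E (T .f (v n m)) - T .f (T .E (v n m)) = ((-1 : ℂ) ^ (p + 1) * (qFactorial p (p - 1))⁻¹) •
      (T .F ^ (p - 1)) (opH p T (v n m)) := by
  have hle := P.le
  have h1 := P.one_le
  rw [P.f n m hm]
  have hH : ∃ c : ℂ, opH p T (v n m) = c • v n m := by
    refine ⟨dl⁻¹ * (q p * kVal p α s n - (q p)⁻¹ * (kVal p α s n)⁻¹), ?_⟩
    simp only [opH, LinearMap.sub_apply, LinearMap.smul_apply]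
    rw [P.K, P.Kinv]
    module
  rcases hn.eq_or_lt with rfl | hn
  · rw [opH_apply (P.K 0 m) (P.Kinv 0 m) rfl, P.E_zero, P.E_zero, map_smul, map_sub, map_smul,
      map_smul]
    rcases P.le.lt_or_eq with h | h
    · have h3 : (T .F ^ (p - 1)) (v 0 m) = X (p - s - 1) (m + 1) + Y (p - s - 1) m := by
        have h4 := P.F_pow_last le_rfl hns hm
        rw [sub_zero] at h4
        have h5 : (0 : ℤ) + ((p - s - 1).toNat : ℤ) = p - s - 1 := by omega
        rw [show p - 1 = (p - s - 1).toNat + s.toNat by omega, pow_add_apply, h4, map_add,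
          P.chX.F_pow _ le_rfl (by omega), P.chY.F_pow _ le_rfl (by omega), h5]
      have h6 : ((-1 : ℂ) ^ (p + 1) * (qFactorial p (p - 1))⁻¹) * (((α : ℤ) : ℂ) * qInt p s) =
          -(((α : ℤ) : ℂ) * gz p s) := by
        rw [gz, gConst, Int.toNat_of_nonneg (by omega), pow_succ]; ring
      have h7 : (m : ℂ) • T .f (Y (p - s - 1) (m - 1)) = (m : ℂ) • Y (p - s - 1) m := P.chY.f_pred _ hm
      rw [map_smul, h3, smul_smul, h6, P.chX.f _ _ hm, h7, add_sub_cancel_right]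
      push_cast
      module
    · obtain ⟨rfl, rfl, rfl⟩ := P.edge h
      rw [h, (qInt_eq_zero_iff p p).2 dvd_rfl]
      simp
  · obtain ⟨c, hc⟩ := hH
    rw [hc, map_smul, P.F_pow_apply_eq_zero hn.le hns hm (by omega), P.E_succ _ _ hn hns,
      P.E_succ _ _ hn hns, map_add, map_smul, map_smul, P.f _ _ hm, P.chN.f _ _ hm]
    simp

end IsPack

end Pack

/-! ### Gluing data -/

/-- Data for gluing irreducible modules with labels `α i, s i, r i`: the highest weight vector `u i`
is mapped to `a i • u (σ i)` and `b i • u (τ i)` by the operators `xop` and `yop`. -/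
structure Glue (p : ℕ) (ι : Type) where
  α : ι → ℤˣ
  s : ι → ℤ
  r : ι → ℤ
  σ : ι → ι
  τ : ι → ι
  a : ι → ℂ
  b : ι → ℂ
  one_le : ∀ i, 1 ≤ s i
  le : ∀ i, s i ≤ p
  label_σ : ∀ i, a i ≠ 0 → s i < p ∧ α (σ i) = -α i ∧ s (σ i) = p - s i ∧ r (σ i) = r i + 1
  label_τ : ∀ i, b i ≠ 0 → s i < p ∧ α (τ i) = -α i ∧ s (τ i) = p - s i ∧ r (τ i) = r i - 1
  aa : ∀ i, a i * a (σ i) = 0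
  bb : ∀ i, b i * b (τ i) = 0
  ab : ∀ i, r i ≠ 1 → (a i * b (σ i) = 0 ∧ b i * a (τ i) = 0) ∨
    (τ (σ i) = σ (τ i) ∧ a i * b (σ i) = -(b i * a (τ i)))

namespace Glue

variable {ι : Type} (D : Glue p ι)

/-- The vectors with these indices form a basis. -/
def InRange (i : ι) (n m : ℤ) : Prop := 0 ≤ n ∧ n < D.s i ∧ 0 ≤ m ∧ m < D.r i

instance (i : ι) (n m : ℤ) : Decidable (D.InRange i n m) := by unfold InRange; infer_instance

/-- The indices of the basis vectors. -/
abbrev Idx : Type := {x : ι × ℤ × ℤ // D.InRange x.1 x.2.1 x.2.2}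

/-- The space with a basis indexed by `D.Idx`. -/
abbrev Space : Type := D.Idx →₀ ℂ

/-- The basis vectors; they vanish if an index is out of range. -/
def bv (i : ι) (n m : ℤ) : D.Space :=
  if h : D.InRange i n m then Finsupp.single ⟨(i, n, m), h⟩ 1 else 0

theorem bv_eq_zero {i : ι} {n m : ℤ} (h : ¬ D.InRange i n m) : D.bv i n m = 0 := dif_neg h

/-- `E v` for a basis vector `v`, in terms of the basis vectors. -/
def formE {V : Type*} [AddCommGroup V] [Module ℂ V] (v : ι → ℤ → ℤ → V) (i : ι) (n m : ℤ) : V :=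
  if n = 0 then
    (((D.α i : ℤ) : ℂ) * gz p (D.s i)) • ((((D.r i : ℂ) - m) * D.a i) • v (D.σ i) (p - D.s i - 1) m -
      ((m : ℂ) * D.b i) • v (D.τ i) (p - D.s i - 1) (m - 1))
  else
    (((D.α i : ℤ) : ℂ) * qInt p n * qInt p (D.s i - n)) • v i (n - 1) m +
      (((D.α i : ℤ) : ℂ) * gz p (D.s i) * D.r i * (D.a i * D.b (D.σ i))) •
        v (D.τ (D.σ i)) (n - 1) m

/-- `F v` for a basis vector `v`, in terms of the basis vectors. -/
def formF {V : Type*} [AddCommGroup V] [Module ℂ V] (v : ι → ℤ → ℤ → V) (i : ι) (n m : ℤ) : V :=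
  if n = D.s i - 1 then D.a i • v (D.σ i) 0 (m + 1) + D.b i • v (D.τ i) 0 m else v i (n + 1) m

/-- The action of the generators on the basis vectors. -/
def form {V : Type*} [AddCommGroup V] [Module ℂ V] (v : ι → ℤ → ℤ → V) (g : Gen) (i : ι)
    (n m : ℤ) : V :=
  match g with
  | .E => D.formE v i n m
  | .F => D.formF v i n m
  | .K => kVal p (D.α i) (D.s i) n • v i n m
  | .Kinv => (kVal p (D.α i) (D.s i) n)⁻¹ • v i n m
  | .e => ((m : ℂ) * (D.r i - m)) • v i n (m - 1)
  | .f => v i n (m + 1)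
  | .h => (((D.r i : ℂ) - 1) / 2 - m) • v i n m

/-- The generators as operators on the space with basis `D.bv`. -/
def op (g : Gen) : End ℂ D.Space :=
  Finsupp.linearCombination ℂ fun x : D.Idx => D.form D.bv g x.1.1 x.1.2.1 x.1.2.2

theorem op_bv (g : Gen) {i : ι} {n m : ℤ} (h : D.InRange i n m) :
    D.op g (D.bv i n m) = D.form D.bv g i n m := by
  rw [bv, dif_pos h, op, Finsupp.linearCombination_single, one_smul]

theorem op_eq_zero (g : Gen) {i : ι} {n m : ℤ} (h : ¬ D.InRange i n m) :
    D.op g (D.bv i n m) = 0 := by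
  rw [D.bv_eq_zero h, map_zero]

theorem label_τσ {i : ι} (h : D.a i * D.b (D.σ i) ≠ 0) : D.α (D.τ (D.σ i)) = D.α i ∧
    D.s (D.τ (D.σ i)) = D.s i ∧ D.r (D.τ (D.σ i)) = D.r i := by
  obtain ⟨-, h1, h2, h3⟩ := D.label_σ i (left_ne_zero_of_mul h)
  obtain ⟨-, h4, h5, h6⟩ := D.label_τ (D.σ i) (right_ne_zero_of_mul h)
  refine ⟨by rw [h4, h1, neg_neg], by omega, by omega⟩

theorem isLayer (i : ι) : IsLayer p D.op (D.α i) (D.s i) (D.r i) (D.bv i) where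
  K n m := by
    by_cases h : D.InRange i n m
    · exact D.op_bv .K h
    · rw [D.op_eq_zero _ h, D.bv_eq_zero h, smul_zero]
  Kinv n m := by
    by_cases h : D.InRange i n m
    · exact D.op_bv .Kinv h
    · rw [D.op_eq_zero _ h, D.bv_eq_zero h, smul_zero]
  h n m := by
    by_cases h : D.InRange i n m
    · exact D.op_bv .h h
    · rw [D.op_eq_zero _ h, D.bv_eq_zero h, smul_zero]
  e n m := by
    by_cases h : D.InRange i n m
    · exact D.op_bv .e h
    · rw [D.op_eq_zero _ h]
      by_cases h' : m = D.r i
      · rw [h', sub_self, mul_zero, zero_smul]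
      · by_cases h0 : m = 0
        · rw [h0, Int.cast_zero, zero_mul, zero_smul]
        · rw [D.bv_eq_zero (by simp only [InRange] at h ⊢; omega), smul_zero]
  f n m hm := by
    by_cases h : D.InRange i n m
    · exact D.op_bv .f h
    · rw [D.op_eq_zero _ h, D.bv_eq_zero (by simp only [InRange] at h ⊢; omega)]

theorem E_zero (i : ι) (m : ℤ) : D.op .E (D.bv i 0 m) =
    (((D.α i : ℤ) : ℂ) * gz p (D.s i)) • ((((D.r i : ℂ) - m) * D.a i) • D.bv (D.σ i) (p - D.s i - 1) m -
      ((m : ℂ) * D.b i) • D.bv (D.τ i) (p - D.s i - 1) (m - 1)) := by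
  have h1 := D.one_le i
  by_cases h : D.InRange i 0 m
  · rw [D.op_bv _ h]; simp [form, formE]
  · rw [D.op_eq_zero _ h]
    have e1 : (((D.r i : ℂ) - m) * D.a i) • D.bv (D.σ i) (p - D.s i - 1) m = 0 := by
      by_cases ha : D.a i = 0
      · rw [ha, mul_zero, zero_smul]
      obtain ⟨-, -, h3, h4⟩ := D.label_σ i ha
      by_cases hm : m = D.r i
      · rw [hm, sub_self, zero_mul, zero_smul]
      · rw [D.bv_eq_zero (by simp only [InRange] at h ⊢; omega), smul_zero]
    have e2 : ((m : ℂ) * D.b i) • D.bv (D.τ i) (p - D.s i - 1) (m - 1) = 0 := by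
      by_cases hb : D.b i = 0
      · rw [hb, mul_zero, zero_smul]
      obtain ⟨-, -, h3, h4⟩ := D.label_τ i hb
      rw [D.bv_eq_zero (by simp only [InRange] at h ⊢; omega), smul_zero]
    rw [e1, e2, sub_zero, smul_zero]

theorem E_succ (i : ι) {n : ℤ} (m : ℤ) (hn : 0 < n) (hns : n < D.s i) : D.op .E (D.bv i n m) =
    (((D.α i : ℤ) : ℂ) * qInt p n * qInt p (D.s i - n)) • D.bv i (n - 1) m +
      (((D.α i : ℤ) : ℂ) * gz p (D.s i) * D.r i) •
        (D.a i * D.b (D.σ i)) • D.bv (D.τ (D.σ i)) (n - 1) m := by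
  by_cases h : D.InRange i n m
  · rw [D.op_bv _ h, smul_smul]; simp [form, formE, hn.ne']
  · rw [D.op_eq_zero _ h, D.bv_eq_zero (by simp only [InRange] at h ⊢; omega)]
    have e1 : (D.a i * D.b (D.σ i)) • D.bv (D.τ (D.σ i)) (n - 1) m = 0 := by
      by_cases hab : D.a i * D.b (D.σ i) = 0
      · rw [hab, zero_smul]
      obtain ⟨-, h3, h4⟩ := D.label_τσ hab
      rw [D.bv_eq_zero (by simp only [InRange] at h ⊢; omega), smul_zero]
    rw [e1, smul_zero, smul_zero, add_zero]

theorem F_succ (i : ι) {n : ℤ} (m : ℤ) (hn : 0 ≤ n) (hns : n < D.s i - 1) :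
    D.op .F (D.bv i n m) = D.bv i (n + 1) m := by
  by_cases h : D.InRange i n m
  · rw [D.op_bv _ h]; simp [form, formF, hns.ne]
  · rw [D.op_eq_zero _ h, D.bv_eq_zero (by simp only [InRange] at h ⊢; omega)]

theorem F_last (i : ι) {m : ℤ} (hm : 0 ≤ m) : D.op .F (D.bv i (D.s i - 1) m) =
    D.a i • D.bv (D.σ i) 0 (m + 1) + D.b i • D.bv (D.τ i) 0 m := by
  have h1 := D.one_le i
  by_cases h : D.InRange i (D.s i - 1) m
  · rw [D.op_bv _ h]; simp [form, formF]
  · rw [D.op_eq_zero _ h]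
    have e1 : D.a i • D.bv (D.σ i) 0 (m + 1) = 0 := by
      by_cases ha : D.a i = 0
      · rw [ha, zero_smul]
      obtain ⟨-, -, h3, h4⟩ := D.label_σ i ha
      rw [D.bv_eq_zero (by simp only [InRange] at h ⊢; omega), smul_zero]
    have e2 : D.b i • D.bv (D.τ i) 0 m = 0 := by
      by_cases hb : D.b i = 0
      · rw [hb, zero_smul]
      obtain ⟨-, -, h3, h4⟩ := D.label_τ i hb
      rw [D.bv_eq_zero (by simp only [InRange] at h ⊢; omega), smul_zero]
    rw [e1, e2, add_zero]

theorem isChain_smul (i : ι) {c : ℂ} {α : ℤˣ} {s r : ℤ}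
    (hl : c ≠ 0 → D.α i = α ∧ D.s i = s ∧ D.r i = r)
    (hc : ∀ n m, (c * (D.a i * D.b (D.σ i))) • D.bv (D.τ (D.σ i)) n m = 0) :
    IsChain p D.op α s r (fun n m => c • D.bv i n m) := by
  by_cases h0 : c = 0
  · subst h0
    constructor
    · constructor <;> intros <;> simp
    all_goals intros; simp
  · obtain ⟨rfl, rfl, rfl⟩ := hl h0
    have L := D.isLayer i
    refine ⟨⟨fun n m => ?_, fun n m => ?_, fun n m => ?_, fun n m => ?_, fun n m hm => ?_⟩,
      fun n m h1 h2 => ?_, fun n m h1 h2 => ?_⟩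
    · rw [map_smul, L.K, smul_comm]
    · rw [map_smul, L.Kinv, smul_comm]
    · rw [map_smul, L.h, smul_comm]
    · rw [map_smul, L.e, smul_comm]
    · rw [map_smul, L.f n m hm]
    · have h3 := hc (n - 1) m
      rw [mul_smul] at h3
      rw [map_smul, D.E_succ i m h1 h2, smul_add, smul_comm c, smul_comm c, h3, smul_zero, add_zero]
    · rw [map_smul, D.F_succ i m h1 h2]

theorem isPack [Fact (2 ≤ p)] (i : ι) : IsPack p D.op (D.α i) (D.s i) (D.r i) (D.bv i)
    (fun n m => D.a i • D.bv (D.σ i) n m) (fun n m => D.b i • D.bv (D.τ i) n m)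
    (fun n m => (D.a i * D.b (D.σ i)) • D.bv (D.τ (D.σ i)) n m) := by
  have h1 := D.one_le i
  have hY : D.r i = 1 → ∀ n m, D.b i • D.bv (D.τ i) n m = 0 := by
    intro hr n m
    by_cases hb : D.b i = 0
    · rw [hb, zero_smul]
    obtain ⟨-, -, h3, h4⟩ := D.label_τ i hb
    rw [D.bv_eq_zero (by simp only [InRange]; omega), smul_zero]
  have hN : ∀ n m, D.r i ≤ m ∨ m < 0 →
      (D.a i * D.b (D.σ i)) • D.bv (D.τ (D.σ i)) n m = 0 := by
    intro n m hm
    by_cases hab : D.a i * D.b (D.σ i) = 0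
    · rw [hab, zero_smul]
    obtain ⟨-, h3, h4⟩ := D.label_τσ hab
    rw [D.bv_eq_zero (by simp only [InRange]; omega), smul_zero]
  have hab : D.r i ≠ 1 → ∀ n m, (D.b i * D.a (D.τ i)) • D.bv (D.σ (D.τ i)) n m =
      -((D.a i * D.b (D.σ i)) • D.bv (D.τ (D.σ i)) n m) := by
    intro hr n m
    rcases D.ab i hr with ⟨h2, h3⟩ | ⟨h2, h3⟩
    · rw [h2, h3]; simp
    · rw [h2, h3, neg_smul, neg_neg]
  have hga : D.a i ≠ 0 → gz p (D.s (D.σ i)) = gz p (D.s i) := fun ha => by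
    obtain ⟨h2, -, h3, -⟩ := D.label_σ i ha
    rw [h3, gz_neg h1 h2]
  have hgb : D.b i ≠ 0 → gz p (D.s (D.τ i)) = gz p (D.s i) := fun hb => by
    obtain ⟨h2, -, h3, -⟩ := D.label_τ i hb
    rw [h3, gz_neg h1 h2]
  have hka : D.a i * D.b (D.σ i) * D.b (D.τ (D.σ i)) = 0 := by rw [mul_assoc, D.bb, mul_zero]
  have hkb : 0 < D.r i → D.a i * D.b (D.σ i) * D.a (D.τ (D.σ i)) = 0 := by
    intro hr
    by_cases ha : D.a i = 0
    · rw [ha]; simp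
    obtain ⟨-, -, -, h4⟩ := D.label_σ i ha
    rcases D.ab (D.σ i) (by omega) with ⟨-, h3⟩ | ⟨-, h3⟩
    · rw [mul_assoc, h3, mul_zero]
    · rw [mul_assoc, ← neg_eq_iff_eq_neg.2 h3, mul_neg, ← mul_assoc, D.aa, zero_mul, neg_zero]
  have hkbv : ∀ n m k l, (D.a i * D.b (D.σ i) * D.a (D.τ (D.σ i))) •
      D.bv (D.σ (D.τ (D.σ i))) k l = 0 ∨ (D.a i * D.b (D.σ i)) • D.bv (D.τ (D.σ i)) n m = 0 := by
    intro n m k l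
    by_cases hr : 0 < D.r i
    · left; rw [hkb hr, zero_smul]
    · right; exact hN n m (by omega)
  refine { D.isLayer i with
    one_le := h1
    le := D.le i
    chX := ?_
    chY := ?_
    chN := ?_
    E_zero := fun m => ?_
    E_succ := fun n m hn hns => D.E_succ i m hn hns
    F_succ := fun n m hn hns => D.F_succ i m hn hns
    F_last := fun m hm => D.F_last i hm
    X_E_zero := fun m => ?_
    X_F_last := fun h m hm => ?_
    Y_E_zero := fun m => ?_
    Y_F_last := fun h m hm => ?_
    N_E_zero := fun m => ?_
    N_F_last := fun m hm => ?_
    edge := fun h => ?_ }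
  · refine D.isChain_smul _ (fun ha => (D.label_σ i ha).2) fun n m => ?_
    rw [← mul_assoc, D.aa, zero_mul, zero_smul]
  · refine D.isChain_smul _ (fun hb => (D.label_τ i hb).2) fun n m => ?_
    by_cases hr : D.r i = 1
    · by_cases h0 : D.b i * (D.a (D.τ i) * D.b (D.σ (D.τ i))) = 0
      · rw [h0, zero_smul]
      obtain ⟨-, -, h3, h4⟩ := D.label_τ i (left_ne_zero_of_mul h0)
      obtain ⟨-, h5, h6⟩ := D.label_τσ (right_ne_zero_of_mul h0)
      rw [D.bv_eq_zero (by simp only [InRange]; omega), smul_zero]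
    · rcases D.ab i hr with ⟨-, h3⟩ | ⟨h2, h3⟩
      · rw [← mul_assoc, h3, zero_mul, zero_smul]
      · rw [← mul_assoc, ← neg_eq_iff_eq_neg.2 h3, ← h2, neg_mul, hka, neg_zero, zero_smul]
  · refine D.isChain_smul _ (fun h => D.label_τσ h) fun n m => ?_
    by_cases hr : 0 < D.r i
    · rw [← mul_assoc, hkb hr, zero_mul, zero_smul]
    · by_cases h0 : D.a i * D.b (D.σ i) * (D.a (D.τ (D.σ i)) * D.b (D.σ (D.τ (D.σ i)))) = 0
      · rw [h0, zero_smul]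
      obtain ⟨-, h3, h4⟩ := D.label_τσ (left_ne_zero_of_mul h0)
      obtain ⟨-, h5, h6⟩ := D.label_τσ (right_ne_zero_of_mul h0)
      rw [D.bv_eq_zero (by simp only [InRange]; omega), smul_zero]
  · rw [D.E_zero, mul_smul ((D.r i : ℂ) - m), mul_smul (m : ℂ)]
  · by_cases ha : D.a i = 0
    · simp [ha]
    obtain ⟨h2, h3, h4, h5⟩ := D.label_σ i ha
    rw [map_smul, D.E_zero, hga ha, h3, h4, h5, sub_sub_cancel, ← smul_comm (_ * _), smul_sub,
      smul_smul (D.a i), smul_smul (D.a i), mul_left_comm, D.aa, mul_left_comm (D.a i)]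
    push_cast
    module
  · rw [map_smul]
    by_cases ha : D.a i = 0
    · simp [ha]
    obtain ⟨h2, h3, h4, h5⟩ := D.label_σ i ha
    rw [← h4, D.F_last _ hm, smul_add, smul_smul, D.aa, zero_smul, zero_add, smul_smul]
  · rw [map_smul]
    by_cases hr : D.r i = 1
    · rw [← map_smul, hY hr, map_zero, hr]
      by_cases hm : m = 0
      · simp [hm]
      · rw [hN _ _ (by omega), smul_zero]
    · by_cases hb : D.b i = 0
      · have := hab hr (D.s i - 1) m
        rw [hb, zero_mul, zero_smul, eq_comm, neg_eq_zero] at this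
        rw [this, hb]
        simp
      obtain ⟨h2, h3, h4, h5⟩ := D.label_τ i hb
      have e := hab hr (D.s i - 1) m
      rw [D.E_zero, hgb hb, h3, h4, h5, sub_sub_cancel, ← smul_comm (_ * _), smul_sub,
        smul_smul (D.b i), smul_smul (D.b i), mul_left_comm, mul_smul _ (D.b i * D.a (D.τ i)), e,
        mul_left_comm, D.bb]
      push_cast
      module
  · by_cases hr : D.r i = 1
    · simp only [hY hr, map_zero, hN 0 (m + 1) (by omega), neg_zero]
    · by_cases hb : D.b i = 0
      · have := hab hr 0 (m + 1)
        rw [hb, zero_mul, zero_smul] at this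
        rw [← this, hb]
        simp
      obtain ⟨h2, h3, h4, h5⟩ := D.label_τ i hb
      rw [map_smul, ← h4, D.F_last _ hm, smul_add, smul_smul, smul_smul, D.bb, zero_smul, add_zero,
        hab hr]
  · rcases hkbv 0 m (p - D.s (D.τ (D.σ i)) - 1) m with h | h
    · rw [map_smul, D.E_zero, ← smul_comm (_ * _), smul_sub, smul_smul _ (_ * D.a _),
        smul_smul _ (_ * D.b _), mul_left_comm, mul_left_comm _ (m : ℂ), hka, mul_smul _ (_ * D.a _), h]
      simp
    · rw [h, map_zero]
  · by_cases hab' : D.a i * D.b (D.σ i) = 0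
    · simp [hab']
    have h3 := (D.label_τσ hab').2.1
    rcases hkbv (D.s i - 1) m 0 (m + 1) with h | h
    · rw [map_smul, ← h3, D.F_last _ hm, smul_add, smul_smul, smul_smul, hka, h]
      simp
    · rw [h, map_zero]
  · have ha : D.a i = 0 := by
      by_contra ha
      exact (D.label_σ i ha).1.ne h
    have hb : D.b i = 0 := by
      by_contra hb
      exact (D.label_τ i hb).1.ne h
    refine ⟨?_, ?_, ?_⟩ <;> funext n m <;> simp [ha, hb]

end Glue

/-! ### Modules from operators -/

/-- The formulas for the action of `E` and `F` on the basis of a module with gluing data `D`. -/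
structure GlueFormula {p : ℕ} {ι : Type} (D : Glue p ι) {M : Type*} [AddCommGroup M]
    [Module (LU p) M] [Module ℂ M] (v : ι → ℤ → ℤ → M) : Prop where
  E : ∀ i n m, D.InRange i n m → gen p Gen.E • v i n m = D.formE v i n m
  F : ∀ i n m, D.InRange i n m → gen p Gen.F • v i n m = D.formF v i n m

/-- A finite-dimensional module is isomorphic to an object of `FinRep p`. -/
theorem exists_finRep_equiv (p : ℕ) (V : Type) [AddCommGroup V] [Module ℂ V] [Module (LU p) V]
    [IsScalarTower ℂ (LU p) V] [FiniteDimensional ℂ V] :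
    ∃ M : FinRep p, Nonempty (V ≃ₗ[LU p] M.obj) := by
  obtain ⟨N, ⟨e⟩⟩ : ∃ N : ModuleCat.{0} (LU p), Nonempty (V ≃ₗ[LU p] N) :=
    ⟨ModuleCat.of _ V, ⟨LinearEquiv.refl _ _⟩⟩
  exact ⟨⟨N, Module.Finite.equiv (e.restrictScalars ℂ)⟩, ⟨e⟩⟩

/-- A vector space with operators satisfying the defining relations is an object of `FinRep p`. -/
theorem exists_finRep {p : ℕ} {V : Type} [AddCommGroup V] [Module ℂ V] [FiniteDimensional ℂ V]
    (T : Gen → End ℂ V)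
    (hT : ∀ ⦃x y⦄, Rel p x y → FreeAlgebra.lift ℂ T x = FreeAlgebra.lift ℂ T y) :
    ∃ (M : FinRep p) (φ : V ≃ₗ[ℂ] M.obj), ∀ (g : Gen) (v : V), φ (T g v) = gen p g • φ v := by
  let ψ : LU p →ₐ[ℂ] End ℂ V := RingQuot.liftAlgHom ℂ ⟨FreeAlgebra.lift ℂ T, hT⟩
  have hψ : ∀ g, ψ (gen p g) = T g := fun g => by
    have := RingQuot.liftAlgHom_mkAlgHom_apply ℂ (FreeAlgebra.lift ℂ T) hT (FreeAlgebra.ι ℂ g)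
    rw [FreeAlgebra.lift_ι_apply] at this
    exact this
  let _ : Module (LU p) V := Module.compHom V ψ.toRingHom
  have h1 : ∀ (x : LU p) (v : V), x • v = ψ x v := fun x v => rfl
  have : IsScalarTower ℂ (LU p) V := ⟨fun c x v => by rw [h1, h1, map_smul]; rfl⟩
  obtain ⟨M, ⟨e⟩⟩ := exists_finRep_equiv p V
  refine ⟨M, e.restrictScalars ℂ, fun g v => ?_⟩
  rw [← hψ, ← h1]
  exact e.map_smul _ _

namespace Glue

variable {ι : Type} (D : Glue p ι)

theorem op_ext {S S' : End ℂ D.Space}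
    (h : ∀ i n m, D.InRange i n m → S (D.bv i n m) = S' (D.bv i n m)) : S = S' := by
  refine Finsupp.lhom_ext' fun x => LinearMap.ext_ring ?_
  have := h x.1.1 x.1.2.1 x.1.2.2 x.2
  rw [bv, dif_pos x.2] at this
  exact this

theorem lift_opH : FreeAlgebra.lift ℂ D.op (Free.H p) = opH p D.op := by
  simp [Free.H, opH, Free.K, Free.Kinv]

theorem lift_casimir : FreeAlgebra.lift ℂ D.op (Free.casimir p) = opCas p D.op := by
  simp [Free.casimir, opCas, Free.K, Free.Kinv, Free.E, Free.F]

theorem lift_A : FreeAlgebra.lift ℂ D.op (Free.A p) = opA p (D.op .K) (opCas p D.op) := by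
  simp only [Free.A, map_sum, map_mul, opA]
  refine Finset.sum_congr rfl fun s _ => ?_
  rw [← Polynomial.aeval_algHom_apply, ← Polynomial.aeval_algHom_apply, lift_casimir]
  simp [Free.K]

theorem lift_rel [Fact (2 ≤ p)] ⦃x y : FreeAlgebra ℂ Gen⦄ (h : Rel p x y) :
    FreeAlgebra.lift ℂ D.op x = FreeAlgebra.lift ℂ D.op y := by
  refine D.op_ext fun i n m hr => ?_
  obtain ⟨h1, h2, h3, h4⟩ := id hr
  have P := D.isPack i
  have L := D.isLayer i
  have h0 := L.kVal_ne_zero n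
  cases h <;> simp only [map_mul, map_sub, map_smul, map_neg, map_pow, map_one, map_zero,
    lift_opH, lift_A, FreeAlgebra.lift_ι_apply, End.mul_apply, LinearMap.sub_apply,
    LinearMap.smul_apply, LinearMap.neg_apply, End.one_apply, LinearMap.zero_apply]
  · rw [L.Kinv, map_smul, L.K, smul_smul, inv_mul_cancel₀ h0, one_smul]
  · rw [L.K, map_smul, L.Kinv, smul_smul, mul_inv_cancel₀ h0, one_smul]
  · exact P.rel_K_E h1 h2
  · exact P.rel_K_F h1 h2 h3
  · exact P.rel_E_F h1 h2 h3
  · exact P.E_pow_apply_eq_zero m h1 h2 (by omega)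
  · exact P.F_pow_apply_eq_zero h1 h2 h3 (by omega)
  · exact L.K_pow n m
  · exact L.h_e n m
  · exact L.h_f n h3
  · exact L.e_f n h3
  · exact L.h_K n m
  · exact P.rel_E_e h1 h2
  · exact L.K_e n m
  · exact P.rel_F_f h1 h2 h3
  · exact L.K_f n h3
  · exact P.rel_F_e h1 h2 h3
  · exact P.rel_E_f h1 h2 h3
  · exact P.rel_h_E h1 h2 h3
  · exact P.rel_h_F h1 h2 h3

theorem span_bv : Submodule.span ℂ {w : D.Space | ∃ i n m, w = D.bv i n m} = ⊤ := by
  rw [eq_top_iff, ← (Finsupp.basisSingleOne (R := ℂ) (ι := D.Idx)).span_eq, Submodule.span_le]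
  rintro _ ⟨x, rfl⟩
  refine Submodule.subset_span ⟨x.1.1, x.1.2.1, x.1.2.2, ?_⟩
  rw [bv, dif_pos x.2, Finsupp.coe_basisSingleOne]

/-- The module with given gluing data exists. -/
theorem exists_module [Fact (2 ≤ p)] [Finite D.Idx] : ∃ (M : FinRep p) (v : ι → ℤ → ℤ → M.obj),
    IsLayeredBasis M D.α D.s D.r v ∧ GlueFormula D v := by
  obtain ⟨M, φ, hφ⟩ := exists_finRep D.op D.lift_rel
  refine ⟨M, fun i n m => φ (D.bv i n m), ⟨fun i n m h => ?_, ?_, ?_, fun i n m => ?_,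
    fun i n m => ?_, fun i n m => ?_, fun i n m hm => ?_⟩, ⟨fun i n m h => ?_, fun i n m h => ?_⟩⟩
  · simp only [D.bv_eq_zero h, map_zero]
  · have h : (fun x : D.Idx => φ (D.bv x.1.1 x.1.2.1 x.1.2.2)) =
        φ.toLinearMap ∘ Finsupp.basisSingleOne (R := ℂ) (ι := D.Idx) := by
      funext x
      simp only [bv]
      rw [dif_pos x.2]
      simp
    have := (Finsupp.basisSingleOne (R := ℂ) (ι := D.Idx)).linearIndependent.map' φ.toLinearMap
      φ.ker
    rw [← h] at this
    exact this
  · have := congrArg (Submodule.map φ.toLinearMap) D.span_bv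
    rw [Submodule.map_span, Submodule.map_top, LinearEquiv.range] at this
    rw [← this]
    congr 1
    ext w
    constructor
    · rintro ⟨i, n, m, rfl⟩; exact ⟨_, ⟨i, n, m, rfl⟩, rfl⟩
    · rintro ⟨_, ⟨i, n, m, rfl⟩, rfl⟩; exact ⟨i, n, m, rfl⟩
  · rw [← hφ, (D.isLayer i).K, map_smul]; rfl
  · rw [← hφ, (D.isLayer i).h, map_smul]
    congr 1
    push_cast
    ring
  · rw [← hφ, (D.isLayer i).e, map_smul]
    push_cast
    rfl
  · rw [← hφ, (D.isLayer i).f n m hm]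
  · rw [← hφ, D.op_bv _ h]
    simp only [form, formE]
    split_ifs <;> simp
  · rw [← hφ, D.op_bv _ h]
    simp only [form, formF]
    split_ifs <;> simp

end Glue

/-! ### Frames of highest weight vectors -/

section Frames

variable {ι : Type} {D : Glue p ι} {M : Type*} [AddCommGroup M] [Module (LU p) M]
  [Module ℂ M] [IsScalarTower ℂ (LU p) M] [hp : Fact (2 ≤ p)]

variable (p) in
/-- The vector `f ^ m F ^ n u`, set to zero if an index is out of range. -/
def bz (s r n m : ℤ) (u : M) : M :=
  if 0 ≤ n ∧ n < s ∧ 0 ≤ m ∧ m < r then br p n.toNat m.toNat u else 0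

variable (D) in
/-- Highest weight vectors that are permuted by `xop` and `yop` according to the data `D`. -/
structure IsFrame (u : ι → M) : Prop where
  mem : ∀ i, u i ∈ hw (p := p) M (D.α i) (D.s i) (D.r i)
  hx : ∀ i, 1 ≤ D.r i → D.s i < p → xop p (D.s i) (D.r i) (u i) = D.a i • u (D.σ i)
  hy : ∀ i, 1 ≤ D.r i → D.s i < p → yop p (D.s i) (D.r i) (u i) = D.b i • u (D.τ i)

variable [FiniteDimensional ℂ M]

section Vector

variable {α : ℤˣ} {s r : ℤ} {u : M}

theorem bz_eq_br (hs : s ≤ p) {n : ℕ} (hn : n < s) (m : ℕ) (hu : u ∈ hw (p := p) M α s r) :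
    bz p s r n m u = br p n m u := by
  by_cases hm : m < r
  · rw [bz, if_pos ⟨by omega, hn, by omega, hm⟩]; simp
  · rw [bz, if_neg (by omega), br_eq_zero hs hn (not_lt.1 hm) hu]

theorem bz_zero_zero (h1 : 1 ≤ s) (hs : s ≤ p) (hu : u ∈ hw (p := p) M α s r) :
    bz p s r 0 0 u = u := by
  have := bz_eq_br hs (n := 0) (by omega) 0 hu
  simpa [br_zero_zero] using this

@[elab_as_elim]
theorem bz_induction {P : ℤ → ℤ → Prop} (n m : ℤ) (h : ¬ (0 ≤ n ∧ n < s ∧ 0 ≤ m) → P n m)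
    (h' : ∀ n m : ℕ, (n : ℤ) < s → P n m) : P n m := by
  by_cases h0 : 0 ≤ n ∧ n < s ∧ 0 ≤ m
  · obtain ⟨n, rfl⟩ := Int.eq_ofNat_of_zero_le h0.1
    obtain ⟨m, rfl⟩ := Int.eq_ofNat_of_zero_le h0.2.2
    exact h' n m h0.2.1
  · exact h h0

theorem K_bz (hs : s ≤ p) (hu : u ∈ hw (p := p) M α s r) (n m : ℤ) :
    gK • bz p s r n m u = kVal p α s n • bz p s r n m u := by
  refine bz_induction n m (s := s) (fun h => ?_) fun n m hn => ?_
  · rw [bz, if_neg (by omega), smul_zero, smul_zero]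
  · rw [bz_eq_br hs hn m hu, K_br n m hu]

theorem h_bz (hs : s ≤ p) (hu : u ∈ hw (p := p) M α s r) (n m : ℤ) :
    gh • bz p s r n m u = (((r - 1 - 2 * m : ℤ) : ℂ) / 2) • bz p s r n m u := by
  refine bz_induction n m (s := s) (fun h => ?_) fun n m hn => ?_
  · rw [bz, if_neg (by omega), smul_zero, smul_zero]
  · rw [bz_eq_br hs hn m hu, h_br hs hn m hu]
    congr 1; push_cast; ring

theorem e_bz (hs : s ≤ p) (hu : u ∈ hw (p := p) M α s r) (n m : ℤ) :
    ge • bz p s r n m u = ((m * (r - m) : ℤ) : ℂ) • bz p s r n (m - 1) u := by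
  refine bz_induction n m (s := s) (fun h => ?_) fun n m hn => ?_
  · rw [bz, if_neg (by omega), bz, if_neg (by omega), smul_zero, smul_zero]
  · rw [bz_eq_br hs hn m hu]
    cases m with
    | zero => rw [e_br_zero hs hn hu]; simp
    | succ m =>
      rw [e_br_succ hs hn m hu, show ((m + 1 : ℕ) : ℤ) - 1 = m by push_cast; ring,
        bz_eq_br hs hn m hu]
      congr 1; push_cast; ring

theorem f_bz (hs : s ≤ p) (hu : u ∈ hw (p := p) M α s r) (n m : ℤ) (hm : 0 ≤ m) :
    gf • bz p s r n m u = bz p s r n (m + 1) u := by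
  revert hm
  refine bz_induction n m (s := s) (fun h hm => ?_) fun n m hn hm => ?_
  · rw [bz, if_neg (by omega), bz, if_neg (by omega), smul_zero]
  · rw [bz_eq_br hs hn m hu, f_br, ← bz_eq_br hs hn (m + 1) hu]
    push_cast; rfl

end Vector

namespace IsFrame

variable {u : ι → M}

theorem smul_br_σ (hu : IsFrame D u) {i : ι} {n : ℤ} (h0 : 0 ≤ n) (hn : n < p - D.s i) (m : ℕ) :
    D.a i • br p n.toNat m (u (D.σ i)) = D.a i • bz p (D.s (D.σ i)) (D.r (D.σ i)) n m (u (D.σ i)) := by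
  by_cases h : D.a i = 0
  · rw [h, zero_smul, zero_smul]
  obtain ⟨h2, -, h3, -⟩ := D.label_σ i h
  rw [← bz_eq_br (D.le _) (by omega) m (hu.mem _), Int.toNat_of_nonneg h0]

theorem smul_br_τ (hu : IsFrame D u) {i : ι} {n : ℤ} (h0 : 0 ≤ n) (hn : n < p - D.s i) (m : ℕ) :
    D.b i • br p n.toNat m (u (D.τ i)) = D.b i • bz p (D.s (D.τ i)) (D.r (D.τ i)) n m (u (D.τ i)) := by
  by_cases h : D.b i = 0
  · rw [h, zero_smul, zero_smul]
  obtain ⟨h2, -, h3, -⟩ := D.label_τ i h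
  rw [← bz_eq_br (D.le _) (by omega) m (hu.mem _), Int.toNat_of_nonneg h0]

theorem yop_xop (hu : IsFrame D u) {i : ι} (hr : 1 ≤ D.r i) (h2 : D.s i < p) :
    yop p (p - D.s i) (D.r i + 1) (xop p (D.s i) (D.r i) (u i)) =
      (D.a i * D.b (D.σ i)) • u (D.τ (D.σ i)) := by
  have h1 := D.one_le i
  rw [hu.hx i hr h2, yop_smul]
  by_cases h : D.a i = 0
  · rw [h]; simp
  obtain ⟨-, -, h3, h4⟩ := D.label_σ i h
  rw [← h3, ← h4, hu.hy _ (by omega) (by omega), smul_smul]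

theorem nuLU_smul (hu : IsFrame D u) {i : ι} (hr : 1 ≤ D.r i) : nuLU p (D.α i) (D.s i) • u i =
    (((D.α i : ℤ) : ℂ) * gz p (D.s i) * D.r i * (D.a i * D.b (D.σ i))) • u (D.τ (D.σ i)) := by
  rcases (D.le i).lt_or_eq with h2 | h2
  · rw [nuLU_eq_yop_xop (D.one_le i) h2 (hu.mem i), hu.yop_xop hr h2, smul_smul]
  · have ha : D.a i = 0 := by
      by_contra ha
      exact (D.label_σ i ha).1.ne h2
    have hm := hu.mem i
    have := E_br_zero_p (r := D.r i) (α := D.α i) (u := u i) (by rwa [← h2]) 0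
    rw [br_zero_zero] at this
    rw [← FE_of_mem_wt_zero hm.1, this, ha]
    simp

theorem glueFormula (hu : IsFrame D u) :
    GlueFormula D (fun i n m => bz p (D.s i) (D.r i) n m (u i)) where
  E i n m h := by
    obtain ⟨hn0, hn, hm0, hm⟩ := h
    obtain ⟨n, rfl⟩ := Int.eq_ofNat_of_zero_le hn0
    obtain ⟨m, rfl⟩ := Int.eq_ofNat_of_zero_le hm0
    rw [bz_eq_br (D.le i) hn m (hu.mem i), Glue.formE]
    cases n with
    | zero =>
      rw [if_pos (by simp)]
      rcases (D.le i).lt_or_eq with h2 | h2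
      · rw [E_br_zero (D.one_le i) h2 (hu.mem i), hu.hx i (by omega) h2, hu.hy i (by omega) h2,
          br_smul, br_smul, hu.smul_br_σ (by omega) (by omega), hu.smul_br_τ (by omega) (by omega),
          smul_smul, smul_smul]
        congr 2
        cases m with
        | zero => simp
        | succ m => simp
      · have ha : D.a i = 0 := by
          by_contra ha
          exact (D.label_σ i ha).1.ne h2
        have hb : D.b i = 0 := by
          by_contra hb
          exact (D.label_τ i hb).1.ne h2
        have hm' := hu.mem i
        rw [E_br_zero_p (r := D.r i) (α := D.α i) (u := u i) (by rwa [← h2]) m, ha, hb]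
        simp
    | succ n =>
      rw [if_neg (by omega), E_br_succ m (hu.mem i), hu.nuLU_smul (by omega),
        br_smul, show ((n + 1 : ℕ) : ℤ) - 1 = n by push_cast; ring,
        bz_eq_br (D.le i) (by omega) m (hu.mem i)]
      push_cast
      congr 1
      by_cases hab : D.a i * D.b (D.σ i) = 0
      · rw [hab]; simp
      obtain ⟨-, h3, h4⟩ := D.label_τσ hab
      rw [bz_eq_br (D.le _) (by omega) m (hu.mem _)]
  F i n m h := by
    obtain ⟨hn0, hn, hm0, hm⟩ := h
    obtain ⟨n, rfl⟩ := Int.eq_ofNat_of_zero_le hn0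
    obtain ⟨m, rfl⟩ := Int.eq_ofNat_of_zero_le hm0
    rw [bz_eq_br (D.le i) hn m (hu.mem i), Glue.formF]
    split_ifs with h
    · rw [show n = (D.s i - 1).toNat by omega, F_br_last (D.one_le i) m (r := D.r i)]
      rcases (D.le i).lt_or_eq with h2 | h2
      · rw [hu.hx i (by omega) h2, hu.hy i (by omega) h2, br_smul, br_smul]
        have h3 := hu.smul_br_σ (i := i) (n := 0) le_rfl (by omega) (m + 1)
        have h4 := hu.smul_br_τ (i := i) (n := 0) le_rfl (by omega) m
        rw [Int.toNat_zero] at h3 h4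
        rw [h3, h4]
        push_cast
        rfl
      · have ha : D.a i = 0 := by
          by_contra ha
          exact (D.label_σ i ha).1.ne h2
        have hb : D.b i = 0 := by
          by_contra hb
          exact (D.label_τ i hb).1.ne h2
        rw [h2, xop_p, yop_p, ha, hb, br_zero, br_zero]
        simp
    · rw [F_br, ← bz_eq_br (D.le i) (by omega) m (hu.mem i)]
      push_cast
      rfl

end IsFrame

end Frames

/-! ### Modules with given gluing data -/

section Glued

theorem Glue.aba {p : ℕ} {ι : Type} (D : Glue p ι) {i : ι} (hr : 0 < D.r i) :
    D.a i * D.b (D.σ i) * D.a (D.τ (D.σ i)) = 0 := by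
  by_cases ha : D.a i = 0
  · rw [ha]; simp
  obtain ⟨-, -, -, h4⟩ := D.label_σ i ha
  rcases D.ab (D.σ i) (by omega) with ⟨-, h3⟩ | ⟨-, h3⟩
  · rw [mul_assoc, h3, mul_zero]
  · rw [mul_assoc, ← neg_eq_iff_eq_neg.2 h3, mul_neg, ← mul_assoc, D.aa, zero_mul, neg_zero]

instance finiteDimensional_finRep {p : ℕ} (M : FinRep p) : FiniteDimensional ℂ M.obj := M.property

/-- The module `M` has the gluing data `D`, with respect to the basis `v`. -/
structure IsGlued {p : ℕ} {ι : Type} (D : Glue p ι) (M : FinRep p) (v : ι → ℤ → ℤ → M.obj) :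
    Prop where
  basis : IsLayeredBasis M D.α D.s D.r v
  formula : GlueFormula D v

variable {ι : Type} {D : Glue p ι} {M : FinRep p} {v : ι → ℤ → ℤ → M.obj}
  [hp : Fact (2 ≤ p)]

theorem IsFrame.isStableFamily {A : Type*} [AddCommGroup A] [Module (LU p) A]
    [Module ℂ A] [IsScalarTower ℂ (LU p) A] [FiniteDimensional ℂ A] {a : ι → A}
    (ha : IsFrame D a) : IsStableFamily (p := p) (spanFamily D.α D.s D.r a) := by
  have h0 : ∀ i, ¬ 1 ≤ D.r i → a i = 0 := fun i hi => by
    by_contra h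
    have := r_pos_of_ne_zero (ha.mem i) h
    omega
  refine isStableFamily_spanFamily ha.mem (fun i hi => ?_) fun i hi => ?_
  · by_cases hr : 1 ≤ D.r i
    · rw [ha.hx i hr hi]
      by_cases h : D.a i = 0
      · rw [h, zero_smul]; exact Submodule.zero_mem _
      obtain ⟨-, h1, h2, h3⟩ := D.label_σ i h
      rw [← h1, ← h2, ← h3]
      exact Submodule.smul_mem _ _ (mem_spanFamily _)
    · rw [h0 i hr, xop_zero]; exact Submodule.zero_mem _
  · by_cases hr : 1 ≤ D.r i
    · rw [ha.hy i hr hi]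
      by_cases h : D.b i = 0
      · rw [h, zero_smul]; exact Submodule.zero_mem _
      obtain ⟨-, h1, h2, h3⟩ := D.label_τ i h
      rw [← h1, ← h2, ← h3]
      exact Submodule.smul_mem _ _ (mem_spanFamily _)
    · rw [h0 i hr, yop_zero]; exact Submodule.zero_mem _

namespace IsGlued

theorem E_zero (h : IsGlued D M v) (i : ι) : gE • v i 0 0 =
    (((D.α i : ℤ) : ℂ) * gz p (D.s i) * D.r i * D.a i) • v (D.σ i) (p - D.s i - 1) 0 := by
  by_cases hr : D.InRange i 0 0
  · rw [h.formula.E i 0 0 hr, Glue.formE, if_pos rfl]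
    simp [smul_smul, mul_assoc]
  · have h1 := D.one_le i
    rw [h.basis.eq_zero i 0 0 hr, smul_zero]
    by_cases ha : D.a i = 0
    · simp [ha]
    obtain ⟨-, -, -, h4⟩ := D.label_σ i ha
    by_cases h0 : D.r i = 0
    · simp [h0]
    rw [h.basis.eq_zero (D.σ i), smul_zero]
    simp only [Glue.InRange] at hr ⊢
    omega

theorem F_last (h : IsGlued D M v) {i : ι} (hr : 1 ≤ D.r i) : gF • v i (D.s i - 1) 0 =
    D.a i • v (D.σ i) 0 1 + D.b i • v (D.τ i) 0 0 := by
  have h1 := D.one_le i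
  rw [h.formula.F i _ 0 ⟨by omega, by omega, by omega, by omega⟩, Glue.formF, if_pos rfl]
  simp

theorem cas_smul (h : IsGlued D M v) {i : ι} (hr : 1 ≤ D.r i) :
    casLU p • v i 0 0 - casVal p (D.α i) (D.s i) • v i 0 0 =
      ((q p - (q p)⁻¹) ^ 2 * (((D.α i : ℤ) : ℂ) * gz p (D.s i) * D.r i)) •
        (D.a i * D.b (D.σ i)) • v (D.τ (D.σ i)) 0 0 := by
  have h1 := FE_of_K (h.basis.smul_K i 0 0)
  have h2 := kVal_FE (p := p) (D.α i) (D.s i) 0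
  rw [kVal] at h2
  rw [h2, qInt_zero, mul_zero, zero_mul, mul_zero, sub_zero] at h1
  rw [← h1, h.E_zero, gen_csmul]
  by_cases ha : D.a i = 0
  · simp [ha]
  obtain ⟨-, -, h3, h4⟩ := D.label_σ i ha
  rw [← h3, h.F_last (by omega), smul_add, smul_smul _ (D.a (D.σ i)), mul_assoc _ (D.a i), D.aa,
    mul_zero, zero_smul, zero_add]
  simp only [smul_smul, mul_assoc]

theorem mem_hw (h : IsGlued D M v) (i : ι) :
    v i 0 0 ∈ hw (p := p) M.obj (D.α i) (D.s i) (D.r i) := by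
  by_cases hr : 1 ≤ D.r i
  swap
  · rw [h.basis.eq_zero i 0 0 (by omega)]; exact Submodule.zero_mem _
  rw [LUq.mem_hw, wt, mem_wSpace]
  refine ⟨⟨?_, h.basis.smul_K i 0 0⟩, ?_, ?_⟩
  · rw [End.mem_maxGenEigenspace]
    refine ⟨2, ?_⟩
    have h2 : ∀ w : M.obj, (act M.obj (casLU p) - casVal p (D.α i) (D.s i) • 1) w =
      casLU p • w - casVal p (D.α i) (D.s i) • w := fun w => rfl
    rw [pow_two, End.mul_apply, h2 (v i 0 0), h.cas_smul hr]
    by_cases hab : D.a i * D.b (D.σ i) = 0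
    · simp [hab]
    obtain ⟨h3, h4, h5⟩ := D.label_τσ hab
    rw [map_smul, map_smul, h2, ← h3, ← h4, h.cas_smul (by omega)]
    rcases mul_eq_zero.1 (D.aba (i := i) (by omega)) with h6 | h6
    · exact absurd h6 hab
    · rw [h6]; simp
  · rw [h.basis.smul_e]; simp
  · rw [h.basis.smul_h]; congr 1; push_cast; ring

theorem eq_br (h : IsGlued D M v) (i : ι) (n m : ℕ) (hn : n < D.s i) (hm : m < D.r i) :
    v i n m = br p n m (v i 0 0) := by
  have h1 := D.one_le i
  have h2 : v i n 0 = gF ^ n • v i 0 0 := by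
    induction n with
    | zero => simp
    | succ n ih =>
      rw [pow_succ', mul_smul, ← ih (by omega),
        h.formula.F i n 0 ⟨by omega, by omega, by omega, by omega⟩, Glue.formF, if_neg (by omega)]
      push_cast; rfl
  rw [br, ← h2]
  clear hm
  induction m with
  | zero => simp
  | succ m ih =>
    rw [pow_succ', mul_smul, ← ih, h.basis.smul_f i n m (by omega)]
    push_cast; rfl

theorem eq_bz (h : IsGlued D M v) (i : ι) (n m : ℤ) :
    v i n m = bz p (D.s i) (D.r i) n m (v i 0 0) := by
  rw [bz]
  split_ifs with h0
  · rw [← h.eq_br i _ _ (by omega) (by omega), Int.toNat_of_nonneg h0.1,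
      Int.toNat_of_nonneg h0.2.2.1]
  · exact h.basis.eq_zero i n m h0

theorem isFrame (h : IsGlued D M v) : IsFrame D (fun i => v i 0 0) := by
  have key : ∀ i, 1 ≤ D.r i → D.s i < p →
      xop p (D.s i) (D.r i) (v i 0 0) = D.a i • v (D.σ i) 0 0 ∧
      yop p (D.s i) (D.r i) (v i 0 0) = D.b i • v (D.τ i) 0 0 := by
    intro i hr hs
    have h1 := D.one_le i
    have e1 := F_br_last (p := p) (u := v i 0 0) h1 (r := D.r i) 0
    rw [← h.eq_br i _ _ (by omega) (by omega), Int.toNat_of_nonneg (by omega), Nat.cast_zero,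
      h.F_last hr, br_zero_zero] at e1
    have hx := xop_mem h1 hs (h.mem_hw i)
    have hy := yop_mem h1 hs (h.mem_hw i)
    have e2 := congrArg (ge • ·) e1
    have e3 := e_br_succ (p := p) (by omega) (n := 0) (by omega) 0 hx
    have e4 : ge • v (D.σ i) 0 1 = ((D.r (D.σ i) : ℂ) - 1) • v (D.σ i) 0 0 := by
      rw [h.basis.smul_e]; push_cast; congr 1; ring
    have e5 : ge • v (D.τ i) 0 0 = 0 := by rw [h.basis.smul_e]; simp
    simp only [smul_add, gen_csmul, e3, e4, e5, (LUq.mem_hw.1 hy).2.1, smul_zero, add_zero,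
      br_zero_zero] at e2
    have e6 : xop p (D.s i) (D.r i) (v i 0 0) = D.a i • v (D.σ i) 0 0 := by
      have hr0 : (D.r i : ℂ) ≠ 0 := by exact_mod_cast (by omega : D.r i ≠ 0)
      refine smul_right_injective _ hr0 ?_
      push_cast at e2
      simp only [zero_add, one_mul, sub_zero, add_sub_cancel_right] at e2
      by_cases ha : D.a i = 0
      · rw [ha, zero_smul] at e2
        simp only [ha, zero_smul, smul_zero]
        exact e2.symm
      obtain ⟨-, -, -, h4⟩ := D.label_σ i ha
      rw [h4] at e2
      push_cast at e2
      rw [add_sub_cancel_right, smul_comm] at e2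
      exact e2.symm
    refine ⟨e6, ?_⟩
    rw [e6, br_smul] at e1
    have e7 : D.a i • br p 0 (0 + 1) (v (D.σ i) 0 0) = D.a i • v (D.σ i) 0 1 := by
      rw [br, pow_zero, one_smul, zero_add, pow_one, h.basis.smul_f _ _ _ le_rfl, zero_add]
    rw [e7] at e1
    exact (add_left_cancel e1).symm
  exact ⟨h.mem_hw, fun i hr hs => (key i hr hs).1, fun i hr hs => (key i hr hs).2⟩

theorem eq_top (h : IsGlued D M v) {N : Submodule (LU p) M.obj} (hN : ∀ i, v i 0 0 ∈ N) : N = ⊤ := by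
  have : (⊤ : Submodule ℂ M.obj) ≤ N.restrictScalars ℂ := by
    rw [← h.basis.span_eq_top, Submodule.span_le]
    rintro _ ⟨i, n, m, rfl⟩
    rw [h.eq_bz, bz]
    split_ifs
    · exact N.smul_mem _ (N.smul_mem _ (hN i))
    · exact N.zero_mem
  exact eq_top_iff.2 fun x _ => this trivial

/-- All highest weight vectors are linear combinations of those in the basis. -/
theorem hw_le (h : IsGlued D M v) {α : ℤˣ} {s r : ℤ} (h1 : 1 ≤ s) (h2 : s ≤ p) {u : M.obj}
    (hu : u ∈ hw (p := p) M.obj α s r) : u ∈ spanFamily D.α D.s D.r (fun i => v i 0 0) α s r := by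
  refine mem_of_mem_hw_of_mem_genSub h.isFrame.isStableFamily h1 h2 hu ?_
  rw [h.eq_top fun i => le_genSub _ (D.one_le i) (D.le i)
    (mem_spanFamily (u := fun i => v i 0 0) i)]
  trivial

variable {A : Type*} [AddCommGroup A] [Module (LU p) A] [Module ℂ A] [IsScalarTower ℂ (LU p) A]
  [FiniteDimensional ℂ A] {a : ι → A}

/-- A frame in another module defines a homomorphism. -/
theorem exists_hom (h : IsGlued D M v) (ha : IsFrame D a) :
    ∃ φ : M.obj →ₗ[LU p] A, ∀ i, φ (v i 0 0) = a i := by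
  have hspan : (⊤ : Submodule ℂ M.obj) ≤ Submodule.span ℂ (Set.range fun x : D.Idx =>
      v x.1.1 x.1.2.1 x.1.2.2) := by
    rw [← h.basis.span_eq_top, Submodule.span_le]
    rintro _ ⟨i, n, m, rfl⟩
    by_cases h0 : D.InRange i n m
    · exact Submodule.subset_span ⟨⟨(i, n, m), h0⟩, rfl⟩
    · rw [h.basis.eq_zero i n m h0]; exact Submodule.zero_mem _
  obtain ⟨B, hB⟩ : ∃ B : Basis D.Idx ℂ M.obj, ∀ i n m (h0 : D.InRange i n m),
      B ⟨(i, n, m), h0⟩ = v i n m :=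
    ⟨Basis.mk h.basis.linearIndependent hspan, fun i n m h0 => Basis.mk_apply _ _ _⟩
  obtain ⟨φ, hφ'⟩ : ∃ φ : M.obj →ₗ[ℂ] A, ∀ x, φ (B x) =
      bz p (D.s x.1.1) (D.r x.1.1) x.1.2.1 x.1.2.2 (a x.1.1) :=
    ⟨B.constr ℂ _, fun x => B.constr_basis ℂ _ x⟩
  have hφ : ∀ i n m, φ (v i n m) = bz p (D.s i) (D.r i) n m (a i) := by
    intro i n m
    by_cases h0 : D.InRange i n m
    · rw [← hB i n m h0, hφ']
    · rw [h.basis.eq_zero i n m h0, map_zero]; exact (if_neg h0).symm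
  have hG := ha.glueFormula
  have hgen : ∀ g : Gen, g ≠ .Kinv → ∀ w, φ (gen p g • w) = gen p g • φ w := by
    intro g hg w
    have : φ ∘ₗ act M.obj (gen p g) = act A (gen p g) ∘ₗ φ := by
      refine B.ext fun ⟨⟨i, n, m⟩, h0⟩ => ?_
      rw [hB]
      change φ (gen p g • v i n m) = gen p g • φ (v i n m)
      rw [hφ]
      cases g with
      | E =>
        rw [h.formula.E i n m h0, hG.E i n m h0, Glue.formE, Glue.formE]
        split_ifs <;> simp only [map_smul, map_add, map_sub, hφ]
      | F =>
        rw [h.formula.F i n m h0, hG.F i n m h0, Glue.formF, Glue.formF]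
        split_ifs <;> simp only [map_smul, map_add, hφ]
      | K => rw [h.basis.smul_K, map_smul, hφ, K_bz (D.le i) (ha.mem i), kVal]
      | Kinv => exact absurd rfl hg
      | e => rw [h.basis.smul_e, map_smul, hφ, e_bz (D.le i) (ha.mem i)]
      | f => rw [h.basis.smul_f _ _ _ h0.2.2.1, hφ, f_bz (D.le i) (ha.mem i) _ _ h0.2.2.1]
      | h => rw [h.basis.smul_h, map_smul, hφ, h_bz (D.le i) (ha.mem i)]
    exact LinearMap.congr_fun this w
  have hall : ∀ (g : Gen) w, φ (gen p g • w) = gen p g • φ w := by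
    intro g w
    by_cases hg : g = .Kinv
    · have h3 := hgen .K (by simp) (gKi • w)
      rw [K_Kinv_smul] at h3
      rw [hg, h3, Kinv_K_smul]
    · exact hgen g hg w
  refine ⟨{ φ with map_smul' := fun x w => map_smul_of_gen φ hall x w }, fun i => ?_⟩
  have := hφ i 0 0
  by_cases hr : 1 ≤ D.r i
  · rw [bz_zero_zero (D.one_le i) (D.le i) (ha.mem i)] at this
    exact this
  · have h3 : a i = 0 := by
      by_contra h3
      have := r_pos_of_ne_zero (ha.mem i) h3
      omega
    rw [h3, bz, if_neg (by omega)] at *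
    exact this

end IsGlued

theorem injective_of_hw {A B : Type*} [AddCommGroup A] [Module (LU p) A] [Module ℂ A]
    [IsScalarTower ℂ (LU p) A] [FiniteDimensional ℂ A] [AddCommGroup B] [Module (LU p) B]
    [Module ℂ B] [IsScalarTower ℂ (LU p) B] (φ : A →ₗ[LU p] B)
    (h : ∀ (α : ℤˣ) (s r : ℤ), 1 ≤ s → s ≤ p → ∀ u ∈ hw (p := p) A α s r, φ u = 0 → u = 0) :
    Function.Injective φ := by
  rw [← LinearMap.ker_eq_bot]
  by_contra hne
  have := Submodule.nontrivial_iff_ne_bot.2 hne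
  obtain ⟨α, s, r, u, h1, h2, hu, h0⟩ := exists_hw_ne_zero (p := p) (M := LinearMap.ker φ)
  exact h0 (Subtype.ext (h α s r h1 h2 u (map_hw (LinearMap.ker φ).subtype hu) u.2))

/-- An isomorphic module has the same gluing data. -/
theorem IsGlued.of_equiv {N : FinRep p} (h : IsGlued D M v) (e : M.obj ≃ₗ[LU p] N.obj) :
    IsGlued D N (fun i n m => e (v i n m)) := by
  have hc : ∀ (c : ℂ) (w : M.obj), e (c • w) = c • e w := fun c w =>
    map_complex_smul e.toLinearMap c w
  refine ⟨⟨fun i n m h0 => ?_, ?_, ?_, fun i n m => ?_, fun i n m => ?_, fun i n m => ?_,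
    fun i n m hm => ?_⟩, ⟨fun i n m h0 => ?_, fun i n m h0 => ?_⟩⟩
  · simp only [h.basis.eq_zero i n m h0, map_zero]
  · exact h.basis.linearIndependent.map' (e.restrictScalars ℂ).toLinearMap (e.restrictScalars ℂ).ker
  · have := congrArg (Submodule.map (e.restrictScalars ℂ).toLinearMap) h.basis.span_eq_top
    rw [Submodule.map_span, Submodule.map_top, LinearEquiv.range] at this
    rw [← this]
    congr 1
    ext w
    constructor
    · rintro ⟨i, n, m, rfl⟩; exact ⟨_, ⟨i, n, m, rfl⟩, rfl⟩
    · rintro ⟨_, ⟨i, n, m, rfl⟩, rfl⟩; exact ⟨i, n, m, rfl⟩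
  · rw [← e.map_smul, h.basis.smul_K, hc]
  · rw [← e.map_smul, h.basis.smul_h, hc]
  · rw [← e.map_smul, h.basis.smul_e, hc]
  · rw [← e.map_smul, h.basis.smul_f _ _ _ hm]
  · rw [← e.map_smul, h.formula.E i n m h0, Glue.formE, Glue.formE]
    split_ifs <;> simp only [hc, map_add, map_sub]
  · rw [← e.map_smul, h.formula.F i n m h0, Glue.formF, Glue.formF]
    split_ifs <;> simp only [hc, map_add]

/-- A module with a frame that is a basis of the space of highest weight vectors has the gluing
data of the frame. -/
theorem IsGlued.exists_of_isFrame {N : FinRep p} (h : IsGlued D M v) {a : ι → N.obj}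
    (ha : IsFrame D a)
    (hinj : ∀ φ : M.obj →ₗ[LU p] N.obj, (∀ i, φ (v i 0 0) = a i) → ∀ (α : ℤˣ) (s r : ℤ), 1 ≤ s →
      s ≤ p → ∀ u ∈ hw (p := p) M.obj α s r, φ u = 0 → u = 0)
    (hsurj : genSub ha.isStableFamily = ⊤) : ∃ w, IsGlued D N w := by
  obtain ⟨φ, hφ⟩ := h.exists_hom ha
  have h1 : Function.Injective φ := injective_of_hw φ (hinj φ hφ)
  have h2 : Function.Surjective φ := by
    rw [← LinearMap.range_eq_top, eq_top_iff, ← hsurj]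
    refine genSub_le _ fun α s r _ _ u hu => ?_
    have : spanFamily D.α D.s D.r a α s r ≤ (LinearMap.range φ).restrictScalars ℂ := by
      rw [spanFamily, Submodule.span_le]
      rintro _ ⟨i, -, -, -, rfl⟩
      exact ⟨_, hφ i⟩
    exact this hu
  exact ⟨_, h.of_equiv (LinearEquiv.ofBijective φ ⟨h1, h2⟩)⟩

end Glued

/-! ### The gluing data of the modules in the classification -/

section Shapes

theorem Glue.finite_idx {ι : Type} (D : Glue p ι) {S : Set ι} (hS : S.Finite) (R : ℤ)
    (h : ∀ i, 1 ≤ D.r i → i ∈ S ∧ D.r i ≤ R) : Finite D.Idx := by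
  have hf : {x : ι × ℤ × ℤ | D.InRange x.1 x.2.1 x.2.2}.Finite := by
    refine (hS.prod ((Set.finite_Ico (0 : ℤ) p).prod (Set.finite_Ico (0 : ℤ) R))).subset ?_
    rintro ⟨i, n, m⟩ ⟨h1, h2, h3, h4⟩
    dsimp only at h1 h2 h3 h4
    obtain ⟨h5, h6⟩ := h i (by omega)
    have := D.le i
    exact ⟨h5, ⟨h1, by dsimp only; omega⟩, h3, by dsimp only; omega⟩
  exact hf.to_subtype

/-- The gluing data of `X^α_{s,r}`. -/
def glueX (α : ℤˣ) (s r : ℕ) (h1 : 1 ≤ s) (h2 : s ≤ p) : Glue p Unit where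
  α _ := α
  s _ := s
  r _ := r
  σ := id
  τ := id
  a _ := 0
  b _ := 0
  one_le _ := by exact_mod_cast h1
  le _ := by exact_mod_cast h2
  label_σ _ h := absurd rfl h
  label_τ _ h := absurd rfl h
  aa _ := by simp
  bb _ := by simp
  ab _ _ := by simp

theorem isX_iff {α : ℤˣ} {s r : ℕ} (h1 : 1 ≤ s) (h2 : s ≤ p) {M : FinRep p} :
    IsX α s r M ↔ ∃ v, IsGlued (glueX α s r h1 h2) M v := by
  have hE : ∀ (v : Unit → ℤ → ℤ → M.obj) n m, (glueX α s r h1 h2).formE v () n m =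
      (((α : ℤ) : ℂ) * qInt p n * qInt p (s - n)) • v () (n - 1) m := by
    intro v n m
    simp only [Glue.formE, glueX]
    split_ifs with h0 <;> simp [h0, qInt_zero]
  have hF : ∀ (v : Unit → ℤ → ℤ → M.obj),
      IsLayeredBasis M (fun _ => α) (fun _ => (s : ℤ)) (fun _ => r) v →
      ∀ n m, (glueX α s r h1 h2).formF v () n m = v () (n + 1) m := by
    intro v hb n m
    rw [Glue.formF]
    by_cases h0 : n = s - 1
    · refine (if_pos h0).trans ?_
      rw [hb.eq_zero _ (n + 1) _ (by omega)]; simp [glueX]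
    · exact if_neg h0
  exact exists_congr fun v => ⟨fun ⟨hb, h⟩ => ⟨hb,
    ⟨fun i n m hr => (h n m hr.1 hr.2.1 hr.2.2.1 hr.2.2.2).1.trans (hE v n m).symm,
      fun i n m hr => (h n m hr.1 hr.2.1 hr.2.2.1 hr.2.2.2).2.trans (hF v hb n m).symm⟩⟩,
    fun ⟨hb, h⟩ => ⟨hb, fun n m hn hn' hm hm' => ⟨(h.E () n m ⟨hn, hn', hm, hm'⟩).trans (hE v n m),
      (h.F () n m ⟨hn, hn', hm, hm'⟩).trans (hF v hb n m)⟩⟩⟩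

/-- The gluing data of `P^α_{s,r}`. -/
def glueP (α : ℤˣ) (s r : ℕ) (h1 : 1 ≤ s) (h2 : s < p) : Glue p Corner where
  α := Corner.sign α
  s := Corner.fst p s
  r := Corner.snd r
  σ
    | .top => .right
    | .left => .bot
    | _ => .top
  τ
    | .top => .left
    | .right => .bot
    | _ => .top
  a
    | .top => (r : ℂ)⁻¹
    | .left => 1
    | _ => 0
  b
    | .top => -(r : ℂ)⁻¹
    | .right => 1
    | _ => 0
  one_le i := by cases i <;> simp only [Corner.fst] <;> omega
  le i := by cases i <;> simp only [Corner.fst] <;> omega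
  label_σ i h := by
    cases i <;> simp at h <;>
    refine ⟨by simp only [Corner.fst]; omega, by simp [Corner.sign], by simp [Corner.fst],
      by simp [Corner.snd]⟩
  label_τ i h := by
    cases i <;> simp at h <;>
    refine ⟨by simp only [Corner.fst]; omega, by simp [Corner.sign], by simp [Corner.fst],
      by simp [Corner.snd]⟩
  aa i := by cases i <;> simp
  bb i := by cases i <;> simp
  ab i _ := by cases i <;> simp

theorem isP_iff {α : ℤˣ} {s r : ℕ} (h1 : 1 ≤ s) (h2 : s < p) (hr : 1 ≤ r) {M : FinRep p} :
    IsP α s r M ↔ ∃ v, IsGlued (glueP α s r h1 h2) M v := by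
  have hr0 : (r : ℂ) ≠ 0 := by exact_mod_cast (by omega : r ≠ 0)
  have g1 : gz p s = gConst p s := by simp [gz]
  have : Fact (2 ≤ p) := ⟨by omega⟩
  have g2 : gz p (p - s) = gConst p s := by rw [gz_neg (by omega) (by omega), g1]
  have e1 : (p : ℤ) - (p - s) - 1 = s - 1 := by ring
  have e2 : (p : ℤ) - s - 1 - 0 = p - s - 1 := by ring
  have hE : ∀ (v : Corner → ℤ → ℤ → M.obj) n m,
      ((glueP α s r h1 h2).formE v .top n m = if n = 0 then
          (((α : ℤ) : ℂ) * gConst p s * ((r - m : ℤ) : ℂ) / r) • v .right (p - s - 1) m +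
          (((α : ℤ) : ℂ) * gConst p s * (m : ℂ) / r) • v .left (p - s - 1) (m - 1)
        else (((α : ℤ) : ℂ) * qInt p n * qInt p (s - n)) • v .top (n - 1) m +
          (((α : ℤ) : ℂ) * gConst p s) • v .bot (n - 1) m) ∧
      ((glueP α s r h1 h2).formE v .left n m = if n = 0 then
          (((α : ℤ) : ℂ) * gConst p s * ((m - r + 1 : ℤ) : ℂ)) • v .bot (s - 1) m
        else (-((α : ℤ) : ℂ) * qInt p n * qInt p (p - s - n)) • v .left (n - 1) m) ∧
      ((glueP α s r h1 h2).formE v .right n m = if n = 0 then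
          (((α : ℤ) : ℂ) * gConst p s * (m : ℂ)) • v .bot (s - 1) (m - 1)
        else (-((α : ℤ) : ℂ) * qInt p n * qInt p (p - s - n)) • v .right (n - 1) m) ∧
      (glueP α s r h1 h2).formE v .bot n m =
        (((α : ℤ) : ℂ) * qInt p n * qInt p (s - n)) • v .bot (n - 1) m := by
    intro v n m
    simp only [Glue.formE, glueP, Corner.fst, Corner.snd, Corner.sign, g1, g2, e1]
    refine ⟨?_, ?_, ?_, ?_⟩
    · refine if_congr Iff.rfl ?_ ?_
      · push_cast
        rw [smul_sub, smul_smul, smul_smul, sub_eq_add_neg, ← neg_smul]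
        congr 2 <;> ring
      · congr 2
        push_cast
        field_simp
    · refine if_congr Iff.rfl ?_ ?_
      · push_cast
        rw [mul_zero, zero_smul, sub_zero, smul_smul]
        congr 1; ring
      · simp
    · refine if_congr Iff.rfl ?_ ?_
      · push_cast
        rw [mul_zero, zero_smul, zero_sub, ← neg_smul, smul_smul]
        congr 1; ring
      · simp
    · split_ifs with h0 <;> simp [h0, qInt_zero]
  have hF : ∀ (v : Corner → ℤ → ℤ → M.obj),
      IsLayeredBasis M (Corner.sign α) (Corner.fst p s) (Corner.snd r) v → ∀ n m,
      ((glueP α s r h1 h2).formF v .top n m = if n = s - 1 then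
          (r : ℂ)⁻¹ • v .right 0 (m + 1) - (r : ℂ)⁻¹ • v .left 0 m else v .top (n + 1) m) ∧
      ((glueP α s r h1 h2).formF v .left n m =
        if n = p - s - 1 then v .bot 0 (m + 1) else v .left (n + 1) m) ∧
      ((glueP α s r h1 h2).formF v .right n m =
        if n = p - s - 1 then v .bot 0 m else v .right (n + 1) m) ∧
      (glueP α s r h1 h2).formF v .bot n m = v .bot (n + 1) m := by
    intro v hb n m
    simp only [Glue.formF, glueP, Corner.fst]
    refine ⟨?_, ?_, ?_, ?_⟩
    · refine if_congr Iff.rfl ?_ rfl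
      rw [neg_smul, sub_eq_add_neg]
    · exact if_congr Iff.rfl (by simp) rfl
    · exact if_congr Iff.rfl (by simp) rfl
    · by_cases h0 : n = s - 1
      · rw [hb.eq_zero .bot (n + 1) _ (by simp only [Corner.fst]; omega)]; simp
      · exact if_neg h0
  refine exists_congr fun v => ⟨fun ⟨hb, ht, hl, hr', hbot⟩ =>
    ⟨hb, ⟨fun i n m ⟨a1, a2, a3, a4⟩ => ?_, fun i n m ⟨a1, a2, a3, a4⟩ => ?_⟩⟩, fun ⟨hb, h⟩ => ?_⟩
  · obtain ⟨b1, b2, b3, b4⟩ := hE v n m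
    cases i
    · rw [b1]; exact (ht n m a1 a2 a3 a4).1
    · rw [b4]; exact (hbot n m a1 a2 a3 a4).1
    · rw [b2]; exact (hl n m a1 a2 a3 a4).1
    · rw [b3]; exact (hr' n m a1 a2 a3 a4).1
  · obtain ⟨b1, b2, b3, b4⟩ := hF v hb n m
    cases i
    · rw [b1]; exact (ht n m a1 a2 a3 a4).2
    · rw [b4]; exact (hbot n m a1 a2 a3 a4).2
    · rw [b2]; exact (hl n m a1 a2 a3 a4).2
    · rw [b3]; exact (hr' n m a1 a2 a3 a4).2
  · refine ⟨hb, fun n m a1 a2 a3 a4 => ?_, fun n m a1 a2 a3 a4 => ?_, fun n m a1 a2 a3 a4 => ?_,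
      fun n m a1 a2 a3 a4 => ?_⟩
    · rw [← (hE v n m).1, ← (hF v hb n m).1]
      exact ⟨h.E .top n m ⟨a1, a2, a3, a4⟩, h.F .top n m ⟨a1, a2, a3, a4⟩⟩
    · rw [← (hE v n m).2.1, ← (hF v hb n m).2.1]
      exact ⟨h.E .left n m ⟨a1, a2, a3, a4⟩, h.F .left n m ⟨a1, a2, a3, a4⟩⟩
    · rw [← (hE v n m).2.2.1, ← (hF v hb n m).2.2.1]
      exact ⟨h.E .right n m ⟨a1, a2, a3, a4⟩, h.F .right n m ⟨a1, a2, a3, a4⟩⟩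
    · rw [← (hE v n m).2.2.2, ← (hF v hb n m).2.2.2]
      exact ⟨h.E .bot n m ⟨a1, a2, a3, a4⟩, h.F .bot n m ⟨a1, a2, a3, a4⟩⟩

theorem zigzagSign_succ (α : ℤˣ) (j : ℤ) : zigzagSign α (j + 1) = -zigzagSign α j := by
  unfold zigzagSign
  by_cases h : Even j
  · rw [if_pos h, if_neg (by simpa [Int.even_add_one] using h)]
  · rw [if_neg h, if_pos (by simpa [Int.even_add_one] using h)]; simp

theorem zigzagFst_succ (p s : ℕ) (j : ℤ) : zigzagFst p s (j + 1) = p - zigzagFst p s j := by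
  unfold zigzagFst
  by_cases h : Even j
  · rw [if_pos h, if_neg (by simpa [Int.even_add_one] using h)]
  · rw [if_neg h, if_pos (by simpa [Int.even_add_one] using h)]; simp

theorem zigzagSign_pred (α : ℤˣ) (j : ℤ) : zigzagSign α (j - 1) = -zigzagSign α j := by
  have := zigzagSign_succ α (j - 1)
  rw [sub_add_cancel] at this
  rw [this, neg_neg]

theorem zigzagFst_pred (p s : ℕ) (j : ℤ) : zigzagFst p s (j - 1) = p - zigzagFst p s j := by
  have := zigzagFst_succ p s (j - 1)
  rw [sub_add_cancel] at this
  omega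

/-- The gluing data of the zigzag modules. -/
def glueZ (α : ℤˣ) (s r l : ℕ) (top : ℤ → Prop) [DecidablePred top]
    (htop : ∀ j, top (j + 1) ↔ ¬ top j) (h1 : 1 ≤ s) (h2 : s < p) : Glue p ℤ where
  α := zigzagSign α
  s := zigzagFst p s
  r := zigzagSnd r l
  σ j := j + 1
  τ j := j - 1
  a j := if top j ∧ 0 ≤ j ∧ j + 1 < l then 1 else 0
  b j := if top j ∧ 1 ≤ j ∧ j < l then 1 else 0
  one_le j := by unfold zigzagFst; split_ifs <;> omega
  le j := by unfold zigzagFst; split_ifs <;> omega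
  label_σ j h := by
    simp only [ne_eq, ite_eq_right_iff, not_forall] at h
    obtain ⟨h, -⟩ := h
    refine ⟨by unfold zigzagFst; split_ifs <;> omega, zigzagSign_succ α j, zigzagFst_succ p s j, ?_⟩
    rw [zigzagSnd, zigzagSnd, if_pos (by omega), if_pos (by omega)]
    ring
  label_τ j h := by
    simp only [ne_eq, ite_eq_right_iff, not_forall] at h
    obtain ⟨h, -⟩ := h
    refine ⟨by unfold zigzagFst; split_ifs <;> omega, zigzagSign_pred α j, zigzagFst_pred p s j, ?_⟩
    rw [zigzagSnd, zigzagSnd, if_pos (by omega), if_pos (by omega)]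
    ring
  aa j := by have := htop j; split_ifs <;> simp_all
  bb j := by have := htop (j - 1); rw [sub_add_cancel] at this; split_ifs <;> simp_all
  ab j _ := by
    have h3 := htop j
    have h4 := htop (j - 1)
    rw [sub_add_cancel] at h4
    left
    constructor <;> split_ifs <;> simp_all

theorem isZigzag_iff {α : ℤˣ} {s r l : ℕ} {top : ℤ → Prop} [DecidablePred top]
    (htop : ∀ j, top (j + 1) ↔ ¬ top j) (h1 : 1 ≤ s) (h2 : s < p) {M : FinRep p} :
    IsZigzag α s r l top M ↔ ∃ v, IsGlued (glueZ α s r l top htop h1 h2) M v := by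
  have : Fact (2 ≤ p) := ⟨by omega⟩
  have g1 : ∀ j : ℤ, gz p (zigzagFst p s j) = gConst p s := by
    intro j
    have e1 : gz p s = gConst p s := by simp [gz]
    unfold zigzagFst
    split_ifs
    · exact e1
    · rw [gz_neg (by omega) (by omega), e1]
  have hab : ∀ j : ℤ, (glueZ α s r l top htop h1 h2).a j * (glueZ α s r l top htop h1 h2).b (j + 1) = 0 := by
    intro j
    have h3 := htop j
    simp only [glueZ]
    split_ifs <;> simp_all
  have hz : ∀ (v : ℤ → ℤ → ℤ → M.obj),
      IsLayeredBasis M (zigzagSign α) (zigzagFst p s) (zigzagSnd r l) v → ∀ j n m : ℤ,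
      ¬ (0 ≤ j ∧ j < l) → v j n m = 0 := by
    intro v hb j n m hj
    exact hb.eq_zero j n m (by rw [zigzagSnd, if_neg hj]; omega)
  have hA : ∀ (v : ℤ → ℤ → ℤ → M.obj),
      IsLayeredBasis M (zigzagSign α) (zigzagFst p s) (zigzagSnd r l) v → ∀ j n m : ℤ,
      0 ≤ j → j < l → (glueZ α s r l top htop h1 h2).a j • v (j + 1) n m =
        (if top j then v (j + 1) n m else 0) ∧
      (glueZ α s r l top htop h1 h2).b j • v (j - 1) n m =
        (if top j then v (j - 1) n m else 0) := by
    intro v hb j n m hj hl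
    simp only [glueZ]
    constructor
    · by_cases h3 : j + 1 < l
      · simp [hj, h3, ite_smul]
      · simp [hz v hb (j + 1) n m (by omega)]
    · by_cases h3 : 1 ≤ j
      · simp [hl, h3, ite_smul]
      · simp [hz v hb (j - 1) n m (by omega)]
  have hE : ∀ (v : ℤ → ℤ → ℤ → M.obj),
      IsLayeredBasis M (zigzagSign α) (zigzagFst p s) (zigzagSnd r l) v → ∀ j n m : ℤ,
      0 ≤ j → j < l → (glueZ α s r l top htop h1 h2).formE v j n m =
        (((zigzagSign α j : ℤ) : ℂ) * qInt p n * qInt p (zigzagFst p s j - n)) • v j (n - 1) m +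
        (if n = 0 ∧ top j then
          (((zigzagSign α j : ℤ) : ℂ) * gConst p s) •
            (((r + j - m : ℤ) : ℂ) • v (j + 1) (zigzagFst p s (j + 1) - 1) m -
              (m : ℂ) • v (j - 1) (zigzagFst p s (j - 1) - 1) (m - 1))
        else 0) := by
    intro v hb j n m hj hl
    rw [Glue.formE]
    split_ifs with h3 h4 h4
    · obtain ⟨a1, -⟩ := hA v hb j (p - zigzagFst p s j - 1) m hj hl
      obtain ⟨-, a2⟩ := hA v hb j (p - zigzagFst p s j - 1) (m - 1) hj hl
      rw [mul_smul (_ - _), mul_smul (m : ℂ)]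
      change (((zigzagSign α j : ℤ) : ℂ) * gz p (zigzagFst p s j)) •
        ((((zigzagSnd r l j : ℤ) : ℂ) - m) • (glueZ α s r l top htop h1 h2).a j •
          v (j + 1) (p - zigzagFst p s j - 1) m - (m : ℂ) • (glueZ α s r l top htop h1 h2).b j •
          v (j - 1) (p - zigzagFst p s j - 1) (m - 1)) = _
      rw [a1, a2, if_pos h4.2, if_pos h4.2, g1, zigzagFst_succ, zigzagFst_pred, zigzagSnd,
        if_pos ⟨hj, hl⟩, h3, qInt_zero]
      push_cast
      simp
    · obtain ⟨a1, -⟩ := hA v hb j (p - zigzagFst p s j - 1) m hj hl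
      obtain ⟨-, a2⟩ := hA v hb j (p - zigzagFst p s j - 1) (m - 1) hj hl
      rw [mul_smul (_ - _), mul_smul (m : ℂ)]
      change (((zigzagSign α j : ℤ) : ℂ) * gz p (zigzagFst p s j)) •
        ((((zigzagSnd r l j : ℤ) : ℂ) - m) • (glueZ α s r l top htop h1 h2).a j •
          v (j + 1) (p - zigzagFst p s j - 1) m - (m : ℂ) • (glueZ α s r l top htop h1 h2).b j •
          v (j - 1) (p - zigzagFst p s j - 1) (m - 1)) = _
      have h5 : ¬ top j := fun h => h4 ⟨h3, h⟩
      rw [a1, a2, if_neg h5, if_neg h5, h3, qInt_zero]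
      simp
    · exact absurd h4.1 h3
    · rw [show (glueZ α s r l top htop h1 h2).σ j = j + 1 from rfl, hab, mul_zero, zero_smul]
      rfl
  have hF : ∀ (v : ℤ → ℤ → ℤ → M.obj),
      IsLayeredBasis M (zigzagSign α) (zigzagFst p s) (zigzagSnd r l) v → ∀ j n m : ℤ,
      0 ≤ j → j < l → (glueZ α s r l top htop h1 h2).formF v j n m = v j (n + 1) m +
        (if n = zigzagFst p s j - 1 ∧ top j then v (j + 1) 0 (m + 1) + v (j - 1) 0 m else 0) := by
    intro v hb j n m hj hl
    rw [Glue.formF, show (glueZ α s r l top htop h1 h2).s j = zigzagFst p s j from rfl]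
    by_cases h3 : n = zigzagFst p s j - 1
    · rw [if_pos h3, hb.eq_zero j (n + 1) m (by omega)]
      change (glueZ α s r l top htop h1 h2).a j • v (j + 1) 0 (m + 1) +
        (glueZ α s r l top htop h1 h2).b j • v (j - 1) 0 m = _
      rw [(hA v hb j 0 (m + 1) hj hl).1, (hA v hb j 0 m hj hl).2]
      split_ifs with h4 h5 h5
      · simp
      · exact absurd ⟨h3, h4⟩ h5
      · exact absurd h5.2 h4
      · simp
    · rw [if_neg h3, if_neg (fun h => h3 h.1), add_zero]
  have hR : ∀ j n m : ℤ, (glueZ α s r l top htop h1 h2).InRange j n m ↔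
      0 ≤ j ∧ j < l ∧ 0 ≤ n ∧ n < zigzagFst p s j ∧ 0 ≤ m ∧ m < r + j := by
    intro j n m
    simp only [Glue.InRange, glueZ, zigzagSnd]
    split_ifs <;> omega
  refine exists_congr fun v => ⟨fun ⟨hb, h⟩ => ⟨hb, ⟨fun j n m hr => ?_, fun j n m hr => ?_⟩⟩,
    fun ⟨hb, h⟩ => ⟨hb, fun j n m a1 a2 a3 a4 a5 a6 => ?_⟩⟩
  · obtain ⟨a1, a2, a3, a4, a5, a6⟩ := (hR j n m).1 hr
    rw [hE v hb j n m a1 a2]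
    exact (h j n m a1 a2 a3 a4 a5 a6).1
  · obtain ⟨a1, a2, a3, a4, a5, a6⟩ := (hR j n m).1 hr
    rw [hF v hb j n m a1 a2]
    exact (h j n m a1 a2 a3 a4 a5 a6).2
  · have hr := (hR j n m).2 ⟨a1, a2, a3, a4, a5, a6⟩
    rw [← hE v hb j n m a1 a2, ← hF v hb j n m a1 a2]
    exact ⟨h.E j n m hr, h.F j n m hr⟩

end Shapes

/-! ### Diamonds and strings -/

section Strings

theorem exists_isX {p : ℕ} [Fact (2 ≤ p)] (α : ℤˣ) {s : ℕ} (r : ℕ) (h1 : 1 ≤ s) (h2 : s ≤ p) :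
    ∃ (M : FinRep p) (v : _), IsGlued (glueX α s r h1 h2) M v := by
  have := (glueX α s r h1 h2).finite_idx Set.finite_univ r fun i _ => ⟨trivial, le_rfl⟩
  obtain ⟨M, v, h, h'⟩ := (glueX α s r h1 h2).exists_module
  exact ⟨M, v, h, h'⟩

theorem exists_isP {p : ℕ} [Fact (2 ≤ p)] (α : ℤˣ) {s : ℕ} (r : ℕ) (h1 : 1 ≤ s) (h2 : s < p) :
    ∃ (M : FinRep p) (v : _), IsGlued (glueP α s r h1 h2) M v := by
  have hC : (Set.univ : Set Corner).Finite := by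
    refine (Set.toFinite {Corner.top, .bot, .left, .right}).subset fun i _ => ?_
    cases i <;> simp
  have := (glueP α s r h1 h2).finite_idx hC (r + 1) fun i _ => ⟨trivial, by
    cases i <;> simp [glueP, Corner.snd]; try omega⟩
  obtain ⟨M, v, h, h'⟩ := (glueP α s r h1 h2).exists_module
  exact ⟨M, v, h, h'⟩

section

variable (α : ℤˣ) {s : ℕ} (r l : ℕ) {top : ℤ → Prop} [DecidablePred top]

theorem exists_isZigzag [Fact (2 ≤ p)] (htop : ∀ j, top (j + 1) ↔ ¬ top j) (h1 : 1 ≤ s)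
    (h2 : s < p) : ∃ (M : FinRep p) (v : _), IsGlued (glueZ α s r l top htop h1 h2) M v := by
  have := (glueZ α s r l top htop h1 h2).finite_idx (Set.finite_Ico (0 : ℤ) l) (r + l) fun j hj => by
    simp only [glueZ, zigzagSnd] at hj ⊢
    split_ifs at hj ⊢ with h
    · exact ⟨h, by omega⟩
    · omega
  obtain ⟨M, v, h, h'⟩ := (glueZ α s r l top htop h1 h2).exists_module
  exact ⟨M, v, h, h'⟩

end

variable {M : Type*} [AddCommGroup M] [Module (LU p) M] [Module ℂ M]
  [IsScalarTower ℂ (LU p) M]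

/-- The highest weight vectors `u j`, `0 ≤ j < l`, form bases of all the spaces of highest weight
vectors; those with `top j` are mapped to their neighbours by `xop` and `yop`, and the others to
zero. -/
structure IsString (α : ℤˣ) (s r l : ℕ) (top : ℤ → Prop) (u : ℤ → M) : Prop where
  mem : ∀ j : ℤ, 0 ≤ j → j < l → u j ∈ hw (p := p) M (zigzagSign α j) (zigzagFst p s j) (r + j)
  ne_zero : ∀ j : ℤ, 0 ≤ j → j < l → u j ≠ 0
  eq_zero : ∀ j : ℤ, ¬ (0 ≤ j ∧ j < l) → u j = 0
  hw_le : ∀ (β : ℤˣ) (t k : ℤ), 1 ≤ t → t ≤ p → ∀ w ∈ hw (p := p) M β t k, w ≠ 0 → ∃ j : ℤ, 0 ≤ j ∧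
    j < l ∧ zigzagSign α j = β ∧ zigzagFst p s j = t ∧ r + j = k ∧ ∃ c : ℂ, w = c • u j
  x_top : ∀ j : ℤ, 0 ≤ j → j < l → top j → xop p (zigzagFst p s j) (r + j) (u j) = u (j + 1)
  y_top : ∀ j : ℤ, 0 ≤ j → j < l → top j → yop p (zigzagFst p s j) (r + j) (u j) = u (j - 1)
  x_not : ∀ j : ℤ, 0 ≤ j → j < l → ¬ top j → xop p (zigzagFst p s j) (r + j) (u j) = 0
  y_not : ∀ j : ℤ, 0 ≤ j → j < l → ¬ top j → yop p (zigzagFst p s j) (r + j) (u j) = 0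

/-- The highest weight vectors `t, x t, y t, y x t` form bases of all the spaces of highest weight
vectors. -/
structure IsDiamond (α : ℤˣ) (s r : ℕ) (t : M) : Prop where
  mem : t ∈ hw (p := p) M α s r
  ne_zero : yop p (p - s) (r + 1) (xop p s r t) ≠ 0
  hw_le : ∀ (β : ℤˣ) (k l : ℤ), 1 ≤ k → k ≤ p → ∀ w ∈ hw (p := p) M β k l, w ≠ 0 →
    (β = α ∧ k = s ∧ l = r ∧ ∃ c d : ℂ, w = c • t + d • yop p (p - s) (r + 1) (xop p s r t)) ∨
    (β = -α ∧ k = p - s ∧ l = r + 1 ∧ ∃ c : ℂ, w = c • xop p s r t) ∨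
    (β = -α ∧ k = p - s ∧ l = r - 1 ∧ ∃ c : ℂ, w = c • yop p s r t)

theorem zigzagFst_bounds {s : ℕ} (h1 : 1 ≤ s) (h2 : s < p) (j : ℤ) :
    1 ≤ zigzagFst p s j ∧ zigzagFst p s j < p := by
  unfold zigzagFst; split_ifs <;> omega

theorem sub_sub_self_int (a b : ℤ) : a - (a - b) = b := by ring

variable [hp : Fact (2 ≤ p)] {α : ℤˣ} {s r l : ℕ} {top : ℤ → Prop} [DecidablePred top]

theorem IsGlued.isString (htop : ∀ j, top (j + 1) ↔ ¬ top j) (h1 : 1 ≤ s) (h2 : s < p) (hr : 1 ≤ r) {M : FinRep p}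
    {v : ℤ → ℤ → ℤ → M.obj} (h : IsGlued (glueZ α s r l top htop h1 h2) M v) :
    IsString (p := p) α s r l top (fun j => v j 0 0) := by
  have hs : ∀ {j : ℤ}, 0 ≤ j → j < l → zigzagSnd r l j = r + j := fun a b => if_pos ⟨a, b⟩
  have h0 : ∀ j : ℤ, ¬ (0 ≤ j ∧ j < l) → v j 0 0 = 0 := fun j hj =>
    h.basis.eq_zero j 0 0 fun ⟨_, _, _, h'⟩ => by
      have : (0 : ℤ) < zigzagSnd r l j := h'
      rw [zigzagSnd, if_neg hj] at this
      omega
  have hF := h.isFrame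
  have hx : ∀ j : ℤ, 0 ≤ j → j < l → xop p (zigzagFst p s j) (r + j) (v j 0 0) =
      (glueZ α s r l top htop h1 h2).a j • v (j + 1) 0 0 := fun j a b => by
    rw [← hs a b]
    exact hF.hx j (by change 1 ≤ zigzagSnd r l j; rw [hs a b]; omega) (zigzagFst_bounds h1 h2 j).2
  have hy : ∀ j : ℤ, 0 ≤ j → j < l → yop p (zigzagFst p s j) (r + j) (v j 0 0) =
      (glueZ α s r l top htop h1 h2).b j • v (j - 1) 0 0 := fun j a b => by
    rw [← hs a b]
    exact hF.hy j (by change 1 ≤ zigzagSnd r l j; rw [hs a b]; omega) (zigzagFst_bounds h1 h2 j).2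
  refine ⟨fun j a b => ?_, fun j a b => ?_, h0, fun β t k k1 k2 w hw hw0 => ?_,
    fun j a b ht => ?_, fun j a b ht => ?_, fun j a b ht => ?_, fun j a b ht => ?_⟩
  · have := h.mem_hw j
    rwa [show (glueZ α s r l top htop h1 h2).r j = r + j from hs a b] at this
  · have hi : (glueZ α s r l top htop h1 h2).InRange j 0 0 := by
      refine ⟨le_rfl, (zigzagFst_bounds h1 h2 j).1, le_rfl, ?_⟩
      change (0 : ℤ) < zigzagSnd r l j
      rw [hs a b]; omega
    exact h.basis.linearIndependent.ne_zero ⟨(j, 0, 0), hi⟩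
  · have hm := h.hw_le k1 k2 hw
    by_cases hl : 0 ≤ k - r ∧ k - r < l ∧ zigzagSign α (k - r) = β ∧ zigzagFst p s (k - r) = t
    · refine ⟨k - r, hl.1, hl.2.1, hl.2.2.1, hl.2.2.2, by ring, ?_⟩
      have : spanFamily (glueZ α s r l top htop h1 h2).α (glueZ α s r l top htop h1 h2).s
          (glueZ α s r l top htop h1 h2).r (fun j => v j 0 0) β t k ≤
          Submodule.span ℂ {v (k - r) 0 0} := by
        rw [spanFamily, Submodule.span_le]
        rintro _ ⟨j, -, -, h5, rfl⟩
        by_cases hj : 0 ≤ j ∧ j < l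
        · have h6 : zigzagSnd r l j = k := h5
          rw [hs hj.1 hj.2] at h6
          rw [show k - r = j by omega]
          exact Submodule.mem_span_singleton_self _
        · simp only [h0 j hj]; exact Submodule.zero_mem _
      obtain ⟨c, hc⟩ := Submodule.mem_span_singleton.1 (this hm)
      exact ⟨c, hc.symm⟩
    · refine absurd ?_ hw0
      have : spanFamily (glueZ α s r l top htop h1 h2).α (glueZ α s r l top htop h1 h2).s
          (glueZ α s r l top htop h1 h2).r (fun j => v j 0 0) β t k ≤ ⊥ := by
        rw [spanFamily, Submodule.span_le]
        rintro _ ⟨j, h3, h4, h5, rfl⟩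
        by_cases hj : 0 ≤ j ∧ j < l
        · have h6 : zigzagSnd r l j = k := h5
          rw [hs hj.1 hj.2] at h6
          have h7 : k - r = j := by omega
          rw [h7] at hl
          exact absurd ⟨hj.1, hj.2, h3, h4⟩ hl
        · exact h0 j hj
      exact (Submodule.mem_bot ℂ).1 (this hm)
  · rw [hx j a b]
    by_cases hj : j + 1 < l
    · simp [glueZ, ht, a, hj]
    · rw [h0 (j + 1) (by omega), smul_zero]
  · rw [hy j a b]
    by_cases hj : 1 ≤ j
    · simp [glueZ, ht, b, hj]
    · rw [h0 (j - 1) (by omega), smul_zero]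
  · rw [hx j a b]; simp [glueZ, ht]
  · rw [hy j a b]; simp [glueZ, ht]

theorem IsString.isZigzag (htop : ∀ j, top (j + 1) ↔ ¬ top j) (h1 : 1 ≤ s) (h2 : s < p) (hr : 1 ≤ r) {N : FinRep p} {u : ℤ → N.obj}
    (h : IsString (p := p) α s r l top u) : IsZigzag α s r l top N := by
  obtain ⟨M, v, hM⟩ := exists_isZigzag (p := p) α r l htop h1 h2
  have hS := hM.isString htop h1 h2 hr
  have hs : ∀ j : ℤ, u j ≠ 0 → 0 ≤ j ∧ j < l ∧ zigzagSnd r l j = r + j := fun j hj => by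
    by_cases h3 : 0 ≤ j ∧ j < l
    · exact ⟨h3.1, h3.2, if_pos h3⟩
    · exact absurd (h.eq_zero j h3) hj
  have hs' : ∀ j : ℤ, 1 ≤ zigzagSnd r l j → 0 ≤ j ∧ j < l ∧ zigzagSnd r l j = r + j := fun j hj => by
    unfold zigzagSnd at hj ⊢
    split_ifs at hj ⊢ <;> omega
  have hF : IsFrame (glueZ α s r l top htop h1 h2) u := by
    refine ⟨fun j => ?_, fun j hj _ => ?_, fun j hj _ => ?_⟩
    · by_cases h0 : u j = 0
      · rw [h0]; exact Submodule.zero_mem _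
      · obtain ⟨a, b, c⟩ := hs j h0
        rw [show (glueZ α s r l top htop h1 h2).r j = r + j from c]
        exact h.mem j a b
    · obtain ⟨a, b, c⟩ := hs' j hj
      rw [show (glueZ α s r l top htop h1 h2).r j = r + j from c]
      by_cases ht : top j
      · refine (h.x_top j a b ht).trans ?_
        by_cases hl : j + 1 < l
        · simp [glueZ, ht, a, hl]
        · rw [show (glueZ α s r l top htop h1 h2).σ j = j + 1 from rfl, h.eq_zero (j + 1) (by omega),
            smul_zero]
      · refine (h.x_not j a b ht).trans ?_
        simp [glueZ, ht]
    · obtain ⟨a, b, c⟩ := hs' j hj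
      rw [show (glueZ α s r l top htop h1 h2).r j = r + j from c]
      by_cases ht : top j
      · refine (h.y_top j a b ht).trans ?_
        by_cases hl : 1 ≤ j
        · simp [glueZ, ht, b, hl]
        · rw [show (glueZ α s r l top htop h1 h2).τ j = j - 1 from rfl, h.eq_zero (j - 1) (by omega),
            smul_zero]
      · refine (h.y_not j a b ht).trans ?_
        simp [glueZ, ht]
  refine (isZigzag_iff htop h1 h2).2 (hM.exists_of_isFrame hF
    (fun φ hφ β t k k1 k2 w hw h0 => ?_) (eq_top_of_hw_le (p := p) fun β t k k1 k2 w hw => ?_))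
  · by_contra hw0
    obtain ⟨j, a, b, -, -, -, c, rfl⟩ := hS.hw_le β t k k1 k2 w hw hw0
    rw [map_complex_smul, hφ] at h0
    rcases smul_eq_zero.1 h0 with h0 | h0
    · exact hw0 (by rw [h0, zero_smul])
    · exact h.ne_zero j a b h0
  · by_cases hw0 : w = 0
    · rw [hw0]; exact Submodule.zero_mem _
    obtain ⟨j, a, b, -, -, -, c, rfl⟩ := h.hw_le β t k k1 k2 w hw hw0
    have := le_genSub hF.isStableFamily (zigzagFst_bounds h1 h2 j).1 (zigzagFst_bounds h1 h2 j).2.le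
      (mem_spanFamily (u := u) (α := (glueZ α s r l top htop h1 h2).α)
        (s := (glueZ α s r l top htop h1 h2).s) (r := (glueZ α s r l top htop h1 h2).r) j)
    exact ((genSub hF.isStableFamily).restrictScalars ℂ).smul_mem c this

end Strings

/-! ### Characterisation of the modules by their highest weight vectors -/

section Characterisation

variable [hp : Fact (2 ≤ p)] {α : ℤˣ} {s r l : ℕ} {top : ℤ → Prop}

section

variable {M : Type*} [AddCommGroup M] [Module (LU p) M] [Module ℂ M] [IsScalarTower ℂ (LU p) M]
  [FiniteDimensional ℂ M]

/-- Relations between the highest weight vectors of a diamond. -/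
theorem diamond_relations (h1 : 1 ≤ s) (h2 : s < p) (hr : 1 ≤ r) {t : M}
    (ht : t ∈ hw (p := p) M α s r) :
    xop p (p - s) (r + 1) (xop p s r t) = 0 ∧
    yop p (p - s) (r - 1) (yop p s r t) = 0 ∧
    (r ≠ 1 → xop p (p - s) (r - 1) (yop p s r t) = -yop p (p - s) (r + 1) (xop p s r t)) ∧
    yop p (p - s) (r + 1) (xop p s r t) ∈ hw (p := p) M α s r ∧
    xop p s r (yop p (p - s) (r + 1) (xop p s r t)) = 0 ∧
    yop p s r (yop p (p - s) (r + 1) (xop p s r t)) = 0 := by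
  have k1 : (1 : ℤ) ≤ s := by exact_mod_cast h1
  have k2 : (s : ℤ) < p := by exact_mod_cast h2
  obtain ⟨a1, a2, a3⟩ := xop_yop_relations k1 k2 ht
  have hx := xop_mem k1 k2 ht
  obtain ⟨b1, b2, b3⟩ := xop_yop_relations (by omega) (by omega) hx
  have hyx := yop_mem (by omega) (by omega) hx
  rw [neg_neg, sub_sub_self_int, add_sub_cancel_right] at hyx
  rw [sub_sub_self_int, add_sub_cancel_right] at b3 b2
  refine ⟨a1, a2, fun hr1 => a3 (by exact_mod_cast hr1), hyx, ?_, b2⟩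
  rw [b3 (by omega), a1, yop_zero, neg_zero]

end

theorem IsGlued.isDiamond (h1 : 1 ≤ s) (h2 : s < p) (hr : 1 ≤ r) {M : FinRep p}
    {v : Corner → ℤ → ℤ → M.obj} (h : IsGlued (glueP α s r h1 h2) M v) :
    IsDiamond (p := p) α s r (v .top 0 0) := by
  have hF := h.isFrame
  have hr1 : (r : ℂ) ≠ 0 := by exact_mod_cast (by omega : r ≠ 0)
  have hr0 := inv_ne_zero hr1
  have hx : xop p s r (v .top 0 0) = (r : ℂ)⁻¹ • v .right 0 0 :=
    hF.hx .top (by change (1 : ℤ) ≤ r; omega) (by change (s : ℤ) < p; omega)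
  have hy : yop p s r (v .top 0 0) = -(r : ℂ)⁻¹ • v .left 0 0 :=
    hF.hy .top (by change (1 : ℤ) ≤ r; omega) (by change (s : ℤ) < p; omega)
  have hyr : yop p (p - s) (r + 1) (v .right 0 0) = (1 : ℂ) • v .bot 0 0 :=
    hF.hy .right (by change (1 : ℤ) ≤ r + 1; omega) (by change (p : ℤ) - s < p; omega)
  have hb : v .bot 0 0 ≠ 0 := h.basis.linearIndependent.ne_zero ⟨(.bot, 0, 0), le_rfl,
    by change (0 : ℤ) < s; omega, le_rfl, by change (0 : ℤ) < r; omega⟩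
  have hyx : yop p (p - s) (r + 1) (xop p s r (v .top 0 0)) = (r : ℂ)⁻¹ • v .bot 0 0 := by
    rw [hx, yop_smul, hyr, one_smul]
  refine ⟨h.mem_hw .top, ?_, fun β k l k1 k2 w hw hw0 => ?_⟩
  · rw [hyx]
    exact smul_ne_zero hr0 hb
  · have hm := h.hw_le k1 k2 hw
    rw [hyx, hx, hy]
    have key : ∀ S : Set M.obj, (∀ i, Corner.sign α i = β → Corner.fst p s i = k →
        Corner.snd r i = l → v i 0 0 ∈ S) → w ∈ Submodule.span ℂ S := fun S hS => by
      refine (Submodule.span_mono ?_ : spanFamily _ _ _ _ _ _ _ ≤ _) hm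
      rintro _ ⟨i, a, b, c, rfl⟩
      exact hS i a b c
    by_cases ht : β = α ∧ k = s ∧ l = r
    · left
      obtain ⟨rfl, rfl, rfl⟩ := ht
      obtain ⟨c, d, hcd⟩ := Submodule.mem_span_pair.1
        (key {v .top 0 0, v .bot 0 0} fun i _ _ h3 => by
          cases i <;> simp only [Corner.snd] at h3 ⊢
          · exact Or.inl rfl
          · exact Or.inr rfl
          · omega
          · omega)
      refine ⟨rfl, rfl, rfl, c, d * r, ?_⟩
      rw [← hcd, smul_smul, mul_assoc, mul_inv_cancel₀ hr1, mul_one]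
    right
    by_cases ht' : β = -α ∧ k = p - s ∧ l = r + 1
    · left
      obtain ⟨rfl, rfl, rfl⟩ := ht'
      obtain ⟨c, hc⟩ := Submodule.mem_span_singleton.1
        (key {v .right 0 0} fun i _ _ h3 => by
          cases i <;> simp only [Corner.snd] at h3 ⊢
          · omega
          · omega
          · omega
          · rfl)
      refine ⟨rfl, rfl, rfl, c * r, ?_⟩
      rw [← hc, smul_smul, mul_assoc, mul_inv_cancel₀ hr1, mul_one]
    right
    by_cases hl' : β = -α ∧ k = p - s ∧ l = r - 1
    · obtain ⟨rfl, rfl, rfl⟩ := hl'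
      obtain ⟨c, hc⟩ := Submodule.mem_span_singleton.1
        (key {v .left 0 0} fun i _ _ h3 => by
          cases i <;> simp only [Corner.snd] at h3 ⊢
          · omega
          · omega
          · rfl
          · omega)
      refine ⟨rfl, rfl, rfl, -(c * r), ?_⟩
      rw [← hc, smul_smul, neg_mul_neg, mul_assoc, mul_inv_cancel₀ hr1, mul_one]
    · have := key ∅ fun i a b c => by
        cases i
        · exact absurd ⟨a.symm, b.symm, c.symm⟩ ht
        · exact absurd ⟨a.symm, b.symm, c.symm⟩ ht
        · exact absurd ⟨a.symm, b.symm, c.symm⟩ hl'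
        · exact absurd ⟨a.symm, b.symm, c.symm⟩ ht'
      rw [Submodule.span_empty, Submodule.mem_bot] at this
      exact absurd this hw0

variable (p s r) in
/-- The vectors that generate the image of `P^α_{s,r}` under the homomorphism determined by `t`. -/
def diamondFrame {M : Type*} [AddCommGroup M] [Module (LU p) M] [Module ℂ M] (t : M) : Corner → M
  | .top => t
  | .bot => (r : ℂ) • yop p (p - s) (r + 1) (xop p s r t)
  | .left => -(r : ℂ) • yop p s r t
  | .right => (r : ℂ) • xop p s r t

theorem isFrame_diamondFrame {M : Type*} [AddCommGroup M] [Module (LU p) M] [Module ℂ M]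
    [IsScalarTower ℂ (LU p) M] [FiniteDimensional ℂ M] (h1 : 1 ≤ s) (h2 : s < p) (hr : 1 ≤ r)
    {t : M} (ht : t ∈ hw (p := p) M α s r) :
    IsFrame (glueP α s r h1 h2) (diamondFrame p s r t) := by
  have hr0 : (r : ℂ) ≠ 0 := by exact_mod_cast (by omega : r ≠ 0)
  obtain ⟨r1, r2, r3, r4, r5, r6⟩ := diamond_relations h1 h2 hr ht
  have k1 : (1 : ℤ) ≤ s := by exact_mod_cast h1
  have k2 : (s : ℤ) < p := by exact_mod_cast h2
  refine ⟨fun i => ?_, fun i hi _ => ?_, fun i hi _ => ?_⟩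
  · cases i
    · exact ht
    · exact Submodule.smul_mem _ _ r4
    · exact Submodule.smul_mem _ _ (yop_mem k1 k2 ht)
    · exact Submodule.smul_mem _ _ (xop_mem k1 k2 ht)
  · cases i
    · change xop p s r t = (r : ℂ)⁻¹ • (r : ℂ) • xop p s r t
      rw [inv_smul_smul₀ hr0]
    · change xop p s r ((r : ℂ) • _) = (0 : ℂ) • t
      rw [xop_smul, r5, smul_zero, zero_smul]
    · change (1 : ℤ) ≤ r - 1 at hi
      change xop p (p - s) (r - 1) (-(r : ℂ) • _) = (1 : ℂ) • (r : ℂ) • _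
      rw [xop_smul, r3 (by omega), one_smul, neg_smul, smul_neg, neg_neg]
    · change xop p (p - s) (r + 1) ((r : ℂ) • _) = (0 : ℂ) • t
      rw [xop_smul, r1, smul_zero, zero_smul]
  · cases i
    · change yop p s r t = -(r : ℂ)⁻¹ • -(r : ℂ) • yop p s r t
      rw [smul_smul, neg_mul_neg, inv_mul_cancel₀ hr0, one_smul]
    · change yop p s r ((r : ℂ) • _) = (0 : ℂ) • t
      rw [yop_smul, r6, smul_zero, zero_smul]
    · change yop p (p - s) (r - 1) (-(r : ℂ) • _) = (0 : ℂ) • t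
      rw [yop_smul, r2, smul_zero, zero_smul]
    · change yop p (p - s) (r + 1) ((r : ℂ) • _) = (1 : ℂ) • (r : ℂ) • _
      rw [yop_smul, one_smul]

theorem IsDiamond.isP (h1 : 1 ≤ s) (h2 : s < p) (hr : 1 ≤ r) {N : FinRep p} {t : N.obj}
    (h : IsDiamond (p := p) α s r t) : IsP α s r N := by
  have hr0 : (r : ℂ) ≠ 0 := by exact_mod_cast (by omega : r ≠ 0)
  obtain ⟨M, v, hM⟩ := exists_isP (p := p) α r h1 h2
  have hS := hM.isDiamond h1 h2 hr
  obtain ⟨r1, r2, r3, r4, r5, r6⟩ := diamond_relations h1 h2 hr h.mem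
  have k1 : (1 : ℤ) ≤ s := by exact_mod_cast h1
  have k2 : (s : ℤ) < p := by exact_mod_cast h2
  let a : Corner → N.obj := diamondFrame p s r t
  have hF : IsFrame (glueP α s r h1 h2) a := isFrame_diamondFrame h1 h2 hr h.mem
  refine (isP_iff h1 h2 hr).2 (hM.exists_of_isFrame hF
    (fun φ hφ β k l k1 k2 w hw h0 => ?_) (eq_top_of_hw_le (p := p) fun β k l k1 k2 w hw => ?_))
  · have ht : φ (v .top 0 0) = t := hφ .top
    by_contra hw0
    rcases hS.hw_le β k l k1 k2 w hw hw0 with ⟨-, -, -, c, d, rfl⟩ | ⟨-, -, -, c, rfl⟩ |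
      ⟨rfl, rfl, rfl, c, rfl⟩
    · rw [map_add, map_complex_smul, map_complex_smul, map_yop, map_xop, ht] at h0
      have h3 := congrArg (fun w => yop p (p - s) (r + 1) (xop p s r w)) h0
      simp only [xop_add, xop_smul, yop_smul, r5, yop_zero, xop_zero, smul_zero,
        add_zero, smul_eq_zero, h.ne_zero, or_false] at h3
      rw [h3, zero_smul, zero_add, smul_eq_zero] at h0
      rw [h3, h0.resolve_right h.ne_zero, zero_smul, zero_smul, add_zero] at hw0
      exact hw0 rfl
    · rw [map_complex_smul, map_xop, ht, smul_eq_zero] at h0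
      rcases h0 with h0 | h0
      · exact hw0 (by rw [h0, zero_smul])
      · exact h.ne_zero (by rw [h0, yop_zero])
    · rw [map_complex_smul, map_yop, ht, smul_eq_zero] at h0
      rcases h0 with h0 | h0
      · exact hw0 (by rw [h0, zero_smul])
      · have := r_pos_of_ne_zero hw hw0
        have h3 := r3 (by omega)
        rw [h0, xop_zero, eq_comm, neg_eq_zero] at h3
        exact h.ne_zero h3
  · have hg : ∀ i, a i ∈ genSub hF.isStableFamily := fun i =>
      le_genSub _ ((glueP α s r h1 h2).one_le i) ((glueP α s r h1 h2).le i)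
        (mem_spanFamily (u := a) i)
    by_cases hw0 : w = 0
    · rw [hw0]; exact Submodule.zero_mem _
    have htm : t ∈ genSub hF.isStableFamily := hg .top
    have hs : ∀ (c : ℂ) {x : N.obj}, x ∈ genSub hF.isStableFamily →
      c • x ∈ genSub hF.isStableFamily := fun c x hx =>
        ((genSub hF.isStableFamily).restrictScalars ℂ).smul_mem c hx
    have hm : ∀ x : LU p, ∀ {w : N.obj}, w ∈ genSub hF.isStableFamily →
      x • w ∈ genSub hF.isStableFamily := fun x w hw => Submodule.smul_mem _ x hw
    have hxm : ∀ (k l : ℤ) {w : N.obj}, w ∈ genSub hF.isStableFamily →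
      xop p k l w ∈ genSub hF.isStableFamily := fun k l w hw => hs _ (hm _ (hm _ hw))
    have hym : ∀ (k l : ℤ) {w : N.obj}, w ∈ genSub hF.isStableFamily →
      yop p k l w ∈ genSub hF.isStableFamily := fun k l w hw =>
        Submodule.sub_mem _ (hm _ hw) (hm _ (hxm _ _ hw))
    rcases h.hw_le β k l k1 k2 w hw hw0 with ⟨-, -, -, c, d, rfl⟩ | ⟨-, -, -, c, rfl⟩ |
      ⟨-, -, -, c, rfl⟩
    · exact Submodule.add_mem _ (hs _ htm) (hs _ (hym _ _ (hxm _ _ htm)))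
    · exact hs _ (hxm _ _ htm)
    · exact hs _ (hym _ _ htm)

theorem isX_of_isKilled {N : FinRep p} {u : N.obj} (h : IsKilled p α s r u)
    (h0 : u ≠ 0) (h' : ∀ (β : ℤˣ) (k l : ℤ), 1 ≤ k → k ≤ p → ∀ w ∈ hw (p := p) N.obj β k l,
      w ∈ genSub h.isStableFamily) : IsX α s r N := by
  have h1 : 1 ≤ s := by exact_mod_cast h.one_le
  have h2 : s ≤ p := by exact_mod_cast h.le
  obtain ⟨M, v, hM⟩ := exists_isX (p := p) α r h1 h2
  have hF : IsFrame (glueX α s r h1 h2) (fun _ => u) :=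
    ⟨fun _ => h.mem, fun _ _ _ => h.xop.trans (zero_smul ℂ u).symm,
      fun _ _ _ => h.yop.trans (zero_smul ℂ u).symm⟩
  refine (isX_iff h1 h2).2 (hM.exists_of_isFrame hF
    (fun φ hφ β k l k1 k2 w hw h3 => ?_) (eq_top_of_hw_le (p := p) fun β k l k1 k2 w hw => ?_))
  · by_contra hw0
    have hm : w ∈ spanFamily (fun _ : Unit => α) (fun _ => (s : ℤ)) (fun _ => (r : ℤ))
      (fun _ => v () 0 0) β k l := hM.hw_le k1 k2 hw
    obtain ⟨-, -, -, c, hc, rfl⟩ := mem_spanFamily_unit hm hw0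
    rw [map_complex_smul, hφ (), smul_eq_zero] at h3
    exact h3.elim hc h0
  · by_cases hw0 : w = 0
    · rw [hw0]; exact Submodule.zero_mem _
    obtain ⟨-, -, -, c, -, rfl⟩ := h.of_mem_genSub k1 k2 hw (h' β k l k1 k2 w hw) hw0
    have := le_genSub hF.isStableFamily h.one_le h.le (mem_spanFamily (u := fun _ => u)
      (α := (glueX α s r h1 h2).α) (s := (glueX α s r h1 h2).s) (r := (glueX α s r h1 h2).r) ())
    exact ((genSub hF.isStableFamily).restrictScalars ℂ).smul_mem c this

theorem IsX.exists_isKilled (h1 : 1 ≤ s) (h2 : s ≤ p) (hr : 1 ≤ r) {M : FinRep p}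
    (h : IsX α s r M) : ∃ (u : M.obj) (hu : IsKilled p α s r u), u ≠ 0 ∧
      genSub hu.isStableFamily = ⊤ := by
  obtain ⟨v, hv⟩ := (isX_iff h1 h2).1 h
  have hF := hv.isFrame
  have hk : IsKilled p α s r (v () 0 0) := by
    refine ⟨by omega, by omega, hF.mem (), ?_, ?_⟩
    · rcases h2.lt_or_eq with h2' | h2'
      · exact (hF.hx () (by change (1 : ℤ) ≤ r; omega) (by change (s : ℤ) < p; omega)).trans
          (zero_smul _ _)
      · rw [h2', xop_p]
    · rcases h2.lt_or_eq with h2' | h2'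
      · exact (hF.hy () (by change (1 : ℤ) ≤ r; omega) (by change (s : ℤ) < p; omega)).trans
          (zero_smul _ _)
      · rw [h2', yop_p]
  exact ⟨v () 0 0, hk, hv.basis.linearIndependent.ne_zero ⟨((), 0, 0), le_rfl,
    by change (0 : ℤ) < s; omega, le_rfl, by change (0 : ℤ) < r; omega⟩,
    hv.eq_top fun _ => hk.mem_genSub⟩

theorem IsX.isSimpleModule (h1 : 1 ≤ s) (h2 : s ≤ p) (hr : 1 ≤ r) {M : FinRep p}
    (h : IsX α s r M) : IsSimpleModule (LU p) M.obj := by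
  obtain ⟨u, hu, h0, ht⟩ := h.exists_isKilled h1 h2 hr
  have := hu.isSimpleModule h0
  rw [ht] at this
  exact IsSimpleModule.congr (Submodule.topEquiv (R := LU p) (M := M.obj)).symm

theorem exists_isX_of_isSimpleModule {M : FinRep p} [IsSimpleModule (LU p) M.obj] :
    ∃ (α : ℤˣ) (s r : ℕ), 1 ≤ s ∧ s ≤ p ∧ 1 ≤ r ∧ IsX α s r M := by
  have := IsSimpleModule.nontrivial (LU p) M.obj
  obtain ⟨α, s, r, u, hu, h0⟩ := LUq.exists_isKilled (p := p) (M := M.obj)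
  have hr := r_pos_of_ne_zero hu.mem h0
  obtain ⟨r, rfl⟩ := Int.eq_ofNat_of_zero_le hr.le
  have hs1 := hu.one_le
  have hs2 := hu.le
  obtain ⟨s, rfl⟩ := Int.eq_ofNat_of_zero_le (by omega : 0 ≤ s)
  refine ⟨α, s, r, by omega, by omega, by omega, isX_of_isKilled hu h0
    fun β k l _ _ w hw => ?_⟩
  rcases eq_bot_or_eq_top (genSub hu.isStableFamily) with h | h
  · have := hu.mem_genSub
    rw [h, Submodule.mem_bot] at this
    exact absurd this h0
  · rw [h]; trivial

theorem IsX.isString (h1 : 1 ≤ s) (h2 : s < p) (hr : 1 ≤ r) {M : FinRep p} (h : IsX α s r M)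
    (top : ℤ → Prop) : ∃ u : ℤ → M.obj, IsString (p := p) α s r 1 top u := by
  obtain ⟨u, hu, h0, ht⟩ := h.exists_isKilled h1 h2.le hr
  have hj : ∀ j : ℤ, 0 ≤ j → j < (1 : ℕ) → j = 0 := fun j a b => by push_cast at b; omega
  refine ⟨fun j => if j = 0 then u else 0, ?_⟩
  constructor
  · intro j a b; cases hj j a b; simpa [zigzagSign, zigzagFst] using hu.mem
  · intro j a b; cases hj j a b; simpa using h0
  · intro j a; rw [if_neg (by rintro rfl; simp at a)]
  · intro β t k k1 k2 w hw hw0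
    obtain ⟨rfl, rfl, rfl, c, -, rfl⟩ := hu.of_mem_genSub k1 k2 hw (by rw [ht]; trivial) hw0
    exact ⟨0, le_rfl, by simp, by simp [zigzagSign], by simp [zigzagFst], by simp, c, by simp⟩
  · intro j a b _; cases hj j a b; simpa [zigzagFst] using hu.xop
  · intro j a b _; cases hj j a b; simpa [zigzagFst] using hu.yop
  · intro j a b _; cases hj j a b; simpa [zigzagFst] using hu.xop
  · intro j a b _; cases hj j a b; simpa [zigzagFst] using hu.yop

theorem IsString.isX (h1 : 1 ≤ s) (h2 : s < p) {N : FinRep p} {u : ℤ → N.obj}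
    (h : IsString (p := p) α s r 1 top u) : IsX α s r N := by
  have hk : IsKilled p α s r (u 0) := by
    have hm := h.mem 0 le_rfl (by simp)
    have hx := h.x_top 0 le_rfl (by simp)
    have hx' := h.x_not 0 le_rfl (by simp)
    have hy := h.y_top 0 le_rfl (by simp)
    have hy' := h.y_not 0 le_rfl (by simp)
    rw [h.eq_zero (0 + 1) (by simp)] at hx
    rw [h.eq_zero (0 - 1) (by simp)] at hy
    simp only [zigzagFst, zigzagSign, Even.zero, if_true, add_zero] at hm hx hx' hy hy'
    exact ⟨by omega, by omega, hm, (Classical.em (top 0)).elim hx hx',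
      (Classical.em (top 0)).elim hy hy'⟩
  refine isX_of_isKilled hk (h.ne_zero 0 le_rfl (by simp)) fun β k l k1 k2 w hw => ?_
  by_cases hw0 : w = 0
  · rw [hw0]; exact Submodule.zero_mem _
  obtain ⟨j, a, b, -, -, -, c, rfl⟩ := h.hw_le β k l k1 k2 w hw hw0
  push_cast at b
  obtain rfl : j = 0 := by omega
  exact ((genSub hk.isStableFamily).restrictScalars ℂ).smul_mem c hk.mem_genSub

end Characterisation

/-! ### Indecomposability, isomorphisms and Loewy lengths -/

section Properties

variable [hp : Fact (2 ≤ p)] {α : ℤˣ} {s r l : ℕ} {top : ℤ → Prop}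
  {M : Type*} [AddCommGroup M] [Module (LU p) M] [Module ℂ M] [IsScalarTower ℂ (LU p) M]

theorem csmul_mem (N : Submodule (LU p) M) (c : ℂ) {w : M} (hw : w ∈ N) : c • w ∈ N :=
  (N.restrictScalars ℂ).smul_mem c hw

theorem xop_mem_submodule (N : Submodule (LU p) M) (k l : ℤ) {w : M} (hw : w ∈ N) :
    xop p k l w ∈ N := csmul_mem N _ (N.smul_mem _ (N.smul_mem _ hw))

theorem yop_mem_submodule (N : Submodule (LU p) M) (k l : ℤ) {w : M} (hw : w ∈ N) :
    yop p k l w ∈ N :=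
  N.sub_mem (N.smul_mem _ hw) (N.smul_mem _ (xop_mem_submodule N k l hw))

variable [FiniteDimensional ℂ M]

theorem exists_add_mem_hw {A B : Submodule (LU p) M} (h : IsCompl A B) {k r : ℤ} {u : M}
    (hu : u ∈ hw (p := p) M α k r) :
    ∃ a ∈ A, ∃ b ∈ B, a ∈ hw (p := p) M α k r ∧ b ∈ hw (p := p) M α k r ∧ a + b = u := by
  have ha : (A.projectionOnto B h u : M) ∈ hw (p := p) M α k r :=
    map_hw A.subtype (map_hw (A.projectionOnto B h) hu)
  have hb : (B.projectionOnto A h.symm u : M) ∈ hw (p := p) M α k r :=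
    map_hw B.subtype (map_hw (B.projectionOnto A h.symm) hu)
  exact ⟨_, (A.projectionOnto B h u).2, _, (B.projectionOnto A h.symm u).2, ha, hb,
    Submodule.projection_add_projection_eq_self h u⟩

theorem IsKilled.genSub_eq_bot_or_eq_top [IsSemisimpleModule (LU p) M]
    (h : IsIndecomposableModule (LU p) M) (A : Submodule (LU p) M) : A = ⊥ ∨ A = ⊤ := by
  obtain ⟨B, hB⟩ := exists_isCompl A
  refine (h.2 A B hB).imp_right fun h => ?_
  have := hB.sup_eq_top
  rwa [h, sup_bot_eq] at this

theorem not_isSemisimple_filtration_one (h : HasSemisimpleFiltration (LU p) M 1) :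
    IsSemisimpleModule (LU p) M := by
  obtain ⟨N, -, h0, h1, h2⟩ := h
  have h3 := h2 0 one_pos
  rw [zero_add] at h3
  have h4 : (N 1).submoduleOf (N 0) = ⊥ := by rw [h1, Submodule.submoduleOf, Submodule.comap_bot,
    Submodule.ker_subtype]
  have e1 := Submodule.quotEquivOfEqBot _ h4
  have e2 := LinearEquiv.ofTop (N 0) h0
  exact IsSemisimpleModule.congr (e1.trans e2).symm

namespace IsDiamond

variable {t : M}

theorem exists_eq (h : IsDiamond (p := p) α s r t) (h1 : 1 ≤ s) (h2 : s < p) {w : M}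
    (hw : w ∈ hw (p := p) M α s r) :
    ∃ c d : ℂ, w = c • t + d • yop p (p - s) (r + 1) (xop p s r t) := by
  by_cases hw0 : w = 0
  · exact ⟨0, 0, by simp [hw0]⟩
  · rcases h.hw_le α s r (by omega) (by omega) w hw hw0 with ⟨-, -, -, h'⟩ | ⟨-, -, h', -⟩ |
      ⟨-, -, h', -⟩
    · exact h'
    · omega
    · omega

theorem eq_top (h : IsDiamond (p := p) α s r t) {N : Submodule (LU p) M} (ht : t ∈ N) : N = ⊤ := by
  refine eq_top_of_hw_le (p := p) fun β k l k1 k2 w hw => ?_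
  by_cases hw0 : w = 0
  · rw [hw0]; exact N.zero_mem
  rcases h.hw_le β k l k1 k2 w hw hw0 with ⟨-, -, -, c, d, rfl⟩ | ⟨-, -, -, c, rfl⟩ |
    ⟨-, -, -, c, rfl⟩
  · exact N.add_mem (csmul_mem N _ ht)
      (csmul_mem N _ (yop_mem_submodule N _ _ (xop_mem_submodule N _ _ ht)))
  · exact csmul_mem N _ (xop_mem_submodule N _ _ ht)
  · exact csmul_mem N _ (yop_mem_submodule N _ _ ht)

theorem yop_xop (h : IsDiamond (p := p) α s r t) (h1 : 1 ≤ s) (h2 : s < p) (hr : 1 ≤ r) (c d : ℂ) :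
    yop p (p - s) (r + 1) (xop p s r (c • t + d • yop p (p - s) (r + 1) (xop p s r t))) =
      c • yop p (p - s) (r + 1) (xop p s r t) := by
  obtain ⟨-, -, -, -, r5, -⟩ := diamond_relations h1 h2 hr h.mem
  rw [xop_add, xop_smul, xop_smul, r5, smul_zero, add_zero, yop_smul]

theorem eq_top_of_smul_add (h : IsDiamond (p := p) α s r t) (h1 : 1 ≤ s) (h2 : s < p) (hr : 1 ≤ r)
    {N : Submodule (LU p) M} {c d : ℂ} (hc : c ≠ 0)
    (hm : c • t + d • yop p (p - s) (r + 1) (xop p s r t) ∈ N) : N = ⊤ := by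
  have h3 := yop_mem_submodule N (p - s) (r + 1) (xop_mem_submodule N s r hm)
  rw [h.yop_xop h1 h2 hr] at h3
  have h4 := csmul_mem N c⁻¹ h3
  rw [inv_smul_smul₀ hc] at h4
  have h5 := csmul_mem N c⁻¹ (N.sub_mem hm (csmul_mem N d h4))
  rw [add_sub_cancel_right, inv_smul_smul₀ hc] at h5
  exact h.eq_top h5

theorem isIndecomposableModule (h : IsDiamond (p := p) α s r t) (h1 : 1 ≤ s) (h2 : s < p)
    (hr : 1 ≤ r) : IsIndecomposableModule (LU p) M := by
  refine ⟨⟨_, _, h.ne_zero⟩, fun A B hAB => ?_⟩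
  obtain ⟨a, ha, b, hb, ha', hb', hab⟩ := exists_add_mem_hw hAB h.mem
  obtain ⟨c, d, rfl⟩ := h.exists_eq h1 h2 ha'
  by_cases hc : c = 0
  · left
    obtain ⟨c', d', rfl⟩ := h.exists_eq h1 h2 hb'
    have e := congrArg (fun w => yop p (p - s) (r + 1) (xop p s r w)) hab
    beta_reduce at e
    rw [xop_add, yop_add, h.yop_xop h1 h2 hr, h.yop_xop h1 h2 hr, hc, zero_smul, zero_add] at e
    have hc' : c' ≠ 0 := by
      rintro rfl
      rw [zero_smul] at e
      exact h.ne_zero e.symm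
    have := hAB.disjoint.eq_bot
    rwa [h.eq_top_of_smul_add h1 h2 hr hc' hb, inf_top_eq] at this
  · right
    have := hAB.disjoint.eq_bot
    rwa [h.eq_top_of_smul_add h1 h2 hr hc ha, top_inf_eq] at this

theorem unique (h : IsDiamond (p := p) α s r t) (h1 : 1 ≤ s) (h2 : s < p) (hr : 1 ≤ r) {α' : ℤˣ}
    {s' r' : ℕ} {t' : M} (h' : IsDiamond (p := p) α' s' r' t') (h1' : 1 ≤ s') (h2' : s' < p)
    (hr' : 1 ≤ r') : α = α' ∧ s = s' ∧ r = r' := by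
  obtain ⟨a1, a2, a3, -, -, a6⟩ := diamond_relations h1 h2 hr h.mem
  have h0 : t' ≠ 0 := by
    rintro rfl
    exact h'.ne_zero (by rw [xop_zero, yop_zero])
  rcases h.hw_le α' s' r' (by omega) (by omega) t' h'.mem h0 with ⟨b1, b2, b3, -⟩ |
    ⟨-, b2, b3, c, rfl⟩ | ⟨-, b2, b3, c, rfl⟩
  · exact ⟨b1.symm, by omega, by omega⟩
  · refine absurd ?_ h'.ne_zero
    rw [b2, b3, xop_smul, a1, smul_zero, yop_zero]
  · refine absurd ?_ h'.ne_zero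
    rw [b2, b3, xop_smul, a3 (by omega), sub_sub_self_int, sub_add_cancel, ← neg_one_smul ℂ, yop_smul,
      yop_smul, a6, smul_zero, smul_zero]

end IsDiamond

namespace IsString

variable {u : ℤ → M}

theorem eq_top (h : IsString (p := p) α s r l top u) {N : Submodule (LU p) M}
    (hN : ∀ j : ℤ, 0 ≤ j → j < l → u j ∈ N) : N = ⊤ := by
  refine eq_top_of_hw_le (p := p) fun β k l k1 k2 w hw => ?_
  by_cases hw0 : w = 0
  · rw [hw0]; exact N.zero_mem
  obtain ⟨j, a, b, -, -, -, c, rfl⟩ := h.hw_le β k l k1 k2 w hw hw0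
  exact csmul_mem N c (hN j a b)

theorem exists_eq_smul (h : IsString (p := p) α s r l top u) (h1 : 1 ≤ s) (h2 : s < p) (j : ℤ) {w : M}
    (hw : w ∈ hw (p := p) M (zigzagSign α j) (zigzagFst p s j) (r + j)) (h0 : w ≠ 0) :
    ∃ c : ℂ, c ≠ 0 ∧ w = c • u j := by
  have := zigzagFst_bounds h1 h2 j
  obtain ⟨i, -, -, -, -, e, c, rfl⟩ := h.hw_le _ _ _ this.1 this.2.le w hw h0
  obtain rfl : i = j := by omega
  exact ⟨c, fun hc => h0 (by rw [hc, zero_smul]), rfl⟩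

theorem mem_or_mem (h : IsString (p := p) α s r l top u) (h1 : 1 ≤ s) (h2 : s < p)
    {A B : Submodule (LU p) M} (hAB : IsCompl A B) {j : ℤ} (hj : 0 ≤ j) (hj' : j < l) :
    u j ∈ A ∨ u j ∈ B := by
  obtain ⟨a, ha, b, hb, ha', -, hab⟩ := exists_add_mem_hw hAB (h.mem j hj hj')
  by_cases h0 : a = 0
  · right; rwa [← hab, h0, zero_add]
  · left
    obtain ⟨c, hc, rfl⟩ := h.exists_eq_smul h1 h2 j ha' h0
    have := csmul_mem A c⁻¹ ha
    rwa [inv_smul_smul₀ hc] at this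

theorem eq_bot_of_mem (htop : ∀ j, top (j + 1) ↔ ¬ top j) (h : IsString (p := p) α s r l top u)
    (h1 : 1 ≤ s) (h2 : s < p) {A B : Submodule (LU p) M} (hAB : IsCompl A B) (h0 : u 0 ∈ A) :
    B = ⊥ := by
  have hA : ∀ j : ℕ, (j : ℤ) < l → u j ∈ A := by
    intro j
    induction j with
    | zero => exact fun _ => h0
    | succ j ih =>
      intro hj
      push_cast at hj ⊢
      have ih := ih (by omega)
      by_cases ht : top j
      · rw [← h.x_top j (by omega) (by omega) ht]
        exact xop_mem_submodule A _ _ ih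
      · refine (h.mem_or_mem h1 h2 hAB (by omega) hj).resolve_right fun hB => ?_
        have h3 := yop_mem_submodule B (zigzagFst p s (j + 1)) (r + (j + 1)) hB
        rw [h.y_top (j + 1) (by omega) hj ((htop j).2 ht), add_sub_cancel_right] at h3
        exact h.ne_zero j (by omega) (by omega) (Submodule.disjoint_def.1 hAB.disjoint _ ih h3)
  have hT : A = ⊤ := h.eq_top fun j a b => by
    have := hA j.toNat (by omega)
    rwa [Int.toNat_of_nonneg a] at this
  have := hAB.disjoint.eq_bot
  rwa [hT, top_inf_eq] at this

theorem isIndecomposableModule (htop : ∀ j, top (j + 1) ↔ ¬ top j)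
    (h : IsString (p := p) α s r l top u) (h1 : 1 ≤ s) (h2 : s < p) (hl : 1 ≤ l) :
    IsIndecomposableModule (LU p) M :=
  ⟨⟨_, _, h.ne_zero 0 le_rfl (by omega)⟩, fun A B hAB =>
    (h.mem_or_mem h1 h2 hAB le_rfl (by omega)).symm.imp
      (h.eq_bot_of_mem htop h1 h2 hAB.symm) (h.eq_bot_of_mem htop h1 h2 hAB)⟩

theorem label_eq (h : IsString (p := p) α s r l top u) (h1 : 1 ≤ s) (h2 : s < p) {α' : ℤˣ}
    {s' r' l' : ℕ} {top' : ℤ → Prop} {u' : ℤ → M} (h' : IsString (p := p) α' s' r' l' top' u')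
    {j : ℤ} (hj : 0 ≤ j) (hj' : j < l) : ∃ i : ℤ, 0 ≤ i ∧ i < l' ∧ zigzagSign α' i = zigzagSign α j ∧
      zigzagFst p s' i = zigzagFst p s j ∧ r' + i = r + j ∧ ∃ c : ℂ, u j = c • u' i :=
  h'.hw_le _ _ _ (zigzagFst_bounds h1 h2 j).1 (zigzagFst_bounds h1 h2 j).2.le _ (h.mem j hj hj')
    (h.ne_zero j hj hj')

theorem unique (h : IsString (p := p) α s r l top u) (h1 : 1 ≤ s) (h2 : s < p) (hl : 1 ≤ l)
    {α' : ℤˣ} {s' r' l' : ℕ} {top' : ℤ → Prop} {u' : ℤ → M}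
    (h' : IsString (p := p) α' s' r' l' top' u') (h1' : 1 ≤ s') (h2' : s' < p) (hl' : 1 ≤ l') :
    α = α' ∧ s = s' ∧ r = r' ∧ l = l' ∧ (2 ≤ l → top 0 → top' 0) := by
  obtain ⟨i, a, -, -, -, b, -⟩ := h.label_eq h1 h2 h' le_rfl (by omega)
  obtain ⟨i', a', -, c1, c2, c3, c, hc⟩ := h'.label_eq h1' h2' h le_rfl (by omega)
  obtain ⟨k, -, d2, -, -, d, -⟩ := h.label_eq h1 h2 h' (j := l - 1) (by omega) (by omega)
  obtain ⟨k', -, d2', -, -, d', -⟩ := h'.label_eq h1' h2' h (j := l' - 1) (by omega) (by omega)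
  obtain rfl : i' = 0 := by omega
  simp only [zigzagSign, zigzagFst, Even.zero, if_true] at c1 c2
  obtain rfl : s = s' := by omega
  obtain rfl : r = r' := by omega
  refine ⟨c1, rfl, rfl, by omega, fun h3 ht => ?_⟩
  by_contra ht'
  have e1 := h.x_top 0 le_rfl (by omega) ht
  have e2 := h'.x_not 0 le_rfl (by omega) ht'
  rw [hc, xop_smul, e1, smul_eq_zero] at e2
  rcases e2 with rfl | e2
  · rw [zero_smul] at hc
    exact h'.ne_zero 0 le_rfl (by omega) hc
  · exact h.ne_zero (0 + 1) (by omega) (by omega) e2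

theorem yop_xop (htop : ∀ j, top (j + 1) ↔ ¬ top j) (h : IsString (p := p) α s r l top u)
    {β : ℤˣ} {t k : ℤ} (k1 : 1 ≤ t) (k2 : t ≤ p) {w : M} (hw : w ∈ hw (p := p) M β t k) :
    yop p (p - t) (k + 1) (xop p t k w) = 0 ∧ xop p (p - t) (k - 1) (yop p t k w) = 0 := by
  by_cases h0 : w = 0
  · simp [h0, xop_zero, yop_zero]
  obtain ⟨j, a, b, rfl, rfl, rfl, c, rfl⟩ := h.hw_le β t k k1 k2 w hw h0
  rw [xop_smul, yop_smul, yop_smul, xop_smul]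
  by_cases ht : top j
  · rw [h.x_top j a b ht, h.y_top j a b ht, ← zigzagFst_succ, add_assoc]
    constructor
    · by_cases hj : j + 1 < l
      · rw [h.y_not _ (by omega) hj (fun h => (htop j).1 h ht), smul_zero]
      · rw [h.eq_zero (j + 1) (by omega), yop_zero, smul_zero]
    · rw [zigzagFst_succ, ← zigzagFst_pred, add_sub_assoc]
      by_cases hj : 0 ≤ j - 1
      · have := (htop (j - 1)).1 (by rwa [sub_add_cancel])
        rw [h.x_not _ hj (by omega) this, smul_zero]
      · rw [h.eq_zero (j - 1) (by omega), xop_zero, smul_zero]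
  · rw [h.x_not j a b ht, h.y_not j a b ht]
    simp [xop_zero, yop_zero]

theorem not_isDiamond (htop : ∀ j, top (j + 1) ↔ ¬ top j) (h : IsString (p := p) α s r l top u)
    {α' : ℤˣ} {s' r' : ℕ} (h1 : 1 ≤ s') (h2 : s' < p) {t : M} :
    ¬ IsDiamond (p := p) α' s' r' t := fun h' =>
  h'.ne_zero (h.yop_xop htop (by omega) (by omega) h'.mem).1

theorem hasLoewyLength (htop : ∀ j, top (j + 1) ↔ ¬ top j) (h : IsString (p := p) α s r l top u)
    (h1 : 1 ≤ s) (h2 : s < p) (hl : 2 ≤ l) : HasLoewyLength (LU p) M 2 := by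
  have hI := h.isIndecomposableModule htop h1 h2 (by omega)
  refine ⟨hasSemisimpleFiltration_two fun β t k k1 k2 w hw => h.yop_xop htop k1 k2.le hw,
    fun k hk => ?_⟩
  by_contra! hk2
  have hS : IsSemisimpleModule (LU p) M := by
    obtain rfl | rfl : k = 0 ∨ k = 1 := by omega
    · obtain ⟨N, -, h0, h3, -⟩ := hk
      have := hI.1
      exact absurd (h0.symm.trans h3) top_ne_bot
    · exact not_isSemisimple_filtration_one hk
  obtain ⟨j, j0, j1, hj⟩ : ∃ j : ℤ, 0 ≤ j ∧ j < l ∧ ¬ top j := by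
    by_cases h0 : top 0
    · exact ⟨0 + 1, by omega, by omega, fun h => (htop 0).1 h h0⟩
    · exact ⟨0, le_rfl, by omega, h0⟩
  have hb := zigzagFst_bounds h1 h2 j
  have hk : IsKilled p (zigzagSign α j) (zigzagFst p s j) (r + j) (u j) :=
    ⟨hb.1, hb.2.le, h.mem j j0 j1, h.x_not j j0 j1 hj, h.y_not j j0 j1 hj⟩
  have hm := hk.mem_genSub
  rcases IsKilled.genSub_eq_bot_or_eq_top hI (genSub hk.isStableFamily) with h3 | h3
  · rw [h3, Submodule.mem_bot] at hm
    exact h.ne_zero j j0 j1 hm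
  · have key : ∀ i : ℤ, 0 ≤ i → i < l → i = j := fun i i0 i1 => by
      have hb' := zigzagFst_bounds h1 h2 i
      have := (hk.of_mem_genSub hb'.1 hb'.2.le (h.mem i i0 i1) (by rw [h3]; trivial)
        (h.ne_zero i i0 i1)).2.2.1
      omega
    have := key 0 le_rfl (by omega)
    have := key 1 (by omega) (by omega)
    omega

end IsString

end Properties

/-! ### Chains of linear relations -/

section Interval

variable {M : Type*} [AddCommGroup M] [Module ℂ M]

/-- If `v` does not start a chain of elements of the relations `C 0, …, C (k - 1)` in which the
entries after the position `l` are arbitrary, then there are functionals that are compatible with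
these relations, the first of them with the value `1` at `v`. -/
theorem exists_functionals (C : ℕ → Submodule ℂ (M × M)) (v : M) (k l : ℕ)
    (h : ∀ c : ℕ → M × M, (∀ j < k, c j ∈ C j) → (∀ j, k ≤ j → c j = 0) → (c 0).1 = v →
      (∀ j < l, (c (j + 1)).1 = (c j).2) → False) :
    ∃ φ : ℕ → M →ₗ[ℂ] ℂ, φ 0 v = 1 ∧
      (∀ j < l, j < k → ∀ a b, (a, b) ∈ C j → φ j a = φ (j + 1) b) ∧
      (l < k → ∀ a b, (a, b) ∈ C l → φ l a = 0) := by
  let T : (ℕ → M × M) →ₗ[ℂ] (ℕ → M) :=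
    { toFun := fun c j => (c j).1 - (if j = 0 then 0 else (c (j - 1)).2)
      map_add' := fun c d => by
        funext j
        simp only [Pi.add_apply, Prod.fst_add, Prod.snd_add]
        split_ifs <;> abel
      map_smul' := fun a c => by
        funext j
        simp only [Pi.smul_apply, Prod.smul_fst, Prod.smul_snd, RingHom.id_apply, smul_sub]
        split_ifs <;> simp }
  let S : Submodule ℂ (ℕ → M × M) :=
    { carrier := {c | (∀ j < k, c j ∈ C j) ∧ ∀ j, k ≤ j → c j = 0}
      add_mem' := fun ha hb => ⟨fun j hj => (C j).add_mem (ha.1 j hj) (hb.1 j hj), fun j hj => by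
        rw [Pi.add_apply, ha.2 j hj, hb.2 j hj, add_zero]⟩
      zero_mem' := ⟨fun j _ => (C j).zero_mem, fun _ _ => rfl⟩
      smul_mem' := fun a c hc => ⟨fun j hj => (C j).smul_mem a (hc.1 j hj), fun j hj => by
        rw [Pi.smul_apply, hc.2 j hj, smul_zero]⟩ }
  let Z : Submodule ℂ (ℕ → M) :=
    { carrier := {w | ∀ j ≤ l, w j = 0}
      add_mem' := fun ha hb j hj => by rw [Pi.add_apply, ha j hj, hb j hj, add_zero]
      zero_mem' := fun _ _ => rfl
      smul_mem' := fun a c hc j hj => by rw [Pi.smul_apply, hc j hj, smul_zero] }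
  have hmem : (LinearMap.single ℂ (fun _ : ℕ => M) 0 v) ∉ S.map T ⊔ Z := by
    intro hm
    obtain ⟨_, ⟨c, hc, rfl⟩, z, hz, e⟩ := Submodule.mem_sup.1 hm
    have e' : ∀ j ≤ l, (c j).1 - (if j = 0 then 0 else (c (j - 1)).2) =
        (Pi.single 0 v : ℕ → M) j := fun j hj => by
      have := congrFun e j
      rw [Pi.add_apply, hz j hj, add_zero] at this
      exact this
    refine h c hc.1 hc.2 ?_ fun j hj => ?_
    · simpa using e' 0 (Nat.zero_le _)
    · have := e' (j + 1) hj
      rw [if_neg (by omega), Pi.single_eq_of_ne (by omega), sub_eq_zero] at this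
      exact this
  obtain ⟨f, hf, hf'⟩ := Submodule.exists_dual_map_eq_bot_of_notMem hmem inferInstance
  have hS : ∀ c : ℕ → M × M, (∀ j < k, c j ∈ C j) → (∀ j, k ≤ j → c j = 0) → ∀ w : ℕ → M,
      (∀ j ≤ l, w j = T c j) → f w = 0 := by
    intro c h1 h2 w hw
    have : f w ∈ (S.map T ⊔ Z).map f := by
      refine ⟨w, Submodule.mem_sup.2 ⟨T c, ⟨c, ⟨h1, h2⟩, rfl⟩, w - T c, fun j hj => ?_,
        add_sub_cancel _ _⟩, rfl⟩
      rw [Pi.sub_apply, hw j hj, sub_self]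
    rwa [hf', Submodule.mem_bot] at this
  have hc : ∀ j < k, ∀ a b, (a, b) ∈ C j → ∀ w : ℕ → M, (∀ i ≤ l, w i = (Pi.single j a : ℕ → M) i -
      (Pi.single (j + 1) b : ℕ → M) i) → f w = 0 := by
    intro j hj a b hab w hw
    refine hS (Pi.single j (a, b)) (fun i hi => ?_) (fun i hi => ?_) w fun i hi => ?_
    · by_cases hij : i = j
      · subst hij; rwa [Pi.single_eq_same]
      · rw [Pi.single_eq_of_ne hij]; exact (C i).zero_mem
    · rw [Pi.single_eq_of_ne (by omega)]
    · rw [hw i hi]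
      change _ = ((Pi.single j (a, b) : ℕ → M × M) i).1 -
        (if i = 0 then 0 else ((Pi.single j (a, b) : ℕ → M × M) (i - 1)).2)
      congr 1
      · by_cases hij : i = j
        · subst hij; simp
        · rw [Pi.single_eq_of_ne hij, Pi.single_eq_of_ne hij]; rfl
      · by_cases hij : i = j + 1
        · subst hij; simp
        · rw [Pi.single_eq_of_ne hij]
          split_ifs with h0
          · rfl
          · rw [Pi.single_eq_of_ne (by omega)]; rfl
  refine ⟨fun j => (f (LinearMap.single ℂ (fun _ : ℕ => M) 0 v))⁻¹ • f ∘ₗ LinearMap.single ℂ _ j,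
    inv_mul_cancel₀ hf, fun j hj hk a b hab => ?_, fun hl a b hab => ?_⟩
  · have e : f ((Pi.single j a : ℕ → M) - (Pi.single (j + 1) b : ℕ → M)) = 0 :=
      hc j hk a b hab _ fun i _ => rfl
    rw [map_sub, sub_eq_zero] at e
    exact congrArg (_ * ·) e
  · change _ * f (Pi.single l a) = 0
    rw [hc l hl a b hab (Pi.single l a) fun i hi => by
      rw [Pi.single_eq_of_ne (i := l + 1) (i' := i) (by omega), sub_zero], mul_zero]

/-- A chain of linear relations starting at `v` that splits off. -/
theorem exists_interval (C : ℕ → Submodule ℂ (M × M)) (v : M) (h0 : (v, 0) ∉ C 0) (N : ℕ)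
    (hN : ∀ a b, (a, b) ∈ C N → b = 0) :
    ∃ (l : ℕ) (u : ℕ → M) (φ : ℕ → M →ₗ[ℂ] ℂ), u 0 = v ∧ (∀ j < l, (u j, u (j + 1)) ∈ C j) ∧
      φ 0 v = 1 ∧ (∀ j < l, ∀ a b, (a, b) ∈ C j → φ j a = φ (j + 1) b) ∧
      ((1 ≤ l ∧ (u l, 0) ∈ C l) ∨ ∀ a b, (a, b) ∈ C l → φ l a = 0) := by
  classical
  have chain : ∀ k l, k ≤ l + 1 → ∀ c : ℕ → M × M, (∀ j < k, c j ∈ C j) → (c 0).1 = v →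
      (∀ j < l, (c (j + 1)).1 = (c j).2) →
      ∃ u : ℕ → M, u 0 = v ∧ (∀ j < k, (u j, u (j + 1)) ∈ C j) ∧ ∀ j ≤ l, u j = (c j).1 := by
    intro k l hkl c hc h1 h2
    refine ⟨fun j => if j = 0 then v else (c (j - 1)).2, if_pos rfl, fun j hj => ?_, fun j hj => ?_⟩
    · beta_reduce
      rw [if_neg (Nat.succ_ne_zero j), Nat.add_sub_cancel]
      convert hc j hj using 1
      refine Prod.ext ?_ rfl
      split_ifs with h
      · rw [h, h1]
      · rw [← h2 (j - 1) (by omega), Nat.sub_add_cancel (by omega)]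
    · beta_reduce
      split_ifs with h
      · rw [h, h1]
      · rw [← h2 (j - 1) (by omega), Nat.sub_add_cancel (by omega)]
  by_cases hR : ∀ l, ∃ u : ℕ → M, u 0 = v ∧ ∀ j < l, (u j, u (j + 1)) ∈ C j
  · have hK : ∃ l, ∃ u : ℕ → M, u 0 = v ∧ (∀ j < l, (u j, u (j + 1)) ∈ C j) ∧ (u l, 0) ∈ C l := by
      obtain ⟨u, hu, h⟩ := hR (N + 1)
      have := h N N.lt_succ_self
      refine ⟨N, u, hu, fun j hj => h j (by omega), ?_⟩
      rwa [hN _ _ this] at this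
    obtain ⟨u, hu, h1, h2⟩ := Nat.find_spec hK
    have hmin := fun k hk => Nat.find_min hK (m := k) hk
    generalize Nat.find hK = l at h1 h2 hmin
    have hl : 1 ≤ l := by
      by_contra hl
      obtain rfl : l = 0 := by omega
      rw [hu] at h2
      exact h0 h2
    obtain ⟨φ, a1, a2, -⟩ := exists_functionals C v l l fun c c1 c2 c3 c4 => by
      obtain ⟨w, w1, w2, w3⟩ := chain (l - 1) l (by omega) c (fun j hj => c1 j (by omega)) c3 c4
      refine hmin (l - 1) (by omega) ⟨w, w1, w2, ?_⟩
      have e1 := c4 (l - 1) (by omega)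
      rw [Nat.sub_add_cancel hl, c2 l le_rfl] at e1
      rw [w3 (l - 1) (by omega), show (0 : M) = (c (l - 1)).2 from e1]
      exact c1 (l - 1) (by omega)
    exact ⟨l, u, φ, hu, h1, a1, fun j hj => a2 j hj hj, Or.inl ⟨hl, h2⟩⟩
  · push Not at hR
    have hmin := fun k hk => Nat.find_min hR (m := k) hk
    have hspec := Nat.find_spec hR
    generalize Nat.find hR = l at hmin hspec
    obtain ⟨l, rfl⟩ : ∃ k, l = k + 1 := Nat.exists_eq_succ_of_ne_zero (by
      rintro rfl
      obtain ⟨j, hj, -⟩ := hspec (fun _ => v) rfl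
      omega)
    have := hmin l (by omega)
    push Not at this
    obtain ⟨u, hu, h1⟩ := this
    obtain ⟨φ, a1, a2, a3⟩ := exists_functionals C v (l + 1) l fun c c1 c2 c3 c4 => by
      obtain ⟨w, w1, w2, -⟩ := chain (l + 1) l le_rfl c c1 c3 c4
      obtain ⟨j, hj, hj'⟩ := hspec w w1
      exact hj' (w2 j hj)
    exact ⟨l, u, φ, hu, h1, a1, fun j hj => a2 j hj (by omega), Or.inr (a3 (by omega))⟩

end Interval

/-! ### Splitting off summands -/

section Splitting

variable [hp : Fact (2 ≤ p)] {M : Type*} [AddCommGroup M] [Module (LU p) M] [Module ℂ M]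
  [IsScalarTower ℂ (LU p) M] [FiniteDimensional ℂ M] {ι : Type} [Finite ι] {α : ι → ℤˣ}
  {s r : ι → ℤ} {u : ι → M} {φ : ι → M →ₗ[ℂ] ℂ}

/-- A family of highest weight vectors that has a dual family of functionals generates a direct
summand. -/
theorem mem_spanFamily_of_isIndecomposableModule (hI : IsIndecomposableModule (LU p) M)
    (h1 : ∀ i, 1 ≤ s i) (h2 : ∀ i, s i ≤ p) (hu : ∀ i, u i ∈ hw (p := p) M (α i) (s i) (r i))
    (hx : ∀ i, s i < p → xop p (s i) (r i) (u i) ∈ spanFamily α s r u (-α i) (p - s i) (r i + 1))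
    (hy : ∀ i, s i < p → yop p (s i) (r i) (u i) ∈ spanFamily α s r u (-α i) (p - s i) (r i - 1))
    (hφ : ∀ i, 1 ≤ r i → φ i (u i) = 1)
    (hφ' : ∀ i j, i ≠ j → α i = α j → s i = s j → r i = r j → φ i (u j) = 0)
    (hφx : ∀ i, s i < p → ∀ w ∈ hw (p := p) M (-α i) (p - s i) (r i - 1),
      (∀ j, α j = -α i → s j = p - s i → r j = r i - 1 → φ j w = 0) →
      φ i (xop p (p - s i) (r i - 1) w) = 0)
    (hφy : ∀ i, s i < p → ∀ w ∈ hw (p := p) M (-α i) (p - s i) (r i + 1),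
      (∀ j, α j = -α i → s j = p - s i → r j = r i + 1 → φ j w = 0) →
      φ i (yop p (p - s i) (r i + 1) w) = 0)
    (i₀ : ι) (hi₀ : 1 ≤ r i₀) {β : ℤˣ} {t k : ℤ} (k1 : 1 ≤ t) (k2 : t ≤ p) {w : M}
    (hw' : w ∈ hw (p := p) M β t k) : w ∈ spanFamily α s r u β t k := by
  classical
  have := Fintype.ofFinite ι
  have hU : IsStableFamily (p := p) (spanFamily α s r u) := isStableFamily_spanFamily hu hx hy
  let H : ℤˣ → ℤ → ℤ → Submodule ℂ M := fun β t k => hw (p := p) M β t k ⊓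
    ⨅ (i) (_ : α i = β ∧ s i = t ∧ r i = k), LinearMap.ker (φ i)
  have memH : ∀ {β : ℤˣ} {t k : ℤ} {w : M}, w ∈ H β t k ↔ w ∈ hw (p := p) M β t k ∧
      ∀ i, α i = β → s i = t → r i = k → φ i w = 0 := by
    intro β t k w
    simp [H, Submodule.mem_iInf]
  have hH : IsStableFamily (p := p) H := by
    refine ⟨fun β t k _ _ => inf_le_left, fun β t k k1 k2 w hw => ?_, fun β t k k1 k2 w hw => ?_⟩
    · obtain ⟨w1, w2⟩ := memH.1 hw
      refine memH.2 ⟨xop_mem k1 k2 w1, fun i a b c => ?_⟩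
      obtain rfl : β = -α i := by rw [a, neg_neg]
      obtain rfl : t = p - s i := by omega
      obtain rfl : k = r i - 1 := by omega
      exact hφx i (by omega) w w1 w2
    · obtain ⟨w1, w2⟩ := memH.1 hw
      refine memH.2 ⟨yop_mem k1 k2 w1, fun i a b c => ?_⟩
      obtain rfl : β = -α i := by rw [a, neg_neg]
      obtain rfl : t = p - s i := by omega
      obtain rfl : k = r i + 1 := by omega
      exact hφy i (by omega) w w1 w2
  have hsum : ∀ (β : ℤˣ) (t k : ℤ), 1 ≤ k → ∀ w : M, ∀ i, α i = β → s i = t → r i = k →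
      φ i (∑ j ∈ Finset.univ.filter (fun j => α j = β ∧ s j = t ∧ r j = k), φ j w • u j) = φ i w := by
    intro β t k hk w i a b c
    rw [map_sum, Finset.sum_eq_single i]
    · rw [map_smul, hφ i (by omega), smul_eq_mul, mul_one]
    · intro j hj hji
      obtain ⟨-, a', b', c'⟩ := Finset.mem_filter.1 hj
      rw [map_smul, hφ' i j hji.symm (a.trans a'.symm) (b.trans b'.symm) (c.trans c'.symm), smul_zero]
    · intro hi
      exact absurd (Finset.mem_filter.2 ⟨Finset.mem_univ _, a, b, c⟩) hi
  have hspan : ∀ (β : ℤˣ) (t k : ℤ) (w : M),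
      ∑ j ∈ Finset.univ.filter (fun j => α j = β ∧ s j = t ∧ r j = k), φ j w • u j ∈
        spanFamily α s r u β t k := by
    intro β t k w
    refine Submodule.sum_mem _ fun j hj => Submodule.smul_mem _ _ ?_
    obtain ⟨-, a, b, c⟩ := Finset.mem_filter.1 hj
    exact Submodule.subset_span ⟨j, a, b, c, rfl⟩
  have hC : IsCompl (genSub hU) (genSub hH) := by
    refine isCompl_genSub hU hH (fun β t k k1 k2 w hw hw' => ?_) fun β t k k1 k2 w hw => ?_
    · by_cases h0 : w = 0
      · exact h0
      have hk := r_pos_of_ne_zero (hU.le β t k k1 k2 hw) h0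
      have key : ∀ w ∈ spanFamily α s r u β t k,
          ∑ j ∈ Finset.univ.filter (fun j => α j = β ∧ s j = t ∧ r j = k), φ j w • u j = w := by
        intro w hw
        refine Submodule.span_induction ?_ ?_ ?_ ?_ hw
        · rintro _ ⟨i, a, b, c, rfl⟩
          rw [Finset.sum_eq_single i]
          · rw [hφ i (by omega), one_smul]
          · intro j hj hji
            obtain ⟨-, a', b', c'⟩ := Finset.mem_filter.1 hj
            rw [hφ' j i hji (a'.trans a.symm) (b'.trans b.symm) (c'.trans c.symm), zero_smul]
          · intro hi
            exact absurd (Finset.mem_filter.2 ⟨Finset.mem_univ _, a, b, c⟩) hi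
        · simp
        · intro x y _ _ hx hy
          simp only [map_add, add_smul, Finset.sum_add_distrib, hx, hy]
        · intro c x _ hx
          simp only [map_smul, smul_assoc, ← Finset.smul_sum, hx]
      rw [← key w hw]
      refine Finset.sum_eq_zero fun j hj => ?_
      obtain ⟨-, a, b, c⟩ := Finset.mem_filter.1 hj
      rw [(memH.1 hw').2 j a b c, zero_smul]
    · refine ⟨_, hspan β t k w, w - _, memH.2 ⟨Submodule.sub_mem _ hw (hU.le β t k k1 k2
        (hspan β t k w)), fun i a b c => ?_⟩, (add_sub_cancel _ _).symm⟩
      by_cases hk : 1 ≤ k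
      · rw [map_sub, hsum β t k hk w i a b c, sub_self]
      · rw [hw_eq_bot (by omega), Submodule.mem_bot] at hw
        rw [hw]
        simp
  have hm := le_genSub hU (h1 i₀) (h2 i₀) (mem_spanFamily (u := u) i₀)
  have hne : u i₀ ≠ 0 := fun h => by
    have := hφ i₀ hi₀
    rw [h, map_zero] at this
    exact zero_ne_one this
  rcases hI.2 _ _ hC with h | h
  · rw [h, Submodule.mem_bot] at hm
    exact absurd hm hne
  · have hT := hC.sup_eq_top
    rw [h, sup_bot_eq] at hT
    exact mem_of_mem_hw_of_mem_genSub hU k1 k2 hw' (by rw [hT]; trivial)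

variable (p M) in
/-- The second labels of highest weight vectors are bounded. -/
theorem exists_hw_bound : ∃ R : ℤ, ∀ (α : ℤˣ) (s r : ℤ), 1 ≤ s → s ≤ p → R ≤ r →
    hw (p := p) M α s r = ⊥ := by
  have hf : {x : Slot p | slotSpace M x ≠ ⊥}.Finite :=
    WellFoundedGT.finite_ne_bot_of_iSupIndep (iSupIndep_slotSpace p M)
  obtain ⟨R, hR⟩ := (hf.image Slot.r).bddAbove
  refine ⟨R + 1, fun α s r h1 h2 hr => ?_⟩
  by_contra hne
  obtain ⟨w, hw, h0⟩ := Submodule.exists_mem_ne_zero_of_ne_bot hne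
  have hr' := r_pos_of_ne_zero hw h0
  let x : Slot p := ⟨α, s, r, 0, 0, h2, by omega, by omega⟩
  have hx : w ∈ slotSpace M x := mem_slotSpace.2 ⟨w, hw, br_zero_zero w⟩
  have hx' : x ∈ {x : Slot p | slotSpace M x ≠ ⊥} := fun h => h0 (by
    rw [h, Submodule.mem_bot] at hx; exact hx)
  have : r ≤ R := hR ⟨x, hx', rfl⟩
  omega

end Splitting

/-! ### Classification of the indecomposable modules -/

section Zigzag

variable {M : Type*} [AddCommGroup M] [Module ℂ M]

/-- A string in a zigzag of linear maps, with functionals that split it off. -/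
theorem exists_string {A : ℤ → Submodule ℂ M} {X Y : ℤ → M →ₗ[ℂ] M} {top : ℤ → Prop}
    (htop : ∀ j, top (j + 1) ↔ ¬ top j)
    (hX : ∀ j, ∀ w ∈ A j, X j w ∈ A (j + 1)) (hY : ∀ j, ∀ w ∈ A (j + 1), Y (j + 1) w ∈ A j)
    (hXX : ∀ j, ∀ w ∈ A j, X (j + 1) (X j w) = 0)
    (hYY : ∀ j, ∀ w ∈ A (j + 2), Y (j + 1) (Y (j + 2) w) = 0)
    (hYX : ∀ j, ∀ w ∈ A j, Y (j + 1) (X j w) = 0)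
    (hXY : ∀ j, ∀ w ∈ A (j + 1), X j (Y (j + 1) w) = 0)
    (hneg : A (-1) = ⊥) {N : ℕ} (hN : ∀ j : ℤ, N ≤ j → A j = ⊥) {v : M} (hv : v ∈ A 0)
    (hv0 : v ≠ 0) (ht : top 0 → X 0 v ≠ 0) (hnt : ¬ top 0 → X 0 v = 0) :
    ∃ (l : ℕ) (u : ℕ → M) (φ : ℕ → M →ₗ[ℂ] ℂ),
      (∀ j ≤ l, u j ∈ A j) ∧ (∀ j ≤ l, φ j (u j) = 1) ∧
      (∀ j ≤ l, top j → X j (u j) = if j < l then u (j + 1) else 0) ∧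
      (∀ j ≤ l, ¬ top j → X j (u j) = 0) ∧
      (∀ j ≤ l, top j → Y j (u j) = if 0 < j then u (j - 1) else 0) ∧
      (∀ j ≤ l, ¬ top j → Y j (u j) = 0) ∧
      (∀ j ≤ l, ∀ w ∈ A (j - 1), (0 < j → φ (j - 1) w = 0) → φ j (X (j - 1) w) = 0) ∧
      (∀ j ≤ l, ∀ w ∈ A (j + 1), (j < l → φ (j + 1) w = 0) → φ j (Y (j + 1) w) = 0) := by
  classical
  let C : ℕ → Submodule ℂ (M × M) := fun j =>
    if top j then (A j).map (LinearMap.prod LinearMap.id (X j))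
    else (A (j + 1)).map (LinearMap.prod (Y (j + 1)) LinearMap.id)
  have C1 : ∀ {j : ℕ}, top j → ∀ {a b : M}, (a, b) ∈ C j ↔ a ∈ A j ∧ X j a = b := by
    intro j hj a b
    simp only [C, if_pos hj, Submodule.mem_map]
    constructor
    · rintro ⟨y, h1, h2⟩
      obtain ⟨h3, h4⟩ := Prod.ext_iff.1 h2
      change y = a at h3
      subst h3
      exact ⟨h1, h4⟩
    · rintro ⟨h1, h2⟩; exact ⟨a, h1, Prod.ext rfl h2⟩
  have C2 : ∀ {j : ℕ}, ¬ top j → ∀ {a b : M}, (a, b) ∈ C j ↔ b ∈ A (j + 1) ∧ Y (j + 1) b = a := by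
    intro j hj a b
    simp only [C, if_neg hj, Submodule.mem_map]
    constructor
    · rintro ⟨y, h1, h2⟩
      obtain ⟨h3, h4⟩ := Prod.ext_iff.1 h2
      change y = b at h4
      subst h4
      exact ⟨h1, h3⟩
    · rintro ⟨h1, h2⟩; exact ⟨b, h1, Prod.ext h2 rfl⟩
  have h0 : (v, 0) ∉ C 0 := fun h => by
    by_cases h' : top (0 : ℕ)
    · exact ht h' ((C1 h').1 h).2
    · have := ((C2 h').1 h).2
      rw [map_zero] at this
      exact hv0 this.symm
  obtain ⟨l, u, φ, hu0, hc, hφ0, hφ, hend⟩ := exists_interval C v h0 N fun a b h => by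
    by_cases h' : top N
    · obtain ⟨h1, rfl⟩ := (C1 h').1 h
      rw [hN N le_rfl, Submodule.mem_bot] at h1
      rw [h1, map_zero]
    · have := ((C2 h').1 h).1
      rwa [hN _ (by omega), Submodule.mem_bot] at this
  have hu : ∀ j ≤ l, u j ∈ A j := by
    rintro (_ | j) hj
    · rw [hu0]; exact hv
    · have h := hc j hj
      push_cast
      by_cases h' : top j
      · obtain ⟨h1, h2⟩ := (C1 h').1 h
        rw [← h2]; exact hX _ _ h1
      · exact ((C2 h').1 h).1
  have hφu : ∀ j ≤ l, φ j (u j) = 1 := by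
    intro j
    induction j with
    | zero => intro _; rw [hu0, hφ0]
    | succ j ih => intro hj; rw [← hφ j hj _ _ (hc j hj), ih (by omega)]
  have F3 : ∀ j < l, top j → X j (u j) = u (j + 1) := fun j hj h => ((C1 h).1 (hc j hj)).2
  have F3' : ∀ j < l, ¬ top j → Y (j + 1) (u (j + 1)) = u j := fun j hj h => ((C2 h).1 (hc j hj)).2
  have hl : top l → X l (u l) = 0 := fun h => by
    rcases hend with ⟨-, he⟩ | he
    · exact ((C1 h).1 he).2
    · have := he _ _ ((C1 h).2 ⟨hu l le_rfl, rfl⟩)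
      rw [hφu l le_rfl] at this
      exact absurd this one_ne_zero
  have hY0 : ∀ w ∈ A (0 : ℕ), Y (0 : ℕ) w = 0 := fun w hw => by
    have := hY (-1) w (by simpa using hw)
    rwa [hneg, Submodule.mem_bot] at this
  refine ⟨l, u, φ, hu, hφu, fun j hj h => ?_, fun j hj h => ?_, fun j hj h => ?_,
    fun j hj h => ?_, fun j hj w hw h => ?_, fun j hj w hw h => ?_⟩
  · split_ifs with h'
    · exact F3 j h' h
    · obtain rfl : j = l := by omega
      exact hl h
  · rcases j with _ | j
    · rw [hu0]; exact hnt h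
    · have h' : top j := by
        push_cast at h
        by_contra h'; exact h ((htop j).2 h')
      rw [← F3 j hj h']
      push_cast
      exact hXX j _ (hu j (by omega))
  · rcases j with _ | j
    · exact hY0 _ (hu 0 hj)
    · rw [if_pos (by omega)]
      push_cast at h ⊢
      exact F3' j hj ((htop j).1 h)
  · rcases j with _ | j
    · exact hY0 _ (hu 0 hj)
    · have h' : top j := by
        push_cast at h
        by_contra h'; exact h ((htop j).2 h')
      rw [← F3 j hj h']
      push_cast
      exact hYX j _ (hu j (by omega))
  · rcases j with _ | j
    · have : w ∈ A (-1) := by simpa using hw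
      rw [hneg, Submodule.mem_bot] at this
      rw [this, map_zero, map_zero]
    · have h := h (by omega)
      push_cast at hw ⊢
      simp only [add_sub_cancel_right, Nat.add_sub_cancel] at hw h ⊢
      by_cases h' : top j
      · rw [← hφ j hj _ _ ((C1 h').2 ⟨hw, rfl⟩), h]
      · rw [← hφ j hj _ _ ((C2 h').2 ⟨hX _ _ hw, hYX _ _ hw⟩), map_zero]
  · rcases hj.lt_or_eq with hj | rfl
    · by_cases h' : top j
      · rw [hφ j hj _ _ ((C1 h').2 ⟨hY _ _ hw, hXY _ _ hw⟩), map_zero]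
      · rw [hφ j hj _ _ ((C2 h').2 ⟨hw, rfl⟩), h hj]
    · rcases hend with ⟨h1, he⟩ | he
      · by_cases h' : top j
        · obtain ⟨k, rfl⟩ : ∃ k, j = k + 1 := ⟨j - 1, by omega⟩
          push_cast at h' hw ⊢
          rw [add_assoc, one_add_one_eq_two] at hw ⊢
          rw [← hφ k (by omega) _ _ ((C2 ((htop k).1 h')).2 ⟨?_, hYY k w hw⟩), map_zero]
          have := hY (k + 1) w (by rwa [add_assoc, one_add_one_eq_two])
          rwa [add_assoc, one_add_one_eq_two] at this
        · have := ((C2 h').1 he).2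
          rw [map_zero] at this
          have h1 := hφu j le_rfl
          rw [← this, map_zero] at h1
          exact absurd h1 zero_ne_one
      · by_cases h' : top j
        · exact he _ _ ((C1 h').2 ⟨hY _ _ hw, rfl⟩)
        · exact he _ _ ((C2 h').2 ⟨hw, rfl⟩)

end Zigzag

section Classification

variable [hp : Fact (2 ≤ p)]

variable (p) in
/-- `xop` as a linear map. -/
def xopL (M : Type*) [AddCommGroup M] [Module (LU p) M] [Module ℂ M] [IsScalarTower ℂ (LU p) M]
    (s r : ℤ) : M →ₗ[ℂ] M where
  toFun := xop p s r
  map_add' := xop_add s r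
  map_smul' := fun c u => xop_smul s r c u

variable (p) in
/-- `yop` as a linear map. -/
def yopL (M : Type*) [AddCommGroup M] [Module (LU p) M] [Module ℂ M] [IsScalarTower ℂ (LU p) M]
    (s r : ℤ) : M →ₗ[ℂ] M where
  toFun := yop p s r
  map_add' := yop_add s r
  map_smul' := fun c u => yop_smul s r c u

theorem exists_dual_eq_one {M : Type*} [AddCommGroup M] [Module ℂ M] {v : M} (h : v ≠ 0) :
    ∃ φ : M →ₗ[ℂ] ℂ, φ v = 1 := by
  obtain ⟨f, hf⟩ : ∃ f : Module.Dual ℂ M, f v ≠ 0 := by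
    by_contra! h'
    exact h ((Module.forall_dual_apply_eq_zero_iff ℂ v).1 h')
  exact ⟨(f v)⁻¹ • f, inv_mul_cancel₀ hf⟩

theorem exists_of_mem_spanFamily {M : Type*} [AddCommGroup M] [Module ℂ M] {ι : Type*}
    {α : ι → ℤˣ} {s r : ι → ℤ} {u : ι → M}
    (h : ∀ i j, α i = α j → s i = s j → r i = r j → i = j) {β : ℤˣ} {t k : ℤ} {w : M}
    (hw : w ∈ spanFamily α s r u β t k) (h0 : w ≠ 0) :
    ∃ i, α i = β ∧ s i = t ∧ r i = k ∧ ∃ c : ℂ, w = c • u i := by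
  obtain ⟨i, a, b, c⟩ : ∃ i, α i = β ∧ s i = t ∧ r i = k := by
    by_contra! h'
    refine h0 ((Submodule.mem_bot ℂ).1 ?_)
    convert hw
    symm
    rw [spanFamily, Submodule.span_eq_bot]
    rintro _ ⟨i, a, b, c, -⟩
    exact absurd c (h' i a b)
  refine ⟨i, a, b, c, ?_⟩
  have : spanFamily α s r u β t k ≤ Submodule.span ℂ {u i} := Submodule.span_mono (by
    rintro _ ⟨j, a', b', c', rfl⟩
    rw [h j i (a'.trans a.symm) (b'.trans b.symm) (c'.trans c.symm)]
    rfl)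
  obtain ⟨c, hc⟩ := Submodule.mem_span_singleton.1 (this hw)
  exact ⟨c, hc.symm⟩

variable {M : FinRep p} {α : ℤˣ} {s r : ℕ}

theorem isX_of_mem_hw_p (hI : IsIndecomposableModule (LU p) M.obj) {u : M.obj}
    (hu : u ∈ hw (p := p) M.obj α p r) (h0 : u ≠ 0) : IsX α p r M := by
  have hp2 := hp.out
  have hr := r_pos_of_ne_zero hu h0
  have hk : IsKilled p α p r u := ⟨by omega, le_rfl, hu, xop_p u, yop_p u⟩
  obtain ⟨φ, hφ⟩ := exists_dual_eq_one h0
  refine isX_of_isKilled hk h0 fun β k l k1 k2 w hw => ?_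
  refine le_genSub hk.isStableFamily k1 k2 (α := β) (r := l) ?_
  exact mem_spanFamily_of_isIndecomposableModule (φ := fun _ => φ) hI (fun _ => by omega)
    (fun _ => le_rfl) (fun _ => hu) (fun _ h => absurd h (lt_irrefl _))
    (fun _ h => absurd h (lt_irrefl _)) (fun _ _ => hφ) (fun i j hij => absurd rfl hij)
    (fun _ h => absurd h (lt_irrefl _)) (fun _ h => absurd h (lt_irrefl _)) () (by omega) k1 k2 hw

theorem isP_of_yop_xop_ne_zero (hI : IsIndecomposableModule (LU p) M.obj) (h1 : 1 ≤ s) (h2 : s < p)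
    {t : M.obj} (ht : t ∈ hw (p := p) M.obj α s r)
    (h : yop p (p - s) (r + 1) (xop p s r t) ≠ 0) : IsP α s r M := by
  have k1 : (1 : ℤ) ≤ s := by exact_mod_cast h1
  have k2 : (s : ℤ) < p := by exact_mod_cast h2
  have hr : 1 ≤ r := by
    have := r_pos_of_ne_zero ht (by rintro rfl; rw [xop_zero, yop_zero] at h; exact h rfl)
    omega
  set z := yop p (p - s) (r + 1) (xop p s r t) with hz
  obtain ⟨φ, hφ⟩ := exists_dual_eq_one h
  obtain ⟨-, -, -, hzm, hz1, hz2⟩ := diamond_relations h1 h2 hr ht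
  rw [← hz] at hzm hz1 hz2
  obtain ⟨t, ht, hφt, hzt⟩ : ∃ t' ∈ hw (p := p) M.obj α s r, φ t' = 0 ∧
      yop p (p - s) (r + 1) (xop p s r t') = z := by
    refine ⟨t + (-φ t) • z, Submodule.add_mem _ ht (Submodule.smul_mem _ _ hzm), ?_, ?_⟩
    · rw [map_add, map_smul, hφ, smul_eq_mul, mul_one, add_neg_cancel]
    · rw [xop_add, xop_smul, hz1, smul_zero, add_zero]
  clear hz
  obtain ⟨r1, r2, r3, -, -, -⟩ := diamond_relations h1 h2 hr ht
  rw [hzt] at r3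
  have hy0 : r = 1 → ∀ w ∈ hw (p := p) M.obj α s r, yop p s r w = 0 := fun hr1 w hw => by
    have := yop_mem k1 k2 hw
    rwa [hw_eq_bot (by omega), Submodule.mem_bot] at this
  let u : Corner → M.obj
    | .top => t
    | .bot => z
    | .right => xop p s r t
    | .left => yop p s r t
  let ψ : Corner → M.obj →ₗ[ℂ] ℂ
    | .top => φ ∘ₗ yopL p M.obj (p - s) (r + 1) ∘ₗ xopL p M.obj s r
    | .bot => φ
    | .right => φ ∘ₗ yopL p M.obj (p - s) (r + 1)
    | .left => -(φ ∘ₗ xopL p M.obj (p - s) (r - 1))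
  have ψt : ∀ w, ψ .top w = φ (yop p (p - s) (r + 1) (xop p s r w)) := fun _ => rfl
  have ψb : ∀ w, ψ .bot w = φ w := fun _ => rfl
  have ψr : ∀ w, ψ .right w = φ (yop p (p - s) (r + 1) w) := fun _ => rfl
  have ψl : ∀ w, ψ .left w = -φ (xop p (p - s) (r - 1) w) := fun _ => rfl
  have : Finite Corner := Set.finite_univ_iff.1
    ((Set.toFinite {Corner.top, .bot, .left, .right}).subset fun i _ => by cases i <;> simp)
  have hmem : ∀ i, u i ∈ spanFamily (Corner.sign α) (Corner.fst p s) (Corner.snd r) u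
      (Corner.sign α i) (Corner.fst p s i) (Corner.snd r i) := fun i => mem_spanFamily i
  have e1 : (p : ℤ) - (p - s) = s := by ring
  have e2 : ((r : ℤ) - 1) + 1 = r := by ring
  have e3 : ((r : ℤ) + 1) - 1 = r := by ring
  have key := fun (β : ℤˣ) (k l : ℤ) (k1' : 1 ≤ k) (k2' : k ≤ p) (w : M.obj)
      (hw' : w ∈ hw (p := p) M.obj β k l) => mem_spanFamily_of_isIndecomposableModule
    (α := Corner.sign α) (s := Corner.fst p s) (r := Corner.snd r) (u := u) (φ := ψ) hI
    (fun i => by cases i <;> simp only [Corner.fst] <;> omega)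
    (fun i => by cases i <;> simp only [Corner.fst] <;> omega)
    (fun i => by
      cases i
      · exact ht
      · exact hzm
      · exact yop_mem k1 k2 ht
      · exact xop_mem k1 k2 ht)
    (fun i _ => by
      cases i <;> simp only [Corner.sign, Corner.fst, Corner.snd, neg_neg, e1, e2]
      · exact hmem .right
      · rw [hz1]; exact Submodule.zero_mem _
      · rw [show u .left = yop p s r t from rfl]
        by_cases hr1 : r = 1
        · rw [hy0 hr1 t ht, xop_zero]; exact Submodule.zero_mem _
        · rw [r3 hr1]; exact Submodule.neg_mem _ (hmem .bot)
      · rw [r1]; exact Submodule.zero_mem _)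
    (fun i _ => by
      cases i <;> simp only [Corner.sign, Corner.fst, Corner.snd, neg_neg, e1, e3]
      · exact hmem .left
      · rw [hz2]; exact Submodule.zero_mem _
      · rw [r2]; exact Submodule.zero_mem _
      · rw [hzt]; exact hmem .bot)
    (fun i hi => by
      cases i
      · rw [ψt, hzt, hφ]
      · rw [ψb, hφ]
      · have hr1 : (1 : ℤ) ≤ r - 1 := hi
        rw [ψl, r3 (by omega), map_neg, neg_neg, hφ]
      · rw [ψr, hzt, hφ])
    (fun i j hij a b c => by
      cases i <;> cases j <;> simp only [Corner.snd] at c <;>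
        first | exact absurd rfl hij | omega | skip
      · rw [ψt, hz1, yop_zero, map_zero])
    (fun i _ w hw h => by
      cases i <;> simp only [Corner.sign, Corner.fst, Corner.snd, neg_neg, e1, e3] at hw h ⊢
      · obtain ⟨a, -, -⟩ := xop_yop_relations (by omega) (by omega) hw
        rw [e1, e2] at a
        rw [ψt, a, yop_zero, map_zero]
      · have := h .left rfl rfl rfl
        rwa [ψl, neg_eq_zero] at this
      · obtain ⟨a, -, -⟩ := xop_yop_relations (by omega) (by omega) hw
        rw [sub_add_cancel] at a
        rw [ψl, a, map_zero, neg_zero]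
      · exact h .top rfl rfl rfl)
    (fun i _ w hw h => by
      cases i <;> simp only [Corner.sign, Corner.fst, Corner.snd, neg_neg, e1, e2] at hw h ⊢
      · obtain ⟨-, -, a⟩ := xop_yop_relations (by omega) (by omega) hw
        rw [e1, e3] at a
        obtain ⟨-, b, -⟩ := xop_yop_relations (by omega) (by omega)
          (xop_mem (by omega) (by omega) hw)
        rw [e1, add_sub_cancel_right] at b
        rw [ψt, a (by omega), ← neg_one_smul ℂ, yop_smul, b, smul_zero, map_zero]
      · exact h .right rfl rfl rfl
      · rw [ψl]
        by_cases hr1 : r = 1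
        · rw [hy0 hr1 w hw, xop_zero, map_zero, neg_zero]
        · obtain ⟨-, -, a⟩ := xop_yop_relations k1 k2 hw
          rw [a (by exact_mod_cast hr1), map_neg, neg_neg]
          exact h .top rfl rfl rfl
      · obtain ⟨-, a, -⟩ := xop_yop_relations (by omega) (by omega) hw
        rw [add_sub_cancel_right] at a
        rw [ψr, a, map_zero])
    .top (by simp only [Corner.snd]; omega) k1' k2' hw'
  refine IsDiamond.isP h1 h2 hr (t := t) ⟨ht, by rwa [hzt], fun β k l a b w hw h0 => ?_⟩
  have hw := key β k l a b w hw
  rw [hzt]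
  rw [spanFamily] at hw
  by_cases hA : β = α ∧ k = s ∧ l = r
  · refine Or.inl ⟨hA.1, hA.2.1, hA.2.2, ?_⟩
    have : w ∈ Submodule.span ℂ {t, z} := Submodule.span_mono (by
      rintro _ ⟨i, -, -, h3, rfl⟩
      cases i <;> simp only [Corner.snd] at h3
      · exact Or.inl rfl
      · exact Or.inr rfl
      · omega
      · omega) hw
    obtain ⟨c, d, h⟩ := Submodule.mem_span_pair.1 this
    exact ⟨c, d, h.symm⟩
  by_cases hB : β = -α ∧ k = p - s ∧ l = r + 1
  · refine Or.inr (Or.inl ⟨hB.1, hB.2.1, hB.2.2, ?_⟩)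
    have : w ∈ Submodule.span ℂ {xop p s r t} := Submodule.span_mono (by
      rintro _ ⟨i, -, -, h3, rfl⟩
      cases i <;> simp only [Corner.snd] at h3
      · omega
      · omega
      · omega
      · rfl) hw
    obtain ⟨c, h⟩ := Submodule.mem_span_singleton.1 this
    exact ⟨c, h.symm⟩
  by_cases hC : β = -α ∧ k = p - s ∧ l = r - 1
  · refine Or.inr (Or.inr ⟨hC.1, hC.2.1, hC.2.2, ?_⟩)
    have : w ∈ Submodule.span ℂ {yop p s r t} := Submodule.span_mono (by
      rintro _ ⟨i, -, -, h3, rfl⟩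
      cases i <;> simp only [Corner.snd] at h3
      · omega
      · omega
      · rfl
      · omega) hw
    obtain ⟨c, h⟩ := Submodule.mem_span_singleton.1 this
    exact ⟨c, h.symm⟩
  refine absurd ((Submodule.mem_bot ℂ).1 ?_) h0
  convert hw
  symm
  rw [Submodule.span_eq_bot]
  rintro _ ⟨i, h1, h2, h3, -⟩
  cases i
  · exact absurd ⟨h1.symm, h2.symm, h3.symm⟩ hA
  · exact absurd ⟨h1.symm, h2.symm, h3.symm⟩ hA
  · exact absurd ⟨h1.symm, h2.symm, h3.symm⟩ hC
  · exact absurd ⟨h1.symm, h2.symm, h3.symm⟩ hB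

/-- An indecomposable module without diamonds is spanned by a string starting at a label with the
least possible second entry. -/
theorem exists_isString_of_isIndecomposableModule (hI : IsIndecomposableModule (LU p) M.obj)
    (h1 : 1 ≤ s) (h2 : s < p) {top : ℤ → Prop} (htop : ∀ j, top (j + 1) ↔ ¬ top j)
    (hYX : ∀ (β : ℤˣ) (t k : ℤ), 1 ≤ t → t < p → ∀ w ∈ hw (p := p) M.obj β t k,
      yop p (p - t) (k + 1) (xop p t k w) = 0)
    (hmin : ∀ (β : ℤˣ) (t k : ℤ), 1 ≤ t → t < p → k < r → hw (p := p) M.obj β t k = ⊥)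
    {v : M.obj} (hv : v ∈ hw (p := p) M.obj α s r) (hv0 : v ≠ 0)
    (ht : top 0 → xop p s r v ≠ 0) (hnt : ¬ top 0 → xop p s r v = 0) :
    ∃ (l : ℕ) (u : ℤ → M.obj), 1 ≤ l ∧ IsString (p := p) α s r l top u := by
  have hb := zigzagFst_bounds (p := p) h1 h2
  have hXY : ∀ (β : ℤˣ) (t k : ℤ), 1 ≤ t → t < p → ∀ w ∈ hw (p := p) M.obj β t k,
      xop p (p - t) (k - 1) (yop p t k w) = 0 := fun β t k a b w hw => by
    by_cases hk : k = 1
    · have := yop_mem a b hw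
      rw [hw_eq_bot (by omega), Submodule.mem_bot] at this
      rw [this, xop_zero]
    · rw [(xop_yop_relations a b hw).2.2 hk, hYX β t k a b w hw, neg_zero]
  let A : ℤ → Submodule ℂ M.obj := fun j =>
    hw (p := p) M.obj (zigzagSign α j) (zigzagFst p s j) (r + j)
  let X : ℤ → M.obj →ₗ[ℂ] M.obj := fun j => xopL p M.obj (zigzagFst p s j) (r + j)
  let Y : ℤ → M.obj →ₗ[ℂ] M.obj := fun j => yopL p M.obj (zigzagFst p s j) (r + j)
  have hX : ∀ j, ∀ w ∈ A j, X j w ∈ A (j + 1) := fun j w hw => by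
    have := xop_mem (hb j).1 (hb j).2 hw
    rwa [← zigzagSign_succ, ← zigzagFst_succ, add_assoc] at this
  have hY : ∀ j, ∀ w ∈ A j, Y j w ∈ A (j - 1) := fun j w hw => by
    have := yop_mem (hb j).1 (hb j).2 hw
    rwa [← zigzagSign_pred, ← zigzagFst_pred, add_sub_assoc] at this
  obtain ⟨R, hR⟩ := exists_hw_bound p M.obj
  obtain ⟨l, u, φ, f1, f2, f3, f4, f5, f6, f7, f8⟩ := exists_string (A := A) (X := X) (Y := Y) htop hX
    (fun j w hw => by
      have := hY _ w hw
      rwa [add_sub_cancel_right] at this)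
    (fun j w hw => by
      have := (xop_yop_relations (hb j).1 (hb j).2 hw).1
      rwa [← zigzagFst_succ, add_assoc] at this)
    (fun j w hw => by
      have := (xop_yop_relations (hb _).1 (hb _).2 hw).2.1
      rwa [← zigzagFst_pred, show j + 2 - 1 = j + 1 by ring,
        show (r : ℤ) + (j + 2) - 1 = r + (j + 1) by ring] at this)
    (fun j w hw => by
      have := hYX _ _ _ (hb j).1 (hb j).2 w hw
      rwa [← zigzagFst_succ, add_assoc] at this)
    (fun j w hw => by
      have := hXY _ _ _ (hb _).1 (hb _).2 w hw
      rwa [← zigzagFst_pred, add_sub_cancel_right, add_sub_assoc, add_sub_cancel_right] at this)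
    (hmin _ _ _ (hb _).1 (hb _).2 (by omega)) (N := R.toNat)
    (fun j hj => hR _ _ _ (hb j).1 (hb j).2.le (by omega)) (v := v)
    (by simpa [A, zigzagSign, zigzagFst] using hv) hv0
    (fun h => by simpa [X, xopL, zigzagFst] using ht h)
    (fun h => by simpa [X, xopL, zigzagFst] using hnt h)
  have hmem : ∀ j : ℕ, j < l + 1 → u j ∈ spanFamily (fun i : Fin (l + 1) => zigzagSign α (i : ℕ))
      (fun i => zigzagFst p s (i : ℕ)) (fun i => (r : ℤ) + (i : ℕ)) (fun i => u i)
      (zigzagSign α j) (zigzagFst p s j) (r + j) := fun j hj => mem_spanFamily (u := fun i : Fin (l + 1) => u i) ⟨j, hj⟩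
  have key := fun (β : ℤˣ) (k m : ℤ) (k1' : 1 ≤ k) (k2' : k ≤ p) (w : M.obj)
      (hw' : w ∈ hw (p := p) M.obj β k m) => mem_spanFamily_of_isIndecomposableModule
    (α := fun i : Fin (l + 1) => zigzagSign α (i : ℕ)) (s := fun i => zigzagFst p s (i : ℕ))
    (r := fun i => (r : ℤ) + (i : ℕ)) (u := fun i => u i) (φ := fun i => φ i) hI
    (fun i => (hb _).1) (fun i => (hb _).2.le) (fun i => f1 i (by omega))
    (fun i _ => by
      rw [← zigzagSign_succ, ← zigzagFst_succ, add_assoc]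
      by_cases hi : top (i : ℕ)
      · have := f3 i (by omega) hi
        change xop p (zigzagFst p s (i : ℕ)) (r + (i : ℕ)) (u i) = _ at this
        rw [this]
        split_ifs with h
        · exact_mod_cast hmem (i + 1) (by omega)
        · exact Submodule.zero_mem _
      · have := f4 i (by omega) hi
        change xop p (zigzagFst p s (i : ℕ)) (r + (i : ℕ)) (u i) = _ at this
        rw [this]
        exact Submodule.zero_mem _)
    (fun i _ => by
      rw [← zigzagSign_pred, ← zigzagFst_pred, add_sub_assoc]
      by_cases hi : top (i : ℕ)
      · have := f5 i (by omega) hi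
        change yop p (zigzagFst p s (i : ℕ)) (r + (i : ℕ)) (u i) = _ at this
        rw [this]
        split_ifs with h
        · have := hmem (i - 1) (by omega)
          rwa [Nat.cast_sub h, Nat.cast_one] at this
        · exact Submodule.zero_mem _
      · have := f6 i (by omega) hi
        change yop p (zigzagFst p s (i : ℕ)) (r + (i : ℕ)) (u i) = _ at this
        rw [this]
        exact Submodule.zero_mem _)
    (fun i _ => f2 i (by omega)) (fun i j hij _ _ h => absurd (Fin.ext (by omega)) hij)
    (fun i _ w hw h => by
      rw [← zigzagFst_pred, ← zigzagSign_pred, add_sub_assoc] at hw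
      rw [← zigzagFst_pred, add_sub_assoc]
      refine f7 i (by omega) w hw fun hi => h ⟨i - 1, by omega⟩ ?_ ?_ ?_
      · rw [Nat.cast_sub hi, Nat.cast_one, zigzagSign_pred]
      · rw [Nat.cast_sub hi, Nat.cast_one, zigzagFst_pred]
      · rw [Nat.cast_sub hi, Nat.cast_one, add_sub_assoc])
    (fun i _ w hw h => by
      rw [← zigzagFst_succ, ← zigzagSign_succ, add_assoc] at hw
      rw [← zigzagFst_succ, add_assoc]
      refine f8 i (by omega) w hw fun hi => h ⟨i + 1, by omega⟩ ?_ ?_ ?_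
      · push_cast; rw [zigzagSign_succ]
      · push_cast; rw [zigzagFst_succ]
      · push_cast; ring)
    0 (by
      have := r_pos_of_ne_zero hv hv0
      simp only [Fin.val_zero]; omega) k1' k2' hw'
  have hU : ∀ j : ℤ, 0 ≤ j → j < (l + 1 : ℕ) → ∃ i : ℕ, i ≤ l ∧ j = i := fun j a b =>
    ⟨j.toNat, by omega, by omega⟩
  refine ⟨l + 1, fun j => if 0 ≤ j ∧ j < (l + 1 : ℕ) then u j.toNat else 0, by omega,
    fun j a b => ?_, fun j a b => ?_, fun j a => if_neg a, fun β t k a b w hw h0 => ?_,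
    fun j a b h => ?_, fun j a b h => ?_, fun j a b h => ?_, fun j a b h => ?_⟩
  · obtain ⟨i, hi, rfl⟩ := hU j a b
    rw [if_pos ⟨a, b⟩]
    exact f1 i hi
  · obtain ⟨i, hi, rfl⟩ := hU j a b
    rw [if_pos ⟨a, b⟩]
    intro h
    have := f2 i hi
    rw [show u i = 0 from h, map_zero] at this
    exact zero_ne_one this
  · obtain ⟨i, c1, c2, c3, c, hc⟩ := exists_of_mem_spanFamily
      (fun i j _ _ h => Fin.ext (by omega)) (key β t k a b w hw) h0
    refine ⟨(i : ℕ), by omega, by omega, c1, c2, c3, c, ?_⟩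
    rw [if_pos (by omega)]
    exact hc
  · obtain ⟨i, hi, rfl⟩ := hU j a b
    rw [if_pos ⟨a, b⟩]
    refine (f3 i hi h).trans ?_
    exact if_congr (by omega) (by congr 1) rfl
  · obtain ⟨i, hi, rfl⟩ := hU j a b
    rw [if_pos ⟨a, b⟩]
    refine (f5 i hi h).trans ?_
    exact if_congr (by omega) (by congr 1; omega) rfl
  · obtain ⟨i, hi, rfl⟩ := hU j a b
    rw [if_pos ⟨a, b⟩]
    exact f4 i hi h
  · obtain ⟨i, hi, rfl⟩ := hU j a b
    rw [if_pos ⟨a, b⟩]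
    exact f6 i hi h

theorem even_add_one_iff (j : ℤ) : Even (j + 1) ↔ ¬ Even j := Int.even_add_one

theorem odd_add_one_iff (j : ℤ) : Odd (j + 1) ↔ ¬ Odd j := by
  rw [← Int.not_even_iff_odd, ← Int.not_even_iff_odd, Int.even_add_one]

/-- The classification of the indecomposable modules. -/
theorem classification (hI : IsIndecomposableModule (LU p) M.obj) :
    (∃ (α : ℤˣ) (r : ℕ), 1 ≤ r ∧ IsX α p r M) ∨ ∃ (α : ℤˣ) (s r : ℕ), 1 ≤ s ∧ s < p ∧ 1 ≤ r ∧
      (IsP α s r M ∨ ∃ (l : ℕ) (u : ℤ → M.obj), 1 ≤ l ∧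
        (IsString (p := p) α s r l Even u ∨ IsString (p := p) α s r l Odd u)) := by
  classical
  have := hI.1
  have toNat : ∀ {α : ℤˣ} {s r : ℤ} {u : M.obj}, 1 ≤ s → u ∈ hw (p := p) M.obj α s r → u ≠ 0 →
      ∃ s' r' : ℕ, s = s' ∧ r = r' ∧ 1 ≤ s' ∧ 1 ≤ r' := fun {α s r u} h hu h0 => by
    have := r_pos_of_ne_zero hu h0
    exact ⟨s.toNat, r.toNat, by omega, by omega, by omega, by omega⟩
  obtain ⟨α, s, r, u, h1, h2, hu, h0⟩ := exists_hw_ne_zero (p := p) (M := M.obj)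
  obtain ⟨s, r, rfl, rfl, s1, r1⟩ := toNat h1 hu h0
  rcases h2.eq_or_lt with h2 | h2
  · obtain rfl : s = p := by omega
    exact Or.inl ⟨α, r, r1, isX_of_mem_hw_p hI hu h0⟩
  right
  by_cases hYX : ∀ (β : ℤˣ) (t k : ℤ), 1 ≤ t → t < p → ∀ w ∈ hw (p := p) M.obj β t k,
      yop p (p - t) (k + 1) (xop p t k w) = 0
  swap
  · push Not at hYX
    obtain ⟨β, t, k, t1, t2, w, hw, hw'⟩ := hYX
    obtain ⟨t, k, rfl, rfl, t1, k1⟩ := toNat t1 hw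
      (by rintro rfl; rw [xop_zero, yop_zero] at hw'; exact hw' rfl)
    exact ⟨β, t, k, t1, by omega, k1, Or.inl (isP_of_yop_xop_ne_zero hI t1 (by omega) hw hw')⟩
  have hex : ∃ r : ℕ, ∃ (α : ℤˣ) (s : ℕ), 1 ≤ s ∧ s < p ∧ ∃ u ∈ hw (p := p) M.obj α s r, u ≠ 0 :=
    ⟨r, α, s, s1, by omega, u, hu, h0⟩
  set r := Nat.find hex
  obtain ⟨α, s, s1, s2, u, hu, h0⟩ := Nat.find_spec hex
  have hmin : ∀ (β : ℤˣ) (t k : ℤ), 1 ≤ t → t < p → k < r → hw (p := p) M.obj β t k = ⊥ := by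
    intro β t k t1 t2 hk
    by_contra h
    obtain ⟨w, hw, hw0⟩ := Submodule.exists_mem_ne_zero_of_ne_bot h
    obtain ⟨t, k, rfl, rfl, t1, k1⟩ := toNat t1 hw hw0
    exact Nat.find_min hex (by omega : k < r) ⟨β, t, t1, by omega, w, hw, hw0⟩
  obtain ⟨-, r', -, hr', -, r1⟩ := toNat (by omega) hu h0
  by_cases hx : ∃ (α : ℤˣ) (s : ℕ), 1 ≤ s ∧ s < p ∧ ∃ u ∈ hw (p := p) M.obj α s r, xop p s r u ≠ 0
  · obtain ⟨α, s, s1, s2, u, hu, hx⟩ := hx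
    obtain ⟨l, u, hl, h⟩ := exists_isString_of_isIndecomposableModule hI s1 s2 (top := Even)
      even_add_one_iff hYX hmin hu (by rintro rfl; rw [xop_zero] at hx; exact hx rfl)
      (fun _ => hx) (fun h => absurd Even.zero h)
    exact ⟨α, s, r, s1, s2, by omega, Or.inr ⟨l, u, hl, Or.inl h⟩⟩
  · push Not at hx
    obtain ⟨l, u, hl, h⟩ := exists_isString_of_isIndecomposableModule hI s1 s2 (top := Odd)
      odd_add_one_iff hYX hmin hu h0
      (fun h => absurd h (by decide)) (fun h => hx α s s1 s2 u hu)
    exact ⟨α, s, r, s1, s2, by omega, Or.inr ⟨l, u, hl, Or.inr h⟩⟩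

end Classification

/-! ### The modules of the six shapes -/

section Shapes

variable {M : FinRep p} {α : ℤˣ} {s r : ℕ}

/-- The number of the subquotients of a zigzag module. -/
def Shape.len : Shape → ℕ
  | .X => 1
  | .P => 0
  | .W n => 2 * n + 1
  | .M n => 2 * n + 1
  | .N n => 2 * n
  | .Nbar n => 2 * n

/-- The indices of the subquotients on top in a zigzag module. -/
def Shape.top : Shape → ℤ → Prop
  | .M _ => Odd
  | .N _ => Odd
  | _ => Even

theorem Shape.top_add_one (t : Shape) (j : ℤ) : t.top (j + 1) ↔ ¬ t.top j := by
  cases t <;> first | exact even_add_one_iff j | exact odd_add_one_iff j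

theorem Shape.one_le_len {t : Shape} (ht : t ≠ .P) : 1 ≤ t.len := by
  rcases t with _ | _ | n | n | n | n <;> simp only [Shape.len] <;>
    first | exact absurd rfl ht | (have := n.pos; omega) | omega

variable [hp : Fact (2 ≤ p)]

theorem HasShape.exists_isString (h1 : 1 ≤ s) (h2 : s < p) (hr : 1 ≤ r) {t : Shape} (ht : t ≠ .P)
    (h : HasShape α s r M t) : ∃ u : ℤ → M.obj, IsString (p := p) α s r t.len t.top u := by
  have hE : ∀ l, IsZigzag α s r l (fun j => Even j) M →
      ∃ u : ℤ → M.obj, IsString (p := p) α s r l Even u := fun l h => by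
    obtain ⟨v, hv⟩ := (isZigzag_iff even_add_one_iff h1 h2).1 h
    exact ⟨_, hv.isString even_add_one_iff h1 h2 hr⟩
  have hO : ∀ l, IsZigzag α s r l (fun j => Odd j) M →
      ∃ u : ℤ → M.obj, IsString (p := p) α s r l Odd u := fun l h => by
    obtain ⟨v, hv⟩ := (isZigzag_iff odd_add_one_iff h1 h2).1 h
    exact ⟨_, hv.isString odd_add_one_iff h1 h2 hr⟩
  cases t with
  | X => exact IsX.isString h1 h2 hr h Even
  | P => exact absurd rfl ht
  | W n => exact hE _ h
  | M n => exact hO _ h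
  | N n => exact hO _ h
  | Nbar n => exact hE _ h

theorem IsP.exists_generator (h1 : 1 ≤ s) (h2 : s < p) (hr : 1 ≤ r) (h : IsP α s r M) :
    ∃ t : M.obj, IsDiamond (p := p) α s r t ∧ ∀ N : FinRep p, ∀ w ∈ hw (p := p) N.obj α s r,
      ∃ φ : M.obj →ₗ[LU p] N.obj, φ t = w := by
  obtain ⟨v, hv⟩ := (isP_iff h1 h2 hr).1 h
  refine ⟨_, hv.isDiamond h1 h2 hr, fun N w hw => ?_⟩
  obtain ⟨φ, hφ⟩ := hv.exists_hom (isFrame_diamondFrame h1 h2 hr hw)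
  exact ⟨φ, hφ .top⟩

theorem IsString.exists_hasShape_even {l : ℕ} {u : ℤ → M.obj} (h1 : 1 ≤ s) (h2 : s < p) (hr : 1 ≤ r)
    (hl : 1 ≤ l) (h : IsString (p := p) α s r l Even u) : ∃ t, HasShape α s r M t := by
  by_cases hl1 : l = 1
  · subst hl1
    exact ⟨.X, h.isX h1 h2⟩
  have h := h.isZigzag even_add_one_iff h1 h2 hr
  rcases Nat.even_or_odd' l with ⟨n, rfl | rfl⟩
  · exact ⟨.Nbar ⟨n, by omega⟩, h⟩
  · exact ⟨.W ⟨n, by omega⟩, h⟩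

theorem IsString.exists_hasShape_odd {l : ℕ} {u : ℤ → M.obj} (h1 : 1 ≤ s) (h2 : s < p) (hr : 1 ≤ r)
    (hl : 1 ≤ l) (h : IsString (p := p) α s r l Odd u) : ∃ t, HasShape α s r M t := by
  by_cases hl1 : l = 1
  · subst hl1
    exact ⟨.X, h.isX h1 h2⟩
  have h := h.isZigzag odd_add_one_iff h1 h2 hr
  rcases Nat.even_or_odd' l with ⟨n, rfl | rfl⟩
  · exact ⟨.N ⟨n, by omega⟩, h⟩
  · exact ⟨.M ⟨n, by omega⟩, h⟩

theorem exists_hasShape (h1 : 1 ≤ s) (h2 : s < p) (hr : 1 ≤ r) (t : Shape) :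
    ∃ M : FinRep p, HasShape α s r M t := by
  have hE : ∀ l, ∃ M : FinRep p, IsZigzag α s r l (fun j => Even j) M := fun l => by
    obtain ⟨M, v, h⟩ := exists_isZigzag (p := p) α r l even_add_one_iff h1 h2
    exact ⟨M, (isZigzag_iff even_add_one_iff h1 h2).2 ⟨v, h⟩⟩
  have hO : ∀ l, ∃ M : FinRep p, IsZigzag α s r l (fun j => Odd j) M := fun l => by
    obtain ⟨M, v, h⟩ := exists_isZigzag (p := p) α r l odd_add_one_iff h1 h2
    exact ⟨M, (isZigzag_iff odd_add_one_iff h1 h2).2 ⟨v, h⟩⟩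
  cases t with
  | X =>
    obtain ⟨M, v, h⟩ := exists_isX α r h1 h2.le
    exact ⟨M, (isX_iff h1 h2.le).2 ⟨v, h⟩⟩
  | P =>
    obtain ⟨M, v, h⟩ := exists_isP α r h1 h2
    exact ⟨M, (isP_iff h1 h2 hr).2 ⟨v, h⟩⟩
  | W n => exact hE _
  | M n => exact hO _
  | N n => exact hO _
  | Nbar n => exact hE _

theorem HasShape.isIndecomposableModule (h1 : 1 ≤ s) (h2 : s < p) (hr : 1 ≤ r) {t : Shape}
    (h : HasShape α s r M t) : IsIndecomposableModule (LU p) M.obj := by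
  by_cases ht : t = .P
  · subst ht
    obtain ⟨t, hd, -⟩ := IsP.exists_generator h1 h2 hr h
    exact hd.isIndecomposableModule h1 h2 hr
  · obtain ⟨u, hu⟩ := h.exists_isString h1 h2 hr ht
    exact hu.isIndecomposableModule t.top_add_one h1 h2 (Shape.one_le_len ht)

theorem HasShape.unique (h1 : 1 ≤ s) (h2 : s < p) (hr : 1 ≤ r) {α' : ℤˣ} {s' r' : ℕ} (h1' : 1 ≤ s')
    (h2' : s' < p) (hr' : 1 ≤ r') {t t' : Shape} (h : HasShape α s r M t)
    (h' : HasShape α' s' r' M t') : α = α' ∧ s = s' ∧ r = r' ∧ t = t' := by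
  by_cases ht : t = .P <;> by_cases ht' : t' = .P
  · subst ht; subst ht'
    obtain ⟨t, hd, -⟩ := IsP.exists_generator h1 h2 hr h
    obtain ⟨t', hd', -⟩ := IsP.exists_generator h1' h2' hr' h'
    obtain ⟨a, b, c⟩ := hd.unique h1 h2 hr hd' h1' h2' hr'
    exact ⟨a, b, c, rfl⟩
  · subst ht
    obtain ⟨t, hd, -⟩ := IsP.exists_generator h1 h2 hr h
    obtain ⟨u, hu⟩ := h'.exists_isString h1' h2' hr' ht'
    exact absurd hd (hu.not_isDiamond t'.top_add_one h1 h2)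
  · subst ht'
    obtain ⟨t', hd, -⟩ := IsP.exists_generator h1' h2' hr' h'
    obtain ⟨u, hu⟩ := h.exists_isString h1 h2 hr ht
    exact absurd hd (hu.not_isDiamond t.top_add_one h1' h2')
  · obtain ⟨u, hu⟩ := h.exists_isString h1 h2 hr ht
    obtain ⟨u', hu'⟩ := h'.exists_isString h1' h2' hr' ht'
    have hl := Shape.one_le_len ht
    have hl' := Shape.one_le_len ht'
    obtain ⟨a, b, c, d, e⟩ := hu.unique h1 h2 hl hu' h1' h2' hl'
    obtain ⟨-, -, -, -, e'⟩ := hu'.unique h1' h2' hl' hu h1 h2 hl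
    refine ⟨a, b, c, ?_⟩
    have e0 : Even (0 : ℤ) := Even.zero
    have o0 : ¬ Odd (0 : ℤ) := by decide
    rcases t with _ | _ | n | n | n | n <;> rcases t' with _ | _ | n' | n' | n' | n' <;>
      simp only [Shape.len, Shape.top, e0, o0, imp_false, imp_true_iff, not_le,
        not_true_eq_false] at d e e' ht ht' ⊢
    all_goals first
      | omega
      | (obtain rfl : n = n' := PNat.coe_injective (by omega); rfl)
      | (have := n.pos; omega)
      | (have := n'.pos; omega)

/-! ### Projective covers -/

/-- The morphism given by a linear map. -/
def toHom {M N : FinRep p} (φ : M.obj →ₗ[LU p] N.obj) : M ⟶ N :=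
  ObjectProperty.homMk (ModuleCat.ofHom φ)

/-- The linear map given by a morphism. -/
def fromHom {M N : FinRep p} (φ : M ⟶ N) : M.obj →ₗ[LU p] N.obj := φ.hom.hom

theorem surjective_of_epi {M N : FinRep p} (φ : M ⟶ N) [Epi φ] :
    Function.Surjective (fromHom φ) := by
  obtain ⟨Q, ⟨e⟩⟩ := exists_finRep_equiv p (N.obj ⧸ LinearMap.range (fromHom φ))
  let ψ : N.obj →ₗ[LU p] Q.obj := e.toLinearMap ∘ₗ (LinearMap.range (fromHom φ)).mkQ
  have h : φ ≫ toHom ψ = φ ≫ toHom 0 := by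
    change toHom (ψ ∘ₗ fromHom φ) = toHom (0 ∘ₗ fromHom φ)
    congr 1
    ext x
    change e ((LinearMap.range (fromHom φ)).mkQ (fromHom φ x)) = 0
    rw [Submodule.mkQ_apply, (Submodule.Quotient.mk_eq_zero _).2 (LinearMap.mem_range_self _ x), map_zero]
  have h' : ψ = 0 := congrArg fromHom ((cancel_epi φ).1 h)
  intro y
  have hy : e ((LinearMap.range (fromHom φ)).mkQ y) = 0 := LinearMap.congr_fun h' y
  rw [map_eq_zero_iff e e.injective, Submodule.mkQ_apply, Submodule.Quotient.mk_eq_zero] at hy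
  exact hy

theorem IsP.isProjectiveCover (h1 : 1 ≤ s) (h2 : s < p) (hr : 1 ≤ r) {P X : FinRep p}
    (hP : IsP α s r P) (hX : IsX α s r X) : IsProjectiveCover P X := by
  obtain ⟨t, ht, hφ⟩ := hP.exists_generator h1 h2 hr
  have k1 : (1 : ℤ) ≤ s := by exact_mod_cast h1
  have k2 : (s : ℤ) ≤ p := by exact_mod_cast h2.le
  refine ⟨⟨fun {E Y} f g _ => ?_⟩, ?_⟩
  · obtain ⟨w, hw, hw'⟩ := exists_map_eq_of_surjective (fromHom g) (surjective_of_epi g) k1 k2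
      (map_hw (fromHom f) ht.mem)
    obtain ⟨ψ, hψ⟩ := hφ E w hw
    refine ⟨toHom ψ, ?_⟩
    have : fromHom g ∘ₗ ψ = fromHom f := by
      have hm : t ∈ LinearMap.eqLocus (fromHom g ∘ₗ ψ) (fromHom f) := by
        change fromHom g (ψ t) = fromHom f t
        rw [hψ, hw']
      ext x
      have : x ∈ LinearMap.eqLocus (fromHom g ∘ₗ ψ) (fromHom f) := by
        rw [ht.eq_top hm]; trivial
      exact this
    exact congrArg toHom this
  · obtain ⟨u, hu, h0, hT⟩ := hX.exists_isKilled h1 h2.le hr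
    obtain ⟨π, hπ⟩ := hφ X u hu.mem
    have hs : ∀ A : Submodule (LU p) X.obj, u ∈ A → A = ⊤ := fun A hA => by
      rw [eq_top_iff, ← hT]
      exact hu.genSub_le hA
    have hπs := LinearMap.range_eq_top.1 (hs _ ⟨t, hπ⟩)
    refine ⟨π, hπs, fun A hA => ?_⟩
    have hs' : Function.Surjective (π ∘ₗ A.subtype) := fun y => by
      obtain ⟨x, rfl⟩ := hπs y
      have : x ∈ A ⊔ LinearMap.ker π := by rw [hA]; trivial
      obtain ⟨a, ha, b, hb, rfl⟩ := Submodule.mem_sup.1 this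
      refine ⟨⟨a, ha⟩, ?_⟩
      rw [map_add, LinearMap.mem_ker.1 hb, add_zero]
      rfl
    obtain ⟨w, hw, hw'⟩ := exists_map_eq_of_surjective (π ∘ₗ A.subtype) hs' k1 k2 hu.mem
    obtain ⟨c, d, hcd⟩ := ht.exists_eq h1 h2 (map_hw A.subtype hw)
    have hm : c • t + d • yop p (p - s) (r + 1) (xop p s r t) ∈ A := by
      rw [← hcd]; exact w.2
    refine ht.eq_top_of_smul_add h1 h2 hr (fun hc => h0 ?_) hm
    rw [← hw']
    change π (A.subtype w) = 0
    rw [hcd, hc, zero_smul, zero_add, map_complex_smul, map_yop, map_xop, hπ, hu.xop, yop_zero,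
      smul_zero]

end Shapes

/-! ### Blocks -/

section Blocks

/-- The label `(α, t, r)` belongs to the given block. -/
def InBlock (α : ℤˣ) (t r : ℤ) : Block p → Prop
  | .C β s _ => t ≠ p ∧ (if α = 1 then t else p - t) = s ∧ -(α * (-1) ^ r) = β
  | .S β k _ => α = β ∧ t = p ∧ r = k

theorem exists_inBlock (α : ℤˣ) {t r : ℤ} (h1 : 1 ≤ t) (h2 : t ≤ p) (hr : 1 ≤ r) :
    ∃ b : Block p, InBlock α t r b := by
  by_cases ht : t = p
  · exact ⟨.S α r.toNat (by omega), rfl, ht, by omega⟩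
  · refine ⟨.C (-(α * (-1) ^ r)) (if α = 1 then t else p - t).toNat ?_, ht, ?_, rfl⟩ <;>
      split_ifs <;> omega

theorem InBlock.unique {α : ℤˣ} {t r : ℤ} {b b' : Block p} (h : InBlock α t r b)
    (h' : InBlock α t r b') : b = b' := by
  rcases b with ⟨β, s, hs⟩ | ⟨β, k, hk⟩ <;> rcases b' with ⟨β', s', hs'⟩ | ⟨β', k', hk'⟩
  · obtain ⟨-, a, rfl⟩ := h
    obtain ⟨-, a', rfl⟩ := h'
    obtain rfl : s = s' := by exact_mod_cast a.symm.trans a'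
    rfl
  · exact absurd h'.2.1 h.1
  · exact absurd h.2.1 h'.1
  · obtain ⟨rfl, -, a⟩ := h
    obtain ⟨rfl, -, a'⟩ := h'
    obtain rfl : k = k' := by exact_mod_cast a.symm.trans a'
    rfl

theorem InBlock.of_shift {α : ℤˣ} {t r r' : ℤ} (h1 : 1 ≤ t) (h2 : t < p) (hr : Odd (r' - r))
    {b : Block p} (h : InBlock α t r b) : InBlock (-α) (p - t) r' b := by
  rcases b with ⟨β, s, hs⟩ | ⟨β, k, hk⟩
  · obtain ⟨-, a, c⟩ := h
    have e : (-1 : ℤˣ) ^ r' = -(-1) ^ r := by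
      rw [show r' = r + (r' - r) by ring, zpow_add, hr.neg_one_zpow, mul_neg_one]
    refine ⟨by omega, ?_, ?_⟩
    · rw [← a]
      rcases Int.units_eq_one_or α with rfl | rfl
      · rw [if_neg (by decide), if_pos rfl]; ring
      · rw [if_pos (by decide), if_neg (by decide)]
    · rw [← c, e, neg_mul_neg]
  · exact absurd h.2.1 (by omega)

theorem inBlock_shift {α : ℤˣ} {t r r' : ℤ} (h1 : 1 ≤ t) (h2 : t < p) (hr : Odd (r' - r))
    {b : Block p} : InBlock (-α) (p - t) r' b ↔ InBlock α t r b := by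
  refine ⟨fun h => ?_, fun h => h.of_shift h1 h2 hr⟩
  have hr' : Odd (r - r') := by rw [← neg_sub]; exact hr.neg
  have := h.of_shift (by omega) (by omega) hr'
  rwa [neg_neg, sub_sub_self_int] at this

theorem inBlock_zigzag {α : ℤˣ} {s r : ℕ} (h1 : 1 ≤ s) (h2 : s < p) {b : Block p} (j : ℕ) :
    InBlock (zigzagSign α j) (zigzagFst p s j) (r + j) b ↔ InBlock α s r b := by
  induction j with
  | zero => simp [zigzagSign, zigzagFst]
  | succ j ih =>
    have := zigzagFst_bounds h1 h2 j
    rw [← ih]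
    push_cast
    rw [zigzagSign_succ, zigzagFst_succ]
    exact inBlock_shift this.1 this.2 ⟨0, by ring⟩

theorem blockLabel_iff {β α : ℤˣ} {s s' r : ℕ} (hs : 1 ≤ s ∧ s ≤ p - 1) :
    BlockLabel p β s α s' r ↔ 1 ≤ s' ∧ s' < p ∧ 1 ≤ r ∧ InBlock (p := p) α s' r (.C β s hs) := by
  have hm : ((-1 : ℤˣ) = 1) ↔ False := by decide
  constructor
  · have e1 : ∀ k : ℕ, (-1 : ℤˣ) ^ ((2 * k : ℕ) : ℤ) = 1 := fun k => by
      rw [zpow_natCast]; exact (even_two_mul k).neg_one_pow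
    have e2 : ∀ k : ℕ, 1 ≤ k → (-1 : ℤˣ) ^ ((2 * k - 1 : ℕ) : ℤ) = -1 := fun k hk => by
      rw [zpow_natCast]
      exact Odd.neg_one_pow ⟨k - 1, by omega⟩
    rintro (⟨s, k, hk⟩ | ⟨s, k, hk⟩ | ⟨s, k, hk⟩ | ⟨s, k, hk⟩)
    · exact ⟨by omega, by omega, by omega, by omega, if_pos rfl, by rw [e2 k hk]; decide⟩
    · exact ⟨by omega, by omega, by omega, by omega, by rw [if_neg (by decide)]; omega,
        by rw [e1 k]; decide⟩
    · exact ⟨by omega, by omega, by omega, by omega, if_pos rfl, by rw [e1 k]; decide⟩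
    · exact ⟨by omega, by omega, by omega, by omega, by rw [if_neg (by decide)]; omega,
        by rw [e2 k hk]; decide⟩
  · rintro ⟨h1, h2, hr, -, a, rfl⟩
    rw [zpow_natCast]
    rcases Int.units_eq_one_or α with rfl | rfl <;> simp only [if_true, hm, if_false] at a <;>
      rcases Nat.even_or_odd' r with ⟨k, rfl | rfl⟩
    · obtain rfl : s' = s := by omega
      rw [(even_two_mul k).neg_one_pow]
      exact .minus_even s' k (by omega)
    · obtain rfl : s' = s := by omega
      rw [Odd.neg_one_pow ⟨k, rfl⟩]
      exact .plus_odd s' (k + 1) (by omega)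
    · obtain rfl : s' = p - s := by omega
      rw [(even_two_mul k).neg_one_pow]
      exact .plus_even s k (by omega)
    · obtain rfl : s' = p - s := by omega
      rw [Odd.neg_one_pow ⟨k, rfl⟩]
      exact .minus_odd s (k + 1) (by omega)

/-- The full subcategory of the modules all of whose highest weight vectors have labels in the given
block. -/
def blockProp (b : Block p) : ObjectProperty (FinRep p) := fun M =>
  ∀ (α : ℤˣ) (t r : ℤ), 1 ≤ t → t ≤ p → ∀ w ∈ hw (p := p) M.obj α t r, w ≠ 0 →
    InBlock α t r b

variable [hp : Fact (2 ≤ p)]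

theorem blockProp_of_injective {b : Block p} {M N : FinRep p} (φ : N.obj →ₗ[LU p] M.obj)
    (hφ : Function.Injective φ) (h : blockProp b M) : blockProp b N :=
  fun α t r h1 h2 _ hw h0 => h α t r h1 h2 _ (map_hw φ hw) fun h' =>
    h0 (hφ (h'.trans (map_zero φ).symm))

theorem eq_zero_of_blockProp {b b' : Block p} (hb : b ≠ b') {M N : FinRep p} (h : blockProp b M)
    (h' : blockProp b' N) (φ : M.obj →ₗ[LU p] N.obj) : φ = 0 := by
  rw [← LinearMap.ker_eq_top]
  refine eq_top_of_hw_le (p := p) fun α t r h1 h2 w hw => ?_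
  rw [LinearMap.mem_ker]
  by_contra h0
  exact hb ((h α t r h1 h2 w hw fun h => h0 (by rw [h, map_zero])).unique
    (h' α t r h1 h2 _ (map_hw φ hw) h0))

section Decomposition

variable (M : Type*) [AddCommGroup M] [Module (LU p) M] [Module ℂ M] [IsScalarTower ℂ (LU p) M]

variable (p) in
open Classical in
/-- The spaces of highest weight vectors whose labels satisfy a predicate. -/
def hwIf (Q : ℤˣ → ℤ → ℤ → Prop) (α : ℤˣ) (t r : ℤ) : Submodule ℂ M :=
  if Q α t r then hw (p := p) M α t r else ⊥

variable [FiniteDimensional ℂ M]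

theorem isStableFamily_hwIf {Q : ℤˣ → ℤ → ℤ → Prop}
    (hQ : ∀ (α : ℤˣ) (t r r' : ℤ), 1 ≤ t → t < p → Odd (r' - r) → Q α t r → Q (-α) (p - t) r') :
    IsStableFamily (p := p) (hwIf p M Q) := by
  refine ⟨fun α t r _ _ => ?_, fun α t r h1 h2 u hu => ?_, fun α t r h1 h2 u hu => ?_⟩
  · unfold hwIf; split_ifs
    · exact le_rfl
    · exact bot_le
  · unfold hwIf at hu
    split_ifs at hu with h
    · rw [hwIf, if_pos (hQ _ _ _ _ h1 h2 ⟨0, by ring⟩ h)]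
      exact xop_mem h1 h2 hu
    · rw [(Submodule.mem_bot ℂ).1 hu, xop_zero]; exact Submodule.zero_mem _
  · unfold hwIf at hu
    split_ifs at hu with h
    · rw [hwIf, if_pos (hQ _ _ _ _ h1 h2 ⟨-1, by ring⟩ h)]
      exact yop_mem h1 h2 hu
    · rw [(Submodule.mem_bot ℂ).1 hu, yop_zero]; exact Submodule.zero_mem _

variable (p) in
/-- The component of a module in a block. -/
def blockSub (b : Block p) : Submodule (LU p) M :=
  genSub (isStableFamily_hwIf M (Q := fun α t r => InBlock α t r b)
    fun _ _ _ _ h1 h2 hr h => h.of_shift h1 h2 hr)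

variable {M}

theorem mem_blockSub {b : Block p} {α : ℤˣ} {t r : ℤ} (h1 : 1 ≤ t) (h2 : t ≤ p) {w : M}
    (hw' : w ∈ hw (p := p) M α t r) (hb : InBlock α t r b) : w ∈ blockSub p M b :=
  le_genSub _ h1 h2 (α := α) (r := r) (by rwa [hwIf, if_pos hb])

theorem inBlock_of_mem_blockSub {b : Block p} {α : ℤˣ} {t r : ℤ} (h1 : 1 ≤ t) (h2 : t ≤ p) {w : M}
    (hw' : w ∈ hw (p := p) M α t r) (hb : w ∈ blockSub p M b) (h0 : w ≠ 0) : InBlock α t r b := by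
  have := mem_of_mem_hw_of_mem_genSub (isStableFamily_hwIf M (Q := fun α t r => InBlock α t r b)
    fun _ _ _ _ h1 h2 hr h => h.of_shift h1 h2 hr) h1 h2 hw' hb
  by_contra h
  rw [hwIf, if_neg h, Submodule.mem_bot] at this
  exact h0 this

variable (M) in
theorem isInternal_blockSub [DecidableEq (Block p)] : DirectSum.IsInternal (blockSub p M) := by
  refine DirectSum.isInternal_submodule_of_iSupIndep_of_iSup_eq_top (fun b => ?_)
    (eq_top_of_hw_le (p := p) fun α t r h1 h2 w hw => ?_)
  · let V := isStableFamily_hwIf M (Q := fun α t r => ¬ InBlock α t r b)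
      fun α t r r' h1 h2 hr h => by rwa [inBlock_shift h1 h2 hr]
    have hV : ⨆ (j : Block p) (_ : j ≠ b), blockSub p M j ≤ genSub V := by
      refine iSup₂_le fun j hj => genSub_le _ fun α t r h1 h2 w hw => ?_
      unfold hwIf at hw
      split_ifs at hw with h
      · refine le_genSub V h1 h2 (α := α) (r := r) ?_
        rwa [hwIf, if_pos fun h' => hj (h.unique h')]
      · rw [(Submodule.mem_bot ℂ).1 hw]; exact Submodule.zero_mem _
    refine Disjoint.mono_right hV (disjoint_genSub _ V fun α t r h1 h2 w hw hw' => ?_)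
    by_cases h : InBlock α t r b
    · rw [hwIf, if_neg (not_not.2 h)] at hw'
      exact (Submodule.mem_bot ℂ).1 hw'
    · rw [hwIf, if_neg h] at hw
      exact (Submodule.mem_bot ℂ).1 hw
  · by_cases h0 : w = 0
    · rw [h0]; exact Submodule.zero_mem _
    obtain ⟨b, hb⟩ := exists_inBlock α h1 h2 (r_pos_of_ne_zero hw h0)
    exact Submodule.mem_iSup_of_mem b (mem_blockSub h1 h2 hw hb)

end Decomposition

/-- An isomorphism in `FinRep p` from a linear equivalence. -/
def isoOfEquiv {M N : FinRep p} (e : M.obj ≃ₗ[LU p] N.obj) : M ≅ N where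
  hom := toHom e.toLinearMap
  inv := toHom e.symm.toLinearMap
  hom_inv_id := congrArg toHom (LinearMap.ext e.symm_apply_apply :
    e.symm.toLinearMap ∘ₗ e.toLinearMap = LinearMap.id)
  inv_hom_id := congrArg toHom (LinearMap.ext e.apply_symm_apply :
    e.toLinearMap ∘ₗ e.symm.toLinearMap = LinearMap.id)

theorem isDirectSumOfSubcategories_blockProp :
    IsDirectSumOfSubcategories (fun _ : FinRep p => True) blockProp where
  closed_iso b := ⟨fun e h => blockProp_of_injective (fromHom e.inv)
    (Function.LeftInverse.injective (g := fromHom e.hom) fun x =>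
      LinearMap.congr_fun (congrArg fromHom e.inv_hom_id) x) h⟩
  le _ _ _ := trivial
  hom_eq_zero _ _ hb _ _ h h' φ := congrArg toHom (eq_zero_of_blockProp hb h h' (fromHom φ))
  exists_decomposition M _ := by
    classical
    choose N hN using fun b => exists_finRep_equiv p (blockSub p M.obj b)
    let e := fun b => (hN b).some
    refine ⟨N, fun b α t r h1 h2 w hw h0 => ?_, ⟨?_⟩⟩
    · have h3 := map_hw (blockSub p M.obj b).subtype (map_hw (e b).symm.toLinearMap hw)
      refine inBlock_of_mem_blockSub h1 h2 h3 (Subtype.property _) fun h => h0 ?_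
      exact (e b).symm.map_eq_zero_iff.1 (Subtype.ext h)
    · exact (LinearEquiv.ofBijective (DirectSum.coeLinearMap (blockSub p M.obj))
        (isInternal_blockSub M.obj)).symm ≪≫ₗ DFinsupp.mapRange.linearEquiv e

end Blocks

/-! ### Indecomposable subcategories -/

section Indecomposable

theorem isZero_of_subsingleton {M : FinRep p} [Subsingleton M.obj] : Limits.IsZero M :=
  (Limits.IsZero.iff_id_eq_zero M).2
    (congrArg toHom (LinearMap.ext fun _ => Subsingleton.elim _ _ : LinearMap.id = (0 : M.obj →ₗ[LU p] M.obj)))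

theorem not_isZero {M : FinRep p} [Nontrivial M.obj] : ¬ Limits.IsZero M := fun h => by
  obtain ⟨x, hx⟩ := exists_ne (0 : M.obj)
  have := congrArg fromHom ((Limits.IsZero.iff_id_eq_zero M).1 h)
  exact hx (LinearMap.congr_fun this x)

/-- An indecomposable module in a direct sum of two subcategories lies in one of them. -/
theorem IsDirectSumOfSubcategories.exists_of_isIndecomposableModule
    {C : ObjectProperty (FinRep p)} {D : Bool → ObjectProperty (FinRep p)}
    (hD : IsDirectSumOfSubcategories C D) {M : FinRep p} (hM : C M)
    (hI : IsIndecomposableModule (LU p) M.obj) : ∃ i, D i M := by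
  obtain ⟨N, hN, ⟨e⟩⟩ := hD.exists_decomposition M hM
  let π : ∀ i, M.obj →ₗ[LU p] (N i).obj := fun i =>
    DirectSum.component (LU p) Bool (fun i => (N i).obj) i ∘ₗ e.toLinearMap
  have hs : ∀ i, Function.Surjective (π i) := fun i y => by
    refine ⟨e.symm (DirectSum.lof (LU p) Bool (fun i => (N i).obj) i y), ?_⟩
    change DirectSum.component (LU p) Bool (fun i => (N i).obj) i (e (e.symm _)) = y
    rw [e.apply_symm_apply, DirectSum.component.lof_self]
  have h0 : ∀ x, π true x = 0 → π false x = 0 → x = 0 := fun x h1 h2 => by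
    refine e.map_eq_zero_iff.1 (DFinsupp.ext fun i => ?_)
    cases i
    · exact h2
    · exact h1
  have hc : IsCompl (LinearMap.ker (π true)) (LinearMap.ker (π false)) := by
    refine ⟨Submodule.disjoint_def.2 fun x h1 h2 => h0 x h1 h2, codisjoint_iff.2 ?_⟩
    rw [eq_top_iff]
    intro x _
    let y := e.symm (DirectSum.lof (LU p) Bool (fun i => (N i).obj) true (π true x))
    have h1 : π true y = π true x := by
      change DirectSum.component (LU p) Bool (fun i => (N i).obj) true (e (e.symm _)) = _
      rw [e.apply_symm_apply, DirectSum.component.lof_self]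
    have h2 : π false y = 0 := by
      change DirectSum.component (LU p) Bool (fun i => (N i).obj) false (e (e.symm _)) = _
      rw [e.apply_symm_apply, DirectSum.component.of, dif_neg (by decide)]
    refine Submodule.mem_sup.2 ⟨x - y, ?_, y, h2, sub_add_cancel x y⟩
    rw [LinearMap.mem_ker, map_sub, h1, sub_self]
  have key : ∀ i, LinearMap.ker (π i) = ⊥ → D i M := fun i h => by
    have := hD.closed_iso i
    exact (D i).prop_of_iso
      (isoOfEquiv (LinearEquiv.ofBijective (π i) ⟨LinearMap.ker_eq_bot.1 h, hs i⟩)).symm (hN i)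
  rcases hI.2 _ _ hc with h | h
  · exact ⟨_, key _ h⟩
  · exact ⟨_, key _ h⟩

/-- A subcategory that is generated by a chain of indecomposable modules with nonzero morphisms
between consecutive ones is indecomposable. -/
theorem isIndecomposableSubcategory_of_chain {C : ObjectProperty (FinRep p)} (G : ℕ → FinRep p)
    (hG : ∀ k, C (G k)) (hI : ∀ k, IsIndecomposableModule (LU p) (G k).obj)
    (hlink : ∀ k, ∃ φ : (G (k + 1)).obj →ₗ[LU p] (G k).obj, φ ≠ 0)
    (hgen : ∀ M, C M → Nontrivial M.obj → ∃ k, ∃ φ : (G k).obj →ₗ[LU p] M.obj, φ ≠ 0) :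
    IsIndecomposableSubcategory C := by
  have := (hI 0).1
  refine ⟨⟨G 0, hG 0, not_isZero⟩, fun D hD => ?_⟩
  have hhom : ∀ i j M N, D i M → D j N → ∀ φ : M.obj →ₗ[LU p] N.obj, φ ≠ 0 → i = j :=
    fun i j M N h h' φ hφ => by
      by_contra hij
      exact hφ (congrArg fromHom (hD.hom_eq_zero i j hij M N h h' (toHom φ)))
  obtain ⟨i, hi⟩ := hD.exists_of_isIndecomposableModule (hG 0) (hI 0)
  have hi : ∀ k, D i (G k) := fun k => by
    induction k with
    | zero => exact hi
    | succ k ih =>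
      obtain ⟨j, hj⟩ := hD.exists_of_isIndecomposableModule (hG (k + 1)) (hI (k + 1))
      obtain ⟨φ, hφ⟩ := hlink k
      rwa [hhom _ _ _ _ hj ih φ hφ] at hj
  refine ⟨!i, fun M hM => ?_⟩
  by_cases hn : Nontrivial M.obj
  · obtain ⟨k, φ, hφ⟩ := hgen M (hD.le _ _ hM) hn
    exact absurd (hhom _ _ _ _ (hi k) hM φ hφ) (by cases i <;> decide)
  · have := not_nontrivial_iff_subsingleton.1 hn
    exact isZero_of_subsingleton

variable [hp : Fact (2 ≤ p)] {α : ℤˣ} {s r : ℕ} {M : FinRep p} {b : Block p}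

theorem HasShape.blockProp_iff (h1 : 1 ≤ s) (h2 : s < p) (hr : 1 ≤ r) {t : Shape}
    (h : HasShape α s r M t) : blockProp b M ↔ InBlock α s r b := by
  have k1 : (1 : ℤ) ≤ s := by exact_mod_cast h1
  have k2 : (s : ℤ) < p := by exact_mod_cast h2
  by_cases ht : t = .P
  · subst ht
    obtain ⟨t, hd, -⟩ := IsP.exists_generator h1 h2 hr h
    refine ⟨fun hb => hb _ _ _ k1 k2.le t hd.mem ?_, fun hb β k l a1 a2 w hw h0 => ?_⟩
    · rintro rfl
      exact hd.ne_zero (by rw [xop_zero, yop_zero])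
    · rcases hd.hw_le β k l a1 a2 w hw h0 with ⟨rfl, rfl, rfl, -⟩ | ⟨rfl, rfl, rfl, -⟩ |
        ⟨rfl, rfl, rfl, -⟩
      · exact hb
      · exact hb.of_shift k1 k2 ⟨0, by ring⟩
      · exact hb.of_shift k1 k2 ⟨-1, by ring⟩
  · obtain ⟨u, hu⟩ := h.exists_isString h1 h2 hr ht
    have hl := Shape.one_le_len ht
    refine ⟨fun hb => ?_, fun hb β k l a1 a2 w hw h0 => ?_⟩
    · have hb' := zigzagFst_bounds h1 h2 0
      exact (inBlock_zigzag h1 h2 0).1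
        (hb _ _ _ hb'.1 hb'.2.le _ (hu.mem 0 le_rfl (by omega)) (hu.ne_zero 0 le_rfl (by omega)))
    · obtain ⟨j, j0, -, rfl, rfl, rfl, -⟩ := hu.hw_le β k l a1 a2 w hw h0
      lift j to ℕ using j0
      exact (inBlock_zigzag h1 h2 j).2 hb

theorem IsX.blockProp_iff (h1 : 1 ≤ s) (h2 : s ≤ p) (hr : 1 ≤ r) (h : IsX α s r M) :
    blockProp b M ↔ InBlock α s r b := by
  obtain ⟨u, hu, h0, hT⟩ := h.exists_isKilled h1 h2 hr
  refine ⟨fun hb => hb _ _ _ hu.one_le hu.le u hu.mem h0, fun hb β k l a1 a2 w hw hw0 => ?_⟩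
  obtain ⟨rfl, rfl, rfl, -⟩ := hu.of_mem_genSub a1 a2 hw (by rw [hT]; trivial) hw0
  exact hb

theorem isIndecomposableSubcategory_blockProp_S (α : ℤˣ) (r : ℕ) (hr : 1 ≤ r) :
    IsIndecomposableSubcategory (blockProp (p := p) (.S α r hr)) := by
  have hp2 := hp.out
  obtain ⟨X, v, hv⟩ := exists_isX (p := p) α r (by omega) le_rfl
  have hX := (isX_iff _ _).2 ⟨v, hv⟩
  have hX' : blockProp (.S α r hr) X := (hX.blockProp_iff (by omega) le_rfl hr).2 ⟨rfl, rfl, rfl⟩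
  have hs := hX.isSimpleModule (by omega) le_rfl hr
  have hn := IsSimpleModule.nontrivial (LU p) X.obj
  refine isIndecomposableSubcategory_of_chain (fun _ => X) (fun _ => hX') (fun _ => ⟨hn, fun A B h => ?_⟩)
    (fun _ => ⟨LinearMap.id, fun h => ?_⟩) fun M hM hn => ⟨0, ?_⟩
  · refine (eq_bot_or_eq_top A).imp_right fun h' => ?_
    have := h.disjoint.eq_bot
    rwa [h', top_inf_eq] at this
  · obtain ⟨x, hx⟩ := exists_ne (0 : X.obj)
    exact hx (LinearMap.congr_fun h x)
  · obtain ⟨β, k, l, w, a1, a2, hw, h0⟩ := exists_hw_ne_zero (p := p) (M := M.obj)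
    obtain ⟨e1, e2, e3⟩ := hM _ _ _ a1 a2 w hw h0
    rw [e1, e2, e3] at hw
    have hF : IsFrame (glueX α p r (by omega) le_rfl) (fun _ => w) :=
      ⟨fun _ => hw, fun _ _ h => absurd h (lt_irrefl (p : ℤ)), fun _ _ h => absurd h (lt_irrefl (p : ℤ))⟩
    obtain ⟨φ, hφ⟩ := hv.exists_hom hF
    refine ⟨φ, fun h => h0 ?_⟩
    rw [← hφ (), h, LinearMap.zero_apply]

theorem InBlock.label_unique {β α α' : ℤˣ} {s : ℕ} {t t' r : ℤ} {hs : 1 ≤ s ∧ s ≤ p - 1}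
    (h : InBlock α t r (.C β s hs)) (h' : InBlock α' t' r (.C β s hs)) : α = α' ∧ t = t' := by
  obtain ⟨-, a, b⟩ := h
  obtain ⟨-, a', b'⟩ := h'
  obtain rfl : α = α' := mul_right_cancel (neg_injective (b.trans b'.symm))
  refine ⟨rfl, ?_⟩
  have := a.trans a'.symm
  split_ifs at this <;> omega

theorem exists_inBlock_C (β : ℤˣ) (s : ℕ) (hs : 1 ≤ s ∧ s ≤ p - 1) (k : ℕ) :
    ∃ (α : ℤˣ) (t : ℕ), 1 ≤ t ∧ t < p ∧ InBlock (p := p) α t (k + 1 : ℕ) (.C β s hs) := by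
  induction k with
  | zero =>
    by_cases hβ : β = 1
    · exact ⟨β, s, by omega, by omega, by omega, if_pos hβ, by simp⟩
    · exact ⟨β, p - s, by omega, by omega, by omega, by rw [if_neg hβ]; omega, by simp⟩
  | succ k ih =>
    obtain ⟨α, t, h1, h2, h⟩ := ih
    refine ⟨-α, p - t, by omega, by omega, ?_⟩
    rw [Nat.cast_sub h2.le]
    exact h.of_shift (by omega) (by omega) ⟨0, by push_cast; ring⟩

theorem isIndecomposableSubcategory_blockProp_C (β : ℤˣ) (s : ℕ) (hs : 1 ≤ s ∧ s ≤ p - 1) :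
    IsIndecomposableSubcategory (blockProp (p := p) (.C β s hs)) := by
  choose α t h1 h2 h using exists_inBlock_C β s hs
  choose G hG using fun k => exists_hasShape (α := α k) (r := k + 1) (h1 k) (h2 k) (by omega) .P
  choose d hd hd' using fun k => IsP.exists_generator (h1 k) (h2 k) (by omega) (hG k)
  refine isIndecomposableSubcategory_of_chain G
    (fun k => ((hG k).blockProp_iff (h1 k) (h2 k) (by omega)).2 (h k))
    (fun k => (hG k).isIndecomposableModule (h1 k) (h2 k) (by omega)) (fun k => ?_)
    fun M hM hn => ?_
  · have hx := xop_mem (by exact_mod_cast h1 k) (by exact_mod_cast h2 k) (hd k).mem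
    obtain ⟨e1, e2⟩ := (h (k + 1)).label_unique
      ((h k).of_shift (by exact_mod_cast h1 k) (by exact_mod_cast h2 k) ⟨0, by push_cast; ring⟩)
    obtain ⟨φ, hφ⟩ := hd' (k + 1) (G k) (xop p (t k) (k + 1 : ℕ) (d k)) (by
      rw [e1, e2]; exact_mod_cast hx)
    refine ⟨φ, fun h0 => (hd k).ne_zero ?_⟩
    rw [← hφ, h0, LinearMap.zero_apply, yop_zero]
  · obtain ⟨γ, a, r, w, a1, a2, hw, h0⟩ := exists_hw_ne_zero (p := p) (M := M.obj)
    have hb := hM _ _ _ a1 a2 w hw h0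
    have hr := r_pos_of_ne_zero hw h0
    obtain ⟨k, rfl⟩ : ∃ k : ℕ, r = (k + 1 : ℕ) := ⟨(r - 1).toNat, by omega⟩
    obtain ⟨rfl, rfl⟩ := hb.label_unique (h k)
    obtain ⟨φ, hφ⟩ := hd' k M w hw
    refine ⟨k, φ, fun h' => h0 ?_⟩
    rw [← hφ, h', LinearMap.zero_apply]

/-! ### The modules in the blocks -/

theorem isSemisimpleModule_of_blockProp_S {α : ℤˣ} {r : ℕ} {hr : 1 ≤ r}
    (h : blockProp (.S α r hr) M) : IsSemisimpleModule (LU p) M.obj :=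
  isSemisimpleModule_of_isKilled fun β k l k1 k2 w hw => by
    by_cases h0 : w = 0
    · rw [h0, xop_zero, yop_zero]; exact ⟨rfl, rfl⟩
    · obtain ⟨-, rfl, -⟩ := h β k l k1 k2 w hw h0
      exact ⟨xop_p w, yop_p w⟩

theorem blockProp_S_and_isSimpleModule_iff {hr : 1 ≤ r} :
    (blockProp (.S α r hr) M ∧ IsSimpleModule (LU p) M.obj) ↔ IsX α p r M := by
  have hp2 := hp.out
  refine ⟨fun ⟨h, hs⟩ => ?_, fun h => ⟨(h.blockProp_iff (by omega) le_rfl hr).2 ⟨rfl, rfl, rfl⟩,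
    h.isSimpleModule (by omega) le_rfl hr⟩⟩
  obtain ⟨α', s', r', h1, h2, hr', hX⟩ := exists_isX_of_isSimpleModule (M := M)
  obtain ⟨rfl, e1, e2⟩ := (hX.blockProp_iff h1 h2 hr').1 h
  obtain rfl : s' = p := by exact_mod_cast e1
  obtain rfl : r' = r := by exact_mod_cast e2
  exact hX

theorem blockProp_C_and_isSimpleModule_iff {β : ℤˣ} {s : ℕ} {hs : 1 ≤ s ∧ s ≤ p - 1} :
    (blockProp (.C β s hs) M ∧ IsSimpleModule (LU p) M.obj) ↔
      ∃ α s' r, BlockLabel p β s α s' r ∧ IsX α s' r M := by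
  constructor
  · rintro ⟨h, hS⟩
    obtain ⟨α', s', r', h1, h2, hr', hX⟩ := exists_isX_of_isSimpleModule (M := M)
    have hb := (hX.blockProp_iff h1 h2 hr').1 h
    have := hb.1
    exact ⟨α', s', r', (blockLabel_iff hs).2 ⟨h1, by omega, hr', hb⟩, hX⟩
  · rintro ⟨α, s', r, h, hX⟩
    obtain ⟨h1, h2, hr, hb⟩ := (blockLabel_iff hs).1 h
    exact ⟨(hX.blockProp_iff h1 h2.le hr).2 hb, hX.isSimpleModule h1 h2.le hr⟩

theorem blockProp_C_and_isIndecomposableModule_iff {β : ℤˣ} {s : ℕ} {hs : 1 ≤ s ∧ s ≤ p - 1} :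
    (blockProp (.C β s hs) M ∧ IsIndecomposableModule (LU p) M.obj) ↔
      ∃ α s' r t, BlockLabel p β s α s' r ∧ HasShape α s' r M t := by
  have hp2 := hp.out
  constructor
  · rintro ⟨h, hI⟩
    obtain ⟨α, r, hr, hX⟩ | ⟨α, s', r, h1, h2, hr, h'⟩ := classification hI
    · exact absurd rfl ((hX.blockProp_iff (by omega) le_rfl hr).1 h).1
    obtain ⟨t, ht⟩ : ∃ t, HasShape α s' r M t := by
      rcases h' with h' | ⟨l, u, hl, h' | h'⟩
      · exact ⟨.P, h'⟩
      · exact h'.exists_hasShape_even h1 h2 hr hl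
      · exact h'.exists_hasShape_odd h1 h2 hr hl
    exact ⟨α, s', r, t, (blockLabel_iff hs).2 ⟨h1, h2, hr, (ht.blockProp_iff h1 h2 hr).1 h⟩, ht⟩
  · rintro ⟨α, s', r, t, h, ht⟩
    obtain ⟨h1, h2, hr, hb⟩ := (blockLabel_iff hs).1 h
    exact ⟨(ht.blockProp_iff h1 h2 hr).2 hb, ht.isIndecomposableModule h1 h2 hr⟩

end Indecomposable

/-! ### Contragredient modules -/

section Contragredient

theorem zpow_mul_self (u : ℤˣ) (n : ℤ) : u ^ n * u ^ n = 1 := by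
  rw [← mul_zpow, Int.units_mul_self, one_zpow]

/-- The signs in the invariant form on zigzag modules. -/
theorem exists_signs (α : ℤˣ) (s : ℕ) : ∃ (κ : ℤˣ) (d : ℤ → ℤˣ),
    (∀ j, κ = zigzagSign α j ^ p * (-1) ^ (zigzagFst p s j - 1)) ∧
    (∀ j, -κ * d (j + 1) = (-zigzagSign α j) ^ zigzagFst p s j * d j) ∧
    ∀ j, d (j - 1) = (-zigzagSign α j) ^ zigzagFst p s j * d j := by
  have hκ : ∀ j, α ^ p * (-1) ^ ((s : ℤ) - 1) = zigzagSign α j ^ p * (-1) ^ (zigzagFst p s j - 1) := by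
    intro j
    unfold zigzagSign zigzagFst
    split_ifs
    · rfl
    · rw [← neg_one_mul α, mul_pow, ← zpow_natCast (-1 : ℤˣ) p, mul_right_comm, ← zpow_add,
        show (p : ℤ) + (p - s - 1) = 2 * (p - s) + (s - 1) by ring, zpow_add, zpow_mul,
        show (-1 : ℤˣ) ^ (2 : ℤ) = 1 by decide, one_zpow, one_mul, mul_comm]
  let d : ℤ → ℤˣ := fun j => (α ^ ((p : ℤ) - s)) ^ ((j + 1) / 2) * ((-α) ^ (s : ℤ)) ^ (j / 2)
  have hd : ∀ j, d (j + 1) = zigzagSign α j ^ ((p : ℤ) - zigzagFst p s j) * d j := by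
    intro j
    unfold zigzagSign zigzagFst
    simp only [d]
    rcases Int.even_or_odd' j with ⟨k, rfl | rfl⟩
    · rw [if_pos (even_two_mul k), if_pos (even_two_mul k), show (2 * k + 1 + 1) / 2 = k + 1 by omega,
        show (2 * k + 1) / 2 = k by omega, show 2 * k / 2 = k by omega, zpow_add_one, mul_left_comm,
        mul_assoc]
    · rw [if_neg (by simp), if_neg (by simp), show (2 * k + 1 + 1 + 1) / 2 = k + 1 by omega,
        show (2 * k + 1 + 1) / 2 = k + 1 by omega, show (2 * k + 1) / 2 = k by omega,
        sub_sub_self_int, zpow_add_one ((-α) ^ (s : ℤ)) k]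
      generalize (α ^ ((p : ℤ) - s)) ^ (k + 1) = x
      generalize (-α) ^ (s : ℤ) = y
      rw [mul_left_comm y, mul_comm y]
  refine ⟨_, d, hκ, fun j => ?_, fun j => ?_⟩
  · have e : (zigzagSign α j) ^ (p : ℤ) * (zigzagSign α j) ^ ((p : ℤ) - zigzagFst p s j) =
        zigzagSign α j ^ zigzagFst p s j := by
      rw [zpow_sub, ← mul_assoc, zpow_mul_self, one_mul, Int.units_inv_eq_self]
    have e' : -(-1 : ℤˣ) ^ (zigzagFst p s j - 1) = (-1) ^ zigzagFst p s j := by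
      rw [zpow_sub_one, Int.units_inv_eq_self, mul_neg_one, neg_neg]
    rw [hκ j, hd, ← mul_assoc, ← zpow_natCast, neg_mul_eq_mul_neg, e',
      mul_right_comm (zigzagSign α j ^ (p : ℤ)), e, ← mul_zpow,
      mul_neg_one]
  · have h := hd (j - 1)
    rw [sub_add_cancel, zigzagSign_pred, zigzagFst_pred, sub_sub_self_int] at h
    rw [h, ← mul_assoc, zpow_mul_self, one_mul]

/-- The pairing of two modules with layered bases that pairs `v i n m` with
`w i (s i - 1 - n) (r i - 1 - m)`. -/
theorem exists_form {ι : Type} {V W : FinRep p} {α : ι → ℤˣ} {s r : ι → ℤ}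
    {v : ι → ℤ → ℤ → V.obj} {w : ι → ℤ → ℤ → W.obj} (hV : IsLayeredBasis V α s r v)
    (hW : IsLayeredBasis W α s r w) (c : ι → ℤ → ℤ → ℂ) (hc : ∀ i n m, c i n m ≠ 0) :
    ∃ B : V.obj →ₗ[ℂ] W.obj →ₗ[ℂ] ℂ, B.Nondegenerate ∧
      (∀ i n m, 0 ≤ n → n < s i → 0 ≤ m → m < r i →
        B (v i n m) (w i (s i - 1 - n) (r i - 1 - m)) = c i n m) ∧
      (∀ i n m i' n' m', ¬ (i' = i ∧ n + n' = s i - 1 ∧ m + m' = r i - 1) →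
        B (v i n m) (w i' n' m') = 0) ∧
      ∀ (T : End ℂ V.obj) (U : End ℂ W.obj),
        (∀ i n m i' n' m', 0 ≤ n → n < s i → 0 ≤ m → m < r i → 0 ≤ n' → n' < s i' → 0 ≤ m' →
          m' < r i' → B (T (v i n m)) (w i' n' m') = B (v i n m) (U (w i' n' m'))) →
        ∀ x y, B (T x) y = B x (U y) := by
  classical
  let I := {x : ι × ℤ × ℤ // 0 ≤ x.2.1 ∧ x.2.1 < s x.1 ∧ 0 ≤ x.2.2 ∧ x.2.2 < r x.1}
  have span : ∀ {V : FinRep p} {v : ι → ℤ → ℤ → V.obj}, IsLayeredBasis V α s r v →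
      ⊤ ≤ Submodule.span ℂ (Set.range fun x : I => v x.1.1 x.1.2.1 x.1.2.2) := fun {V v} h => by
    rw [← h.span_eq_top, Submodule.span_le]
    rintro _ ⟨i, n, m, rfl⟩
    by_cases h0 : 0 ≤ n ∧ n < s i ∧ 0 ≤ m ∧ m < r i
    · exact Submodule.subset_span ⟨⟨(i, n, m), h0⟩, rfl⟩
    · rw [h.eq_zero i n m h0]; exact Submodule.zero_mem _
  let bV : Basis I ℂ V.obj := Basis.mk hV.linearIndependent (span hV)
  let bW : Basis I ℂ W.obj := Basis.mk hW.linearIndependent (span hW)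
  have eV : ∀ x : I, bV x = v x.1.1 x.1.2.1 x.1.2.2 := fun x => Basis.mk_apply _ _ x
  have eW : ∀ x : I, bW x = w x.1.1 x.1.2.1 x.1.2.2 := fun x => Basis.mk_apply _ _ x
  let σ : I → I := fun x => ⟨(x.1.1, s x.1.1 - 1 - x.1.2.1, r x.1.1 - 1 - x.1.2.2), by
    have := x.2; dsimp only at this ⊢; omega⟩
  have hσ : ∀ x, σ (σ x) = x := fun x => Subtype.ext (Prod.ext rfl (Prod.ext
    (by simp only [σ]; ring) (by simp only [σ]; ring)))
  let B : V.obj →ₗ[ℂ] W.obj →ₗ[ℂ] ℂ :=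
    bV.constr ℂ fun x => c x.1.1 x.1.2.1 x.1.2.2 • bW.coord (σ x)
  have hB : ∀ x y : I, B (bV x) (bW y) = if y = σ x then c x.1.1 x.1.2.1 x.1.2.2 else 0 := fun x y => by
    simp only [B, Basis.constr_basis, LinearMap.smul_apply, Basis.coord_apply, Basis.repr_self,
      smul_eq_mul, Finsupp.single_apply, mul_ite, mul_one, mul_zero]
  have hr : ∀ (x : I) (z : W.obj), B (bV x) z = c x.1.1 x.1.2.1 x.1.2.2 * bW.repr z (σ x) :=
    fun x z => by
      simp only [B, Basis.constr_basis, LinearMap.smul_apply, Basis.coord_apply, smul_eq_mul]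
  have hl : ∀ (y : I) (z : V.obj), B z (bW y) =
      c (σ y).1.1 (σ y).1.2.1 (σ y).1.2.2 * bV.repr z (σ y) := fun y z => by
    have : B.flip (bW y) = c (σ y).1.1 (σ y).1.2.1 (σ y).1.2.2 • bV.coord (σ y) := by
      refine bV.ext fun x => ?_
      rw [LinearMap.flip_apply, hB, LinearMap.smul_apply, Basis.coord_apply, Basis.repr_self,
        Finsupp.single_apply]
      by_cases h : y = σ x
      · rw [if_pos h, h, hσ, if_pos rfl, smul_eq_mul, mul_one]
      · rw [if_neg h, if_neg fun h' => h (by rw [h', hσ]), smul_zero]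
    exact LinearMap.congr_fun this z
  refine ⟨B, ⟨fun z hz => ?_, fun z hz => ?_⟩, fun i n m a1 a2 a3 a4 => ?_,
    fun i n m i' n' m' h => ?_, fun T U h => ?_⟩
  · refine bV.ext_elem fun x => ?_
    have h := hl (σ x) z
    rw [hz, hσ, eq_comm, mul_eq_zero] at h
    rw [h.resolve_left (hc _ _ _), map_zero, Finsupp.zero_apply]
  · refine bW.ext_elem fun x => ?_
    have h := hr (σ x) z
    rw [hz, hσ, eq_comm, mul_eq_zero] at h
    rw [h.resolve_left (hc _ _ _), map_zero, Finsupp.zero_apply]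
  · have h := hB ⟨(i, n, m), a1, a2, a3, a4⟩ (σ ⟨(i, n, m), a1, a2, a3, a4⟩)
    rwa [if_pos rfl, eV, eW] at h
  · by_cases h1 : 0 ≤ n ∧ n < s i ∧ 0 ≤ m ∧ m < r i
    · by_cases h2 : 0 ≤ n' ∧ n' < s i' ∧ 0 ≤ m' ∧ m' < r i'
      · have h3 := hB ⟨(i, n, m), h1⟩ ⟨(i', n', m'), h2⟩
        rw [if_neg, eV, eW] at h3
        · exact h3
        · intro h4
          obtain ⟨h5, h6⟩ := Prod.ext_iff.1 (Subtype.ext_iff.1 h4)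
          obtain ⟨h6, h7⟩ := Prod.ext_iff.1 h6
          dsimp only [σ] at h5 h6 h7
          exact h ⟨h5, by omega, by omega⟩
      · rw [hW.eq_zero _ _ _ h2, map_zero]
    · rw [hV.eq_zero _ _ _ h1, map_zero, LinearMap.zero_apply]
  · have : B.comp T = B.compl₂ U := LinearMap.ext_basis bV bW fun x y => by
      rw [LinearMap.comp_apply, LinearMap.compl₂_apply, eV, eW]
      exact h _ _ _ _ _ _ x.2.1 x.2.2.1 x.2.2.2.1 x.2.2.2.2 y.2.1 y.2.2.1 y.2.2.2.1 y.2.2.2.2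
    exact fun x y => LinearMap.congr_fun₂ this x y

end Contragredient

section Contragredient

section Zigzag

variable [hp : Fact (2 ≤ p)] {V W : FinRep p} {ε : ℤ → ℤˣ} {S R : ℤ → ℤ} {v : ℤ → ℤ → ℤ → V.obj}
  {w : ℤ → ℤ → ℤ → W.obj} {κ : ℤˣ} {d : ℤ → ℤˣ}

theorem Kinv_smul_layered (hW : IsLayeredBasis W ε S R w) (j n m : ℤ) :
    gKi • w j n m = (((ε j : ℤ) : ℂ) * q p ^ (S j - 1 - 2 * n))⁻¹ • w j n m :=
  Kinv_of_K (hW.smul_K j n m)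

theorem K_pow_smul_layered (hW : IsLayeredBasis W ε S R w)
    (hκ : ∀ j, κ = ε j ^ p * (-1) ^ (S j - 1)) (j n m : ℤ) :
    gK ^ p • w j n m = ((κ : ℤ) : ℂ) • w j n m := by
  have h : ∀ k : ℕ, gK ^ k • w j n m = (((ε j : ℤ) : ℂ) * q p ^ (S j - 1 - 2 * n)) ^ k • w j n m := by
    intro k
    induction k with
    | zero => simp
    | succ k ih => rw [pow_succ', mul_smul, ih, gen_csmul, hW.smul_K, smul_smul, ← pow_succ]
  rw [h, mul_pow, ← zpow_natCast (q p ^ _), zpow_comm, q_zpow_p, zpow_sub₀ (by norm_num), zpow_mul,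
    hκ j]
  have e : ∀ k : ℤ, ((((-1) ^ k : ℤˣ) : ℤ) : ℂ) = (-1) ^ k := fun k => by
    rcases Int.even_or_odd k with h | h <;> rw [h.neg_one_zpow, h.neg_one_zpow] <;> simp
  push_cast
  rw [e]
  simp

/-- The coefficients of the invariant form on zigzag modules. -/
def formCoeff (p : ℕ) (ε : ℤ → ℤˣ) (S : ℤ → ℤ) (κ : ℤˣ) (d : ℤ → ℤˣ) (j n m : ℤ) : ℂ :=
  ((((-κ) ^ m * (-ε j) ^ n * d j : ℤˣ) : ℤ) : ℂ) * q p ^ (n * (n - S j))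

theorem formCoeff_ne_zero (j n m : ℤ) : formCoeff p ε S κ d j n m ≠ 0 :=
  mul_ne_zero (by exact_mod_cast Units.ne_zero _) (zpow_ne_zero _ (q_ne_zero p))

theorem formCoeff_m (j n m : ℤ) :
    formCoeff p ε S κ d j n (m + 1) = -((κ : ℤ) : ℂ) * formCoeff p ε S κ d j n m := by
  unfold formCoeff
  rw [zpow_add_one]
  push_cast
  ring

theorem formCoeff_n (j n m : ℤ) : formCoeff p ε S κ d j (n + 1) m =
    -(((ε j : ℤ) : ℂ) * q p ^ (2 * n + 1 - S j)) * formCoeff p ε S κ d j n m := by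
  unfold formCoeff
  rw [zpow_add_one, show (n + 1) * (n + 1 - S j) = (2 * n + 1 - S j) + n * (n - S j) by ring,
    zpow_add₀ (q_ne_zero p)]
  push_cast
  ring

theorem formCoeff_last (j m : ℤ) : -(((ε j : ℤ) : ℂ) * q p ^ (S j - 1)) *
    formCoeff p ε S κ d j (S j - 1) m = (((-κ) ^ m * ((-ε j) ^ S j * d j) : ℤˣ) : ℤ) := by
  unfold formCoeff
  rw [show (S j - 1) * (S j - 1 - S j) = -(S j - 1) by ring, zpow_neg]
  have h1 := zpow_ne_zero (S j - 1) (q_ne_zero p)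
  have h2 : (-ε j) ^ S j = (-ε j) ^ (S j - 1) * -ε j := by rw [← zpow_add_one, sub_add_cancel]
  rw [h2]
  push_cast
  field_simp

theorem formCoeff_up (hd : ∀ j, -κ * d (j + 1) = (-ε j) ^ S j * d j) (j m : ℤ) :
    formCoeff p ε S κ d (j + 1) 0 (m + 1) =
      -(((ε j : ℤ) : ℂ) * q p ^ (S j - 1)) * formCoeff p ε S κ d j (S j - 1) m := by
  rw [formCoeff_last, ← hd, formCoeff, zero_mul, zpow_zero, zpow_zero, zpow_add_one, mul_one, mul_one,
    mul_assoc]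

theorem formCoeff_down (hd : ∀ j, d (j - 1) = (-ε j) ^ S j * d j) (j m : ℤ) :
    formCoeff p ε S κ d (j - 1) 0 m =
      -(((ε j : ℤ) : ℂ) * q p ^ (S j - 1)) * formCoeff p ε S κ d j (S j - 1) m := by
  rw [formCoeff_last, ← hd, formCoeff, zero_mul, zpow_zero, zpow_zero, mul_one, mul_one]

theorem isContragredient_of_layered {top top' : ℤ → Prop} [DecidablePred top] [DecidablePred top']
    (htop : ∀ j, top (j + 1) ↔ ¬ top j) (htop' : ∀ j, top' j ↔ ¬ top j) {r l : ℕ} {g : ℂ}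
    (hε : ∀ j, ε (j + 1) = -ε j) (hR : ∀ j, 0 < R j → 0 ≤ j ∧ j < l ∧ R j = r + j)
    (hκ : ∀ j, κ = ε j ^ p * (-1) ^ (S j - 1)) (hd1 : ∀ j, -κ * d (j + 1) = (-ε j) ^ S j * d j)
    (hd2 : ∀ j, d (j - 1) = (-ε j) ^ S j * d j)
    (hV : IsLayeredBasis V ε S R v) (hW : IsLayeredBasis W ε S R w)
    (fV : ∀ j n m : ℤ, 0 ≤ j → j < l → 0 ≤ n → n < S j → 0 ≤ m → m < r + j →
      gE • v j n m = (((ε j : ℤ) : ℂ) * qInt p n * qInt p (S j - n)) • v j (n - 1) m +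
        (if n = 0 ∧ top j then (((ε j : ℤ) : ℂ) * g) •
            (((r + j - m : ℤ) : ℂ) • v (j + 1) (S (j + 1) - 1) m -
              (m : ℂ) • v (j - 1) (S (j - 1) - 1) (m - 1)) else 0) ∧
      gF • v j n m = v j (n + 1) m +
        (if n = S j - 1 ∧ top j then v (j + 1) 0 (m + 1) + v (j - 1) 0 m else 0))
    (fW : ∀ j n m : ℤ, 0 ≤ j → j < l → 0 ≤ n → n < S j → 0 ≤ m → m < r + j →
      gE • w j n m = (((ε j : ℤ) : ℂ) * qInt p n * qInt p (S j - n)) • w j (n - 1) m +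
        (if n = 0 ∧ top' j then (((ε j : ℤ) : ℂ) * g) •
            (((r + j - m : ℤ) : ℂ) • w (j + 1) (S (j + 1) - 1) m -
              (m : ℂ) • w (j - 1) (S (j - 1) - 1) (m - 1)) else 0) ∧
      gF • w j n m = w j (n + 1) m +
        (if n = S j - 1 ∧ top' j then w (j + 1) 0 (m + 1) + w (j - 1) 0 m else 0)) :
    IsContragredient V W := by
  obtain ⟨B, hB, B1, B0, hext⟩ := exists_form hV hW (formCoeff p ε S κ d) formCoeff_ne_zero
  have B1 : ∀ {j n m n' m' : ℤ}, 0 ≤ n → n < S j → 0 ≤ m → m < R j → n + n' = S j - 1 →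
      m + m' = R j - 1 → B (v j n m) (w j n' m') = formCoeff p ε S κ d j n m := by
    intro j n m n' m' a1 a2 a3 a4 a5 a6
    obtain rfl : n' = S j - 1 - n := by omega
    obtain rfl : m' = R j - 1 - m := by omega
    exact B1 j n m a1 a2 a3 a4
  have hq := fun n : ℤ => zpow_ne_zero n (q_ne_zero p)
  have hε2 : ∀ j, ((ε j : ℤ) : ℂ) * ((ε j : ℤ) : ℂ) = 1 := fun j => by
    rw [← Int.cast_mul, ← Units.val_mul, Int.units_mul_self, Units.val_one, Int.cast_one]
  have hκ2 : ((κ : ℤ) : ℂ) * ((κ : ℤ) : ℂ) = 1 := by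
    rw [← Int.cast_mul, ← Units.val_mul, Int.units_mul_self, Units.val_one, Int.cast_one]
  have hε0 : ∀ j, ((ε j : ℤ) : ℂ) ≠ 0 := fun j => left_ne_zero_of_mul_eq_one (hε2 j)
  have hk0 : ∀ j n : ℤ, ((ε j : ℤ) : ℂ) * q p ^ n ≠ 0 := fun j n => mul_ne_zero (hε0 j) (hq n)
  have hεc : ∀ j, ((ε (j + 1) : ℤ) : ℂ) = -((ε j : ℤ) : ℂ) := fun j => by
    rw [hε]; push_cast; ring
  have ht : ∀ j, top j → top' (j + 1) ∧ top' (j - 1) := fun j h => by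
    rw [htop', htop', htop, not_not]
    have := htop (j - 1)
    rw [sub_add_cancel] at this
    exact ⟨h, this.1 h⟩
  have ht' : ∀ j, top' j → top (j + 1) ∧ top (j - 1) := fun j h => by
    rw [htop'] at h
    have := htop (j - 1)
    rw [sub_add_cancel] at this
    exact ⟨(htop j).2 h, not_not.1 fun h' => h (this.2 h')⟩
  refine ⟨B, hB, fun x y => ⟨hext (act V.obj gE) (act W.obj (-(gE * gKi))) ?_ x y,
    hext (act V.obj gF) (act W.obj (-(gK * gF))) ?_ x y,
    hext (act V.obj gK) (act W.obj gKi) ?_ x y,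
    hext (act V.obj ge) (act W.obj (-(gK ^ p * ge))) ?_ x y,
    hext (act V.obj gf) (act W.obj (-(gK ^ p * gf))) ?_ x y,
    hext (act V.obj gh) (act W.obj (-gh)) ?_ x y⟩⟩ <;>
    intro j n m j' n' m' a1 a2 a3 a4 a1' a2' a3' a4' <;> simp only [act_apply]
  · obtain ⟨b1, b2, b3⟩ := hR j (by omega)
    obtain ⟨b1', b2', b3'⟩ := hR j' (by omega)
    have hl : (((ε j : ℤ) : ℂ) * qInt p n * qInt p (S j - n)) * B (v j (n - 1) m) (w j' n' m') =
        -((((ε j' : ℤ) : ℂ) * q p ^ (S j' - 1 - 2 * n'))⁻¹ *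
          (((ε j' : ℤ) : ℂ) * qInt p n' * qInt p (S j' - n'))) * B (v j n m) (w j' (n' - 1) m') := by
      by_cases h : j' = j ∧ n + n' = S j ∧ m + m' = R j - 1
      · obtain ⟨rfl, h, h'⟩ := h
        have e := formCoeff_n (p := p) (ε := ε) (S := S) (κ := κ) (d := d) j' (n - 1) m
        obtain rfl : n' = S j' - n := by omega
        rw [sub_add_cancel, show 2 * (n - 1) + 1 - S j' = S j' - 1 - 2 * (S j' - n) by ring] at e
        rw [B1 (by omega) (by omega) a3 a4 (by omega) h', B1 a1 a2 a3 a4 (by omega) h', e,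
          sub_sub_cancel]
        have := hk0 j' (S j' - 1 - 2 * (S j' - n))
        generalize ((ε j' : ℤ) : ℂ) * q p ^ (S j' - 1 - 2 * (S j' - n)) = k at this ⊢
        field_simp
      · rw [B0 _ _ _ _ _ _ (fun h' => h ⟨h'.1, by omega, by omega⟩),
          B0 _ _ _ _ _ _ (fun h' => h ⟨h'.1, by omega, by omega⟩)]
        simp
    rw [(fV j n m b1 b2 a1 a2 a3 (by omega)).1, neg_smul, mul_smul gE gKi,
      Kinv_smul_layered hW, gen_csmul, (fW j' n' m' b1' b2' a1' a2' a3' (by omega)).1, map_add, map_smul, LinearMap.add_apply,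
      LinearMap.smul_apply, smul_eq_mul, hl, map_neg, map_smul, map_add, map_smul]
    suffices hg : B (if n = 0 ∧ top j then (((ε j : ℤ) : ℂ) * g) •
            (((r + j - m : ℤ) : ℂ) • v (j + 1) (S (j + 1) - 1) m -
              (m : ℂ) • v (j - 1) (S (j - 1) - 1) (m - 1)) else 0) (w j' n' m') =
        -(((ε j' : ℤ) : ℂ) * q p ^ (S j' - 1 - 2 * n'))⁻¹ * B (v j n m)
          (if n' = 0 ∧ top' j' then (((ε j' : ℤ) : ℂ) * g) •
            (((r + j' - m' : ℤ) : ℂ) • w (j' + 1) (S (j' + 1) - 1) m' -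
              (m' : ℂ) • w (j' - 1) (S (j' - 1) - 1) (m' - 1)) else 0) by
      rw [hg]
      simp only [smul_eq_mul]
      ring
    by_cases hn : n = 0 ∧ top j <;> by_cases hn' : n' = 0 ∧ top' j'
    · obtain ⟨rfl, hn⟩ := hn
      obtain ⟨rfl, hn'⟩ := hn'
      rw [if_pos ⟨rfl, hn⟩, if_pos ⟨rfl, hn'⟩]
      simp only [map_smul, map_sub, LinearMap.smul_apply, LinearMap.sub_apply, smul_eq_mul]
      have hK := hk0 j' (S j' - 1 - 2 * 0)
      by_cases hj : j' = j + 1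
      · subst hj
        rw [B0 (j - 1) _ _ _ _ _ (fun h' => by omega), B0 j _ _ (j + 1 + 1) _ _ (fun h' => by omega),
          add_sub_cancel_right]
        by_cases hm : m + m' = R j
        · have e := formCoeff_down hd2 (p := p) (κ := κ) (j + 1) m
          rw [add_sub_cancel_right] at e
          rw [B1 (by omega) (by omega) a3 (by omega) (by omega) (by omega),
            B1 a1 a2 a3 a4 (by omega) (by omega), e, hεc]
          simp only [hεc, mul_zero, sub_zero, zero_sub] at hK ⊢
          obtain rfl : m' = r + j - m := by omega
          generalize formCoeff p ε S κ d (j + 1) (S (j + 1) - 1) m = c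
          have hk := inv_mul_cancel₀ hK
          push_cast
          linear_combination
            (-(((ε j : ℤ) : ℂ) * g * ((r : ℂ) + j - m) * c)) * hk
        · rw [B0 _ _ _ _ _ _ (fun h' => hm (by omega)), B0 _ _ _ _ _ _ (fun h' => hm (by omega))]
          simp
      by_cases hj : j' = j - 1
      · subst hj
        rw [B0 (j + 1) _ _ _ _ _ (fun h' => by omega), B0 j _ _ (j - 1 - 1) _ _ (fun h' => by omega),
          sub_add_cancel]
        by_cases hm : m + m' = R j - 1
        · obtain rfl : m' = r + j - 1 - m := by omega
          by_cases hm0 : m = 0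
          · subst hm0
            push_cast
            ring
          have e := formCoeff_up hd1 (p := p) (j - 1) (m - 1)
          rw [sub_add_cancel, sub_add_cancel] at e
          rw [B1 (by omega) (by omega) (by omega) (by omega) (by omega) (by omega),
            B1 a1 a2 a3 a4 (by omega) (by omega), e]
          have hε' := hεc (j - 1)
          rw [sub_add_cancel] at hε'
          simp only [hε', mul_zero, sub_zero, zero_sub] at hK ⊢
          generalize formCoeff p ε S κ d (j - 1) (S (j - 1) - 1) (m - 1) = c
          have hk := inv_mul_cancel₀ hK
          push_cast
          linear_combination
            (-(((ε (j - 1) : ℤ) : ℂ) * g * m * c)) * hk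
        · rw [B0 _ _ _ _ _ _ (fun h' => hm (by omega)), B0 _ _ _ _ _ _ (fun h' => hm (by omega))]
          simp
      rw [B0 _ _ _ _ _ _ (fun h' => by omega), B0 _ _ _ _ _ _ (fun h' => by omega),
        B0 _ _ _ _ _ _ (fun h' => by omega), B0 _ _ _ _ _ _ (fun h' => by omega)]
      simp
    · rw [if_pos hn, if_neg hn']
      simp only [map_smul, map_sub, LinearMap.smul_apply, LinearMap.sub_apply, smul_eq_mul, map_zero]
      rw [B0 _ _ _ _ _ _ (fun h' => hn' ⟨by omega, by rw [h'.1]; exact (ht j hn.2).1⟩),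
        B0 _ _ _ _ _ _ (fun h' => hn' ⟨by omega, by rw [h'.1]; exact (ht j hn.2).2⟩)]
      simp
    · rw [if_neg hn, if_pos hn']
      simp only [map_smul, map_sub, smul_eq_mul, map_zero, LinearMap.zero_apply]
      rw [B0 _ _ _ _ _ _ (fun h' => hn ⟨by rw [h'.1] at h'; omega, by
          rw [← h'.1]; exact (ht' j' hn'.2).1⟩),
        B0 _ _ _ _ _ _ (fun h' => hn ⟨by rw [h'.1] at h'; omega, by
          rw [← h'.1]; exact (ht' j' hn'.2).2⟩)]
      simp
    · rw [if_neg hn, if_neg hn']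
      simp
  · obtain ⟨b1, b2, b3⟩ := hR j (by omega)
    obtain ⟨b1', b2', b3'⟩ := hR j' (by omega)
    have hl : B (v j (n + 1) m) (w j' n' m') =
        -(((ε j' : ℤ) : ℂ) * q p ^ (S j' - 1 - 2 * (n' + 1))) * B (v j n m) (w j' (n' + 1) m') := by
      by_cases h : j' = j ∧ n + 1 + n' = S j - 1 ∧ m + m' = R j - 1
      · obtain ⟨rfl, h, h'⟩ := h
        rw [B1 (by omega) (by omega) a3 a4 h h', B1 a1 a2 a3 a4 (by omega) h', formCoeff_n,
          show S j' - 1 - 2 * (n' + 1) = 2 * n + 1 - S j' by omega]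
      · rw [B0 _ _ _ _ _ _ (fun h' => h ⟨h'.1, by omega, by omega⟩),
          B0 _ _ _ _ _ _ (fun h' => h ⟨h'.1, by omega, by omega⟩)]
        simp
    rw [(fV j n m b1 b2 a1 a2 a3 (by omega)).2, neg_smul, mul_smul gK gF,
      (fW j' n' m' b1' b2' a1' a2' a3' (by omega)).2, map_add, LinearMap.add_apply, hl, smul_add,
      hW.smul_K, map_neg, map_add, map_smul]
    suffices hg : B (if n = S j - 1 ∧ top j then v (j + 1) 0 (m + 1) + v (j - 1) 0 m else 0)
          (w j' n' m') = -B (v j n m) (gK • if n' = S j' - 1 ∧ top' j' then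
            w (j' + 1) 0 (m' + 1) + w (j' - 1) 0 m' else 0) by
      rw [hg]
      simp only [smul_eq_mul]
      ring
    by_cases hn : n = S j - 1 ∧ top j <;> by_cases hn' : n' = S j' - 1 ∧ top' j'
    · rw [if_pos hn, if_pos hn']
      simp only [smul_add, map_add, hW.smul_K, map_smul, LinearMap.add_apply, smul_eq_mul, mul_zero,
        sub_zero]
      obtain ⟨rfl, hn⟩ := hn
      obtain ⟨rfl, hn'⟩ := hn'
      by_cases hj : j' = j + 1
      · subst hj
        rw [B0 (j - 1) _ _ _ _ _ (fun h' => by omega), B0 j _ _ (j + 1 + 1) _ _ (fun h' => by omega),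
          add_sub_cancel_right]
        by_cases hm : m + m' = R j - 1
        · rw [B1 (by omega) (by omega) (by omega) (by omega) (by omega) (by omega),
            B1 a1 a2 a3 a4 (by omega) (by omega), formCoeff_up hd1]
          ring
        · rw [B0 _ _ _ _ _ _ (fun h' => hm (by omega)), B0 _ _ _ _ _ _ (fun h' => hm (by omega))]
          simp
      by_cases hj : j' = j - 1
      · subst hj
        rw [B0 (j + 1) _ _ _ _ _ (fun h' => by omega), B0 j _ _ (j - 1 - 1) _ _ (fun h' => by omega),
          sub_add_cancel]
        by_cases hm : m + m' = R j - 2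
        · rw [B1 (by omega) (by omega) (by omega) (by omega) (by omega) (by omega),
            B1 a1 a2 a3 a4 (by omega) (by omega), formCoeff_down hd2]
          ring
        · rw [B0 _ _ _ _ _ _ (fun h' => hm (by omega)), B0 _ _ _ _ _ _ (fun h' => hm (by omega))]
          simp
      rw [B0 _ _ _ _ _ _ (fun h' => by omega), B0 _ _ _ _ _ _ (fun h' => by omega),
        B0 _ _ _ _ _ _ (fun h' => by omega), B0 _ _ _ _ _ _ (fun h' => by omega)]
      simp
    · rw [if_pos hn, if_neg hn']
      simp only [map_add, LinearMap.add_apply, smul_zero, map_zero]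
      rw [B0 _ _ _ _ _ _ (fun h' => hn' ⟨by rw [← h'.1] at h'; omega, by
          rw [h'.1]; exact (ht j hn.2).1⟩),
        B0 _ _ _ _ _ _ (fun h' => hn' ⟨by rw [← h'.1] at h'; omega, by
          rw [h'.1]; exact (ht j hn.2).2⟩)]
      simp
    · rw [if_neg hn, if_pos hn']
      simp only [smul_add, hW.smul_K, map_add, map_smul, smul_eq_mul, map_zero, LinearMap.zero_apply]
      rw [B0 _ _ _ _ _ _ (fun h' => hn ⟨by omega, by rw [← h'.1]; exact (ht' j' hn'.2).1⟩),
        B0 _ _ _ _ _ _ (fun h' => hn ⟨by omega, by rw [← h'.1]; exact (ht' j' hn'.2).2⟩)]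
      simp
    · rw [if_neg hn, if_neg hn']
      simp
  · rw [hV.smul_K, Kinv_smul_layered hW, map_smul, map_smul, LinearMap.smul_apply]
    by_cases h : j' = j ∧ n + n' = S j - 1 ∧ m + m' = R j - 1
    · obtain ⟨rfl, h, -⟩ := h
      rw [show S j' - 1 - 2 * n' = -(S j' - 1 - 2 * n) by omega, zpow_neg, mul_inv, inv_inv,
        inv_eq_of_mul_eq_one_right (hε2 j')]
    · rw [B0 _ _ _ _ _ _ h, smul_zero, smul_zero]
  · rw [hV.smul_e, neg_smul, mul_smul, hW.smul_e, smul_comm, K_pow_smul_layered hW hκ, map_smul, map_neg,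
      map_smul, map_smul, LinearMap.smul_apply]
    by_cases h : j' = j ∧ n + n' = S j - 1 ∧ m + m' = R j
    · obtain ⟨rfl, h, h'⟩ := h
      have e := formCoeff_m (p := p) (ε := ε) (S := S) (κ := κ) (d := d) j' n (m - 1)
      rw [sub_add_cancel] at e
      rw [B1 a1 a2 (by omega) (by omega) h (by omega), B1 a1 a2 a3 a4 h (by omega), e]
      obtain rfl : m' = R j' - m := by omega
      simp only [smul_eq_mul]
      push_cast
      linear_combination (-(m * (R j' - m) * formCoeff p ε S κ d j' n (m - 1) : ℂ)) * hκ2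
    · rw [B0 _ _ _ _ _ _ (fun h' => h ⟨h'.1, by omega, by omega⟩),
        B0 _ _ _ _ _ _ (fun h' => h ⟨h'.1, by omega, by omega⟩)]
      simp
  · rw [hV.smul_f _ _ _ a3, neg_smul, mul_smul, hW.smul_f _ _ _ a3', K_pow_smul_layered hW hκ, map_neg,
      map_smul]
    by_cases h : j' = j ∧ n + n' = S j - 1 ∧ m + 1 + m' = R j - 1
    · obtain ⟨rfl, h, h'⟩ := h
      rw [B1 a1 a2 (by omega) (by omega) h (by omega), B1 a1 a2 a3 a4 h (by omega), formCoeff_m,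
        smul_eq_mul, neg_mul]
    · rw [B0 _ _ _ _ _ _ (fun h' => h ⟨h'.1, by omega, by omega⟩),
        B0 _ _ _ _ _ _ (fun h' => h ⟨h'.1, by omega, by omega⟩)]
      simp
  · rw [hV.smul_h, neg_smul, hW.smul_h, map_neg, map_smul, map_smul, LinearMap.smul_apply]
    by_cases h : j' = j ∧ n + n' = S j - 1 ∧ m + m' = R j - 1
    · obtain ⟨rfl, -, h⟩ := h
      rw [← neg_smul]
      congr 1
      obtain rfl : m' = R j' - 1 - m := by omega
      push_cast
      ring
    · rw [B0 _ _ _ _ _ _ h, smul_zero, smul_zero, neg_zero]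

theorem IsZigzag.isContragredient {α : ℤˣ} {s r l : ℕ} {top top' : ℤ → Prop} [DecidablePred top]
    [DecidablePred top'] (htop : ∀ j, top (j + 1) ↔ ¬ top j) (htop' : ∀ j, top' j ↔ ¬ top j)
    (hV : IsZigzag α s r l top V) (hW : IsZigzag α s r l top' W) : IsContragredient V W := by
  obtain ⟨v, bV, fV⟩ := hV
  obtain ⟨w, bW, fW⟩ := hW
  obtain ⟨κ, d, hκ, hd1, hd2⟩ := exists_signs (p := p) α s
  refine isContragredient_of_layered (r := r) (l := l) htop htop' (zigzagSign_succ α) (fun j hj => ?_)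
    hκ hd1 hd2 bV bW fV fW
  unfold zigzagSnd at hj ⊢
  split_ifs at hj ⊢ with h
  · exact ⟨h.1, h.2, rfl⟩
  · omega

end Zigzag

end Contragredient

end LUq

end

theorem mainTheorem1 (p : ℕ) (hp : 2 ≤ p) :
    -- the modules in the statement exist
    (∀ (α : ℤˣ) (s r : ℕ), 1 ≤ s → s ≤ p → 1 ≤ r → ∃ M : LUq.FinRep p, LUq.IsX α s r M) ∧
    (∀ (α : ℤˣ) (s r : ℕ), 1 ≤ s → s ≤ p - 1 → 1 ≤ r → ∀ t : LUq.Shape,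
      ∃ M : LUq.FinRep p, LUq.HasShape α s r M t) ∧
    -- different labels give nonisomorphic modules
    (∀ (α α' : ℤˣ) (s s' r r' : ℕ) (t t' : LUq.Shape),
      1 ≤ s → s ≤ p - 1 → 1 ≤ r → 1 ≤ s' → s' ≤ p - 1 → 1 ≤ r' →
      ∀ M : LUq.FinRep p, LUq.HasShape α s r M t → LUq.HasShape α' s' r' M t' →
        α = α' ∧ s = s' ∧ r = r' ∧ t = t') ∧
    -- `P` is the projective cover of `X`
    (∀ (α : ℤˣ) (s r : ℕ), 1 ≤ s → s ≤ p - 1 → 1 ≤ r → ∀ M N : LUq.FinRep p,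
      LUq.IsP α s r M → LUq.IsX α s r N → LUq.IsProjectiveCover M N) ∧
    -- `M` is contragredient to `W` and `N̄` to `N`; all four have Loewy length two
    (∀ (α : ℤˣ) (s r n : ℕ), 1 ≤ s → s ≤ p - 1 → 1 ≤ r → 1 ≤ n →
      (∀ V V' : LUq.FinRep p, LUq.IsM α s r n V → LUq.IsW α s r n V' →
        LUq.IsContragredient V V') ∧
      (∀ V V' : LUq.FinRep p, LUq.IsNbar α s r n V → LUq.IsN α s r n V' →
        LUq.IsContragredient V V') ∧
      (∀ V : LUq.FinRep p, LUq.IsW α s r n V ∨ LUq.IsM α s r n V ∨ LUq.IsN α s r n V ∨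
        LUq.IsNbar α s r n V → LUq.HasLoewyLength (LUq.LU p) V.obj 2)) ∧
    -- the decomposition into blocks
    ∃ D : LUq.Block p → CategoryTheory.ObjectProperty (LUq.FinRep p),
      LUq.IsDirectSumOfSubcategories (fun _ => True) D ∧
      (∀ b, LUq.IsIndecomposableSubcategory (D b)) ∧
      -- the semisimple blocks
      (∀ (α : ℤˣ) (r : ℕ) (hr : 1 ≤ r),
        (∀ M, D (.S α r hr) M → IsSemisimpleModule (LUq.LU p) M.obj) ∧
        (∀ M, (D (.S α r hr) M ∧ IsSimpleModule (LUq.LU p) M.obj) ↔ LUq.IsX α p r M)) ∧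
      -- the irreducible and the indecomposable modules of the other blocks
      (∀ (β : ℤˣ) (s : ℕ) (hs : 1 ≤ s ∧ s ≤ p - 1),
        (∀ M, (D (.C β s hs) M ∧ IsSimpleModule (LUq.LU p) M.obj) ↔
          ∃ α s' r, LUq.BlockLabel p β s α s' r ∧ LUq.IsX α s' r M) ∧
        (∀ M, (D (.C β s hs) M ∧ LUq.IsIndecomposableModule (LUq.LU p) M.obj) ↔
          ∃ α s' r t, LUq.BlockLabel p β s α s' r ∧ LUq.HasShape α s' r M t)) := by
  have : Fact (2 ≤ p) := ⟨hp⟩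
  have hlt : ∀ {s : ℕ}, s ≤ p - 1 → s < p := fun h => by omega
  refine ⟨fun α s r h1 h2 _ => ?_, fun α s r h1 h2 hr t => LUq.exists_hasShape h1 (hlt h2) hr t,
    fun α α' s s' r r' t t' h1 h2 hr h1' h2' hr' M h h' =>
      LUq.HasShape.unique h1 (hlt h2) hr h1' (hlt h2') hr' h h',
    fun α s r h1 h2 hr M N hM hN => hM.isProjectiveCover h1 (hlt h2) hr hN,
    fun α s r n h1 h2 hr hn => ⟨fun V V' h h' => ?_, fun V V' h h' => ?_, fun V h => ?_⟩,
    LUq.blockProp, LUq.isDirectSumOfSubcategories_blockProp, fun b => ?_,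
    fun α r hr => ⟨fun M h => LUq.isSemisimpleModule_of_blockProp_S h,
      fun M => LUq.blockProp_S_and_isSimpleModule_iff⟩,
    fun β s hs => ⟨fun M => LUq.blockProp_C_and_isSimpleModule_iff,
      fun M => LUq.blockProp_C_and_isIndecomposableModule_iff⟩⟩
  · obtain ⟨M, v, h⟩ := LUq.exists_isX (p := p) α r h1 h2
    exact ⟨M, (LUq.isX_iff h1 h2).2 ⟨v, h⟩⟩
  · exact LUq.IsZigzag.isContragredient LUq.odd_add_one_iff
      (fun j => Int.not_odd_iff_even.symm) h h'
  · exact LUq.IsZigzag.isContragredient LUq.even_add_one_iff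
      (fun j => Int.not_even_iff_odd.symm) h h'
  · obtain ⟨t, ht, hl, h⟩ : ∃ t : LUq.Shape, t ≠ .P ∧ 2 ≤ t.len ∧ LUq.HasShape α s r V t := by
      rcases h with h | h | h | h
      · exact ⟨.W ⟨n, hn⟩, nofun, by simp only [LUq.Shape.len, PNat.mk_coe]; omega, h⟩
      · exact ⟨.M ⟨n, hn⟩, nofun, by simp only [LUq.Shape.len, PNat.mk_coe]; omega, h⟩
      · exact ⟨.N ⟨n, hn⟩, nofun, by simp only [LUq.Shape.len, PNat.mk_coe]; omega, h⟩
      · exact ⟨.Nbar ⟨n, hn⟩, nofun, by simp only [LUq.Shape.len, PNat.mk_coe]; omega, h⟩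
    obtain ⟨u, hu⟩ := h.exists_isString h1 (hlt h2) hr ht
    exact hu.hasLoewyLength t.top_add_one h1 (hlt h2) hl
  · cases b with
    | C β s hs => exact LUq.isIndecomposableSubcategory_blockProp_C β s hs
    | S α r hr => exact LUq.isIndecomposableSubcategory_blockProp_S α r hr
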